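/- **Conventions.** A set of ordinals is a bounded class of ordinals. For sets of ordinals, $x\oplus y=\{2\iota:\iota\in x\}\cup\{2\iota+1:\iota\in y\}$; it also serves as the ordered pair of $x$ and $y$, and $(z)_0=\{\iota:2\iota\in z\}$. An ordinal $\alpha$ is identified with the set of smaller ordinals. Ordinal Turing machines (OTMs) are Koepke's, with several tapes of length $\mathrm{On}$ and inferior limits at limit times. $P^{x}(\rho)\downarrow=y$ means that the program $P$, started with the set of ordinals $x$ (oracle or input) and the parameter $\rho$ on its tapes, halts with $y$ on its output tape; the ends of the given sets $x$ and $\rho$ are marked, so that the machine can detect them. $P$ *recognizes* $z$ relative to $y$ in $\rho$ if, for every set of ordinals $w$, $P^{y\oplus w}(\rho)\downarrow=1$ if $w=z$ and $P^{y\oplus w}(\rho)\downarrow=0$ if $w\neq z$; $P$ *c-recognizes* $x$ if it recognizes some $z$ with $x=(z)_0$. A *code* of a set $x$ is $\{p(\iota,\xi):\iota,\xi<\alpha,\ f(\iota)\in f(\xi)\}$ for a bijection $f$ from an ordinal $\alpha$ to $\mathrm{tc}(\{x\})$ with $f(0)=x$, where $p$ is the ordinal pairing function. **Realizability.** Formulas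 are $\in$-formulas whose free variables are replaced by set parameters. The relation "$r$ $r$-realizes $\phi$" ($r$ a set of ordinals) is defined by recursion on $\phi$. A true atomic formula is realized by every $r$, a false one (such as $0=1$) by none. $r$ realizes $\psi_0\wedge\psi_1$ if $r=(r_0,r_1)$ with $r_i$ realizing $\psi_i$; $r$ realizes $\psi_0\vee\psi_1$ if $r=(i,r')$ with $i\in\{0,1\}$ and $r'$ realizing $\psi_i$. In the remaining cases $r=(P,\rho)$ is a pair of (the Gödel number of) an OTM program and an admissible parameter. - $(P,\rho)$ realizes $\psi_0(\vec p)\to\psi_1(\vec q)$ if, for all codes of $\vec p$ and of $\vec q$ and every realizer $r'$ of $\psi_0$, $P$ in $\rho$ c-recognizes, relative to $r'$ and these codes, a realizer of $\psi_1$. - $(P,\rho)$ realizes $\exists x\,\psi(x,\vec p)$ if, for all codes of $\vec p$, $P$ in $\rho$ c-recognizes relative to them a pair $(e,r')$ such that $e$ is a code of some set $a$ and $r'$ realizes $\psi(a,\vec p)$. - $(P,\rho)$ realizes $\forall x\,\psi(x,\vec p)$ if, for all codes of $\vec p$, every set $a$ and every code $e$ of $a$, $P$ in $\rho$ c-recognizes,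 relative to $e$ and the codes of $\vec p$, a realizer of $\psi(a,\vec p)$. $\neg\psi$ is read as $\psi\to 0=1$, $\psi_0\leftrightarrow\psi_1$ as $(\psi_0\to\psi_1)\wedge(\psi_1\to\psi_0)$, $\forall x\in X\,\psi$ as $\forall x(x\in X\to\psi)$ and $\exists x\in X\,\psi$ as $\exists x(x\in X\wedge\psi)$. If free variables other than parameters occur, the formula is read as its universal closure. The formula is $r$-realizable *without parameters*, *with parameters*, or *strongly* $r$-realizable, if it has a realizer when the admissible parameters are only $0$, all ordinals, or all sets of ordinals, respectively. Replacing "c-recognizes" by "computes" gives the three variants of OTM-realizability. $\Delta_0$ formulas have only bounded quantifiers; $\Pi_1$ is $\forall\vec x\,\Delta_0$, $\Sigma_1$ is $\exists\vec x\,\Delta_0$, $\Pi_2$ is $\forall\vec x\,\Sigma_1$, and $\Sigma_2$ is $\exists\vec x\,\Pi_1$. **Lemma (truth lemma).** 1. There is a single OTM program which, given (the Gödel number of) any true $\Delta_0$ formula (read as its universal closure, if it has free variables other than parameters) and codes of its set parameters, computes an $r$-realizer of it, which is a realizer in each of the three senses (without parameters, with parameters, strong). Moreover, a $\Delta_0$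 formula all of whose free variables are replaced by set parameters is OTM-realizable (in any of the three variants) iff it is $r$-realizable without parameters iff it is $r$-realizable with parameters iff it is strongly $r$-realizable iff it is true. 2. A $\Pi_1$ formula with set parameters is $r$-realizable without parameters iff it is $r$-realizable with parameters iff it is strongly $r$-realizable iff it is true (and iff it is OTM-realizable, in any of the three variants). 3. A $\Sigma_2$ formula with set parameters is strongly $r$-realizable iff it is true. 4. A $\Pi_2$ formula with set parameters that is $r$-realizable, in any of the three senses, is true. 5. A $\Pi_2$ formula with set parameters that is $r$-realizable, without or with parameters, is strongly $r$-realizable. -/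

import Mathlib

/-!
Ordinal Turing machines, recognizability, codes of sets, and the realizability relations based on them.
The set-theoretic universe `V` is `ZFSet.{u}`, its ordinals are `Ordinal.{u}`, and a set of ordinals
is a bounded `Set Ordinal.{u}`.
-/

universe u

namespace OTM

noncomputable section

open Classical in
/-- One step to the left on an ordinal tape: from `a + 1` to `a`, and from `0` or a limit to `0`. -/
def moveLeft (h : Ordinal.{u}) : Ordinal.{u} :=
  if hs : ∃ a, h = a + 1 then hs.choose else 0

/-- What a machine does after reading a symbol: write a symbol, move the head of the current tape
(`some true` is right, `some false` is left, `none` is no move), go to a state. -/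
abbrev Action := Bool × Option Bool × ℕ

/-- A state of a machine: the number of the tape it works on, the action for the symbol `0` and the
action for the symbol `1`. -/
abbrev Line := ℕ × Action × Action

/-- An OTM program (for a machine with several tapes, of which a program uses finitely many):
its states are the numbers below its length. -/
abbrev Program := List Line

/-- The position of a computation: the state, the position of the head on each tape, and for each
tape the set of cells that contain the symbol `1`. -/
structure Config where
  state : ℕ
  head : ℕ → Ordinal.{u}
  tape : ℕ → Set Ordinal.{u}

open Classical in
/-- The effect of an action on tape `i`. -/
def Config.act (C : Config.{u}) (i : ℕ) (a : Action) : Config.{u} where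
  state := a.2.2
  head := Function.update C.head i
    (match a.2.1 with
      | none => C.head i
      | some true => C.head i + 1
      | some false => moveLeft (C.head i))
  tape := Function.update C.tape i
    (if a.1 = true then insert (C.head i) (C.tape i) else C.tape i \ {C.head i})

open Classical in
/-- The successor configuration. A configuration whose state is not a state of the program is
halting, and is kept. -/
def Program.step (P : Program) (C : Config.{u}) : Config.{u} :=
  match P[C.state]? with
  | none => C
  | some (i, a₀, a₁) => if C.head i ∈ C.tape i then C.act i a₁ else C.act i a₀

/-- The inferior limit at `t` of a sequence of length `t`, along the set `D` of indices. -/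
def liminfAlong {β : Type*} [SupSet β] [InfSet β] (t : Ordinal.{u}) (D : Set (Set.Iio t))
    (f : Set.Iio t → β) : β :=
  ⨆ r : Set.Iio t, sInf (f '' {s | r ≤ s ∧ s ∈ D})

/-- The configuration at a limit time: the state and the cells are the inferior limits of the earlier
ones; each head position is the inferior limit of the earlier positions in that same state. -/
def limitConfig (t : Ordinal.{u}) (C : Set.Iio t → Config.{u}) : Config.{u} :=
  let q : ℕ := liminfAlong t Set.univ fun s => (C s).state
  { state := q
    head := fun i => liminfAlong t {s | (C s).state = q} fun s => (C s).head i
    tape := fun i => {ξ | ∃ r : Set.Iio t, ∀ s : Set.Iio t, r ≤ s → ξ ∈ (C s).tape i} }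

/-- The start on oracle (or input) `x` with parameter `ρ`, both sets of ordinals. Tape 0 holds `x`
and tape 2 holds `ρ`. Tapes 1 and 3 mark the cells below the ends of `x` and of `ρ`, so that the
machine can detect where a set that is given to it ends. -/
def initConfig (x ρ : Set Ordinal.{u}) : Config.{u} where
  state := 0
  head := fun _ => 0
  tape := fun i => match i with
    | 0 => x
    | 1 => {β | ∃ ξ ∈ x, β ≤ ξ}
    | 2 => ρ
    | 3 => {β | ∃ ξ ∈ ρ, β ≤ ξ}
    | _ => ∅

/-- The configuration at time `t` of the computation of `P` on `x` with parameter `ρ`. -/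
def Program.run (P : Program) (x ρ : Set Ordinal.{u}) (t : Ordinal.{u}) : Config.{u} :=
  Ordinal.limitRecOn t (initConfig x ρ) (fun _ C => P.step C)
    (fun t _ C => limitConfig t fun s => C s.1 s.2)

/-- `P` with oracle (or input) `x` and parameter `ρ` halts with output `y` (on tape 4). -/
def Program.Outputs (P : Program) (x ρ y : Set Ordinal.{u}) : Prop :=
  ∃ t : Ordinal.{u}, P.length ≤ (P.run x ρ t).state ∧ (P.run x ρ t).tape 4 = y

/-- `x ⊕ y = {2ι | ι ∈ x} ∪ {2ι + 1 | ι ∈ y}`, which also serves as the ordered pair of `x`, `y`. -/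
def join (x y : Set Ordinal.{u}) : Set Ordinal.{u} :=
  (fun ι => 2 * ι) '' x ∪ (fun ι => 2 * ι + 1) '' y

/-- The join of the finitely many sets `c i`, `i ∈ s`. -/
def joinFam (s : Finset ℕ) (c : ℕ → Set Ordinal.{u}) : Set Ordinal.{u} :=
  {η | ∃ i ∈ s, ∃ ξ ∈ c i, η = Ordinal.omega0 * ξ + (i : Ordinal.{u})}

/-- An ordinal as a set of ordinals. -/
def ofOrd (α : Ordinal.{u}) : Set Ordinal.{u} := Set.Iio α

open Classical in
/-- `P` recognizes `z` relative to the oracle `y` in the parameter `ρ`: on each oracle `y ⊕ w` it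
halts, with output `1` if `w = z` and with output `0` otherwise. -/
def Program.Recognizes (P : Program) (y ρ z : Set Ordinal.{u}) : Prop :=
  BddAbove z ∧ ∀ w : Set Ordinal.{u}, BddAbove w →
    P.Outputs (join y w) ρ (ofOrd (if w = z then 1 else 0))

/-- `P` c-recognizes `x` relative to `y` in the parameter `ρ`: it recognizes some `z` whose first
component is `x`. -/
def Program.CRecognizes (P : Program) (y ρ x : Set Ordinal.{u}) : Prop :=
  ∃ z, P.Recognizes y ρ z ∧ x = {ι | 2 * ι ∈ z}

/-- The least value of the ordinal pairing function on pairs with maximum `μ`. -/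
def pairBase (μ : Ordinal.{u}) : Ordinal.{u} :=
  ⨆ ν : Set.Iio μ, (pairBase ν.1 + ν.1 + ν.1 + 1)
termination_by μ
decreasing_by exact ν.2

open Classical in
/-- The ordinal pairing function: it enumerates the pairs of ordinals by their maximum, then by
their first, then by their second component. -/
def opair (α β : Ordinal.{u}) : Ordinal.{u} :=
  if α < β then pairBase β + α else pairBase α + α + β

/-- The transitive closure of `{x}`: the `y` from which a finite `∈`-chain leads to `x`. -/
def tcSingleton (x : ZFSet.{u}) : Set ZFSet.{u} :=
  {y | Relation.ReflTransGen (fun a b : ZFSet.{u} => a ∈ b) y x}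

/-- `c` is a code of the set `x`: for some bijection `f` from an ordinal to the transitive closure
of `{x}` with `f 0 = x`, it consists of the pairs `(ι, ξ)` with `f ι ∈ f ξ`. -/
def IsCode (c : Set Ordinal.{u}) (x : ZFSet.{u}) : Prop :=
  ∃ (α : Ordinal.{u}) (f : Ordinal.{u} → ZFSet.{u}), 0 < α ∧
    Set.BijOn f (Set.Iio α) (tcSingleton x) ∧ f 0 = x ∧
    c = {η | ∃ ι < α, ∃ ξ < α, f ι ∈ f ξ ∧ η = opair ι ξ}

/-- Formulas of set theory in intuitionistic logic, with variables numbered by `ℕ`; `falsum` plays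
the role of `0 = 1`. Together with an assignment of sets to the free variables, a formula stands for
a sentence with set parameters. -/
inductive Formula : Type
  | falsum : Formula
  | mem (i j : ℕ) : Formula
  | eq (i j : ℕ) : Formula
  | and (φ ψ : Formula) : Formula
  | or (φ ψ : Formula) : Formula
  | imp (φ ψ : Formula) : Formula
  | all (i : ℕ) (φ : Formula) : Formula
  | ex (i : ℕ) (φ : Formula) : Formula

namespace Formula

/-- `¬ φ` is `φ → 0 = 1`. -/
def neg (φ : Formula) : Formula := imp φ falsum

/-- `φ ↔ ψ` is `(φ → ψ) ∧ (ψ → φ)`. -/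
def iff (φ ψ : Formula) : Formula := and (imp φ ψ) (imp ψ φ)

/-- `∀ xᵢ ∈ xⱼ φ` is `∀ xᵢ (xᵢ ∈ xⱼ → φ)`. -/
def ball (i j : ℕ) (φ : Formula) : Formula := all i (imp (mem i j) φ)

/-- `∃ xᵢ ∈ xⱼ φ` is `∃ xᵢ (xᵢ ∈ xⱼ ∧ φ)`. -/
def bex (i j : ℕ) (φ : Formula) : Formula := ex i (and (mem i j) φ)

/-- The free variables. -/
def fv : Formula → Finset ℕ
  | falsum => ∅
  | mem i j => {i, j}
  | eq i j => {i, j}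
  | and φ ψ => fv φ ∪ fv ψ
  | or φ ψ => fv φ ∪ fv ψ
  | imp φ ψ => fv φ ∪ fv ψ
  | all i φ => (fv φ).erase i
  | ex i φ => (fv φ).erase i

/-- A Gödel numbering of the formulas. -/
def code : Formula → ℕ
  | falsum => Nat.pair 0 0
  | mem i j => Nat.pair 1 (Nat.pair i j)
  | eq i j => Nat.pair 2 (Nat.pair i j)
  | and φ ψ => Nat.pair 3 (Nat.pair (code φ) (code ψ))
  | or φ ψ => Nat.pair 4 (Nat.pair (code φ) (code ψ))
  | imp φ ψ => Nat.pair 5 (Nat.pair (code φ) (code ψ))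
  | all i φ => Nat.pair 6 (Nat.pair i (code φ))
  | ex i φ => Nat.pair 7 (Nat.pair i (code φ))

/-- Truth in the universe of sets, under the assignment `v`. -/
def Truth : Formula → (ℕ → ZFSet.{u}) → Prop
  | falsum, _ => False
  | mem i j, v => v i ∈ v j
  | eq i j, v => v i = v j
  | and φ ψ, v => Truth φ v ∧ Truth ψ v
  | or φ ψ, v => Truth φ v ∨ Truth ψ v
  | imp φ ψ, v => Truth φ v → Truth ψ v
  | all i φ, v => ∀ a : ZFSet.{u}, Truth φ (Function.update v i a)
  | ex i φ, v => ∃ a : ZFSet.{u}, Truth φ (Function.update v i a)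

/-- `∀ x_{i₁} … ∀ x_{iₙ} φ`. -/
def alls (l : List ℕ) (φ : Formula) : Formula := l.foldr all φ

/-- `∃ x_{i₁} … ∃ x_{iₙ} φ`. -/
def exs (l : List ℕ) (φ : Formula) : Formula := l.foldr ex φ

/-- `Δ₀`: all quantifiers are bounded. -/
inductive IsDelta0 : Formula → Prop
  | falsum : IsDelta0 falsum
  | mem (i j : ℕ) : IsDelta0 (mem i j)
  | eq (i j : ℕ) : IsDelta0 (eq i j)
  | and {φ ψ : Formula} : IsDelta0 φ → IsDelta0 ψ → IsDelta0 (and φ ψ)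
  | or {φ ψ : Formula} : IsDelta0 φ → IsDelta0 ψ → IsDelta0 (or φ ψ)
  | imp {φ ψ : Formula} : IsDelta0 φ → IsDelta0 ψ → IsDelta0 (imp φ ψ)
  | ball {i j : ℕ} {φ : Formula} : i ≠ j → IsDelta0 φ → IsDelta0 (ball i j φ)
  | bex {i j : ℕ} {φ : Formula} : i ≠ j → IsDelta0 φ → IsDelta0 (bex i j φ)

/-- `Π₁`: a block of universal quantifiers in front of a `Δ₀` formula. -/
def IsPi1 (φ : Formula) : Prop := ∃ l ψ, IsDelta0 ψ ∧ φ = alls l ψ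

/-- `Σ₁`: a block of existential quantifiers in front of a `Δ₀` formula. -/
def IsSigma1 (φ : Formula) : Prop := ∃ l ψ, IsDelta0 ψ ∧ φ = exs l ψ

/-- `Π₂`: a block of universal quantifiers in front of a `Σ₁` formula. -/
def IsPi2 (φ : Formula) : Prop := ∃ l ψ, IsSigma1 ψ ∧ φ = alls l ψ

/-- `Σ₂`: a block of existential quantifiers in front of a `Π₁` formula. -/
def IsSigma2 (φ : Formula) : Prop := ∃ l ψ, IsPi1 ψ ∧ φ = exs l ψ

end Formula

/-- `c i` is a code of `v i` for each `i ∈ s`. -/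
def CodesOn (s : Finset ℕ) (v : ℕ → ZFSet.{u}) (c : ℕ → Set Ordinal.{u}) : Prop :=
  ∀ i ∈ s, IsCode (c i) (v i)

/-- How a realizer gives access to an object: c-recognition (`r`-realizability) or computation
(OTM-realizability). -/
inductive Mode : Type
  | recognition
  | computation

/-- Which parameters realizers may use: none, single ordinals, or sets of ordinals. -/
inductive Params : Type
  | none
  | ordinal
  | set

/-- The admissible parameters; no parameter is the parameter `0`. -/
def Params.Allows : Params → Set Ordinal.{u} → Prop
  | .none, ρ => ρ = ∅
  | .ordinal, ρ => ∃ α : Ordinal.{u}, ρ = ofOrd α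
  | .set, ρ => BddAbove ρ

/-- `P`, with oracle `y` and parameter `ρ`, c-recognizes or computes `x`. -/
def Mode.Obtains : Mode → Program → Set Ordinal.{u} → Set Ordinal.{u} → Set Ordinal.{u} → Prop
  | .recognition, P, y, ρ, x => P.CRecognizes y ρ x
  | .computation, P, y, ρ, x => P.Outputs y ρ x

/-- The pair of (the Gödel number of) a program and a parameter. -/
def progPair (P : Program) (ρ : Set Ordinal.{u}) : Set Ordinal.{u} :=
  join (ofOrd ((Encodable.encode P : ℕ) : Ordinal.{u})) ρ

/-- `Realizes m k φ v r`: the set of ordinals `r` realizes the formula `φ`, with the sets `v i` as its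
parameters, in the sense of mode `m` with realizers using the parameters allowed by `k`. A realizer
that contains a program has to work for all codes of the sets occurring in the formula. -/
def Realizes (m : Mode) (k : Params) : Formula → (ℕ → ZFSet.{u}) → Set Ordinal.{u} → Prop
  | .falsum, _, _ => False
  | .mem i j, v, _ => v i ∈ v j
  | .eq i j, v, _ => v i = v j
  | .and φ ψ, v, r => ∃ r₀ r₁, r = join r₀ r₁ ∧ Realizes m k φ v r₀ ∧ Realizes m k ψ v r₁
  | .or φ ψ, v, r => ∃ r', (r = join (ofOrd 0) r' ∧ Realizes m k φ v r') ∨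
      (r = join (ofOrd 1) r' ∧ Realizes m k ψ v r')
  | .imp φ ψ, v, r => ∃ P ρ, k.Allows ρ ∧ r = progPair P ρ ∧
      ∀ c d : ℕ → Set Ordinal.{u}, CodesOn φ.fv v c → CodesOn ψ.fv v d →
        ∀ r', BddAbove r' → Realizes m k φ v r' →
          ∃ r'', m.Obtains P (join r' (join (joinFam φ.fv c) (joinFam ψ.fv d))) ρ r'' ∧
            Realizes m k ψ v r''
  | .all i φ, v, r => ∃ P ρ, k.Allows ρ ∧ r = progPair P ρ ∧
      ∀ c : ℕ → Set Ordinal.{u}, CodesOn (φ.all i).fv v c →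
        ∀ (a : ZFSet.{u}) (e : Set Ordinal.{u}), IsCode e a →
          ∃ r', m.Obtains P (join e (joinFam (φ.all i).fv c)) ρ r' ∧
            Realizes m k φ (Function.update v i a) r'
  | .ex i φ, v, r => ∃ P ρ, k.Allows ρ ∧ r = progPair P ρ ∧
      ∀ c : ℕ → Set Ordinal.{u}, CodesOn (φ.ex i).fv v c →
        ∃ e r', m.Obtains P (joinFam (φ.ex i).fv c) ρ (join e r') ∧
          ∃ a : ZFSet.{u}, IsCode e a ∧ Realizes m k φ (Function.update v i a) r'

/-- Some set of ordinals is a realizer. -/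
def Realizable (m : Mode) (k : Params) (φ : Formula) (v : ℕ → ZFSet.{u}) : Prop :=
  ∃ r, BddAbove r ∧ Realizes m k φ v r

end

end OTM

namespace OTM

noncomputable section

open Ordinal Set

section

/-! ### Computations of ordinal Turing machines -/

/-! A machine can decide the truth of a `Δ₀` formula from codes of its parameters, and this is why
truth and realizability agree. Each formula gets a canonical realizer `rz`. It depends only on the
formula and, at disjunctions, on which disjunct is true; for implications and quantifiers it is a
program that knows the Gödel number of the formula and uses the parameter `∅`. By a simultaneous
induction, a `Δ₀` formula that has any realizer is true (`Sound`), and a true one is realized by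
`rz` (`Complete`). Implication exchanges the two properties: to exploit a realizer of `φ → ψ` one
needs a realizer of `φ`, and the canonical program for `φ → ψ` may ignore the realizer of `φ` it is
given, because the existence of that realizer already makes `φ`, and hence `ψ`, true. A bounded
existential quantifier is served by a search in the code of the bounding set (`obtains_rz_bex`).
Nothing here depends on the admissible parameters or on whether objects are computed or recognized.

Blocks of universal quantifiers preserve both properties, which settles `Π₁`. Existential
quantifiers preserve soundness, so realizable `Π₂` formulas are true. With set parameters, a code of
a witness and a realizer can simply be stored in the parameter (`realizable_ex`), which settles
`Σ₂`.

The programs come from a definability calculus. Commands on registers for ordinals and for sets of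
ordinals are compiled to machine code, and formulas `PE` with bounded quantifiers and ordinal
recursion are evaluated by commands (`PE.runs`). `Dfn` collects the relations expressed by such
formulas, so that closure properties replace programming. Through `exists_computes` and
`exists_decides`, a definition with a bound `Γ` becomes a program: it searches for the least `Γ`
with a definable property that certifies that `Γ` is large enough, and evaluates the definition
below `Γ`. Sets are represented by pointers into codes, equality by bisimilarity in stages, truth by
recursion on Gödel numbers. A program `withNumeral K N` carries the number `N`; if `N` contains the
code of `K`, the program can write down the codes of other programs with the same lines, and no
recursion theorem is required.

A realizer with fewer parameters is not automatically a strong one: implications inside the matrix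
have to cope with more realizers of their premises. So the realizer of the matrix is replaced by the
canonical one, and this change is propagated outwards through the quantifiers. If the given program
`P` recognizes `z`, the new program has the whole old realizer as its set parameter and recognizes a
pair `(T, z)`, where `T` contains the changed realizer: it simulates `P` on the second component
and, once `P` accepts, compares the first component with the `T` determined by `z`
(`xfer_recognizes`, `Prenex.realizes`). The simulation of machines is itself a definable recursion
(`sim_iff`). -/

theorem Config.eq_of {C D : Config.{u}} (h₁ : C.state = D.state) (h₂ : ∀ i, C.head i = D.head i)
    (h₃ : ∀ i, C.tape i = D.tape i) : C = D := by
  cases C; cases D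
  simp only at h₁ h₂ h₃
  obtain rfl := h₁
  obtain rfl := funext h₂
  obtain rfl := funext h₃
  rfl

/-- `C` is a computation of `P`, from an arbitrary configuration. -/
structure IsRun (P : Program) (C : Ordinal.{u} → Config.{u}) : Prop where
  step : ∀ t, C (t + 1) = P.step (C t)
  limit : ∀ t, Order.IsSuccLimit t → C t = limitConfig t fun s => C s.1

theorem isRun_run (P : Program) (x ρ : Set Ordinal.{u}) : IsRun P (P.run x ρ) where
  step t := by unfold Program.run; rw [limitRecOn_add_one]
  limit t ht := by unfold Program.run; rw [limitRecOn_limit _ _ _ _ ht]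

/-- The program `P` gets from the configuration `D` to `D'`; until then the states are at least `b`,
and the tapes include `M`. -/
def Leads (P : Program) (b : ℕ) (M : ℕ → Set Ordinal.{u}) (D D' : Config.{u}) : Prop :=
  ∀ C, IsRun P C → ∀ t, C t = D → ∃ t', t ≤ t' ∧ C t' = D' ∧
    ∀ s, t ≤ s → s < t' → b ≤ (C s).state ∧ ∀ i, M i ⊆ (C s).tape i

variable {P : Program} {b : ℕ} {M : ℕ → Set Ordinal.{u}} {D D₁ D' : Config.{u}}

theorem Leads.refl : Leads P b M D D :=
  fun _ _ t ht => ⟨t, le_rfl, ht, fun _ h h' => absurd h' h.not_gt⟩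

theorem Leads.trans (h : Leads P b M D D₁) (h' : Leads P b M D₁ D') : Leads P b M D D' := by
  intro C hC t ht
  obtain ⟨t₁, h₁, h₂, h₃⟩ := h C hC t ht
  obtain ⟨t₂, h₄, h₅, h₆⟩ := h' C hC t₁ h₂
  refine ⟨t₂, h₁.trans h₄, h₅, fun s hs hs' => ?_⟩
  rcases lt_or_ge s t₁ with hh | hh
  · exact h₃ s hs hh
  · exact h₆ s hh hs'

theorem Leads.mono {b' : ℕ} {M' : ℕ → Set Ordinal.{u}} (h : Leads P b M D D') (hb : b' ≤ b)
    (hM : ∀ i, M' i ⊆ M i) : Leads P b' M' D D' := by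
  intro C hC t ht
  obtain ⟨t₁, h₁, h₂, h₃⟩ := h C hC t ht
  exact ⟨t₁, h₁, h₂, fun s hs hs' => ⟨hb.trans (h₃ s hs hs').1,
    fun i => (hM i).trans ((h₃ s hs hs').2 i)⟩⟩

theorem Leads.head (h : Leads P b M D₁ D') (h₁ : P.step D = D₁) (hb : b ≤ D.state)
    (hM : ∀ i, M i ⊆ D.tape i) : Leads P b M D D' := by
  refine Leads.trans ?_ h
  intro C hC t ht
  refine ⟨t + 1, le_self_add, by rw [hC.step, ht, h₁], fun s hs hs' => ?_⟩
  obtain rfl : s = t := le_antisymm (Order.lt_add_one_iff.1 hs') hs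
  rw [ht]
  exact ⟨hb, hM⟩

/-- Transfinite iteration: the configurations `D p` are passed one after the other, in the state `b`,
which is smaller than the states in between. -/
theorem Leads.loop (D : Ordinal.{u} → Config.{u}) (τ : Ordinal.{u})
    (hs : ∀ p ≤ τ, (D p).state = b)
    (hstep : ∀ p < τ, Leads P (b + 1) (fun i => (D p).tape i ∩ (D (p + 1)).tape i)
      (P.step (D p)) (D (p + 1)))
    (hM : ∀ p ≤ τ, ∀ i, M i ⊆ (D p).tape i)
    (hmono : ∀ p q, p ≤ q → q ≤ τ → ∀ i, (D p).head i ≤ (D q).head i)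
    (hlim : ∀ p ≤ τ, Order.IsSuccLimit p → ∀ i, ∀ ξ < (D p).head i, ∃ q < p, ξ < (D q).head i)
    (htape : ∀ p ≤ τ, Order.IsSuccLimit p → ∀ i ξ, ξ ∈ (D p).tape i ↔
      ∃ r < p, ∀ q, r ≤ q → q < p → ξ ∈ (D q).tape i) : Leads P b M (D 0) (D τ) := by
  intro C hC t ht
  -- The hypotheses stay inside the existential, so that `choose` gives a total function: `nx p s`
  -- is the time of the pass that follows the pass at time `s`. Iteration with suprema at limits
  -- gives the times `T p` of the passes.
  have nxt : ∀ p s, ∃ s', p < τ → C s = D p → s < s' ∧ C s' = D (p + 1) ∧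
      ∀ r, s < r → r < s' → b + 1 ≤ (C r).state ∧
        ∀ i, (D p).tape i ∩ (D (p + 1)).tape i ⊆ (C r).tape i := by
    intro p s
    by_cases h : p < τ ∧ C s = D p
    · obtain ⟨s', h₁, h₂, h₃⟩ := hstep p h.1 C hC (s + 1) (by rw [hC.step, h.2])
      exact ⟨s', fun _ _ => ⟨(Order.lt_add_one_iff.2 le_rfl).trans_le h₁, h₂,
        fun r hr hr' => h₃ r (Order.add_one_le_of_lt hr) hr'⟩⟩
    · exact ⟨0, fun h₁ h₂ => absurd ⟨h₁, h₂⟩ h⟩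
  choose nx hnx using nxt
  let T : Ordinal.{u} → Ordinal.{u} := fun p =>
    limitRecOn p t (fun p s => nx p s) (fun p _ f => ⨆ q : Iio p, f q.1 q.2)
  have hT0 : T 0 = t := limitRecOn_zero ..
  have hTs : ∀ p, T (p + 1) = nx p (T p) := fun p => limitRecOn_add_one ..
  have hTl : ∀ p, Order.IsSuccLimit p → T p = ⨆ q : Iio p, T q.1 := fun p hp =>
    limitRecOn_limit _ _ _ _ hp
  -- The last clause cuts the time before `T p` into segments from one pass to the next. At limits
  -- it locates every earlier time between two consecutive passes.
  have key : ∀ p, p ≤ τ → C (T p) = D p ∧ (∀ q < p, T q < T p) ∧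
      (∀ s, t ≤ s → s < T p → ∃ q < p, T q ≤ s ∧ s < T (q + 1)) := by
    intro p
    induction p using Ordinal.limitRecOn with
    | zero => exact fun _ => ⟨by rw [hT0, ht], fun q hq => absurd hq (not_lt_bot ),
        fun s h h' => absurd (hT0 ▸ h') h.not_gt⟩
    | add_one p ih =>
      intro hp
      have hp' : p < τ := (Order.lt_add_one_iff.2 le_rfl).trans_le hp
      obtain ⟨h₁, h₂, h₃⟩ := ih hp'.le
      obtain ⟨h₄, h₅, h₆⟩ := hnx p (T p) hp' h₁
      rw [← hTs] at h₄ h₅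
      refine ⟨h₅, fun q hq => ?_, fun s hs hs' => ?_⟩
      · rcases (Order.lt_add_one_iff.1 hq).lt_or_eq with h | rfl
        · exact (h₂ q h).trans h₄
        · exact h₄
      · rcases lt_or_ge s (T p) with h | h
        · obtain ⟨q, hq, h'⟩ := h₃ s hs h
          exact ⟨q, hq.trans (Order.lt_add_one_iff.2 le_rfl), h'⟩
        · exact ⟨p, Order.lt_add_one_iff.2 le_rfl, h, hs'⟩
    | limit p hp ih =>
      intro hpτ
      have hbdd : BddAbove (range fun q : Iio p => T q.1) := bddAbove_of_small
      have hlt : ∀ q < p, T q < T p := by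
        intro q hq
        have hq' := hp.succ_lt hq
        rw [Order.succ_eq_add_one] at hq'
        refine ((ih _ hq' (hq'.le.trans hpτ)).2.1 q (Order.lt_add_one_iff.2 le_rfl)).trans_le ?_
        rw [hTl p hp]
        exact le_ciSup hbdd ⟨q + 1, hq'⟩
      have hex : ∀ s < T p, ∃ q < p, s < T q := by
        intro s hs
        rw [hTl p hp] at hs
        obtain ⟨q, hq⟩ := exists_lt_of_lt_ciSup' hs
        exact ⟨q.1, q.2, hq⟩
      have hseg : ∀ s, t ≤ s → s < T p → ∃ q < p, T q ≤ s ∧ s < T (q + 1) := by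
        intro s hs hs'
        obtain ⟨q, hq, h⟩ := hex s hs'
        obtain ⟨q', hq', h'⟩ := (ih q hq (hq.le.trans hpτ)).2.2 s hs h
        exact ⟨q', hq'.trans hq, h'⟩
      refine ⟨?_, hlt, hseg⟩
      have hp0 : 0 < p := hp.bot_lt
      have hTlim : Order.IsSuccLimit (T p) := by
        rw [Order.isSuccLimit_iff]
        refine ⟨fun h => ?_, Order.isSuccPrelimit_of_succ_lt fun s hs => ?_⟩
        · have := hlt 0 hp0
          rw [isMin_iff_eq_bot.1 h] at this
          exact not_lt_bot this
        · obtain ⟨q, hq, h⟩ := hex s hs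
          exact (Order.succ_le_of_lt h).trans_lt (hlt q hq)
      have hTmono : ∀ q r, q ≤ r → r < p → T q ≤ T r := by
        intro q r h h'
        rcases h.lt_or_eq with h | rfl
        · exact ((ih r h' (h'.le.trans hpτ)).2.1 q h).le
        · exact le_rfl
      have ht0 : ∀ q < p, t ≤ T q := fun q hq => hT0 ▸ hTmono 0 q (zero_le) hq
      have hCT : ∀ q < p, C (T q) = D q := fun q hq => (ih q hq (hq.le.trans hpτ)).1
      -- Strictly between two passes the state is at least `b + 1`. So `b` is the inferior limit of
      -- the states, and the inferior limits of the head positions, which are taken along the times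
      -- in that state, see only the passes.
      have hst : ∀ s, t ≤ s → s < T p → b ≤ (C s).state ∧
          ((C s).state = b → ∃ q < p, s = T q) := by
        intro s h h'
        obtain ⟨q, hq, h₁, h₂⟩ := hseg s h h'
        rcases h₁.lt_or_eq with h₁ | rfl
        · have := ((hnx q (T q) (hq.trans_le hpτ) (hCT q hq)).2.2 s h₁ (hTs q ▸ h₂)).1
          exact ⟨by omega, fun h => by omega⟩
        · have := hs q (hq.le.trans hpτ)
          rw [hCT q hq]
          exact ⟨this.ge, fun _ => ⟨q, hq, rfl⟩⟩
      have hstate : liminfAlong (T p) Set.univ (fun s : Iio (T p) => (C s.1).state) = b := by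
        unfold liminfAlong
        have hub : ∀ r : Iio (T p),
            sInf ((fun s : Iio (T p) => (C s.1).state) '' {s | r ≤ s ∧ s ∈ Set.univ}) ≤ b := by
          intro r
          obtain ⟨q, hq, h⟩ := hex r.1 r.2
          refine Nat.sInf_le ⟨⟨T q, hlt q hq⟩, ⟨h.le, trivial⟩, ?_⟩
          change (C (T q)).state = b
          rw [hCT q hq]
          exact hs q (hq.le.trans hpτ)
        apply le_antisymm
        · exact ciSup_le' hub
        · refine le_trans ?_ (le_ciSup ⟨b, by rintro _ ⟨r, rfl⟩; exact hub r⟩ ⟨T 0, hlt 0 hp0⟩)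
          refine le_csInf ⟨_, ⟨T 0, hlt 0 hp0⟩, ⟨le_rfl, trivial⟩, rfl⟩ ?_
          rintro _ ⟨s, ⟨h, -⟩, rfl⟩
          exact (hst s.1 ((ht0 0 hp0).trans h) s.2).1
      rw [hC.limit _ hTlim]
      apply Config.eq_of
      · change liminfAlong (T p) Set.univ (fun s : Iio (T p) => (C s.1).state) = _
        rw [hstate, hs p hpτ]
      · intro i
        change liminfAlong (T p) {s | (C s.1).state = liminfAlong (T p) Set.univ
          (fun s : Iio (T p) => (C s.1).state)} (fun s : Iio (T p) => (C s.1).head i) = _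
        rw [hstate]
        unfold liminfAlong
        have hub : ∀ r : Iio (T p), sInf ((fun s : Iio (T p) => (C s.1).head i) ''
            {s | r ≤ s ∧ s ∈ {s : Iio (T p) | (C s.1).state = b}}) ≤ (D p).head i := by
          intro r
          obtain ⟨q, hq, h⟩ := hex r.1 r.2
          refine le_trans (b := (C (T q)).head i) (csInf_le' ?_) ?_
          · refine ⟨⟨T q, hlt q hq⟩, ⟨h.le, ?_⟩, rfl⟩
            change (C (T q)).state = b
            rw [hCT q hq]
            exact hs q (hq.le.trans hpτ)
          · rw [hCT q hq]
            exact hmono q p hq.le hpτ i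
        apply le_antisymm
        · exact ciSup_le' hub
        · refine le_of_forall_lt fun ξ hξ => ?_
          obtain ⟨q, hq, h⟩ := hlim p hpτ hp i ξ hξ
          refine lt_of_lt_of_le ?_ (le_ciSup ⟨_, by rintro _ ⟨r, rfl⟩; exact hub r⟩
            ⟨T q, hlt q hq⟩)
          refine h.trans_le (le_csInf ⟨_, ⟨T q, hlt q hq⟩, ⟨le_rfl, ?_⟩, rfl⟩ ?_)
          · change (C (T q)).state = b
            rw [hCT q hq]
            exact hs q (hq.le.trans hpτ)
          · rintro _ ⟨s, ⟨h₁, h₂⟩, rfl⟩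
            obtain ⟨q', hq', h₃⟩ := (hst s.1 ((ht0 q hq).trans h₁) s.2).2 h₂
            change _ ≤ (C s.1).head i
            rw [h₃, hCT q' hq']
            refine hmono q q' ?_ (hq'.le.trans hpτ) i
            by_contra hcon
            have := (ih q hq (hq.le.trans hpτ)).2.1 q' (not_le.1 hcon)
            rw [← h₃] at this
            exact absurd this (not_lt.2 h₁)
      · intro i
        ext ξ
        rw [htape p hpτ hp]
        change (∃ r : Iio (T p), ∀ s : Iio (T p), r ≤ s → ξ ∈ (C s.1).tape i) ↔ _
        constructor
        · rintro ⟨r, hr⟩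
          obtain ⟨q, hq, h⟩ := hex r.1 r.2
          refine ⟨q, hq, fun q' h₁ h₂ => ?_⟩
          have := hr ⟨T q', hlt q' h₂⟩ (h.le.trans (hTmono q q' h₁ h₂))
          change ξ ∈ (C (T q')).tape i at this
          rwa [hCT q' h₂] at this
        · rintro ⟨q, hq, h⟩
          refine ⟨⟨T q, hlt q hq⟩, fun s hsq => ?_⟩
          change T q ≤ s.1 at hsq
          obtain ⟨q', hq', h₁, h₂⟩ := hseg s.1 ((ht0 q hq).trans hsq) s.2
          have hqq : q ≤ q' := by
            by_contra hcon
            have h₃ : T (q' + 1) ≤ T q :=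
              hTmono _ _ (Order.add_one_le_of_lt (not_le.1 hcon)) hq
            exact absurd (hsq.trans_lt h₂) (not_lt.2 h₃)
          -- A cell may change between two passes, but by `hstep` a cell that is marked at both
          -- neighbouring passes is marked at all times between them. So the inferior limit over all
          -- times agrees with that over the passes.
          rcases h₁.lt_or_eq with h₁ | h₁
          · refine ((hnx q' (T q') (hq'.trans_le hpτ) (hCT q' hq')).2.2 s.1 h₁
              (hTs q' ▸ h₂)).2 i ⟨h q' hqq hq', h (q' + 1) (hqq.trans le_self_add) ?_⟩
            have := hp.succ_lt hq'
            rwa [Order.succ_eq_add_one] at this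
          · rw [← h₁, hCT q' hq']
            exact h q' hqq hq'
  refine ⟨T τ, ?_, (key τ le_rfl).1, fun s h h' => ?_⟩
  · rcases (zero_le (a := τ)).lt_or_eq with h | h
    · exact hT0 ▸ ((key τ le_rfl).2.1 0 h).le
    · rw [← h, hT0]
  · obtain ⟨q, hq, h₁, h₂⟩ := (key τ le_rfl).2.2 s h h'
    have hCq := (key q hq.le).1
    rcases h₁.lt_or_eq with h₁ | rfl
    · obtain ⟨h₃, h₄⟩ := (hnx q (T q) hq hCq).2.2 s h₁ (hTs q ▸ h₂)
      exact ⟨by omega, fun i => (subset_inter (hM q hq.le i)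
        (hM _ (Order.add_one_le_of_lt hq) i)).trans (h₄ i)⟩
    · rw [hCq]
      exact ⟨(hs q hq.le).ge, hM q hq.le⟩

end

section

/-! ### Structured programs -/

/-- This makes the rewinding of a head a descent through the ordinals, which ends after finitely
many steps. -/
theorem moveLeft_lt {h : Ordinal.{u}} (h₀ : h ≠ 0) : moveLeft h < h := by
  unfold moveLeft
  split_ifs with hs
  · conv_rhs => rw [hs.choose_spec]
    exact Order.lt_add_one_iff.2 le_rfl
  · exact pos_iff_ne_zero.2 h₀

/-- A move of the head. -/
def moveHead (m : Option Bool) (h : Ordinal.{u}) : Ordinal.{u} :=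
  match m with
  | none => h
  | some true => h + 1
  | some false => moveLeft h

/-- The line that keeps the symbol. -/
def keepLine (i : ℕ) (m : Option Bool) (g : ℕ) : Line := (i, (false, m, g), (true, m, g))

/-- The effect of writing a symbol. -/
def setBit (v : Bool) (p : Ordinal.{u}) (s : Set Ordinal.{u}) : Set Ordinal.{u} :=
  if v = true then insert p s else s \ {p}

theorem step_of_mem {P : Program} {C : Config.{u}} {i : ℕ} {a₀ : Action} {v m g}
    (h : P[C.state]? = some (i, a₀, (v, m, g))) (hm : C.head i ∈ C.tape i) :
    P.step C = ⟨g, Function.update C.head i (moveHead m (C.head i)),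
      Function.update C.tape i (setBit v (C.head i) (C.tape i))⟩ := by
  simp only [Program.step, h, if_pos hm]
  rfl

theorem step_of_notMem {P : Program} {C : Config.{u}} {i : ℕ} {a₁ : Action} {v m g}
    (h : P[C.state]? = some (i, (v, m, g), a₁)) (hm : C.head i ∉ C.tape i) :
    P.step C = ⟨g, Function.update C.head i (moveHead m (C.head i)),
      Function.update C.tape i (setBit v (C.head i) (C.tape i))⟩ := by
  simp only [Program.step, h, if_neg hm]
  rfl

theorem step_keepLine {P : Program} {C : Config.{u}} {i : ℕ} {m g}
    (h : P[C.state]? = some (keepLine i m g)) :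
    P.step C = ⟨g, Function.update C.head i (moveHead m (C.head i)), C.tape⟩ := by
  by_cases hm : C.head i ∈ C.tape i
  · rw [step_of_mem h hm]
    simp [setBit, insert_eq_of_mem hm]
  · rw [step_of_notMem h hm]
    simp [setBit, hm]

/-- Commands. They are started and left with all heads on cell `0`. Tape 5 has to contain only the
symbol on cell `0`. -/
inductive Cmd : Type
  | skip : Cmd
  /-- Tape `x` has to contain an initial segment, which is rewritten with the symbol `k`. At its end
  the cell of tape `A` is read, and its value determines which symbol is written on tape `W`. -/
  | op (k : Bool) (x A W : ℕ) (b₀ b₁ : Bool) : Cmd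
  | seq (c c' : Cmd) : Cmd
  /-- A conditional, on cell `0` of tape `F`. -/
  | ite (F : ℕ) (c c' : Cmd) : Cmd
  /-- A loop, while cell `0` of tape `F` contains the symbol. -/
  | whil (F : ℕ) (c : Cmd) : Cmd

/-- The number of states of the program of a command. -/
def Cmd.len : Cmd → ℕ
  | skip => 0
  | op .. => 9
  | seq c c' => c.len + c'.len
  | ite _ c c' => c.len + c'.len + 2
  | whil _ c => c.len + 2

/-- The program of a command, from state `b` on. -/
def Cmd.compile : Cmd → ℕ → List Line
  | skip, _ => []
  | op k x A W b₀ b₁, b =>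
    [(x, (false, none, b + 3), (k, some true, b + 1)), keepLine A (some true) (b + 2),
      keepLine 5 (some true) b, (A, (false, none, b + 4), (true, none, b + 5)),
      (W, (b₀, none, b + 6), (b₀, none, b + 6)), (W, (b₁, none, b + 6), (b₁, none, b + 6)),
      (5, (false, some false, b + 7), (true, none, b + 9)), keepLine A (some false) (b + 8),
      keepLine x (some false) (b + 6)]
  | seq c c', b => c.compile b ++ c'.compile (b + c.len)
  | ite F c c', b => (F, (false, none, b + c.len + 2), (true, none, b + 1)) :: (c.compile (b + 1) ++
      keepLine 5 none (b + c.len + 2 + c'.len) :: c'.compile (b + c.len + 2))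
  | whil F c, b => (F, (false, none, b + c.len + 2), (true, none, b + 1)) :: (c.compile (b + 1) ++
      [keepLine 5 none b])

theorem Cmd.length_compile (c : Cmd) : ∀ b, (c.compile b).length = c.len := by
  induction c with
  | skip => intro; rfl
  | op => intro; rfl
  | seq c c' h h' => intro b; simp [compile, len, h, h']
  | ite F c c' h h' => intro b; simp [compile, len, h, h']; omega
  | whil F c h => intro b; simp [compile, len, h]

/-- The program `P` contains the lines `l`, from state `b` on. -/
def HasCode (P : Program) (b : ℕ) (l : List Line) : Prop :=
  ∀ k, k < l.length → P[b + k]? = l[k]?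

theorem HasCode.left {P : Program} {b : ℕ} {l l' : List Line} (h : HasCode P b (l ++ l')) :
    HasCode P b l := by
  intro k hk
  rw [h k (by simp; omega), List.getElem?_append_left hk]

theorem HasCode.right {P : Program} {b : ℕ} {l l' : List Line} (h : HasCode P b (l ++ l')) :
    HasCode P (b + l.length) l' := by
  intro k hk
  rw [add_assoc, h (l.length + k) (by simp; omega), List.getElem?_append_right (by omega)]
  simp

theorem HasCode.head {P : Program} {b : ℕ} {a : Line} {l : List Line} (h : HasCode P b (a :: l)) :
    P[b]? = some a := by simpa using h 0 (by simp)

theorem HasCode.tail {P : Program} {b : ℕ} {a : Line} {l : List Line} (h : HasCode P b (a :: l)) :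
    HasCode P (b + 1) l := HasCode.right (l := [a]) h

/-- The contents of the tapes. -/
abbrev Tapes := ℕ → Set Ordinal.{u}

/-- The configuration with all heads on cell `0`. -/
def restCfg (q : ℕ) (T : Tapes.{u}) : Config.{u} := ⟨q, fun _ => 0, T⟩

/-- The command turns `T` into `T'`, and the tapes include `m` all the time. -/
def RunsT (c : Cmd) (m T T' : Tapes.{u}) : Prop :=
  ∀ P b, HasCode P b (c.compile b) → Leads P b m (restCfg b T) (restCfg (b + c.len) T')

theorem RunsT.skip {m T : Tapes.{u}} : RunsT Cmd.skip m T T := fun _ _ _ => Leads.refl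

theorem RunsT.seq {c c' : Cmd} {m T T₁ T' : Tapes.{u}} (h : RunsT c m T T₁)
    (h' : RunsT c' m T₁ T') : RunsT (c.seq c') m T T' := by
  intro P b hP
  have h₁ := h P b hP.left
  have h₂ := h' P (b + c.len) (by
    have := hP.right
    rwa [Cmd.length_compile] at this)
  refine h₁.trans ?_
  have := h₂.mono (Nat.le_add_right b c.len) (fun i => le_rfl)
  rwa [add_assoc] at this

/-- After the first branch there is one more step, the jump over the second branch. It is executed
on the tapes `T'`, hence the hypothesis `m ≤ T'`. -/
theorem RunsT.ite_true {F : ℕ} {c c' : Cmd} {m T T' : Tapes.{u}} (h : RunsT c m T T')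
    (hm : m ≤ T) (hm' : m ≤ T') (hF : 0 ∈ T F) : RunsT (Cmd.ite F c c') m T T' := by
  intro P b hP
  refine Leads.head ?_ rfl le_rfl hm
  rw [step_of_mem hP.head hF]
  have h₁ := (h P (b + 1) hP.tail.left).mono (Nat.le_succ b) (fun i => le_rfl)
  have h₂ := hP.tail.right.head
  rw [Cmd.length_compile] at h₂
  have h₃ : Leads P b m (restCfg (b + 1 + c.len) T') (restCfg (b + (Cmd.ite F c c').len) T') := by
    refine Leads.head ?_ rfl (by simp [restCfg]; omega) hm'
    rw [step_keepLine h₂]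
    convert Leads.refl using 1
    simp [restCfg, moveHead, Cmd.len]
    omega
  convert h₁.trans h₃ using 1
  simp [restCfg, moveHead, setBit]
  exact hF

theorem RunsT.ite_false {F : ℕ} {c c' : Cmd} {m T T' : Tapes.{u}} (h : RunsT c' m T T')
    (hm : m ≤ T) (hF : 0 ∉ T F) : RunsT (Cmd.ite F c c') m T T' := by
  intro P b hP
  refine Leads.head ?_ rfl le_rfl hm
  rw [step_of_notMem hP.head hF]
  have h₂ := hP.tail.right.tail
  rw [Cmd.length_compile] at h₂
  have h₁ := (h P (b + c.len + 2) (by convert h₂ using 1; omega)).mono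
    (by omega : b ≤ b + c.len + 2) (fun i => le_rfl)
  convert h₁ using 1
  · simp [restCfg, moveHead, setBit, hF]
  · simp [Cmd.len]
    congr 1
    omega

/-- The test of the flag sits in the smallest state of the loop, so `Leads.loop` applies with the
tests as passes. The heads are on cell `0` at each test, and their limit conditions are trivial. The
body has to keep the marks common to its start and its end, since otherwise marks could get lost at
limits of the loop. -/
theorem RunsT.whil {F : ℕ} {c : Cmd} {m : Tapes.{u}} (D : Ordinal.{u} → Tapes.{u}) (τ : Ordinal.{u})
    (hm : ∀ p ≤ τ, m ≤ D p) (hF : ∀ p < τ, 0 ∈ D p F) (hF' : 0 ∉ D τ F)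
    (hc : ∀ p < τ, RunsT c (D p ⊓ D (p + 1)) (D p) (D (p + 1)))
    (hlim : ∀ p ≤ τ, Order.IsSuccLimit p → ∀ i ξ, ξ ∈ D p i ↔
      ∃ r < p, ∀ q, r ≤ q → q < p → ξ ∈ D q i) : RunsT (Cmd.whil F c) m (D 0) (D τ) := by
  intro P b hP
  refine Leads.trans (D₁ := restCfg b (D τ)) ?_ ?_
  · refine Leads.loop (fun p => restCfg b (D p)) τ (fun _ _ => rfl) (fun p hp => ?_) hm
      (fun _ _ _ _ _ => le_rfl) (fun _ _ _ _ ξ h => absurd h not_lt_bot) hlim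
    rw [step_of_mem hP.head (hF p hp)]
    have h₁ := hc p hp P (b + 1) hP.tail.left
    have h₂ := hP.tail.right.head
    rw [Cmd.length_compile] at h₂
    have h₃ : Leads P (b + 1) (D p ⊓ D (p + 1)) (restCfg (b + 1 + c.len) (D (p + 1)))
        (restCfg b (D (p + 1))) := by
      refine Leads.head ?_ rfl (by simp [restCfg]) (fun i => inter_subset_right)
      rw [step_keepLine h₂]
      convert Leads.refl using 1
      simp [restCfg, moveHead]
    convert h₁.trans h₃ using 1
    · rfl
    · simp [restCfg, moveHead, setBit]
      exact hF p hp
  · refine Leads.head ?_ rfl le_rfl (hm τ le_rfl)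
    rw [step_of_notMem hP.head hF']
    convert Leads.refl using 1
    simp [restCfg, moveHead, setBit, hF', Cmd.len]
    omega

/-- The result of `Cmd.op`. -/
def opTapes (k : Bool) (x A W : ℕ) (b₀ b₁ : Bool) (α : Ordinal.{u}) (T : Tapes.{u}) : Tapes.{u} :=
  open Classical in
  let T₁ : Tapes.{u} := Function.update T x (if k then Iio α else ∅)
  Function.update T₁ W (setBit (if α ∈ T A then b₁ else b₀) (if W = x ∨ W = A then α else 0) (T₁ W))

/-- A configuration in which the heads on the tapes `x`, `A` and `5` are moved. -/
def walkCfg (x A q : ℕ) (p p' p'' : Ordinal.{u}) (T : Tapes.{u}) : Config.{u} :=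
  ⟨q, fun i => if i = x then p else if i = A then p' else if i = 5 then p'' else 0, T⟩

/-- The heads on `x`, `A` and `5` advance in step until tape `x` shows an unmarked cell, which
happens at cell `α`. There the cell of `A` is read and its value is kept in the state. The head on
`W` stands on `α` if `W` is one of the tapes walked on, and on `0` otherwise. Finally the three
heads go back until tape 5 shows its only mark. -/
theorem RunsT.op {k : Bool} {x A W : ℕ} {b₀ b₁ : Bool} {α : Ordinal.{u}} {m T : Tapes.{u}}
    (hxA : x ≠ A) (hx : x ≠ 5) (hA : A ≠ 5) (hW : W ≠ 5) (h5 : T 5 = {0}) (hT : T x = Iio α)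
    (hm : m ≤ T) (hm' : m ≤ opTapes k x A W b₀ b₁ α T) :
    RunsT (Cmd.op k x A W b₀ b₁) m T (opTapes k x A W b₀ b₁ α T) := by
  classical
  intro P b hP
  have l0 := hP 0 (by simp [Cmd.compile])
  have l1 := hP 1 (by simp [Cmd.compile])
  have l2 := hP 2 (by simp [Cmd.compile])
  have l3 := hP 3 (by simp [Cmd.compile])
  have l4 := hP 4 (by simp [Cmd.compile])
  have l5 := hP 5 (by simp [Cmd.compile])
  have l6 := hP 6 (by simp [Cmd.compile])
  have l7 := hP 7 (by simp [Cmd.compile])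
  have l8 := hP 8 (by simp [Cmd.compile])
  simp only [Cmd.compile, List.getElem?_cons_succ, List.getElem?_cons_zero, add_zero] at l0 l1 l2 l3 l4 l5 l6 l7 l8
  have st : ∀ {C D : Config.{u}}, C = D → P.step C = P.step D := fun h => by rw [h]
  -- The tapes when the heads are on cell `p`: in the erasing mode the cells of `x` below `p` are
  -- already empty.
  let X : Ordinal.{u} → Tapes.{u} := fun p => Function.update T x (if k then Iio α else Ico p α)
  have hX0 : X 0 = T := by
    have : (Ico 0 α) = Iio α := by ext; simp
    simp only [X, this, ite_self, ← hT]
    exact Function.update_eq_self x T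
  have hXα : X α = Function.update T x (if k then Iio α else ∅) := by simp [X]
  -- If tape `x` is being erased, `m` has to be empty there: it is included in the old content `Iio
  -- α` and in the final content, which has no element except possibly `α`.
  have hmX : ∀ p ≤ α, m ≤ X p := by
    intro p hp i
    by_cases hi : i = x
    · subst hi
      cases k
      · have h₁ : m i ⊆ Iio α := hT ▸ hm i
        have h₂ := hm' i
        by_cases hWi : W = i
        · subst hWi
          simp only [opTapes, Function.update_self, true_or, if_true] at h₂
          intro ξ hξ
          have h₃ := h₁ hξ
          have h₄ := h₂ hξ
          generalize (if α ∈ T A then b₁ else b₀) = v at h₄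
          exact absurd h₃ (by cases v <;> simp [setBit] at h₄ ⊢; exact h₄.ge)
        · simp only [opTapes, Function.update_of_ne (Ne.symm hWi), Function.update_self] at h₂
          intro ξ hξ
          exact absurd (h₂ hξ) (by simp)
      · simp only [X, Function.update_self, if_true]
        exact hT ▸ hm i
    · simp only [X, Function.update_of_ne hi]
      exact hm i
  have walk : Leads P b m (walkCfg x A b 0 0 0 (X 0)) (walkCfg x A b α α α (X α)) := by
    refine Leads.loop (fun p => walkCfg x A b p p p (X p)) α (fun _ _ => rfl) ?_ hmX ?_ ?_ ?_
    · intro p hp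
      have e0 : P.step (walkCfg x A b p p p (X p)) = walkCfg x A (b + 1) (p + 1) p p (X (p + 1)) := by
        rw [step_of_mem (C := walkCfg x A b p p p (X p)) l0
          (by simp [walkCfg, X]; split_ifs <;> simp [hp])]
        refine Config.eq_of rfl (fun i => ?_) (fun i => ?_)
        · by_cases hi : i = x <;> simp [walkCfg, Function.update_apply, hi, moveHead]
        · by_cases hi : i = x
          · subst hi
            simp only [walkCfg, X, Function.update_self, if_true, setBit]
            cases k
            · ext ξ; simp [lt_iff_le_and_ne, eq_comm]
            · ext ξ; simp only [if_true, mem_insert_iff, mem_Iio]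
              exact ⟨fun h => h.elim (fun h => h ▸ hp) id, Or.inr⟩
          · simp [walkCfg, X, hi]
      have e1 : P.step (walkCfg x A (b + 1) (p + 1) p p (X (p + 1))) =
          walkCfg x A (b + 2) (p + 1) (p + 1) p (X (p + 1)) := by
        rw [step_keepLine (C := walkCfg x A (b + 1) (p + 1) p p (X (p + 1))) l1]
        refine Config.eq_of rfl (fun i => ?_) (fun i => rfl)
        by_cases hi : i = A <;> simp [walkCfg, Function.update_apply, hi, moveHead, hxA.symm]
      have e2 : P.step (walkCfg x A (b + 2) (p + 1) (p + 1) p (X (p + 1))) =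
          walkCfg x A b (p + 1) (p + 1) (p + 1) (X (p + 1)) := by
        rw [step_keepLine (C := walkCfg x A (b + 2) (p + 1) (p + 1) p (X (p + 1))) l2]
        refine Config.eq_of rfl (fun i => ?_) (fun i => rfl)
        by_cases hi : i = 5 <;> simp [walkCfg, Function.update_apply, hi, moveHead, hx.symm, hA.symm]
      rw [e0]
      exact Leads.head (Leads.head Leads.refl e2 (by simp [walkCfg]) fun i => inter_subset_right)
        e1 (by simp [walkCfg]) fun i => inter_subset_right
    · intro p q hpq _ i
      simp only [walkCfg]
      split_ifs <;> first | exact hpq | exact le_rfl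
    · intro p _ hp i ξ hξ
      have : ξ + 1 < p → ∃ q < p, ξ < (walkCfg x A b q q q (X q)).head i := by
        intro h
        refine ⟨ξ + 1, h, ?_⟩
        simp only [walkCfg] at hξ ⊢
        split_ifs at hξ ⊢ <;> first | exact Order.lt_add_one_iff.2 le_rfl | exact absurd hξ not_lt_bot
      refine this ?_
      have h := hp.succ_lt (a := ξ) (by
        simp only [walkCfg] at hξ
        split_ifs at hξ <;> first | exact hξ | exact absurd hξ not_lt_bot)
      rwa [Order.succ_eq_add_one] at h
    · intro p hpα hp i ξ
      simp only [walkCfg, X]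
      have h0 : (0 : Ordinal) < p := hp.bot_lt
      by_cases hi : i = x
      · subst hi
        simp only [Function.update_self]
        cases k
        · simp only [Bool.false_eq_true, if_false, mem_Ico]
          constructor
          · intro h
            exact ⟨0, h0, fun q _ hq => ⟨hq.le.trans h.1, h.2⟩⟩
          · rintro ⟨r, hr, h⟩
            refine ⟨le_of_forall_lt fun c hc => ?_, (h r le_rfl hr).2⟩
            have h' := hp.succ_lt (max_lt hc hr)
            rw [Order.succ_eq_add_one] at h'
            exact ((le_max_left c r).trans_lt (Order.lt_add_one_iff.2 le_rfl)).trans_le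
              (h _ ((le_max_right c r).trans le_self_add) h').1
        · simp only [if_true]
          exact ⟨fun h => ⟨0, h0, fun _ _ _ => h⟩, fun ⟨r, hr, h⟩ => h r le_rfl hr⟩
      · simp only [Function.update_of_ne hi]
        exact ⟨fun h => ⟨0, h0, fun _ _ _ => h⟩, fun ⟨r, hr, h⟩ => h r le_rfl hr⟩
  have hstart : restCfg b T = walkCfg x A b 0 0 0 (X 0) := by
    rw [hX0]; simp [restCfg, walkCfg]
  rw [hstart]
  refine walk.trans ?_
  have e3 : P.step (walkCfg x A b α α α (X α)) = walkCfg x A (b + 3) α α α (X α) := by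
    have hn : α ∉ X α x := by simp [hXα]
    rw [step_of_notMem (C := walkCfg x A b α α α (X α)) l0 (by simpa [walkCfg] using hn)]
    refine Config.eq_of rfl (fun i => ?_) (fun i => ?_)
    · simp only [moveHead, Function.update_eq_self]; rfl
    · simp only [walkCfg, setBit, if_true, Bool.false_eq_true, if_false]
      rw [sdiff_singleton_eq_self hn, Function.update_eq_self]
  have hXA : X α A = T A := by simp [hXα, hxA.symm]
  let q := if α ∈ T A then b + 5 else b + 4
  have e4 : P.step (walkCfg x A (b + 3) α α α (X α)) = walkCfg x A q α α α (X α) := by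
    have hh : (walkCfg x A (b + 3) α α α (X α)).head A = α := by simp [walkCfg]
    by_cases hα : α ∈ T A
    · rw [step_of_mem (C := walkCfg x A (b + 3) α α α (X α)) l3 (by rw [hh]; simp only [walkCfg]; rwa [hXA])]
      refine Config.eq_of (by simp [walkCfg, q, hα]) (fun i => by simp only [moveHead, Function.update_eq_self]; rfl)
        (fun i => ?_)
      rw [hh]
      simp only [walkCfg, setBit, if_true]
      rw [insert_eq_of_mem (hXA ▸ hα), Function.update_eq_self]
    · rw [step_of_notMem (C := walkCfg x A (b + 3) α α α (X α)) l3 (by rw [hh]; simp only [walkCfg]; rwa [hXA])]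
      refine Config.eq_of (by simp [walkCfg, q, hα]) (fun i => by simp only [moveHead, Function.update_eq_self]; rfl)
        (fun i => ?_)
      rw [hh]
      simp only [walkCfg, setBit, Bool.false_eq_true, if_false]
      rw [sdiff_singleton_eq_self (hXA ▸ hα), Function.update_eq_self]
  have e5 : P.step (walkCfg x A q α α α (X α)) =
      walkCfg x A (b + 6) α α α (opTapes k x A W b₀ b₁ α T) := by
    have hline : P[(walkCfg x A q α α α (X α)).state]? = some (W,
        ((if α ∈ T A then b₁ else b₀), none, b + 6), ((if α ∈ T A then b₁ else b₀), none, b + 6)) := by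
      by_cases hα : α ∈ T A
      · simp only [walkCfg, q, hα, if_true]; exact l5
      · simp only [walkCfg, q, hα, if_false]; exact l4
    have hhead : (walkCfg x A q α α α (X α)).head W = if W = x ∨ W = A then α else 0 := by
      simp only [walkCfg, hW, if_false]
      split_ifs <;> simp_all
    have key : P.step (walkCfg x A q α α α (X α)) =
      ⟨b + 6, Function.update (walkCfg x A q α α α (X α)).head W (moveHead none
        ((walkCfg x A q α α α (X α)).head W)), Function.update (X α) W (setBit
          (if α ∈ T A then b₁ else b₀) ((walkCfg x A q α α α (X α)).head W) (X α W))⟩ := by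
      by_cases hmem : (walkCfg x A q α α α (X α)).head W ∈ (walkCfg x A q α α α (X α)).tape W
      · exact step_of_mem hline hmem
      · exact step_of_notMem hline hmem
    rw [key]
    refine Config.eq_of rfl (fun i => by simp [moveHead, walkCfg]) (fun i => ?_)
    rw [hhead]
    simp only [walkCfg, opTapes, hXα]
  have hT5 : opTapes k x A W b₀ b₁ α T 5 = {0} := by
    simp [opTapes, Function.update_of_ne hW.symm, Function.update_of_ne hx.symm, h5]
  -- The heads are moved separately but from the same position, so they agree again after each
  -- round, even when a limit sends all of them to `0`.
  have rewind : ∀ p, Leads P b m (walkCfg x A (b + 6) p p p (opTapes k x A W b₀ b₁ α T))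
      (walkCfg x A (b + 9) 0 0 0 (opTapes k x A W b₀ b₁ α T)) := by
    intro p
    set T' := opTapes k x A W b₀ b₁ α T
    induction p using WellFoundedLT.induction with
    | ind p ih =>
    have h5p : (walkCfg x A (b + 6) p p p T').head 5 = p := by simp [walkCfg, hx.symm, hA.symm]
    by_cases hp : p = 0
    · subst hp
      refine Leads.head Leads.refl ?_ (by simp [walkCfg]) hm'
      rw [step_of_mem (C := walkCfg x A (b + 6) 0 0 0 T') l6 (by rw [h5p]; simp [walkCfg, hT5])]
      refine Config.eq_of rfl (fun i => by simp [moveHead, walkCfg]) (fun i => ?_)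
      rw [h5p]
      simp only [walkCfg, setBit, if_true]
      rw [insert_eq_of_mem (by rw [hT5]; rfl), Function.update_eq_self]
    · have r1 : P.step (walkCfg x A (b + 6) p p p T') = walkCfg x A (b + 7) p p (moveLeft p) T' := by
        have hn : p ∉ T' 5 := by rw [hT5]; exact hp
        rw [step_of_notMem (C := walkCfg x A (b + 6) p p p T') l6 (by rw [h5p]; exact hn)]
        refine Config.eq_of rfl (fun i => ?_) (fun i => ?_)
        · rw [h5p]
          by_cases hi : i = 5 <;> simp [walkCfg, Function.update_apply, hi, moveHead, hx.symm, hA.symm]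
        · rw [h5p]
          simp only [walkCfg, setBit, Bool.false_eq_true, if_false]
          rw [sdiff_singleton_eq_self hn, Function.update_eq_self]
      have r2 : P.step (walkCfg x A (b + 7) p p (moveLeft p) T') =
          walkCfg x A (b + 8) p (moveLeft p) (moveLeft p) T' := by
        rw [step_keepLine (C := walkCfg x A (b + 7) p p (moveLeft p) T') l7]
        refine Config.eq_of rfl (fun i => ?_) (fun i => rfl)
        by_cases hi : i = A <;> simp [walkCfg, Function.update_apply, hi, moveHead, hxA.symm]
      have r3 : P.step (walkCfg x A (b + 8) p (moveLeft p) (moveLeft p) T') =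
          walkCfg x A (b + 6) (moveLeft p) (moveLeft p) (moveLeft p) T' := by
        rw [step_keepLine (C := walkCfg x A (b + 8) p (moveLeft p) (moveLeft p) T') l8]
        refine Config.eq_of rfl (fun i => ?_) (fun i => rfl)
        by_cases hi : i = x <;> simp [walkCfg, Function.update_apply, hi, moveHead]
      exact Leads.head (Leads.head (Leads.head (ih _ (moveLeft_lt hp)) r3 (by simp [walkCfg]) hm')
        r2 (by simp [walkCfg]) hm') r1 (by simp [walkCfg]) hm'
  refine Leads.head (Leads.head (Leads.head ?_ e5 (by simp only [walkCfg, q]; split_ifs <;> omega)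
    (hmX α le_rfl)) e4 (by simp [walkCfg]) (hmX α le_rfl)) e3 (by simp [walkCfg]) (hmX α le_rfl)
  convert rewind α using 1
  simp [restCfg, walkCfg, Cmd.len]

end

section

/-! ### Registers -/

/-- Registers for ordinals and registers for sets of ordinals. -/
abbrev St := (ℕ → Ordinal.{u}) × (ℕ → Set Ordinal.{u})

namespace St

/-- The registers on the tapes: the ordinal registers are on the odd tapes. -/
def tapes (s : St.{u}) : Tapes.{u} := fun i => if i % 2 = 0 then s.2 (i / 2) else Iio (s.1 (i / 2))

/-- Assignment to an ordinal register. -/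
def setX (s : St.{u}) (j : ℕ) (α : Ordinal.{u}) : St.{u} := (Function.update s.1 j α, s.2)

/-- Assignment to a set register. -/
def setA (s : St.{u}) (a : ℕ) (S : Set Ordinal.{u}) : St.{u} := (s.1, Function.update s.2 a S)

@[simp] theorem tapes_even (s : St.{u}) (j : ℕ) : s.tapes (2 * j) = s.2 j := by simp [tapes]

@[simp] theorem tapes_odd (s : St.{u}) (j : ℕ) : s.tapes (2 * j + 1) = Iio (s.1 j) := by
  have : (2 * j + 1) / 2 = j := by omega
  simp [tapes, this]

theorem tapes_mono {m s : St.{u}} (h : m ≤ s) : m.tapes ≤ s.tapes := by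
  intro i
  unfold tapes
  split_ifs
  · exact h.2 _
  · exact Iio_subset_Iio (h.1 _)

theorem tapes_inf (s s' : St.{u}) : (s ⊓ s').tapes = s.tapes ⊓ s'.tapes := by
  funext i
  simp only [tapes, Pi.inf_apply, Prod.fst_inf, Prod.snd_inf]
  split_ifs
  · rfl
  · ext; simp

theorem tapes_setX (s : St.{u}) (j : ℕ) (α : Ordinal.{u}) :
    (s.setX j α).tapes = Function.update s.tapes (2 * j + 1) (Iio α) := by
  funext i
  rcases Nat.even_or_odd' i with ⟨k, rfl | rfl⟩
  · simp [setX, Function.update_of_ne (by omega : 2 * k ≠ 2 * j + 1)]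
  · by_cases h : k = j
    · subst h; simp [setX]
    · simp [setX, h]

theorem tapes_setA (s : St.{u}) (a : ℕ) (S : Set Ordinal.{u}) :
    (s.setA a S).tapes = Function.update s.tapes (2 * a) S := by
  funext i
  rcases Nat.even_or_odd' i with ⟨k, rfl | rfl⟩
  · by_cases h : k = a
    · subst h; simp [setA]
    · simp [setA, h]
  · simp [setA, Function.update_of_ne (by omega : 2 * k + 1 ≠ 2 * a)]

theorem le_setX {m s : St.{u}} {j : ℕ} {α : Ordinal.{u}} (h : m ≤ s) (h' : m.1 j ≤ α) :
    m ≤ s.setX j α := by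
  refine ⟨fun i => ?_, h.2⟩
  by_cases hi : i = j
  · subst hi; simpa [setX] using h'
  · simpa [setX, Function.update_of_ne hi] using h.1 i

theorem le_setA {m s : St.{u}} {a : ℕ} {S : Set Ordinal.{u}} (h : m ≤ s) (h' : m.2 a ⊆ S) :
    m ≤ s.setA a S := by
  refine ⟨h.1, fun i => ?_⟩
  by_cases hi : i = a
  · subst hi; simpa [setA] using h'
  · simpa [setA, Function.update_of_ne hi] using h.2 i

@[simp] theorem setX_same (s : St.{u}) (j : ℕ) (α : Ordinal.{u}) : (s.setX j α).1 j = α := by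
  simp [setX]

theorem setX_ne (s : St.{u}) {i j : ℕ} (α : Ordinal.{u}) (h : i ≠ j) :
    (s.setX j α).1 i = s.1 i := by
  simp [setX, Function.update_of_ne h]

theorem setX_apply (s : St.{u}) (i j : ℕ) (α : Ordinal.{u}) :
    (s.setX j α).1 i = if i = j then α else s.1 i := by
  simp [setX, Function.update_apply]

@[simp] theorem setX_snd (s : St.{u}) (j : ℕ) (α : Ordinal.{u}) : (s.setX j α).2 = s.2 := rfl

@[simp] theorem setA_fst (s : St.{u}) (a : ℕ) (S : Set Ordinal.{u}) : (s.setA a S).1 = s.1 := rfl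

@[simp] theorem setA_same (s : St.{u}) (a : ℕ) (S : Set Ordinal.{u}) : (s.setA a S).2 a = S := by
  simp [setA]

theorem setA_apply (s : St.{u}) (i a : ℕ) (S : Set Ordinal.{u}) :
    (s.setA a S).2 i = if i = a then S else s.2 i := by
  simp [setA, Function.update_apply]

theorem ext' {s s' : St.{u}} (h : ∀ i, s.1 i = s'.1 i) (h' : ∀ i, s.2 i = s'.2 i) : s = s' :=
  Prod.ext (funext h) (funext h')

end St

/-- The command `c` turns `s` into `s'`, and all the time the registers are at least as in `m`. -/
def Runs (c : Cmd) (m s s' : St.{u}) : Prop :=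
  s.1 2 = 1 → s'.1 2 = 1 ∧ RunsT c m.tapes s.tapes s'.tapes

namespace Runs

variable {c c' : Cmd} {m m' s s₁ s' : St.{u}}

theorem of_eq (h : Runs c m s s₁) (h' : s₁ = s') : Runs c m s s' := h' ▸ h

theorem mono (h : Runs c m s s') (hm : m' ≤ m) : Runs c m' s s' := fun h2 =>
  ⟨(h h2).1, fun P b hP => ((h h2).2 P b hP).mono le_rfl (St.tapes_mono hm)⟩

theorem skip : Runs Cmd.skip m s s := fun h => ⟨h, RunsT.skip⟩

theorem seq (h : Runs c m s s₁) (h' : Runs c' m s₁ s') : Runs (c.seq c') m s s' := fun h2 =>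
  ⟨(h' (h h2).1).1, (h h2).2.seq (h' (h h2).1).2⟩

theorem ite_true {f : ℕ} (h : Runs c m s s') (hm : m ≤ s) (hm' : m ≤ s') (hf : s.1 f ≠ 0) :
    Runs (Cmd.ite (2 * f + 1) c c') m s s' := fun h2 =>
  ⟨(h h2).1, (h h2).2.ite_true (St.tapes_mono hm) (St.tapes_mono hm')
    (by simpa [pos_iff_ne_zero] using hf)⟩

theorem ite_false {f : ℕ} (h : Runs c' m s s') (hm : m ≤ s) (hf : s.1 f = 0) :
    Runs (Cmd.ite (2 * f + 1) c c') m s s' := fun h2 =>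
  ⟨(h h2).1, (h h2).2.ite_false (St.tapes_mono hm) (by simp [hf])⟩

end Runs

theorem RunsT.of_eq {c : Cmd} {m T T₁ T' : Tapes.{u}} (h : RunsT c m T T₁) (h' : T₁ = T') :
    RunsT c m T T' := h' ▸ h

theorem insert_Iio (α : Ordinal.{u}) : insert α (Iio α) = Iio (α + 1) := by
  ext ξ
  simp only [mem_insert_iff, mem_Iio, Order.lt_add_one_iff]
  exact ⟨fun h => h.elim le_of_eq le_of_lt, fun h => h.eq_or_lt⟩

theorem insert_zero_Iio (α : Ordinal.{u}) : insert 0 (Iio α) = Iio (max α 1) := by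
  ext ξ
  simp [or_comm]

namespace Cmd

/-- Adds one to an ordinal register. -/
def incr (j : ℕ) : Cmd := op true (2 * j + 1) 0 (2 * j + 1) true true

/-- Sets an ordinal register to `0`. -/
def clear (j : ℕ) : Cmd := op false (2 * j + 1) 0 (2 * j + 1) false false

/-- Sets register `f` to `1` if register `i` is less than register `j`. -/
def getLt (i j f : ℕ) : Cmd := op true (2 * i + 1) (2 * j + 1) (2 * f + 1) false true

/-- Sets register `f` to `1` if register `i` is in the set register `a`. -/
def getMem (i a f : ℕ) : Cmd := op true (2 * i + 1) (2 * a) (2 * f + 1) false true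

/-- Changes the membership of register `i` in the set register `a`. -/
def putMem (i a : ℕ) (v : Bool) : Cmd := op true (2 * i + 1) (2 * a) (2 * a) v v

/-- Makes an ordinal register at least `1`. -/
def setOne (f : ℕ) : Cmd := op true (2 * (f + 3) + 1) 0 (2 * f + 1) true true

end Cmd

namespace Runs

variable {c c' : Cmd} {m m' s s₁ s' : St.{u}}

/-- Tape 5 is the ordinal register 2. The value `1`, which `Runs` requires and preserves, makes it
the mark for the left end that the basic commands use. -/
theorem tape5 (h2 : s.1 2 = 1) : s.tapes 5 = {0} := by
  have := St.tapes_odd s 2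
  rw [h2] at this
  exact this.trans (by ext; simp)

/-- The tape walked on is also the tape written on, so the mark goes to the cell just behind the
initial segment. What is read on tape 0 does not matter, because both symbols to be written are
equal. -/
theorem incr {j : ℕ} (hj : j ≠ 2) (hm : m ≤ s) :
    Runs (Cmd.incr j) m s (s.setX j (s.1 j + 1)) := by
  intro h2
  have heq : opTapes true (2 * j + 1) 0 (2 * j + 1) true true (s.1 j) s.tapes =
      (s.setX j (s.1 j + 1)).tapes := by
    simp [opTapes, St.tapes_setX, setBit, ← insert_Iio]
  refine ⟨by rw [St.setX_ne _ _ hj.symm, h2], RunsT.of_eq ?_ heq⟩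
  refine RunsT.op (by omega) (by omega) (by omega) (by omega) (tape5 h2) (by simp)
    (St.tapes_mono hm) ?_
  rw [heq]
  exact St.tapes_mono (St.le_setX hm ((hm.1 j).trans le_self_add))

theorem clear {j : ℕ} (hj : j ≠ 2) (hm : m ≤ s) (hm' : m.1 j = 0) :
    Runs (Cmd.clear j) m s (s.setX j 0) := by
  intro h2
  have heq : opTapes false (2 * j + 1) 0 (2 * j + 1) false false (s.1 j) s.tapes =
      (s.setX j 0).tapes := by
    simp [opTapes, St.tapes_setX, setBit]
  refine ⟨by rw [St.setX_ne _ _ hj.symm, h2], RunsT.of_eq ?_ heq⟩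
  refine RunsT.op (by omega) (by omega) (by omega) (by omega) (tape5 h2) (by simp)
    (St.tapes_mono hm) ?_
  rw [heq]
  exact St.tapes_mono (St.le_setX hm hm'.le)

open Classical in
-- After the walk along `Iio (s.1 i)` the head on the tape of `j` stands on cell `s.1 i`, which is
-- marked exactly if `s.1 i < s.1 j`. The answer is written on cell `0` of a third tape and thus
-- turns the value `0` of its register into a truth value.
theorem getLt {i j f : ℕ} (hij : i ≠ j) (hi : i ≠ 2) (hj : j ≠ 2) (hf : f ≠ 2) (hfi : f ≠ i)
    (hfj : f ≠ j) (hf0 : s.1 f = 0) (hm : m ≤ s) :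
    Runs (Cmd.getLt i j f) m s (s.setX f (if s.1 i < s.1 j then 1 else 0)) := by
  intro h2
  have heq : opTapes true (2 * i + 1) (2 * j + 1) (2 * f + 1) false true (s.1 i) s.tapes =
      (s.setX f (if s.1 i < s.1 j then 1 else 0)).tapes := by
    have h₁ : Function.update s.tapes (2 * i + 1) (Iio (s.1 i)) = s.tapes := by
      rw [← St.tapes_odd]; exact Function.update_eq_self _ _
    simp only [opTapes, St.tapes_setX, setBit, if_true, h₁, St.tapes_odd, mem_Iio, hf0]
    congr 1
    split_ifs with hh <;> simp_all
  refine ⟨by rw [St.setX_ne _ _ hf.symm, h2], RunsT.of_eq ?_ heq⟩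
  refine RunsT.op (by omega) (by omega) (by omega) (by omega) (tape5 h2) (by simp)
    (St.tapes_mono hm) ?_
  rw [heq]
  exact St.tapes_mono (St.le_setX hm ((hm.1 f).trans (by simp [hf0])))

open Classical in
theorem getMem {i a f : ℕ} (hi : i ≠ 2) (hf : f ≠ 2) (hfi : f ≠ i)
    (hf0 : s.1 f = 0) (hm : m ≤ s) :
    Runs (Cmd.getMem i a f) m s (s.setX f (if s.1 i ∈ s.2 a then 1 else 0)) := by
  intro h2
  have heq : opTapes true (2 * i + 1) (2 * a) (2 * f + 1) false true (s.1 i) s.tapes =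
      (s.setX f (if s.1 i ∈ s.2 a then 1 else 0)).tapes := by
    have h₁ : Function.update s.tapes (2 * i + 1) (Iio (s.1 i)) = s.tapes := by
      rw [← St.tapes_odd]; exact Function.update_eq_self _ _
    have h₃ : ¬ (2 * f + 1 = 2 * a) := by omega
    simp only [opTapes, St.tapes_setX, setBit, if_true, h₁, St.tapes_odd, St.tapes_even, hf0]
    congr 1
    split_ifs with hh <;> simp_all
  refine ⟨by rw [St.setX_ne _ _ hf.symm, h2], RunsT.of_eq ?_ heq⟩
  refine RunsT.op (by omega) (by omega) (by omega) (by omega) (tape5 h2) (by simp)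
    (St.tapes_mono hm) ?_
  rw [heq]
  exact St.tapes_mono (St.le_setX hm ((hm.1 f).trans (by simp [hf0])))

theorem putMem {i a : ℕ} {v : Bool} (hi : i ≠ 2) (hm : m ≤ s)
    (hm' : m.2 a ⊆ setBit v (s.1 i) (s.2 a)) :
    Runs (Cmd.putMem i a v) m s (s.setA a (setBit v (s.1 i) (s.2 a))) := by
  intro h2
  have heq : opTapes true (2 * i + 1) (2 * a) (2 * a) v v (s.1 i) s.tapes =
      (s.setA a (setBit v (s.1 i) (s.2 a))).tapes := by
    have h₁ : Function.update s.tapes (2 * i + 1) (Iio (s.1 i)) = s.tapes := by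
      rw [← St.tapes_odd]; exact Function.update_eq_self _ _
    simp [opTapes, St.tapes_setA, h₁]
  refine ⟨h2, RunsT.of_eq ?_ heq⟩
  refine RunsT.op (by omega) (by omega) (by omega) (by omega) (tape5 h2) (by simp)
    (St.tapes_mono hm) ?_
  rw [heq]
  exact St.tapes_mono (St.le_setA hm hm')

/-- The walk takes place on an unrelated tape, that of register `f + 3`, only in order to leave the
head on the tape of `f` on cell `0`. -/
theorem setOne {f : ℕ} (hf : f ≠ 2) (hm : m ≤ s) :
    Runs (Cmd.setOne f) m s (s.setX f (max (s.1 f) 1)) := by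
  intro h2
  have heq : opTapes true (2 * (f + 3) + 1) 0 (2 * f + 1) true true (s.1 (f + 3)) s.tapes =
      (s.setX f (max (s.1 f) 1)).tapes := by
    have h₁ : Function.update s.tapes (2 * (f + 3) + 1) (Iio (s.1 (f + 3))) = s.tapes := by
      rw [← St.tapes_odd]; exact Function.update_eq_self _ _
    simp [opTapes, St.tapes_setX, h₁, setBit, insert_zero_Iio]
  refine ⟨by rw [St.setX_ne _ _ hf.symm, h2], RunsT.of_eq ?_ heq⟩
  refine RunsT.op (by omega) (by omega) (by omega) (by omega) (tape5 h2) (by simp)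
    (St.tapes_mono hm) ?_
  rw [heq]
  exact St.tapes_mono (St.le_setX hm ((hm.1 f).trans (le_max_left _ _)))

/-- The limit of registers `S q`, `q < p`. -/
def _root_.OTM.St.IsLim (S : Ordinal.{u} → St.{u}) (p : Ordinal.{u}) : Prop :=
  (∀ i ξ, ξ < (S p).1 i ↔ ∃ r < p, ∀ q, r ≤ q → q < p → ξ < (S q).1 i) ∧
    ∀ i ξ, ξ ∈ (S p).2 i ↔ ∃ r < p, ∀ q, r ≤ q → q < p → ξ ∈ (S q).2 i

theorem whil {f : ℕ} (D : Ordinal.{u} → St.{u}) (τ : Ordinal.{u})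
    (hm : ∀ p ≤ τ, m ≤ D p) (h2 : ∀ p ≤ τ, (D p).1 2 = 1) (hF : ∀ p < τ, (D p).1 f ≠ 0)
    (hF' : (D τ).1 f = 0)
    (hc : ∀ p < τ, Runs c (D p ⊓ D (p + 1)) (D p) (D (p + 1)))
    (hlim : ∀ p ≤ τ, Order.IsSuccLimit p → St.IsLim D p) :
    Runs (Cmd.whil (2 * f + 1) c) m (D 0) (D τ) := by
  refine fun _ => ⟨h2 τ le_rfl, RunsT.whil (fun p => (D p).tapes) τ (fun p hp => St.tapes_mono (hm p hp))
    (fun p hp => ?_) ?_ (fun p hp => ?_) (fun p hp hp' i ξ => ?_)⟩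
  · simpa [pos_iff_ne_zero] using hF p hp
  · simp [hF']
  · have := ((hc p hp) (h2 p hp.le)).2
    rwa [St.tapes_inf] at this
  · rcases Nat.even_or_odd' i with ⟨k, rfl | rfl⟩
    · simpa using (hlim p hp hp').2 k ξ
    · simpa using (hlim p hp hp').1 k ξ

end Runs

/-- `for d+1 < j do c`. The registers `d` and `d+2` are used, too. -/
def Cmd.forC (d j : ℕ) (c : Cmd) : Cmd :=
  seq (incr d) (seq (whil (2 * d + 1) (seq (getLt (d + 1) j (d + 2))
    (ite (2 * (d + 2) + 1) (seq (clear (d + 2)) (seq c (incr (d + 1)))) (clear d)))) (clear (d + 1)))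

/-- The registers during the execution of a `for` loop. -/
def St.stage (s : St.{u}) (d : ℕ) (p : Ordinal.{u}) : St.{u} := (s.setX d 1).setX (d + 1) p

/-- Register `d` is the flag of the loop, `d + 1` the counter and `d + 2` the result of the
comparison. The round with counter `β` only takes down the flag, so the `while` loop has `β + 1`
rounds and all its limit stages are at most `β`. At a limit stage `p` the inferior limit of the
counter is `p` itself, and the rest is given by the continuity of `S`. -/
theorem Runs.forC {d j : ℕ} {c : Cmd} {m : St.{u}} {β : Ordinal.{u}} (hd : 3 ≤ d) (hjd : j < d)
    (hj2 : j ≠ 2) (S : Ordinal.{u} → St.{u}) (h0 : ∀ p ≤ β, (S p).1 d = 0)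
    (h1 : ∀ p ≤ β, (S p).1 (d + 1) = 0) (h2 : ∀ p ≤ β, (S p).1 (d + 2) = 0)
    (hS2 : ∀ p ≤ β, (S p).1 2 = 1) (hβ : ∀ p ≤ β, (S p).1 j = β) (hm : ∀ p ≤ β, m ≤ S p)
    (hc : ∀ p < β, Runs c ((S p).stage d p ⊓ (S (p + 1)).stage d p) ((S p).stage d p)
      ((S (p + 1)).stage d p))
    (hlim : ∀ p ≤ β, Order.IsSuccLimit p → St.IsLim S p) :
    Runs (Cmd.forC d j c) m (S 0) (S β) := by
  classical
  have hmd : m.1 d = 0 := le_antisymm ((h0 0 zero_le) ▸ (hm 0 zero_le).1 d) zero_le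
  have hmd1 : m.1 (d + 1) = 0 := le_antisymm ((h1 0 zero_le) ▸ (hm 0 zero_le).1 _) zero_le
  have hmstage : ∀ p ≤ β, ∀ q, m ≤ (S p).stage d q := fun p hp q =>
    St.le_setX (St.le_setX (hm p hp) (by simp [hmd])) (by simp [hmd1])
  let D : Ordinal.{u} → St.{u} := fun p =>
    if p ≤ β then (S p).stage d p else ((S β).stage d β).setX d 0
  have hD : ∀ p ≤ β, D p = (S p).stage d p := fun p hp => if_pos hp
  have hDe : D (β + 1) = ((S β).stage d β).setX d 0 := if_neg (by simp)
  have hcase : ∀ p ≤ β + 1, p ≤ β ∨ p = β + 1 := fun p hp => by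
    rcases hp.lt_or_eq with h | h
    · exact Or.inl (Order.lt_add_one_iff.1 h)
    · exact Or.inr h
  have hloop : Runs (Cmd.whil (2 * d + 1) (Cmd.seq (Cmd.getLt (d + 1) j (d + 2))
    (Cmd.ite (2 * (d + 2) + 1) (Cmd.seq (Cmd.clear (d + 2)) (Cmd.seq c (Cmd.incr (d + 1))))
      (Cmd.clear d)))) m (D 0) (D (β + 1)) := by
    refine Runs.whil D (β + 1) (fun p hp => ?_) (fun p hp => ?_) (fun p hp => ?_) ?_ ?_ ?_
    · rcases hcase p hp with h | rfl
      · rw [hD p h]; exact hmstage p h p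
      · rw [hDe]; exact St.le_setX (hmstage β le_rfl β) (by simp [hmd])
    · rcases hcase p hp with h | rfl
      · rw [hD p h]
        simp [St.stage, St.setX_apply, hS2 p h, show 2 ≠ d by omega, show 2 ≠ d + 1 by omega]
      · rw [hDe]
        simp [St.stage, St.setX_apply, hS2 β le_rfl, show 2 ≠ d by omega, show 2 ≠ d + 1 by omega]
    · rw [hD p (Order.lt_add_one_iff.1 hp)]
      simp [St.stage, St.setX_apply]
    · rw [hDe]; simp
    · intro p hp
      have hp' := Order.lt_add_one_iff.1 hp
      rw [hD p hp']
      have hf : ((S p).stage d p).1 (d + 2) = 0 := by simp [St.stage, St.setX_apply, h2 p hp']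
      have hv : ((S p).stage d p).1 (d + 1) = p := by simp [St.stage]
      have hj : ((S p).stage d p).1 j = β := by
        simp [St.stage, St.setX_apply, hβ p hp', show j ≠ d by omega, show j ≠ d + 1 by omega]
      have get := fun (m' : St.{u}) (hm' : m' ≤ (S p).stage d p) =>
        Runs.getLt (i := d + 1) (j := j) (f := d + 2) (s := (S p).stage d p) (m := m')
        (by omega) (by omega) hj2 (by omega) (by omega) (by omega) hf hm'
      rw [hv, hj] at get
      rcases hp'.lt_or_eq with h | rfl
      · have hp1 := Order.add_one_le_of_lt h
        rw [hD _ hp1]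
        rw [if_pos h] at get
        -- The body is specified with the counter `p` at its start and at its end. The lower bound
        -- for the whole round fits this, because its counter is at most `p`.
        have hle : (S p).stage d p ⊓ (S (p + 1)).stage d (p + 1) ≤
            (S p).stage d p ⊓ (S (p + 1)).stage d p := by
          refine le_inf inf_le_left ⟨fun i => ?_, fun i => inter_subset_right⟩
          by_cases hi : i = d + 1
          · subst hi
            exact (min_le_left _ _).trans (by rw [hv, St.stage, St.setX_same])
          · exact (min_le_right _ _).trans (by simp [St.stage, St.setX_ne _ _ hi])
        have e : (((S p).stage d p).setX (d + 2) 1).setX (d + 2) 0 = (S p).stage d p := by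
          refine St.ext' (fun i => ?_) (fun i => rfl)
          by_cases hi : i = d + 2
          · subst hi; simp [hf]
          · simp [St.setX_apply, hi]
        have hmf : ∀ m' : St.{u}, m' ≤ (S p).stage d p → m'.1 (d + 2) = 0 := fun m' hm' =>
          le_antisymm (hf ▸ hm'.1 _) zero_le
        have e' : ((S (p + 1)).stage d p).setX (d + 1) (((S (p + 1)).stage d p).1 (d + 1) + 1) =
            (S (p + 1)).stage d (p + 1) := by
          refine St.ext' (fun i => ?_) (fun i => rfl)
          by_cases hi : i = d + 1
          · subst hi; simp [St.stage]
          · simp [St.stage, St.setX_apply, hi]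
        refine Runs.seq (get _ inf_le_left) (Runs.ite_true (Runs.seq ((Runs.clear (by omega)
          (St.le_setX inf_le_left (by rw [hmf _ inf_le_left]; exact zero_le)) (hmf _ inf_le_left)).of_eq e)
          (Runs.seq ((hc p h).mono hle) ((Runs.incr (by omega) (hle.trans inf_le_right)).of_eq e')))
          (St.le_setX inf_le_left (by rw [hmf _ inf_le_left]; exact zero_le)) inf_le_right (by simp))
      · rw [hDe]
        rw [if_neg (lt_irrefl _)] at get
        have e : ((S p).stage d p).setX (d + 2) 0 = (S p).stage d p := by
          refine St.ext' (fun i => ?_) (fun i => rfl)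
          by_cases hi : i = d + 2
          · subst hi; simp [hf]
          · simp [St.setX_apply, hi]
        rw [e] at get
        refine Runs.seq (get _ inf_le_left) (Runs.ite_false (Runs.clear (by omega) inf_le_left ?_)
          inf_le_left hf)
        refine le_antisymm ?_ zero_le
        refine (inf_le_right : (S p).stage d p ⊓ ((S p).stage d p).setX d 0 ≤ _).1 d |>.trans ?_
        simp
    · intro p hp hlp
      have hpβ : p ≤ β := (hcase p hp).resolve_right fun h => by
        rw [h] at hlp
        exact Order.not_isSuccLimit_succ β (by rwa [Order.succ_eq_add_one])
      have hp0 : 0 < p := hlp.bot_lt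
      have hDq : ∀ q < p, D q = (S q).stage d q := fun q hq => hD q (hq.le.trans hpβ)
      constructor
      · intro i ξ
        have e : (∃ r < p, ∀ q, r ≤ q → q < p → ξ < (D q).1 i) ↔
            ∃ r < p, ∀ q, r ≤ q → q < p → ξ < ((S q).stage d q).1 i := by
          refine exists_congr fun r => and_congr_right fun _ => forall_congr' fun q =>
            forall_congr' fun _ => forall_congr' fun hq => by rw [hDq q hq]
        rw [e, hD p hpβ]
        by_cases hi : i = d + 1
        · subst hi
          simp only [St.stage, St.setX_same]
          constructor
          · intro h
            have := hlp.succ_lt h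
            rw [Order.succ_eq_add_one] at this
            exact ⟨ξ + 1, this, fun q hq _ => (Order.lt_add_one_iff.2 le_rfl).trans_le hq⟩
          · rintro ⟨r, hr, h⟩
            exact (h r le_rfl hr).trans hr
        · by_cases hi' : i = d
          · subst hi'
            simp only [St.stage, St.setX_ne _ _ hi, St.setX_same]
            exact ⟨fun h => ⟨0, hp0, fun _ _ _ => h⟩, fun ⟨r, hr, h⟩ => h r le_rfl hr⟩
          · simp only [St.stage, St.setX_ne _ _ hi, St.setX_ne _ _ hi']
            exact (hlim p hpβ hlp).1 i ξ
      · intro i ξ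
        have e : (∃ r < p, ∀ q, r ≤ q → q < p → ξ ∈ (D q).2 i) ↔
            ∃ r < p, ∀ q, r ≤ q → q < p → ξ ∈ (S q).2 i := by
          refine exists_congr fun r => and_congr_right fun _ => forall_congr' fun q =>
            forall_congr' fun _ => forall_congr' fun hq => by rw [hDq q hq]; rfl
        rw [e, hD p hpβ]
        exact (hlim p hpβ hlp).2 i ξ
  have e0 : (S 0).setX d ((S 0).1 d + 1) = D 0 := by
    rw [hD 0 zero_le]
    refine St.ext' (fun i => ?_) (fun i => rfl)
    simp only [St.stage, St.setX_apply, h0 0 zero_le, zero_add]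
    split_ifs <;> simp_all
  have e1 : (D (β + 1)).setX (d + 1) 0 = S β := by
    rw [hDe]
    refine St.ext' (fun i => ?_) (fun i => rfl)
    simp only [St.stage, St.setX_apply]
    split_ifs <;> simp_all
  refine Runs.seq ((Runs.incr (by omega) (hm 0 zero_le)).of_eq e0) (Runs.seq hloop
    ((Runs.clear (by omega) ?_ hmd1).of_eq e1))
  rw [hDe]
  exact St.le_setX (hmstage β le_rfl β) (by simp [hmd])

end

section

/-! ### The pairing function -/

theorem pairBase_le_iff {μ a : Ordinal.{u}} :
    pairBase μ ≤ a ↔ ∀ ν < μ, pairBase ν + ν + ν + 1 ≤ a := by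
  rw [pairBase]
  constructor
  · intro h ν hν
    exact (le_ciSup (bddAbove_of_small (s := range fun ν : Iio μ =>
      pairBase ν.1 + ν.1 + ν.1 + 1)) ⟨ν, hν⟩).trans h
  · exact fun h => ciSup_le' fun ν => h ν.1 ν.2

theorem lt_pairBase_iff {μ a : Ordinal.{u}} :
    a < pairBase μ ↔ ∃ ν < μ, a < pairBase ν + ν + ν + 1 := by
  rw [← not_le, pairBase_le_iff]; push Not; rfl

theorem pairBase_strictMono : StrictMono pairBase.{u} := fun _ _ h =>
  lt_pairBase_iff.2 ⟨_, h, Order.lt_add_one_iff.2 (by rw [add_assoc]; exact le_self_add)⟩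

@[simp] theorem pairBase_zero : pairBase.{u} 0 = 0 :=
  le_antisymm (pairBase_le_iff.2 fun _ h => absurd h not_lt_bot) zero_le

/-- The pairs with maximum `μ` are the `(α, μ)` with `α < μ`, followed by the `(μ, β)` with `β ≤ μ`;
they have the order type `μ + μ + 1`. -/
theorem pairBase_succ (μ : Ordinal.{u}) : pairBase (μ + 1) = pairBase μ + μ + μ + 1 := by
  refine le_antisymm (pairBase_le_iff.2 fun ν hν => ?_)
    (pairBase_le_iff.1 le_rfl μ (Order.lt_add_one_iff.2 le_rfl))
  have h := Order.lt_add_one_iff.1 hν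
  gcongr
  exact pairBase_strictMono.monotone h

theorem lt_pairBase_limit {μ a : Ordinal.{u}} (hμ : Order.IsSuccLimit μ) (h : a < pairBase μ) :
    ∃ ν < μ, a < pairBase ν := by
  obtain ⟨ν, hν, h⟩ := lt_pairBase_iff.1 h
  have := hμ.succ_lt hν
  rw [Order.succ_eq_add_one] at this
  exact ⟨ν + 1, this, by rwa [pairBase_succ]⟩

/-! ### Arithmetic commands -/

/-- The ordinal registers from `d` on contain `0`. -/
def St.Clean (s : St.{u}) (d : ℕ) : Prop := ∀ i, d ≤ i → s.1 i = 0

theorem St.Clean.mono {s : St.{u}} {d d' : ℕ} (h : s.Clean d) (hd : d ≤ d') : s.Clean d' :=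
  fun i hi => h i (hd.trans hi)

theorem St.Clean.setX {s : St.{u}} {d j : ℕ} {α : Ordinal.{u}} (h : s.Clean d) (hj : j < d) :
    (s.setX j α).Clean d := fun i hi => by rw [St.setX_ne _ _ (by omega), h i hi]

theorem St.Clean.le {s : St.{u}} {d j : ℕ} {α : Ordinal.{u}} (h : s.Clean d) (hj : d ≤ j) :
    s ≤ s.setX j α := St.le_setX le_rfl (by rw [h j hj]; exact zero_le)

theorem St.Clean.stage {s : St.{u}} {d : ℕ} {p : Ordinal.{u}} (h : s.Clean d) :
    (s.stage d p).Clean (d + 2) := fun i hi => by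
  simp [St.stage, St.setX_apply, h i (by omega), show i ≠ d by omega, show i ≠ d + 1 by omega]

theorem St.stage_apply (s : St.{u}) {d i : ℕ} (p : Ordinal.{u}) (h : i < d) :
    (s.stage d p).1 i = s.1 i := by
  simp [St.stage, St.setX_apply, show i ≠ d by omega, show i ≠ d + 1 by omega]

/-- The inferior limit of an increasing sequence is its supremum. So a loop computes every monotone
function that is continuous at limits, as soon as the body performs the successor step. Sums,
products and `pairBase` are instances. -/
theorem Runs.forAcc {d j r : ℕ} {c : Cmd} {s : St.{u}} (F : Ordinal.{u} → Ordinal.{u}) (hd : 3 ≤ d)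
    (hjd : j < d) (hj2 : j ≠ 2) (hrd : r < d) (hrj : r ≠ j) (hr2 : r ≠ 2) (hs : s.Clean d)
    (hF0 : F 0 = s.1 r) (hF : Monotone F)
    (hFl : ∀ p, Order.IsSuccLimit p → ∀ ξ < F p, ∃ q < p, ξ < F q)
    (hc : ∀ p < s.1 j, Runs c ((s.setX r (F p)).stage d p) ((s.setX r (F p)).stage d p)
      (((s.setX r (F p)).stage d p).setX r (F (p + 1)))) :
    Runs (Cmd.forC d j c) s s (s.setX r (F (s.1 j))) := by
  intro hs2
  have h := Runs.forC (m := s) (β := s.1 j) (c := c) hd hjd hj2 (fun p => s.setX r (F p))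
    (fun p _ => by rw [St.setX_ne _ _ (by omega), hs d le_rfl])
    (fun p _ => by rw [St.setX_ne _ _ (by omega), hs _ (by omega)])
    (fun p _ => by rw [St.setX_ne _ _ (by omega), hs _ (by omega)])
    (fun p _ => by rw [St.setX_ne _ _ hr2.symm, hs2])
    (fun p _ => by rw [St.setX_ne _ _ hrj.symm])
    (fun p _ => St.le_setX le_rfl (hF0 ▸ hF zero_le)) (fun p hp => ?_) (fun p _ hp => ?_)
  · have e : s.setX r (F 0) = s := by
      rw [hF0]
      exact St.ext' (fun i => by rw [St.setX_apply]; split_ifs with h <;> simp [h]) fun _ => rfl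
    simp only [e] at h
    exact h hs2
  · refine ((hc p hp).mono inf_le_left).of_eq (St.ext' (fun i => ?_) fun i => rfl)
    simp only [St.stage, St.setX_apply]
    split_ifs <;> first | rfl | omega
  · have h0 : 0 < p := hp.bot_lt
    refine ⟨fun i ξ => ?_, fun i ξ => ⟨fun h => ⟨0, h0, fun _ _ _ => h⟩,
      fun ⟨r, hr, h⟩ => h r le_rfl hr⟩⟩
    simp only [St.setX_apply]
    split_ifs
    · constructor
      · intro h
        obtain ⟨q, hq, h'⟩ := hFl p hp ξ h
        exact ⟨q, hq, fun q' h₁ _ => h'.trans_le (hF h₁)⟩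
      · rintro ⟨q, hq, h⟩
        exact (h q le_rfl hq).trans_le (hF hq.le)
    · exact ⟨fun h => ⟨0, h0, fun _ _ _ => h⟩, fun ⟨r, hr, h⟩ => h r le_rfl hr⟩

namespace Cmd

/-- Adds register `j` to register `r`. -/
def addTo (r j d : ℕ) : Cmd := forC d j (incr r)

/-- Adds the product of the registers `i` and `j` to register `r`. -/
def mulTo (r i j d : ℕ) : Cmd := forC d j (addTo r i (d + 3))

/-- Computes `pairBase` of register `j` in register `r`. -/
def pairBaseTo (r j d : ℕ) : Cmd :=
  forC d j (seq (addTo r (d + 1) (d + 3)) (seq (addTo r (d + 1) (d + 3)) (incr r)))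

end Cmd

namespace Runs

variable {s : St.{u}} {d r i j : ℕ}

theorem addTo (hd : 3 ≤ d) (hjd : j < d) (hj2 : j ≠ 2) (hrd : r < d) (hrj : r ≠ j) (hr2 : r ≠ 2)
    (hs : s.Clean d) : Runs (Cmd.addTo r j d) s s (s.setX r (s.1 r + s.1 j)) := by
  refine Runs.forAcc (fun p => s.1 r + p) hd hjd hj2 hrd hrj hr2 hs (add_zero _)
    (fun a b h => by dsimp only; gcongr) (fun p hp ξ h => ?_) (fun p _ => ?_)
  · exact (lt_add_iff_of_isSuccLimit hp).1 h
  · refine (Runs.incr hr2 le_rfl).of_eq ?_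
    rw [St.stage_apply _ _ hrd, St.setX_same, add_assoc]

theorem mulTo (hd : 3 ≤ d) (hjd : j < d) (hj2 : j ≠ 2) (hid : i < d) (hi2 : i ≠ 2) (hrd : r < d)
    (hrj : r ≠ j) (hri : r ≠ i) (hr2 : r ≠ 2) (hs : s.Clean d) :
    Runs (Cmd.mulTo r i j d) s s (s.setX r (s.1 r + s.1 i * s.1 j)) := by
  refine Runs.forAcc (fun p => s.1 r + s.1 i * p) hd hjd hj2 hrd hrj hr2 hs (by simp)
    (fun a b h => by dsimp only; gcongr) (fun p hp ξ h => ?_) (fun p _ => ?_)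
  -- With the factor `0` the product at a limit is not a limit ordinal, and the general argument
  -- does not apply.
  · rcases eq_or_ne (s.1 i) 0 with h0 | h0
    · exact ⟨0, hp.bot_lt, by simpa [h0] using h⟩
    · have h0 := pos_iff_ne_zero.2 h0
      have hl : Order.IsSuccLimit (s.1 i * p) := isSuccLimit_mul_right h0 hp
      obtain ⟨q, hq, h⟩ := (lt_add_iff_of_isSuccLimit hl).1 h
      obtain ⟨q', hq', h'⟩ := (lt_mul_iff_of_isSuccLimit hp).1 hq
      exact ⟨q', hq', h.trans (by gcongr)⟩
  · refine (Runs.addTo (by omega) (by omega) hi2 (by omega) hri hr2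
      ((hs.setX hrd).stage.mono (by omega))).of_eq ?_
    rw [St.stage_apply _ _ hrd, St.setX_same, St.stage_apply _ _ hid, St.setX_ne _ _ hri.symm,
      mul_add_one, add_assoc]

theorem setX_setX (s : St.{u}) (r : ℕ) (a b : Ordinal.{u}) : (s.setX r a).setX r b = s.setX r b :=
  St.ext' (fun i => by simp only [St.setX_apply]; split_ifs <;> rfl) fun _ => rfl

theorem pairBaseTo (hd : 3 ≤ d) (hjd : j < d) (hj2 : j ≠ 2) (hrd : r < d) (hrj : r ≠ j) (hr2 : r ≠ 2)
    (hs : s.Clean d) (hr : s.1 r = 0) :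
    Runs (Cmd.pairBaseTo r j d) s s (s.setX r (pairBase (s.1 j))) := by
  refine Runs.forAcc pairBase hd hjd hj2 hrd hrj hr2 hs (by simp [hr])
    pairBase_strictMono.monotone (fun p hp ξ h => lt_pairBase_limit hp h) (fun p _ => ?_)
  set t := (s.setX r (pairBase p)).stage d p
  have ht : t.Clean (d + 3) := (hs.setX hrd).stage.mono (by omega)
  have htr : t.1 r = pairBase p := by rw [St.stage_apply _ _ hrd, St.setX_same]
  have htv : t.1 (d + 1) = p := by simp [t, St.stage]
  have h1 := Runs.addTo (s := t) (d := d + 3) (j := d + 1) (r := r) (by omega) (by omega) (by omega)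
    (by omega) (by omega) hr2 ht
  have h2 := Runs.addTo (s := t.setX r (t.1 r + t.1 (d + 1))) (d := d + 3) (j := d + 1) (r := r)
    (by omega) (by omega) (by omega) (by omega) (by omega) hr2 (ht.setX (by omega))
  rw [St.setX_same, setX_setX, St.setX_ne _ _ (by omega : d + 1 ≠ r), htr, htv] at h2
  rw [htr, htv] at h1
  have hle : t ≤ t.setX r (pairBase p + p) := St.le_setX le_rfl (htr ▸ le_self_add)
  have hle' : t ≤ t.setX r (pairBase p + p + p) :=
    St.le_setX le_rfl (by rw [htr, add_assoc]; exact le_self_add)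
  refine h1.seq ((h2.mono hle).seq ((Runs.incr hr2 hle').of_eq ?_))
  rw [St.setX_same, setX_setX, pairBase_succ]

end Runs

/-! ### Terms -/

/-- Terms for ordinals; the variables are ordinal registers. -/
inductive Tm : Type
  | var (i : ℕ) : Tm
  | zero : Tm
  | succ (t : Tm) : Tm
  | add (t t' : Tm) : Tm
  | mul (t t' : Tm) : Tm
  | pair (t t' : Tm) : Tm

namespace Tm

/-- The value of a term. -/
def eval (x : ℕ → Ordinal.{u}) : Tm → Ordinal.{u}
  | var i => x i
  | zero => 0
  | succ t => t.eval x + 1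
  | add t t' => t.eval x + t'.eval x
  | mul t t' => t.eval x * t'.eval x
  | pair t t' => opair (t.eval x) (t'.eval x)

/-- The variables of the term are in `V`. -/
def Ok (V : Set ℕ) : Tm → Prop
  | var i => i ∈ V
  | zero => True
  | succ t => t.Ok V
  | add t t' => t.Ok V ∧ t'.Ok V
  | mul t t' => t.Ok V ∧ t'.Ok V
  | pair t t' => t.Ok V ∧ t'.Ok V

theorem eval_congr {V : Set ℕ} {x x' : ℕ → Ordinal.{u}} (hx : ∀ i ∈ V, x i = x' i) :
    ∀ {t : Tm}, t.Ok V → t.eval x = t.eval x'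
  | var _, h => hx _ h
  | zero, _ => rfl
  | succ t, h => by simp only [eval]; rw [eval_congr (t := t) hx h]
  | add _ _, h => by simp only [eval]; rw [eval_congr hx h.1, eval_congr hx h.2]
  | mul _ _, h => by simp only [eval]; rw [eval_congr hx h.1, eval_congr hx h.2]
  | pair _ _, h => by simp only [eval]; rw [eval_congr hx h.1, eval_congr hx h.2]

/-- The command that computes the value of a term in register `d`. -/
def comp : Tm → ℕ → Cmd
  | var i, d => .addTo d i (d + 1)
  | zero, _ => .skip
  | succ t, d => .seq (t.comp d) (.incr d)
  | add t t', d => .seq (t.comp d) (.seq (t'.comp (d + 1)) (.seq (.addTo d (d + 1) (d + 2))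
      (.clear (d + 1))))
  | mul t t', d => .seq (t.comp (d + 1)) (.seq (t'.comp (d + 2))
      (.seq (.mulTo d (d + 1) (d + 2) (d + 3)) (.seq (.clear (d + 2)) (.clear (d + 1)))))
  | pair t t', d => .seq (t.comp (d + 1)) (.seq (t'.comp (d + 2))
      (.seq (.getLt (d + 1) (d + 2) (d + 3))
      (.seq (.ite (2 * (d + 3) + 1) (.seq (.clear (d + 3)) (.seq (.pairBaseTo d (d + 2) (d + 3))
          (.addTo d (d + 1) (d + 3))))
        (.seq (.pairBaseTo d (d + 1) (d + 3)) (.seq (.addTo d (d + 1) (d + 3))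
          (.addTo d (d + 2) (d + 3)))))
        (.seq (.clear (d + 2)) (.clear (d + 1))))))

open Classical in
-- The variables are below `d`, and the registers from `d` on are workspace. Subterms are evaluated
-- in higher registers that are cleared again, so that the net effect is a single assignment to
-- register `d`.
theorem runs {V : Set ℕ} : ∀ (t : Tm) (d : ℕ), 3 ≤ d → (∀ i ∈ V, i < d ∧ i ≠ 2) → t.Ok V →
    ∀ s : St.{u}, s.Clean d → Runs (t.comp d) s s (s.setX d (t.eval s.1))
  | var i, d, hd, hV, h, s, hs => by
    refine (Runs.addTo (by omega) ((hV i h).1.trans (by omega)) (hV i h).2 (by omega)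
      (hV i h).1.ne' (by omega) (hs.mono (by omega))).of_eq ?_
    rw [hs d le_rfl, zero_add]; rfl
  | zero, d, hd, hV, h, s, hs => Runs.skip.of_eq <| by
    refine St.ext' (fun i => ?_) fun _ => rfl
    rw [St.setX_apply]; split_ifs with hi
    · rw [hs i hi.ge]; rfl
    · rfl
  | succ t, d, hd, hV, h, s, hs => by
    refine (runs t d hd hV h s hs).seq ((Runs.incr (by omega) (hs.le le_rfl)).of_eq ?_)
    rw [St.setX_same, Runs.setX_setX]; rfl
  | add t t', d, hd, hV, h, s, hs => by
    have h1 := runs t d hd hV h.1 s hs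
    have c1 : (s.setX d (t.eval s.1)).Clean (d + 1) := (hs.mono (Nat.le_succ d)).setX (by omega)
    have h2 := runs t' (d + 1) (by omega) (fun i hi => ⟨(hV i hi).1.trans (by omega), (hV i hi).2⟩)
      h.2 _ c1
    have e : t'.eval (s.setX d (t.eval s.1)).1 = t'.eval s.1 :=
      eval_congr (fun i hi => St.setX_ne _ _ (hV i hi).1.ne) h.2
    rw [e] at h2
    set a := t.eval s.1
    set b := t'.eval s.1
    have c2 : ((s.setX d a).setX (d + 1) b).Clean (d + 2) := (c1.mono (by omega)).setX (by omega)
    have h3 := Runs.addTo (r := d) (j := d + 1) (by omega) (by omega) (by omega) (by omega) (by omega)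
      (by omega) c2
    have l1 : s ≤ s.setX d a := hs.le le_rfl
    have l2 := l1.trans (c1.le (j := d + 1) (α := b) le_rfl)
    have hsd := hs d le_rfl
    have hsd1 := hs (d + 1) (by omega)
    refine h1.seq ((h2.mono l1).seq ((h3.mono l2).seq
      ((Runs.clear (by omega) (St.le_setX l2 (by rw [hsd]; exact zero_le)) hsd1).of_eq ?_)))
    refine St.ext' (fun i => ?_) fun _ => rfl
    simp only [St.setX_apply, eval]
    split_ifs <;> first | rfl | omega | (subst_vars; simp_all; try rfl)
  | mul t t', d, hd, hV, h, s, hs => by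
    have h1 := runs t (d + 1) (by omega) (fun i hi => ⟨(hV i hi).1.trans (by omega), (hV i hi).2⟩)
      h.1 s (hs.mono (by omega))
    set a := t.eval s.1
    have c1 : (s.setX (d + 1) a).Clean (d + 2) := (hs.mono (by omega)).setX (by omega)
    have h2 := runs t' (d + 2) (by omega) (fun i hi => ⟨(hV i hi).1.trans (by omega), (hV i hi).2⟩)
      h.2 _ c1
    have e : t'.eval (s.setX (d + 1) a).1 = t'.eval s.1 :=
      eval_congr (fun i hi => St.setX_ne _ _ (by have := (hV i hi).1; omega)) h.2
    rw [e] at h2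
    set b := t'.eval s.1
    have c2 : ((s.setX (d + 1) a).setX (d + 2) b).Clean (d + 3) := (c1.mono (by omega)).setX (by omega)
    have h3 := Runs.mulTo (r := d) (i := d + 1) (j := d + 2) (by omega) (by omega) (by omega)
      (by omega) (by omega) (by omega) (by omega) (by omega) (by omega) c2
    have l1 : s ≤ s.setX (d + 1) a := hs.le (by omega)
    have l2 := l1.trans (c1.le (j := d + 2) (α := b) le_rfl)
    have hsd := hs d le_rfl
    have hsd1 := hs (d + 1) (by omega)
    have hsd2 := hs (d + 2) (by omega)
    have l3 := fun α => St.le_setX (j := d) (α := α) l2 (by rw [hsd]; exact zero_le)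
    refine h1.seq ((h2.mono l1).seq ((h3.mono l2).seq
      ((Runs.clear (by omega) (l3 _) hsd2).seq
        ((Runs.clear (by omega) (St.le_setX (l3 _) hsd2.le) hsd1).of_eq ?_))))
    refine St.ext' (fun i => ?_) fun _ => rfl
    simp only [St.setX_apply, eval]
    split_ifs <;> first | rfl | omega | (subst_vars; simp_all; try rfl)
  | pair t t', d, hd, hV, h, s, hs => by
    have h1 := runs t (d + 1) (by omega) (fun i hi => ⟨(hV i hi).1.trans (by omega), (hV i hi).2⟩)
      h.1 s (hs.mono (by omega))
    set a := t.eval s.1 with ha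
    have c1 : (s.setX (d + 1) a).Clean (d + 2) := (hs.mono (by omega)).setX (by omega)
    have h2 := runs t' (d + 2) (by omega) (fun i hi => ⟨(hV i hi).1.trans (by omega), (hV i hi).2⟩)
      h.2 _ c1
    have e : t'.eval (s.setX (d + 1) a).1 = t'.eval s.1 :=
      eval_congr (fun i hi => St.setX_ne _ _ (by have := (hV i hi).1; omega)) h.2
    rw [e] at h2
    set b := t'.eval s.1 with hb
    set s₂ := (s.setX (d + 1) a).setX (d + 2) b with hs₂
    have c2 : s₂.Clean (d + 3) := (c1.mono (by omega)).setX (by omega)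
    have va : s₂.1 (d + 1) = a := by simp [hs₂, St.setX_apply]
    have vb : s₂.1 (d + 2) = b := by simp [hs₂]
    have hsd := hs d le_rfl
    have hsd1 := hs (d + 1) (by omega)
    have hsd2 := hs (d + 2) (by omega)
    have hsd3 := hs (d + 3) (by omega)
    have v0 : s₂.1 d = 0 := by simp [hs₂, St.setX_apply, hsd]
    have l1 : s ≤ s.setX (d + 1) a := hs.le (by omega)
    have l2 : s ≤ s₂ := l1.trans (c1.le (j := d + 2) (α := b) le_rfl)
    have l3 : ∀ α, s ≤ s₂.setX d α := fun α => St.le_setX l2 (by rw [hsd]; exact zero_le)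
    have h3 := Runs.getLt (s := s₂) (m := s) (i := d + 1) (j := d + 2) (f := d + 3) (by omega)
      (by omega) (by omega) (by omega) (by omega) (by omega) (c2 _ le_rfl) l2
    rw [va, vb] at h3
    have h4 : Runs (Cmd.ite (2 * (d + 3) + 1) (Cmd.seq (Cmd.clear (d + 3))
          (Cmd.seq (Cmd.pairBaseTo d (d + 2) (d + 3)) (Cmd.addTo d (d + 1) (d + 3))))
        (Cmd.seq (Cmd.pairBaseTo d (d + 1) (d + 3)) (Cmd.seq (Cmd.addTo d (d + 1) (d + 3))
          (Cmd.addTo d (d + 2) (d + 3))))) s (s₂.setX (d + 3) (if a < b then 1 else 0))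
        (s₂.setX d (opair a b)) := by
      have hpb : ∀ j, j < d + 3 → j ≠ 2 → d ≠ j →
          Runs (Cmd.pairBaseTo d j (d + 3)) s s₂ (s₂.setX d (pairBase (s₂.1 j))) :=
        fun j h1 h2 h3 => (Runs.pairBaseTo (by omega) h1 h2 (by omega) h3 (by omega) c2 v0).mono l2
      have hadd : ∀ α j, j < d + 3 → j ≠ 2 → d ≠ j → Runs (Cmd.addTo d j (d + 3)) s (s₂.setX d α)
          (s₂.setX d (α + s₂.1 j)) := by
        intro α j h1 h2 h3
        refine ((Runs.addTo (by omega) h1 h2 (by omega) h3 (by omega)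
          (c2.setX (j := d) (α := α) (by omega))).of_eq ?_).mono (l3 α)
        rw [St.setX_same, Runs.setX_setX, St.setX_ne _ _ h3.symm]
      have p1 := hpb (d + 1) (by omega) (by omega) (by omega)
      have p2 := hpb (d + 2) (by omega) (by omega) (by omega)
      have a1 := fun α => hadd α (d + 1) (by omega) (by omega) (by omega)
      have a2 := fun α => hadd α (d + 2) (by omega) (by omega) (by omega)
      rw [va] at p1
      rw [vb] at p2
      simp only [va] at a1
      simp only [vb] at a2
      have e0 : s₂.setX (d + 3) 0 = s₂ := St.ext' (fun i => by
        rw [St.setX_apply]; split_ifs with hi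
        · rw [hi, c2 _ le_rfl]
        · rfl) fun _ => rfl
      by_cases hab : a < b
      · rw [if_pos hab, opair, if_pos hab]
        refine Runs.ite_true ((Runs.clear (by omega) (l2.trans (c2.le le_rfl)) hsd3).seq ?_)
          (l2.trans (c2.le le_rfl)) (l3 _) (by simp)
        rw [Runs.setX_setX, e0]
        exact p2.seq (a1 _)
      · rw [if_neg hab, opair, if_neg hab, e0]
        exact Runs.ite_false (p1.seq ((a1 _).seq (a2 _))) l2 (c2 _ le_rfl)
    refine h1.seq ((h2.mono l1).seq (h3.seq (h4.seq
      ((Runs.clear (by omega) (l3 _) hsd2).seq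
        ((Runs.clear (by omega) (St.le_setX (l3 _) hsd2.le) hsd1).of_eq ?_)))))
    refine St.ext' (fun i => ?_) fun _ => rfl
    simp only [St.setX_apply, eval, hs₂, ← ha, ← hb]
    split_ifs <;> first | rfl | omega | (subst_vars; simp_all; try rfl)

end Tm

end

section

/-! ### Predicates -/

/-- The predicate that is defined by recursion on ordinals: it holds for `v` iff `Φ` holds for `v` and
the set of the `w < v` for which it holds. -/
def RecMem (Φ : Set Ordinal.{u} → Ordinal.{u} → Prop) (v : Ordinal.{u}) : Prop :=
  Φ {w | ∃ _ : w < v, RecMem Φ w} v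
termination_by v

/-- The set of ordinals below `β` that is defined by recursion. -/
def recSet (Φ : Set Ordinal.{u} → Ordinal.{u} → Prop) (β : Ordinal.{u}) : Set Ordinal.{u} :=
  {v | v < β ∧ RecMem Φ v}

theorem recMem_iff (Φ : Set Ordinal.{u} → Ordinal.{u} → Prop) (v : Ordinal.{u}) :
    RecMem Φ v ↔ Φ (recSet Φ v) v := by
  rw [RecMem]
  simp [recSet]

/-- Formulas about ordinals and sets of ordinals, in which definitions by recursion are allowed. The
variables are registers. In depth `(d, e)` the ordinal registers from `d` on and the set registers
from `e` on are free. -/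
inductive PE : Type
  | lt (t t' : Tm) : PE
  | mem (t : Tm) (a : ℕ) : PE
  | not (φ : PE) : PE
  | and (φ ψ : PE) : PE
  | ex (t : Tm) (φ : PE) : PE
  | recur (t : Tm) (φ ψ : PE) : PE

namespace PE

/-- The meaning of a formula. -/
def sem : PE → ℕ → ℕ → (ℕ → Ordinal.{u}) → (ℕ → Set Ordinal.{u}) → Prop
  | lt t t', _, _, x, _ => t.eval x < t'.eval x
  | mem t a, _, _, x, A => t.eval x ∈ A a
  | not φ, d, e, x, A => ¬ φ.sem d e x A
  | and φ ψ, d, e, x, A => φ.sem d e x A ∧ ψ.sem d e x A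
  | ex t φ, d, e, x, A => ∃ α < t.eval x, φ.sem (d + 4) e (Function.update x (d + 3) α) A
  | recur t φ ψ, d, e, x, A => ψ.sem (d + 2) (e + 1) x (Function.update A e (recSet
      (fun S v => φ.sem (d + 6) (e + 1) (Function.update x (d + 5) v) (Function.update A e S))
      (t.eval x)))

/-- The free variables are in `V` resp. below `e`, and the output register is not used. -/
def Ok : PE → Set ℕ → ℕ → ℕ → Prop
  | lt t t', V, _, _ => t.Ok V ∧ t'.Ok V
  | mem t a, V, _, e => t.Ok V ∧ a < e ∧ a ≠ 2
  | not φ, V, d, e => φ.Ok V d e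
  | and φ ψ, V, d, e => φ.Ok V d e ∧ ψ.Ok V d e
  | ex t φ, V, d, e => t.Ok V ∧ φ.Ok (insert (d + 3) V) (d + 4) e
  | recur t φ ψ, V, d, e => t.Ok V ∧ φ.Ok (insert (d + 5) V) (d + 6) (e + 1) ∧
      ψ.Ok V (d + 2) (e + 1)

theorem agree_update {V : Set ℕ} {x x' : ℕ → Ordinal.{u}} (hx : ∀ i ∈ V, x i = x' i) (j : ℕ)
    (α : Ordinal.{u}) : ∀ i ∈ insert j V, Function.update x j α i = Function.update x' j α i := by
  intro i hi
  by_cases h : i = j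
  · subst h; simp
  · simp only [Function.update_of_ne h]
    exact hx i (hi.resolve_left h)

/-- Set register 2 is exempt from the agreement, because formulas do not read it. Output can
therefore be collected in it while formulas are being evaluated. -/
theorem sem_congr : ∀ (φ : PE) {V : Set ℕ} {d e : ℕ} {x x' : ℕ → Ordinal.{u}}
    {A A' : ℕ → Set Ordinal.{u}}, φ.Ok V d e → 3 ≤ e → (∀ i ∈ V, x i = x' i) →
    (∀ a < e, a ≠ 2 → A a = A' a) →
    (φ.sem d e x A ↔ φ.sem d e x' A')
  | lt t t', _, _, _, _, _, _, _, h, _, hx, _ => by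
    simp only [sem]; rw [Tm.eval_congr hx h.1, Tm.eval_congr hx h.2]
  | mem t a, _, _, _, _, _, _, _, h, _, hx, hA => by
    simp only [sem]; rw [Tm.eval_congr hx h.1, hA a h.2.1 h.2.2]
  | not φ, _, _, _, _, _, _, _, h, he, hx, hA => not_congr (sem_congr φ h he hx hA)
  | and φ ψ, _, _, _, _, _, _, _, h, he, hx, hA =>
    and_congr (sem_congr φ h.1 he hx hA) (sem_congr ψ h.2 he hx hA)
  | ex t φ, _, d, _, _, _, _, _, h, he, hx, hA => by
    simp only [sem]; rw [Tm.eval_congr hx h.1]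
    exact exists_congr fun α => and_congr_right fun _ =>
      sem_congr φ h.2 he (agree_update hx _ α) hA
  | recur t φ ψ, V, d, e, x, x', A, A', h, he, hx, hA => by
    have hup : ∀ S, ∀ a < e + 1, a ≠ 2 → Function.update A e S a = Function.update A' e S a := by
      intro S a ha ha2
      by_cases h : a = e
      · subst h; simp
      · simp only [Function.update_of_ne h]
        exact hA a (by omega) ha2
    simp only [sem]; rw [Tm.eval_congr hx h.1]
    have : (fun S v => φ.sem (d + 6) (e + 1) (Function.update x (d + 5) v) (Function.update A e S)) =
        fun S v => φ.sem (d + 6) (e + 1) (Function.update x' (d + 5) v) (Function.update A' e S) := by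
      funext S v
      exact propext (sem_congr φ h.2.1 (by omega) (agree_update hx _ v) (hup S))
    rw [this]
    exact sem_congr ψ h.2.2 (by omega) hx (hup _)

/-- The command that computes the truth value of a formula in register `d`. -/
def comp : PE → ℕ → ℕ → Cmd
  | lt t t', d, _ => .seq (t.comp (d + 1)) (.seq (t'.comp (d + 2)) (.seq (.getLt (d + 1) (d + 2) d)
      (.seq (.clear (d + 2)) (.clear (d + 1)))))
  | mem t a, d, _ => .seq (t.comp (d + 1)) (.seq (.getMem (d + 1) a d) (.clear (d + 1)))
  | not φ, d, e => .seq (φ.comp d e) (.ite (2 * d + 1) (.clear d) (.incr d))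
  | and φ ψ, d, e => .seq (φ.comp d e) (.ite (2 * d + 1) (.seq (.clear d) (ψ.comp d e)) .skip)
  | ex t φ, d, e => .seq (t.comp (d + 1)) (.seq (.forC (d + 2) (d + 1) (.seq (φ.comp (d + 4) e)
      (.ite (2 * (d + 4) + 1) (.seq (.clear (d + 4)) (.setOne d)) .skip))) (.clear (d + 1)))
  | recur t φ ψ, d, e => .seq (t.comp (d + 1)) (.seq
      (.forC (d + 4) (d + 1) (.seq (φ.comp (d + 6) (e + 1))
        (.ite (2 * (d + 6) + 1) (.seq (.clear (d + 6)) (.putMem (d + 5) e true)) .skip)))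
      (.seq (ψ.comp (d + 2) (e + 1)) (.seq
        (.ite (2 * (d + 2) + 1) (.seq (.clear (d + 2)) (.incr d)) .skip)
        (.seq (.forC (d + 4) (d + 1) (.putMem (d + 5) e false)) (.clear (d + 1))))))

end PE

theorem isLim_const {α : Type*} {p : Ordinal.{u}} (hp : Order.IsSuccLimit p) (Q : α → Prop) (a : α) :
    Q a ↔ ∃ r < p, ∀ q, r ≤ q → q < p → Q a :=
  ⟨fun h => ⟨0, hp.bot_lt, fun _ _ _ => h⟩, fun ⟨r, hr, h⟩ => h r le_rfl hr⟩

open Classical in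
/-- A loop that collects the ordinals with some property in the set register `e`. -/
theorem Runs.collect {d j e : ℕ} {c : Cmd} {s : St.{u}} (hd : 3 ≤ d) (hjd : j < d) (hj2 : j ≠ 2)
    (hs : s.Clean d) (he : s.2 e = ∅) (Φ : Set Ordinal.{u} → Ordinal.{u} → Prop)
    (hc : ∀ p < s.1 j, let t := (s.setA e (recSet Φ p)).stage d p
      Runs c t t (t.setX (d + 2) (if Φ (recSet Φ p) p then 1 else 0))) :
    Runs (.forC d j (.seq c (.ite (2 * (d + 2) + 1) (.seq (.clear (d + 2)) (.putMem (d + 1) e true))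
      .skip))) s s (s.setA e (recSet Φ (s.1 j))) := by
  intro hs2
  have h := Runs.forC (m := s) (β := s.1 j) (c := .seq c (.ite (2 * (d + 2) + 1)
      (.seq (.clear (d + 2)) (.putMem (d + 1) e true)) .skip)) hd hjd hj2
    (fun p => s.setA e (recSet Φ p))
    (fun p _ => hs d le_rfl) (fun p _ => hs _ (by omega)) (fun p _ => hs _ (by omega))
    (fun p _ => hs2) (fun p _ => rfl)
    (fun p _ => St.le_setA le_rfl (by rw [he]; exact empty_subset _)) (fun p hp => ?_) (fun p _ hp => ?_)
  · have e0 : s.setA e (recSet Φ 0) = s := St.ext' (fun _ => rfl) fun i => by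
      rw [St.setA_apply]
      split_ifs with h
      · subst h
        rw [he]
        ext ξ; simp [recSet]
      · rfl
    rw [e0] at h
    exact h hs2
  · have h1 := hc p hp
    set t := (s.setA e (recSet Φ p)).stage d p with ht
    have htc : t.Clean (d + 2) := St.Clean.stage (s := s.setA e (recSet Φ p)) hs
    have hv : t.1 (d + 1) = p := by simp [ht, St.stage]
    have hte : t.2 e = recSet Φ p := by simp [ht, St.stage]
    have e1 : t.setX (d + 2) 0 = t := St.ext' (fun i => by
      rw [St.setX_apply]; split_ifs with h
      · rw [h, htc _ le_rfl]
      · rfl) fun _ => rfl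
    -- In round `p` the register holds the part of the set below `p`, which is just what the
    -- recursion needs to decide about `p`. These parts increase, so at limits the tape holds their
    -- union.
    have hsucc : recSet Φ (p + 1) = if Φ (recSet Φ p) p then insert p (recSet Φ p) else recSet Φ p := by
      have h0 : ∀ ξ, ξ ∈ recSet Φ (p + 1) ↔ (ξ = p ∧ Φ (recSet Φ p) p) ∨ ξ ∈ recSet Φ p := by
        intro ξ
        have hpi := recMem_iff Φ p
        simp only [recSet, mem_ofPred_eq, Order.lt_add_one_iff, le_iff_eq_or_lt, or_and_right] at hpi ⊢
        refine or_congr_left (and_congr_right ?_)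
        rintro rfl; exact hpi
      ext ξ
      rw [h0]
      split_ifs with hh <;> simp [hh]
    have e2 : (s.setA e (recSet Φ (p + 1))).stage d p = t.setA e (recSet Φ (p + 1)) :=
      St.ext' (fun i => rfl) fun i => by
        simp only [ht, St.stage, St.setX_snd, St.setA_apply]
        split_ifs <;> rfl
    rw [e2]
    refine Runs.mono ?_ inf_le_left
    refine h1.seq ?_
    rw [hsucc]
    split_ifs with hh
    · refine Runs.ite_true ((Runs.clear (by omega) (htc.le le_rfl) (htc _ le_rfl)).seq ?_)
        (htc.le le_rfl) (St.le_setA le_rfl (by rw [hte]; exact subset_insert _ _)) (by simp)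
      rw [Runs.setX_setX, e1]
      refine (Runs.putMem (by omega) le_rfl ?_).of_eq ?_
      · simp [setBit]
      · rw [hv, hte]; simp [setBit]
    · rw [e1]
      refine (Runs.ite_false Runs.skip le_rfl (htc _ le_rfl)).of_eq ?_
      exact St.ext' (fun i => rfl) fun i => by
        rw [St.setA_apply]; split_ifs with h
        · rw [h, hte]
        · rfl
  · refine ⟨fun i ξ => isLim_const hp (fun i => ξ < s.1 i) i, fun i ξ => ?_⟩
    simp only [St.setA_apply]
    split_ifs
    · simp only [recSet, mem_ofPred_eq]
      constructor
      · rintro ⟨h₁, h₂⟩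
        have := hp.succ_lt h₁
        rw [Order.succ_eq_add_one] at this
        exact ⟨ξ + 1, this, fun q hq _ => ⟨(Order.lt_add_one_iff.2 le_rfl).trans_le hq, h₂⟩⟩
      · rintro ⟨r, hr, h⟩
        exact ⟨(h r le_rfl hr).1.trans hr, (h r le_rfl hr).2⟩
    · exact isLim_const hp (fun i => ξ ∈ s.2 i) i

/-- A loop that removes the ordinals below register `j` from the set register `e`. -/
theorem Runs.removeAll {d j e : ℕ} {m s : St.{u}} (hd : 3 ≤ d) (hjd : j < d) (hj2 : j ≠ 2)
    (hs : s.Clean d) (hm : m ≤ s) (hme : m.2 e = ∅) :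
    Runs (.forC d j (.putMem (d + 1) e false)) m s (s.setA e (s.2 e \ Iio (s.1 j))) := by
  intro hs2
  have h := Runs.forC (m := m) (β := s.1 j) (c := .putMem (d + 1) e false) hd hjd hj2
    (fun p => s.setA e (s.2 e \ Iio p))
    (fun p _ => hs d le_rfl) (fun p _ => hs _ (by omega)) (fun p _ => hs _ (by omega))
    (fun p _ => hs2) (fun p _ => rfl)
    (fun p _ => St.le_setA hm (by rw [hme]; exact empty_subset _)) (fun p hp => ?_) (fun p _ hp => ?_)
  · have e0 : s.setA e (s.2 e \ Iio 0) = s := St.ext' (fun _ => rfl) fun i => by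
      rw [St.setA_apply]
      split_ifs with h
      · subst h; ext; simp
      · rfl
    rw [e0] at h
    exact h hs2
  · have e2 : setBit false (((s.setA e (s.2 e \ Iio p)).stage d p).1 (d + 1))
        (((s.setA e (s.2 e \ Iio p)).stage d p).2 e) = s.2 e \ Iio (p + 1) := by
      ext ξ
      simp only [St.stage, setBit, St.setX_same, St.setX_snd, St.setA_same, Bool.false_eq_true,
        if_false, mem_sdiff, mem_Iio, not_lt, mem_singleton_iff, Order.add_one_le_iff]
      rw [and_assoc, lt_iff_le_and_ne, ne_comm]
    have := Runs.putMem (i := d + 1) (a := e) (v := false) (s := (s.setA e (s.2 e \ Iio p)).stage d p)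
      (m := (s.setA e (s.2 e \ Iio p)).stage d p ⊓ (s.setA e (s.2 e \ Iio (p + 1))).stage d p)
      (by omega) inf_le_left (by
        rw [e2]
        refine inter_subset_right.trans ?_
        simp [St.stage])
    rw [e2] at this
    refine this.of_eq (St.ext' (fun i => rfl) fun i => ?_)
    simp only [St.stage, St.setX_snd, St.setA_apply]
    split_ifs <;> rfl
  · refine ⟨fun i ξ => isLim_const hp (fun i => ξ < s.1 i) i, fun i ξ => ?_⟩
    simp only [St.setA_apply]
    split_ifs
    · simp only [mem_sdiff, mem_Iio, not_lt]
      constructor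
      · rintro ⟨h₁, h₂⟩
        exact ⟨0, hp.bot_lt, fun q _ hq => ⟨h₁, hq.le.trans h₂⟩⟩
      · rintro ⟨r, hr, h⟩
        refine ⟨(h r le_rfl hr).1, le_of_forall_lt fun c hc => ?_⟩
        have := hp.succ_lt (max_lt hc hr)
        rw [Order.succ_eq_add_one] at this
        exact ((le_max_left c r).trans_lt (Order.lt_add_one_iff.2 le_rfl)).trans_le
          (h _ ((le_max_right c r).trans le_self_add) this).2
    · exact isLim_const hp (fun i => ξ ∈ s.2 i) i

open Classical in
/-- A loop that looks whether there is an ordinal with some property. -/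
theorem Runs.search {d j r : ℕ} {c : Cmd} {s : St.{u}} (hd : 3 ≤ d) (hjd : j < d) (hj2 : j ≠ 2)
    (hrd : r < d) (hr2 : r ≠ 2) (hrj : r ≠ j)
    (hs : s.Clean d) (hr : s.1 r = 0) (Φ : Ordinal.{u} → Prop)
    (hc : ∀ p < s.1 j, ∀ b, let t := (s.setX r b).stage d p
      Runs c t t (t.setX (d + 2) (if Φ p then 1 else 0))) :
    Runs (.forC d j (.seq c (.ite (2 * (d + 2) + 1) (.seq (.clear (d + 2)) (.setOne r))
      .skip))) s s (s.setX r (if ∃ p < s.1 j, Φ p then 1 else 0)) := by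
  refine Runs.forAcc (fun p => if ∃ q < p, Φ q then 1 else 0) hd hjd hj2 hrd hrj hr2 hs ?_ ?_ ?_ ?_
  · rw [hr]; exact if_neg (by rintro ⟨q, hq, -⟩; exact not_lt_bot hq)
  · intro a b hab
    dsimp only
    split_ifs with h1 h2
    · exact le_rfl
    · obtain ⟨q, hq, h⟩ := h1; exact absurd ⟨q, hq.trans_le hab, h⟩ h2
    · exact zero_le
    · exact le_rfl
  · intro p hp ξ hξ
    split_ifs at hξ with h
    · obtain ⟨q, hq, h⟩ := h
      have := hp.succ_lt hq
      rw [Order.succ_eq_add_one] at this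
      exact ⟨q + 1, this, by rwa [if_pos ⟨q, Order.lt_add_one_iff.2 le_rfl, h⟩]⟩
    · exact absurd hξ not_lt_bot
  · intro p hp
    have h1 := hc p hp (if ∃ q < p, Φ q then 1 else 0)
    set t := (s.setX r (if ∃ q < p, Φ q then 1 else 0)).stage d p with ht
    have htc : t.Clean (d + 2) := (hs.setX hrd).stage
    have htr : t.1 r = if ∃ q < p, Φ q then 1 else 0 := by
      rw [ht, St.stage_apply _ _ hrd, St.setX_same]
    have e1 : t.setX (d + 2) 0 = t := St.ext' (fun i => by
      rw [St.setX_apply]; split_ifs with h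
      · rw [h, htc _ le_rfl]
      · rfl) fun _ => rfl
    have htr1 : t.1 r ≤ 1 := by rw [htr]; split_ifs <;> simp
    refine h1.seq ?_
    by_cases hh : Φ p
    · rw [if_pos hh, if_pos ⟨p, Order.lt_add_one_iff.2 le_rfl, hh⟩]
      refine Runs.ite_true ((Runs.clear (by omega) (htc.le le_rfl) (htc _ le_rfl)).seq ?_)
        (htc.le le_rfl) (St.le_setX le_rfl htr1) (by simp)
      rw [Runs.setX_setX, e1]
      refine (Runs.setOne hr2 le_rfl).of_eq ?_
      rw [max_eq_right htr1]
    · have e2 : (∃ q < p + 1, Φ q) ↔ ∃ q < p, Φ q := by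
        constructor
        · rintro ⟨q, hq, h⟩
          rcases (Order.lt_add_one_iff.1 hq).lt_or_eq with h' | rfl
          · exact ⟨q, h', h⟩
          · exact absurd h hh
        · rintro ⟨q, hq, h⟩
          exact ⟨q, hq.trans (Order.lt_add_one_iff.2 le_rfl), h⟩
      rw [if_neg hh, e1]
      simp only [e2]
      refine (Runs.ite_false Runs.skip le_rfl (htc _ le_rfl)).of_eq ?_
      rw [← htr]
      exact St.ext' (fun i => by rw [St.setX_apply]; split_ifs with h <;> simp [h]) fun _ => rfl

namespace PE

open Classical in
-- The offsets in `PE.sem` are dictated by the registers of the loops. For `ex`, register `d + 1` is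
-- the bound and the loop occupies `d + 2` to `d + 4`, so its counter `d + 3` is the bound variable.
-- For `recur`, the loop occupies `d + 4` to `d + 6` with counter `d + 5`, and `d + 2` receives the
-- value of the continuation.
theorem runs : ∀ (φ : PE) {V : Set ℕ} {d e : ℕ}, 3 ≤ d → 3 ≤ e → (∀ i ∈ V, i < d ∧ i ≠ 2) → φ.Ok V d e →
    ∀ s : St.{u}, s.Clean d → (∀ a, e ≤ a → s.2 a = ∅) →
      Runs (φ.comp d e) s s (s.setX d (if φ.sem d e s.1 s.2 then 1 else 0))
  | lt t t', V, d, e, hd, he, hV, h, s, hs, hA => by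
    have hV' : ∀ k, ∀ i ∈ V, i < d + k ∧ i ≠ 2 := fun k i hi => ⟨(hV i hi).1.trans_le (by omega), (hV i hi).2⟩
    have h1 := t.runs (d + 1) (by omega) (hV' 1) h.1 s (hs.mono (by omega))
    have c1 : (s.setX (d + 1) (t.eval s.1)).Clean (d + 2) := (hs.mono (by omega)).setX (by omega)
    have h2 := t'.runs (d + 2) (by omega) (hV' 2) h.2 _ c1
    have ee : t'.eval (s.setX (d + 1) (t.eval s.1)).1 = t'.eval s.1 :=
      Tm.eval_congr (fun i hi => St.setX_ne _ _ (by have := (hV i hi).1; omega)) h.2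
    rw [ee] at h2
    simp only [sem]
    set a := t.eval s.1
    set b := t'.eval s.1
    set s₂ := (s.setX (d + 1) a).setX (d + 2) b with hs₂
    have va : s₂.1 (d + 1) = a := by simp [hs₂, St.setX_apply]
    have vb : s₂.1 (d + 2) = b := by simp [hs₂]
    have hsd := hs d le_rfl
    have hsd1 := hs (d + 1) (by omega)
    have hsd2 := hs (d + 2) (by omega)
    have v0 : s₂.1 d = 0 := by simp [hs₂, St.setX_apply, hsd]
    have l1 : s ≤ s.setX (d + 1) a := hs.le (by omega)
    have l2 : s ≤ s₂ := l1.trans (c1.le (j := d + 2) (α := b) le_rfl)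
    have l3 : ∀ α, s ≤ s₂.setX d α := fun α => St.le_setX l2 (by rw [hsd]; exact zero_le)
    have h3 := Runs.getLt (s := s₂) (m := s) (i := d + 1) (j := d + 2) (f := d) (by omega)
      (by omega) (by omega) (by omega) (by omega) (by omega) v0 l2
    rw [va, vb] at h3
    refine h1.seq ((h2.mono l1).seq (h3.seq ((Runs.clear (by omega) (l3 _) hsd2).seq
        ((Runs.clear (by omega) (St.le_setX (l3 _) hsd2.le) hsd1).of_eq ?_))))
    refine St.ext' (fun i => ?_) fun _ => rfl
    simp only [St.setX_apply, hs₂]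
    by_cases i1 : i = d + 1 <;> by_cases i2 : i = d + 2 <;> by_cases i0 : i = d <;>
      first | omega | (simp_all; try first | rfl | congr)
  | mem t a, V, d, e, hd, he, hV, h, s, hs, hA => by
    have hV' : ∀ k, ∀ i ∈ V, i < d + k ∧ i ≠ 2 := fun k i hi => ⟨(hV i hi).1.trans_le (by omega), (hV i hi).2⟩
    have h1 := t.runs (d + 1) (by omega) (hV' 1) h.1 s (hs.mono (by omega))
    simp only [sem]
    set b := t.eval s.1
    have hsd := hs d le_rfl
    have hsd1 := hs (d + 1) (by omega)
    have l1 : s ≤ s.setX (d + 1) b := hs.le (by omega)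
    have h3 := Runs.getMem (s := s.setX (d + 1) b) (m := s) (i := d + 1) (a := a) (f := d) (by omega)
      (by omega) (by omega) (by rw [St.setX_ne _ _ (by omega), hsd]) l1
    rw [St.setX_same] at h3
    refine h1.seq (h3.seq ((Runs.clear (by omega) (St.le_setX l1 (by rw [hsd]; exact zero_le))
      hsd1).of_eq ?_))
    refine St.ext' (fun i => ?_) fun _ => rfl
    simp only [St.setX_apply, St.setX_snd]
    by_cases i1 : i = d + 1 <;> by_cases i0 : i = d <;> first | omega | (simp_all; try first | rfl | congr)
  | not φ, V, d, e, hd, he, hV, h, s, hs, hA => by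
    have h1 := runs φ hd he hV h s hs hA
    have hsd := hs d le_rfl
    refine h1.seq ?_
    by_cases hh : φ.sem d e s.1 s.2
    · simp only [sem, hh, if_true, not_true, if_false]
      refine Runs.ite_true ((Runs.clear (by omega) (hs.le le_rfl) hsd).of_eq ?_) (hs.le le_rfl)
        (hs.le le_rfl) (by simp)
      rw [Runs.setX_setX]
    · simp only [sem, hh, if_true, not_false_eq_true, if_false]
      refine Runs.ite_false ((Runs.incr (by omega) (hs.le le_rfl)).of_eq ?_) (hs.le le_rfl)
        (by simp)
      rw [Runs.setX_setX, St.setX_same, zero_add]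
  | and φ ψ, V, d, e, hd, he, hV, h, s, hs, hA => by
    have h1 := runs φ hd he hV h.1 s hs hA
    have h2 := runs ψ hd he hV h.2 s hs hA
    have hsd := hs d le_rfl
    have e0 : s.setX d 0 = s := St.ext' (fun i => by
      rw [St.setX_apply]; split_ifs with h
      · rw [h, hsd]
      · rfl) fun _ => rfl
    refine h1.seq ?_
    by_cases hh : φ.sem d e s.1 s.2
    · simp only [sem, hh, if_true, true_and]
      refine Runs.ite_true ((Runs.clear (by omega) (hs.le le_rfl) hsd).seq ?_) (hs.le le_rfl)
        (hs.le le_rfl) (by simp)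
      rw [Runs.setX_setX, e0]
      exact h2
    · simp only [sem, hh, if_false, false_and]
      exact Runs.ite_false Runs.skip (hs.le le_rfl) (by simp)
  | ex t φ, V, d, e, hd, he, hV, h, s, hs, hA => by
    have h1 := t.runs (d + 1) (by omega) (fun i hi => ⟨(hV i hi).1.trans (by omega), (hV i hi).2⟩)
      h.1 s (hs.mono (by omega))
    simp only [sem]
    set b := t.eval s.1
    have hsd := hs d le_rfl
    have hsd1 := hs (d + 1) (by omega)
    have l1 : s ≤ s.setX (d + 1) b := hs.le (by omega)
    have h2 := Runs.search (s := s.setX (d + 1) b) (d := d + 2) (j := d + 1) (r := d)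
      (c := φ.comp (d + 4) e) (by omega) (by omega) (by omega) (by omega) (by omega) (by omega)
      ((hs.mono (by omega)).setX (by omega)) (by rw [St.setX_ne _ _ (by omega), hsd])
      (fun α => φ.sem (d + 4) e (Function.update s.1 (d + 3) α) s.2) (fun p _ b' => by
        intro t'
        have hc : t'.Clean (d + 4) :=
          ((((hs.mono (by omega : d ≤ d + 2)).setX (by omega)).setX (by omega)).stage)
        have := runs φ (V := insert (d + 3) V) (d := d + 4) (e := e) (by omega) he (by
          intro i hi
          rcases hi with rfl | hi
          · omega
          · exact ⟨(hV i hi).1.trans (by omega), (hV i hi).2⟩) h.2 t' hc hA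
        have ec : φ.sem (d + 4) e t'.1 t'.2 ↔
            φ.sem (d + 4) e (Function.update s.1 (d + 3) p) s.2 := by
          refine sem_congr φ h.2 he (fun i hi => ?_) (fun _ _ _ => rfl)
          rcases hi with rfl | hi
          · simp [t', St.stage]
          · have hi := (hV i hi).1
            simp only [t', St.stage, St.setX_apply, Function.update_apply]
            split_ifs <;> first | rfl | omega
        simp only [ec] at this
        exact this)
    rw [St.setX_same] at h2
    refine h1.seq ((h2.mono l1).seq ((Runs.clear (by omega) (St.le_setX l1 (by rw [hsd]; exact zero_le))
      hsd1).of_eq ?_))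
    refine St.ext' (fun i => ?_) fun _ => rfl
    simp only [St.setX_apply]
    by_cases i1 : i = d + 1 <;> by_cases i0 : i = d <;> first | omega | (simp_all; try first | rfl | congr)
  | recur t φ ψ, V, d, e, hd, he, hV, h, s, hs, hA => by
    have hV' : ∀ k, ∀ i ∈ V, i < d + k ∧ i ≠ 2 := fun k i hi => ⟨(hV i hi).1.trans_le (by omega), (hV i hi).2⟩
    have h1 := t.runs (d + 1) (by omega) (hV' 1) h.1 s (hs.mono (by omega))
    simp only [sem]
    set b := t.eval s.1
    set Φ : Set Ordinal.{u} → Ordinal.{u} → Prop :=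
      fun S v => φ.sem (d + 6) (e + 1) (Function.update s.1 (d + 5) v) (Function.update s.2 e S)
    have hsd := hs d le_rfl
    have hsd1 := hs (d + 1) (by omega)
    have hsd2 := hs (d + 2) (by omega)
    have hse := hA e le_rfl
    have l1 : s ≤ s.setX (d + 1) b := hs.le (by omega)
    have c1 : (s.setX (d + 1) b).Clean (d + 2) := (hs.mono (by omega)).setX (by omega)
    have hA' : ∀ S, ∀ a, e + 1 ≤ a → (s.setA e S).2 a = ∅ := fun S a ha => by
      rw [St.setA_apply, if_neg (by omega), hA a (by omega)]
    have h2 := Runs.collect (s := s.setX (d + 1) b) (d := d + 4) (j := d + 1) (e := e)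
      (c := φ.comp (d + 6) (e + 1)) (by omega) (by omega) (by omega) (c1.mono (by omega)) hse Φ
      (fun p _ => by
        intro t'
        have hc : t'.Clean (d + 6) :=
          St.Clean.stage (s := (s.setX (d + 1) b).setA e (recSet Φ p)) (c1.mono (by omega))
        have := runs φ (V := insert (d + 5) V) (d := d + 6) (e := e + 1) (by omega) (by omega) (by
          intro i hi
          rcases hi with rfl | hi
          · omega
          · exact ⟨(hV i hi).1.trans (by omega), (hV i hi).2⟩) h.2.1 t' hc (hA' _)
        have ec : φ.sem (d + 6) (e + 1) t'.1 t'.2 ↔ Φ (recSet Φ p) p := by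
          refine sem_congr φ h.2.1 (by omega) (fun i hi => ?_) (fun _ _ _ => rfl)
          rcases hi with rfl | hi
          · simp [t', St.stage]
          · have hi := (hV i hi).1
            simp only [t', St.stage, St.setX_apply, Function.update_apply, St.setA_fst]
            split_ifs <;> first | rfl | omega
        simp only [ec] at this
        exact this)
    rw [St.setX_same] at h2
    set R := recSet Φ b with hR
    set s₂ := (s.setX (d + 1) b).setA e R with hs₂
    have c2 : s₂.Clean (d + 2) := c1
    have l2 : s ≤ s₂ := St.le_setA l1 (by rw [hse]; exact empty_subset _)
    have h3 := runs ψ (V := V) (d := d + 2) (e := e + 1) (by omega) (by omega) (hV' 2) h.2.2 s₂ c2 (hA' _)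
    have ec : ψ.sem (d + 2) (e + 1) s₂.1 s₂.2 ↔ ψ.sem (d + 2) (e + 1) s.1 (Function.update s.2 e R) :=
      sem_congr ψ h.2.2 (by omega) (fun i hi => St.setX_ne _ _ (by have := (hV i hi).1; omega)) (fun _ _ _ => rfl)
    simp only [ec] at h3
    set Ψ := ψ.sem (d + 2) (e + 1) s.1 (Function.update s.2 e R)
    have e2 : s₂.setX (d + 2) 0 = s₂ := St.ext' (fun i => by
      rw [St.setX_apply]; split_ifs with h
      · rw [h, c2 _ le_rfl]
      · rfl) fun _ => rfl
    have v0 : s₂.1 d = 0 := by simp [hs₂, St.setX_apply, hsd]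
    have l3 : ∀ α, s ≤ s₂.setX d α := fun α => St.le_setX l2 (by rw [hsd]; exact zero_le)
    have h4 : Runs (.ite (2 * (d + 2) + 1) (.seq (.clear (d + 2)) (.incr d)) .skip) s
        (s₂.setX (d + 2) (if Ψ then 1 else 0)) (s₂.setX d (if Ψ then 1 else 0)) := by
      by_cases hh : Ψ
      · simp only [hh, if_true]
        refine Runs.ite_true ((Runs.clear (by omega) (l2.trans (c2.le le_rfl)) hsd2).seq ?_)
          (l2.trans (c2.le le_rfl)) (l3 _) (by simp)
        rw [Runs.setX_setX, e2]
        refine (Runs.incr (by omega) l2).of_eq ?_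
        rw [v0, zero_add]
      · simp only [hh, if_false]
        rw [e2]
        refine (Runs.ite_false Runs.skip l2 (c2 _ le_rfl)).of_eq ?_
        exact St.ext' (fun i => by
          rw [St.setX_apply]; split_ifs with h
          · rw [h, v0]
          · rfl) fun _ => rfl
    -- The auxiliary set is erased again: evaluation may change register `d` only, and further
    -- evaluations rely on empty set registers from `e` on.
    have h5 := Runs.removeAll (s := s₂.setX d (if Ψ then 1 else 0)) (m := s) (d := d + 4) (j := d + 1)
      (e := e) (by omega) (by omega) (by omega) ((c2.mono (by omega)).setX (by omega)) (l3 _) hse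
    refine h1.seq ((h2.mono l1).seq ((h3.mono l2).seq (h4.seq (h5.seq
      ((Runs.clear (by omega) (St.le_setA (l3 _) (by rw [hse]; exact empty_subset _)) hsd1).of_eq ?_)))))
    refine St.ext' (fun i => ?_) fun a => ?_
    · simp only [St.setX_apply, St.setA_fst, hs₂]
      by_cases i1 : i = d + 1 <;> by_cases i0 : i = d <;> first | omega | (simp_all; try first | rfl | congr)
    · simp only [St.setX_snd, St.setA_apply, hs₂]
      by_cases ha : a = e
      · subst ha
        rw [if_pos rfl, hse, St.setX_ne _ _ (by omega : d + 1 ≠ d), St.setA_fst, St.setX_same]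
        simp only [if_true]
        ext ξ
        simp only [hR, recSet, mem_sdiff, mem_ofPred_eq, mem_Iio, mem_empty_iff_false, iff_false]
        tauto
      · simp [ha]

end PE

end

section

/-! ### Programs with a numeral -/

/-- The command that looks for the least value of register `d + 3` for which `φ` holds. -/
def PE.findC (φ : PE) (d e : ℕ) : Cmd :=
  .seq (.incr (d + 2)) (.whil (2 * (d + 2) + 1) (.seq (φ.comp (d + 4) e)
    (.ite (2 * (d + 4) + 1) (.seq (.clear (d + 4)) (.clear (d + 2))) (.incr (d + 3)))))

theorem Runs.setX_self (s : St.{u}) {r : ℕ} {a : Ordinal.{u}} (h : s.1 r = a) : s.setX r a = s :=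
  St.ext' (fun i => by rw [St.setX_apply]; split_ifs with hi <;> simp [hi, h]) fun _ => rfl

/-- This is the one search without a bound given in advance; it ends because a solution exists. As
in the bounded loop there is an additional last stage `α + 1`, in which the flag is down and only
the value found is left. -/
theorem PE.runs_findC (φ : PE) {V : Set ℕ} {d e : ℕ} (hd : 3 ≤ d) (he : 3 ≤ e)
    (hV : ∀ i ∈ V, i < d ∧ i ≠ 2) (hφ : φ.Ok (insert (d + 3) V) (d + 4) e)
    (s : St.{u}) (hs : s.Clean d) (hA : ∀ a, e ≤ a → s.2 a = ∅) (α : Ordinal.{u})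
    (hα : φ.sem (d + 4) e (Function.update s.1 (d + 3) α) s.2)
    (hα' : ∀ β < α, ¬ φ.sem (d + 4) e (Function.update s.1 (d + 3) β) s.2) :
    Runs (φ.findC d e) s s (s.setX (d + 3) α) := by
  classical
  intro hs2
  let E : Ordinal.{u} → St.{u} := fun p => (s.setX (d + 2) 1).setX (d + 3) p
  let D : Ordinal.{u} → St.{u} := fun p => if p ≤ α then E p else s.setX (d + 3) α
  have hD : ∀ p ≤ α, D p = E p := fun p hp => if_pos hp
  have hDe : D (α + 1) = s.setX (d + 3) α := if_neg (by simp)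
  have hcase : ∀ p ≤ α + 1, p ≤ α ∨ p = α + 1 := fun p hp => by
    rcases hp.lt_or_eq with h | h
    · exact Or.inl (Order.lt_add_one_iff.1 h)
    · exact Or.inr h
  have hsE : ∀ p, s ≤ E p := fun p => St.le_setX (hs.le (by omega))
    (by rw [hs _ (by omega)]; exact zero_le)
  have cE : ∀ p, (E p).Clean (d + 4) := fun p =>
    ((hs.mono (by omega : d ≤ d + 4)).setX (by omega)).setX (by omega)
  have key : ∀ p, Runs (φ.comp (d + 4) e) (E p) (E p) ((E p).setX (d + 4)
      (if φ.sem (d + 4) e (Function.update s.1 (d + 3) p) s.2 then 1 else 0)) := fun p => by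
    have h1 := PE.runs φ (V := insert (d + 3) V) (d := d + 4) (e := e) (by omega) he (by
      intro i hi
      rcases hi with rfl | hi
      · omega
      · exact ⟨(hV i hi).1.trans (by omega), (hV i hi).2⟩) hφ (E p) (cE p) hA
    have ec : φ.sem (d + 4) e (E p).1 (E p).2 ↔
        φ.sem (d + 4) e (Function.update s.1 (d + 3) p) s.2 := by
      refine PE.sem_congr φ hφ he (fun i hi => ?_) (fun _ _ _ => rfl)
      rcases hi with rfl | hi
      · simp [E]
      · have hi := (hV i hi).1
        simp only [E, St.setX_apply, Function.update_apply]
        split_ifs <;> first | rfl | omega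
    simp only [ec] at h1
    exact h1
  have e0 : E 0 = s.setX (d + 2) 1 :=
    Runs.setX_self _ (by rw [St.setX_ne _ _ (by omega), hs _ (by omega)])
  have hl := Runs.whil (m := s) (f := d + 2) (c := .seq (φ.comp (d + 4) e)
    (.ite (2 * (d + 4) + 1) (.seq (.clear (d + 4)) (.clear (d + 2))) (.incr (d + 3)))) D (α + 1)
    (fun p hp => ?_) (fun p hp => ?_) (fun p hp => ?_) ?_ (fun p hp => ?_) (fun p hp hp' => ?_)
  · rw [hD 0 zero_le, e0, hDe] at hl
    have h0 := Runs.incr (j := d + 2) (s := s) (m := s) (by omega) le_rfl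
    rw [hs (d + 2) (by omega), zero_add] at h0
    exact h0.seq hl hs2
  · rcases hcase p hp with h | rfl
    · rw [hD p h]; exact hsE p
    · rw [hDe]; exact hs.le (by omega)
  · rcases hcase p hp with h | rfl
    · rw [hD p h]
      simp only [E, St.setX_apply]
      split_ifs <;> omega
    · rw [hDe, St.setX_ne _ _ (by omega), hs2]
  · rw [hD p (Order.lt_add_one_iff.1 hp)]
    simp [E, St.setX_apply]
  · rw [hDe, St.setX_ne _ _ (by omega), hs _ (by omega)]
  · have hp' := Order.lt_add_one_iff.1 hp
    rw [hD p hp']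
    have h1 := key p
    have hz : (E p).1 (d + 4) = 0 := cE p _ le_rfl
    rcases hp'.lt_or_eq with h | rfl
    · rw [if_neg (hα' p h), Runs.setX_self _ hz] at h1
      have h2 : E (p + 1) = (E p).setX (d + 3) (p + 1) := by simp [E, Runs.setX_setX]
      have h3 : (E p).1 (d + 3) = p := by simp [E]
      have hle : E p ≤ E (p + 1) := by
        rw [h2]; exact St.le_setX le_rfl (by rw [h3]; exact le_self_add)
      rw [hD _ (Order.add_one_le_of_lt h)]
      refine (h1.mono inf_le_left).seq (Runs.ite_false ?_ inf_le_left hz)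
      refine (Runs.incr (by omega) inf_le_left).of_eq ?_
      rw [h2, h3]
    · rw [if_pos hα] at h1
      rw [hDe]
      refine (h1.mono inf_le_left).seq ?_
      have hf : (s.setX (d + 3) p).1 (d + 2) = 0 := by
        rw [St.setX_ne _ _ (by omega), hs _ (by omega)]
      refine Runs.ite_true ((Runs.clear (by omega) (inf_le_left.trans ((cE p).le le_rfl)) ?_).seq
        ((Runs.clear (by omega) ?_ ?_).of_eq ?_))
        (inf_le_left.trans ((cE p).le le_rfl)) inf_le_right (by simp)
      · exact le_antisymm ((inf_le_left : E p ⊓ s.setX (d + 3) p ≤ _).1 _ |>.trans hz.le) zero_le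
      · rw [Runs.setX_setX, Runs.setX_self _ hz]; exact inf_le_left
      · exact le_antisymm ((inf_le_right : E p ⊓ s.setX (d + 3) p ≤ _).1 _ |>.trans hf.le) zero_le
      · rw [Runs.setX_setX, Runs.setX_self _ hz]
        refine St.ext' (fun i => ?_) fun _ => rfl
        simp only [E, St.setX_apply]
        split_ifs with h1 h2 <;> first | rfl | omega | (rw [h1, hs _ (by omega)])
  · have hp1 : p ≤ α := (hcase p hp).resolve_right (by
      rintro rfl
      exact Order.not_isSuccLimit_add_one α hp')
    refine ⟨fun i ξ => ?_, fun i ξ => ?_⟩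
    · have : (∃ r < p, ∀ q, r ≤ q → q < p → ξ < (D q).1 i) ↔
          ∃ r < p, ∀ q, r ≤ q → q < p → ξ < (E q).1 i :=
        exists_congr fun r => and_congr_right fun _ => forall_congr' fun q => imp_congr_right fun _ =>
          forall_congr' fun hq => by rw [hD q (hq.le.trans hp1)]
      rw [this, hD p hp1]
      simp only [E, St.setX_apply]
      by_cases h3 : i = d + 3
      · simp only [if_pos h3]
        constructor
        · intro h
          have := hp'.succ_lt h
          rw [Order.succ_eq_add_one] at this
          exact ⟨ξ + 1, this, fun q hq _ => (Order.lt_add_one_iff.2 le_rfl).trans_le hq⟩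
        · rintro ⟨r, hr, h⟩
          exact (h r le_rfl hr).trans hr
      · simp only [if_neg h3]
        exact isLim_const hp' (fun i => ξ < if i = d + 2 then 1 else s.1 i) i
    · have hD2 : ∀ q, (D q).2 = s.2 := fun q => by
        simp only [D]; split_ifs <;> rfl
      simp only [hD2]
      exact isLim_const hp' (fun i => ξ ∈ s.2 i) i

/-- Lines that write a numeral on tape 7. They are passed once more at the end of the computation. -/
def writer (L N : ℕ) : Program :=
  (List.range N).map (fun j => (7, (true, some true, L + j + 1), (true, some true, L + j + 1))) ++
    [(5, (false, none, 1), (true, none, L + N + 1))]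

/-- The program that consists of the lines `K` and lines that provide the numeral `N`. -/
def withNumeral (K : Program) (N : ℕ) : Program := K ++ writer K.length N

/-- The lines around a command. -/
def mainLines (c : Cmd) : Program :=
  [(7, (false, some true, 4 + c.len), (false, some true, 4 + c.len)),
    keepLine 7 (some false) 2,
    (7, (true, none, 3), (true, some false, 2)),
    (5, (true, none, 4), (true, none, 4))] ++ c.compile 4

theorem length_writer (L N : ℕ) : (writer L N).length = N + 1 := by simp [writer]

theorem length_mainLines (c : Cmd) : (mainLines c).length = 4 + c.len := by
  simp [mainLines, Cmd.length_compile]; omega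

/-- The least ordinal that is greater than or equal to the elements in the marked initial segment. -/
def endOf (x : Set Ordinal.{u}) : Ordinal.{u} := sSup ((· + 1) '' x)

/-- The marks for the end of `x` on the initial tapes are thus the initial segment `Iio (endOf x)`,
that is, the value of an ordinal register. -/
theorem lt_endOf_iff {x : Set Ordinal.{u}} (hx : BddAbove x) {β : Ordinal.{u}} :
    β < endOf x ↔ ∃ ξ ∈ x, β ≤ ξ := by
  obtain ⟨b, hb⟩ := hx
  rw [endOf, lt_csSup_iff']
  · simp
  · exact ⟨b + 1, by rintro _ ⟨ξ, hξ, rfl⟩; have := hb hξ; simpa using this⟩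

theorem lt_endOf {x : Set Ordinal.{u}} (hx : BddAbove x) {β : Ordinal.{u}} (h : β ∈ x) :
    β < endOf x := (lt_endOf_iff hx).2 ⟨β, h, le_rfl⟩

/-- The registers at the start. -/
def initSt (x ρ : Set Ordinal.{u}) (N : ℕ) : St.{u} :=
  (fun i => match i with
    | 0 => endOf x
    | 1 => endOf ρ
    | 2 => 1
    | 3 => N + 1
    | _ => 0,
   fun i => match i with
    | 0 => x
    | 1 => ρ
    | _ => ∅)

end

/-! ### Correctness of the start and the end of a program with a numeral. -/

section

theorem moveLeft_add_one (a : Ordinal.{u}) : moveLeft (a + 1) = a := by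
  rw [moveLeft, dif_pos ⟨a, rfl⟩]
  exact (Order.add_one_inj.1 (⟨a, rfl⟩ : ∃ b, a + 1 = b + 1).choose_spec).symm

/-- The configuration with the heads other than that of tape 7 on cell `0`. -/
def cfg7 (q : ℕ) (T : Tapes.{u}) (p : ℕ) (S : Set Ordinal.{u}) : Config.{u} :=
  ⟨q, Function.update (fun _ => 0) 7 (p : Ordinal.{u}), Function.update T 7 S⟩

theorem Leads.single {P : Program} {D D' : Config.{u}} (h : P.step D = D') :
    Leads P 0 (fun _ => ∅) D D' :=
  Leads.refl.head h (Nat.zero_le _) fun _ => empty_subset _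

/-- The interval of the natural numbers from `p` to `q - 1`. -/
def natIco (p q : ℕ) : Set Ordinal.{u} := {ξ | ∃ n : ℕ, p ≤ n ∧ n < q ∧ ξ = n}

theorem mem_natIco {p q n : ℕ} : (n : Ordinal.{u}) ∈ natIco.{u} p q ↔ p ≤ n ∧ n < q := by
  constructor
  · rintro ⟨m, h1, h2, h3⟩
    obtain rfl : n = m := by exact_mod_cast h3
    exact ⟨h1, h2⟩
  · exact fun h => ⟨n, h.1, h.2, rfl⟩

theorem insert_natIco_right {p q : ℕ} (h : p ≤ q) :
    insert (q : Ordinal.{u}) (natIco p q) = natIco p (q + 1) := by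
  ext ξ
  constructor
  · rintro (rfl | ⟨n, h1, h2, rfl⟩)
    · exact ⟨q, h, by omega, rfl⟩
    · exact ⟨n, h1, by omega, rfl⟩
  · rintro ⟨n, h1, h2, rfl⟩
    rcases Nat.lt_succ_iff_lt_or_eq.1 h2 with h | rfl
    · exact Or.inr ⟨n, h1, h, rfl⟩
    · exact Or.inl rfl

theorem Iio_natCast (N : ℕ) : Iio (N : Ordinal.{u}) = natIco 0 N := by
  ext ξ
  constructor
  · intro h
    obtain ⟨n, rfl⟩ := lt_omega0.1 ((mem_Iio.1 h).trans (natCast_lt_omega0 N))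
    exact ⟨n, Nat.zero_le _, by simpa using h, rfl⟩
  · rintro ⟨n, -, h, rfl⟩
    simpa using h

theorem insert_zero_natIco (N : ℕ) :
    insert (0 : Ordinal.{u}) (natIco 1 N) = Iio ((max N 1 : ℕ) : Ordinal.{u}) := by
  rw [Iio_natCast]
  ext ξ
  constructor
  · rintro (rfl | ⟨n, h1, h2, rfl⟩)
    · exact ⟨0, le_rfl, by simp, by simp⟩
    · exact ⟨n, by omega, by simp [h2], rfl⟩
  · rintro ⟨n, h1, h2, rfl⟩
    rcases Nat.eq_zero_or_pos n with rfl | h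
    · simp
    · exact Or.inr ⟨n, h, by omega, rfl⟩

theorem leads_writer {P : Program} {L N : ℕ} (hP : HasCode P L (writer L N)) (T : Tapes.{u}) (p : ℕ)
    (S : Set Ordinal.{u}) : ∀ j, j ≤ N → Leads P 0 (fun _ => ∅) (cfg7 L T p S)
      (cfg7 (L + j) T (p + j) (S ∪ natIco p (p + j)))
  | 0, _ => by
    have : S ∪ natIco.{u} p (p + 0) = S := by
      refine union_eq_left.2 ?_
      rintro ξ ⟨n, h1, h2, -⟩; omega
    rw [this]
    exact Leads.refl
  | j + 1, hj => by
    refine (leads_writer hP T p S j (by omega)).trans (Leads.single ?_)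
    have hl : P[L + j]? = some (7, (true, some true, L + j + 1), (true, some true, L + j + 1)) := by
      rw [hP j (by rw [length_writer]; omega), writer, List.getElem?_append_left (by simp; omega)]
      simp [show j < N by omega]
    have hs : P.step (cfg7 (L + j) T (p + j) (S ∪ natIco p (p + j))) =
        ⟨L + j + 1, Function.update (Function.update (fun _ => 0) 7 ((p + j : ℕ) : Ordinal.{u})) 7
          (((p + j : ℕ) : Ordinal.{u}) + 1), Function.update (Function.update T 7
          (S ∪ natIco p (p + j))) 7 (insert ((p + j : ℕ) : Ordinal.{u}) (S ∪ natIco p (p + j)))⟩ := by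
      by_cases hm : (cfg7 (L + j) T (p + j) (S ∪ natIco p (p + j))).head 7 ∈
          (cfg7 (L + j) T (p + j) (S ∪ natIco p (p + j))).tape 7
      · rw [step_of_mem hl hm]; simp [cfg7, moveHead, setBit]
      · rw [step_of_notMem hl hm]; simp [cfg7, moveHead, setBit]
    rw [hs, Function.update_idem, Function.update_idem, ← union_insert,
      insert_natIco_right (by omega)]
    simp [cfg7, add_assoc]

/-- The numeral was written from cell `1` on. The empty cell `0` tells the returning head where the
tape begins, and it is filled last; this is why the register gets the value `N + 1`. -/
theorem leads_back {P : Program} (h2 : P[2]? = some (7, (true, none, 3), (true, some false, 2)))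
    (T : Tapes.{u}) (N : ℕ) : ∀ j, j ≤ N → Leads P 0 (fun _ => ∅)
      (cfg7 2 T j (natIco 1 (N + 1))) (cfg7 3 T 0 (Iio ((N + 1 : ℕ) : Ordinal.{u})))
  | 0, _ => by
    refine Leads.single ?_
    rw [step_of_notMem h2]
    · simp only [cfg7, moveHead, setBit, if_true, Function.update_self, Function.update_idem,
        Nat.cast_zero]
      rw [insert_zero_natIco, max_eq_left (by omega)]
    · simp only [cfg7, Function.update_self]
      rw [mem_natIco]; omega
  | j + 1, hj => by
    refine (Leads.single ?_).trans (leads_back h2 T N j (by omega))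
    rw [step_of_mem h2]
    · have hm : moveLeft ((j + 1 : ℕ) : Ordinal.{u}) = j := by
        rw [Nat.cast_succ, moveLeft_add_one]
      have hmem : ((j + 1 : ℕ) : Ordinal.{u}) ∈ natIco.{u} 1 (N + 1) := mem_natIco.2 (by omega)
      simp only [cfg7, moveHead, setBit, if_true, Function.update_self, Function.update_idem,
        insert_eq_of_mem hmem, hm]
    · simp only [cfg7, Function.update_self]
      rw [mem_natIco]; omega

/-- The lines `K` do not depend on `N`; they start with a jump to the numeral lines behind them,
which lie exactly where the command ends. These lines are hence executed twice. Their last line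
distinguishes the two occasions by the mark on tape 5, which is set in between. The second execution
spoils only tape 7, not the output. -/
theorem withNumeral_outputs {c : Cmd} {x ρ : Set Ordinal.{u}} {N : ℕ} {m s' : St.{u}}
    (hx : BddAbove x) (hρ : BddAbove ρ) (h : Runs c m (initSt x ρ N) s') :
    (withNumeral (mainLines c) N).Outputs x ρ (s'.2 2) := by
  obtain ⟨hs2, hr⟩ := h rfl
  set P := withNumeral (mainLines c) N with hP
  have hPl : P = mainLines c ++ writer (4 + c.len) N := by
    rw [hP, withNumeral, length_mainLines]
  have hw : HasCode P (4 + c.len) (writer (4 + c.len) N) := by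
    have : HasCode P 0 (mainLines c ++ writer (4 + c.len) N) := by
      intro k _; rw [← hPl, zero_add]
    have := this.right
    rwa [length_mainLines, zero_add] at this
  have hm : HasCode P 0 (mainLines c) := by
    have : HasCode P 0 (mainLines c ++ writer (4 + c.len) N) := by
      intro k _; rw [← hPl, zero_add]
    exact this.left
  have hc : HasCode P 4 (c.compile 4) := hm.right
  have h0 : P[0]? = some (7, (false, some true, 4 + c.len), (false, some true, 4 + c.len)) := hm.left.head
  have h1 : P[1]? = some (keepLine 7 (some false) 2) := hm.left.tail.head
  have h2 : P[2]? = some (7, (true, none, 3), (true, some false, 2)) := hm.left.tail.tail.head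
  have h3 : P[3]? = some (5, (true, none, 4), (true, none, 4)) := hm.left.tail.tail.tail.head
  have hwl : P[4 + c.len + N]? = some (5, (false, none, 1), (true, none, 4 + c.len + N + 1)) := by
    rw [hw N (by rw [length_writer]; omega), writer, List.getElem?_append_right (by simp)]
    simp
  have hlen : P.length = 4 + c.len + N + 1 := by
    rw [hPl, List.length_append, length_mainLines, length_writer]; omega
  set T₀ : Tapes.{u} := (initConfig x ρ).tape
  have e7 : Function.update T₀ 7 ∅ = T₀ := Function.update_eq_self_iff.2 rfl
  have s0 : P.step (initConfig x ρ) = cfg7 (4 + c.len) T₀ 1 ∅ := by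
    rw [step_of_notMem h0 (by simp [initConfig])]
    simp only [initConfig, cfg7, moveHead, setBit, zero_add, Nat.cast_one, T₀]
    refine Config.eq_of rfl (fun i => rfl) (fun i => ?_)
    simp
  have s1 := leads_writer hw T₀ 1 ∅ N le_rfl
  -- First occasion: tape 5 is still empty, and control goes back to state `1`.
  have s2 : P.step (cfg7 (4 + c.len + N) T₀ (1 + N) (∅ ∪ natIco 1 (1 + N))) =
      cfg7 1 T₀ (1 + N) (natIco 1 (1 + N)) := by
    rw [step_of_notMem hwl (by simp [cfg7, T₀, initConfig])]
    simp only [cfg7, moveHead, setBit, empty_union]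
    refine Config.eq_of rfl (fun i => ?_) (fun i => ?_)
    · simp only [Function.update_apply]
      split_ifs <;> first | rfl | omega
    · simp only [Bool.false_eq_true, if_false]
      by_cases hi : i = 5
      · subst hi; simp [T₀, initConfig]
      · simp [Function.update_of_ne hi]
  have s3 : P.step (cfg7 1 T₀ (1 + N) (natIco 1 (1 + N))) = cfg7 2 T₀ N (natIco 1 (N + 1)) := by
    have h1' : P[(cfg7 1 T₀ (1 + N) (natIco.{u} 1 (1 + N))).state]? =
      some (keepLine 7 (some false) 2) := h1
    rw [step_keepLine h1']
    have hm : moveLeft ((1 + N : ℕ) : Ordinal.{u}) = N := by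
      rw [add_comm, Nat.cast_succ, moveLeft_add_one]
    simp only [cfg7, moveHead, Function.update_self, Function.update_idem, hm]
    rw [add_comm 1 N]
  have s4 := leads_back h2 T₀ N N le_rfl
  have s5 : P.step (cfg7 3 T₀ 0 (Iio ((N + 1 : ℕ) : Ordinal.{u}))) =
      restCfg 4 (initSt x ρ N).tapes := by
    rw [step_of_notMem h3 (by simp [cfg7, T₀, initConfig])]
    refine Config.eq_of rfl (fun i => ?_) (fun i => ?_)
    · simp [cfg7, restCfg, moveHead, Function.update_apply]
    · simp only [cfg7, setBit, restCfg]
      have hend : ∀ {y : Set Ordinal.{u}}, BddAbove y → {β | ∃ ξ ∈ y, β ≤ ξ} = Iio (endOf y) :=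
        fun hy => by ext β; rw [mem_Iio, lt_endOf_iff hy]; rfl
      rcases Nat.even_or_odd' i with ⟨k, rfl | rfl⟩
      · rw [St.tapes_even, Function.update_of_ne (by omega), Function.update_of_ne (by omega)]
        rcases k with _ | _ | k <;> rfl
      · rw [St.tapes_odd]
        rcases k with _ | _ | _ | _ | k
        · simpa [T₀, initConfig, initSt] using hend hx
        · simpa [T₀, initConfig, initSt] using hend hρ
        · simp only [T₀, initConfig, initSt]
          ext ξ; simp
        · simp [initSt]
        · rw [Function.update_of_ne (by omega), Function.update_of_ne (by omega)]
          simp only [T₀, initConfig, initSt, show 2 * (k + 1 + 1 + 1 + 1) + 1 = 2 * k + 5 + 4 by ring]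
          ext ξ; simp
  have s6 := (hr P 4 hc).mono (b' := 0) (M' := fun _ => ∅) (Nat.zero_le _) fun _ => empty_subset _
  have s7 : restCfg (4 + c.len) s'.tapes = cfg7 (4 + c.len) s'.tapes 0 (s'.tapes 7) :=
    Config.eq_of rfl (fun i => by simp [restCfg, cfg7]) (fun i => by simp [restCfg, cfg7])
  have s8 := leads_writer hw s'.tapes 0 (s'.tapes 7) N le_rfl
  set S := s'.tapes 7 ∪ natIco 0 (0 + N)
  have h5 : Function.update s'.tapes 7 S 5 = {0} := by
    rw [Function.update_of_ne (by omega)]; exact Runs.tape5 hs2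
  -- Second occasion: tape 5 carries its mark, and control leaves the program.
  have s9 : P.step (cfg7 (4 + c.len + N) s'.tapes (0 + N) S) =
      cfg7 (4 + c.len + N + 1) s'.tapes (0 + N) S := by
    rw [step_of_mem hwl (by simp [cfg7, Runs.tape5 hs2])]
    refine Config.eq_of rfl (fun i => ?_) (fun i => ?_)
    · simp only [cfg7, moveHead, Function.update_apply]
      split_ifs <;> first | rfl | omega
    · simp only [cfg7, setBit, if_true, h5]
      by_cases hi : i = 5
      · subst hi; simp [Runs.tape5 hs2]
      · simp [Function.update_of_ne hi]
  have all := (((((((Leads.single s0).trans s1).trans (Leads.single s2)).trans (Leads.single s3)).trans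
    s4).trans (Leads.single s5)).trans (s7 ▸ s6)).trans (s8.trans (Leads.single s9))
  obtain ⟨t, -, ht, -⟩ := all _ (isRun_run P x ρ) 0 (by simp [Program.run])
  refine ⟨t, ?_, ?_⟩
  · rw [ht, hlen]; exact le_rfl
  · rw [ht]
    simp only [cfg7]
    rw [Function.update_of_ne (by omega)]
    exact s'.tapes_even 2

end

section

/-! ### Definability -/

/-- A context: the meaning of the registers as functions of the elements of a type `γ`. One register
contains `ω`. -/
structure Ctx (γ : Type (u + 1)) where
  x : γ → ℕ → Ordinal.{u}
  A : γ → ℕ → Set Ordinal.{u}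
  V : Set ℕ
  d : ℕ
  e : ℕ
  hd : 3 ≤ d
  he : 3 ≤ e
  hV : ∀ i ∈ V, i < d ∧ i ≠ 2
  w : ℕ
  hw : w ∈ V
  hx : ∀ g, x g w = omega0

variable {γ γ' γ'' : Type (u + 1)}

/-- The context with one more variable for ordinals. -/
def Ctx.ext (C : Ctx γ) : Ctx (γ × Ordinal.{u}) where
  x p := Function.update (C.x p.1) (C.d + 3) p.2
  A p := C.A p.1
  V := insert (C.d + 3) C.V
  d := C.d + 4
  e := C.e
  hd := by have := C.hd; omega
  he := C.he
  hV i hi := by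
    rcases hi with rfl | hi
    · omega
    · have := C.hV i hi; omega
  w := C.w
  hw := Or.inr C.hw
  hx g := by
    have := C.hV _ C.hw
    rw [Function.update_of_ne (by omega), C.hx]

/-- The context with one more variable for sets of ordinals. -/
def Ctx.extS (C : Ctx γ) : Ctx (γ × Set Ordinal.{u}) where
  x p := C.x p.1
  A p := Function.update (C.A p.1) C.e p.2
  V := C.V
  d := C.d + 2
  e := C.e + 1
  hd := by have := C.hd; omega
  he := by have := C.he; omega
  hV i hi := by have := C.hV i hi; omega
  w := C.w
  hw := C.hw
  hx g := C.hx _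

/-- The function is the value of a term. -/
def TDfn (C : Ctx γ) (f : γ → Ordinal.{u}) : Prop :=
  ∃ t : Tm, t.Ok C.V ∧ ∀ g, t.eval (C.x g) = f g

/-- The function is the value of a set register. -/
def SReg (C : Ctx γ) (S : γ → Set Ordinal.{u}) : Prop :=
  ∃ a, a < C.e ∧ a ≠ 2 ∧ ∀ g, C.A g a = S g

/-- The registers of `C` are available in `C'`. -/
def Ext (C : Ctx γ) (C' : Ctx γ') (π : γ' → γ) : Prop :=
  (∀ i ∈ C.V, TDfn C' fun g => C.x (π g) i) ∧
    ∀ a, a < C.e → a ≠ 2 → SReg C' fun g => C.A (π g) a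

/-- The relation is the meaning of a formula. -/
def DfnAt (C : Ctx γ) (R : γ → Prop) : Prop :=
  ∃ φ : PE, φ.Ok C.V C.d C.e ∧ ∀ g, φ.sem C.d C.e (C.x g) (C.A g) ↔ R g

/-- The relation is definable whenever the registers of `C` are available. -/
def Dfn (C : Ctx γ) (R : γ → Prop) : Prop :=
  ∀ (γ' : Type (u + 1)) (C' : Ctx γ') (π : γ' → γ), Ext C C' π → DfnAt C' fun g => R (π g)

/-- Membership in the set is definable. -/
def SDfn (C : Ctx γ) (S : γ → Set Ordinal.{u}) : Prop := Dfn C.ext fun p => p.2 ∈ S p.1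

variable {C : Ctx γ} {C' : Ctx γ'} {C'' : Ctx γ''} {π : γ' → γ} {π' : γ'' → γ'}

namespace TDfn

variable {f f' : γ → Ordinal.{u}}

theorem zero : TDfn C fun _ => 0 := ⟨.zero, trivial, fun _ => rfl⟩

theorem omega : TDfn C fun _ => omega0 := ⟨.var C.w, C.hw, C.hx⟩

theorem succ (h : TDfn C f) : TDfn C fun g => f g + 1 := by
  obtain ⟨t, ht, h⟩ := h
  exact ⟨.succ t, ht, fun g => by simp [Tm.eval, h]⟩

theorem add (h : TDfn C f) (h' : TDfn C f') : TDfn C fun g => f g + f' g := by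
  obtain ⟨t, ht, h⟩ := h
  obtain ⟨t', ht', h'⟩ := h'
  exact ⟨.add t t', ⟨ht, ht'⟩, fun g => by simp [Tm.eval, h, h']⟩

theorem mul (h : TDfn C f) (h' : TDfn C f') : TDfn C fun g => f g * f' g := by
  obtain ⟨t, ht, h⟩ := h
  obtain ⟨t', ht', h'⟩ := h'
  exact ⟨.mul t t', ⟨ht, ht'⟩, fun g => by simp [Tm.eval, h, h']⟩

theorem pair (h : TDfn C f) (h' : TDfn C f') : TDfn C fun g => opair (f g) (f' g) := by
  obtain ⟨t, ht, h⟩ := h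
  obtain ⟨t', ht', h'⟩ := h'
  exact ⟨.pair t t', ⟨ht, ht'⟩, fun g => by simp [Tm.eval, h, h']⟩

theorem nat : ∀ n : ℕ, TDfn C fun _ => (n : Ordinal.{u})
  | 0 => by simpa using zero
  | n + 1 => by simpa using (nat n).succ

theorem one : TDfn C fun _ => 1 := by simpa using nat (C := C) 1

theorem two : TDfn C fun _ => 2 := by simpa using nat (C := C) 2

theorem subst (h : TDfn C f) (E : Ext C C' π) : TDfn C' fun g => f (π g) := by
  obtain ⟨t, ht, h⟩ := h
  simp only [← h]
  clear h
  induction t with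
  | var i => exact E.1 i ht
  | zero => exact zero
  | succ t ih => exact (ih ht).succ
  | add t t' ih ih' => exact (ih ht.1).add (ih' ht.2)
  | mul t t' ih ih' => exact (ih ht.1).mul (ih' ht.2)
  | pair t t' ih ih' => exact (ih ht.1).pair (ih' ht.2)

end TDfn

theorem SReg.subst {S : γ → Set Ordinal.{u}} (h : SReg C S) (E : Ext C C' π) :
    SReg C' fun g => S (π g) := by
  obtain ⟨a, ha, ha', h⟩ := h
  simp only [← h]
  exact E.2 a ha ha'

namespace Ext

theorem refl : Ext C C id :=
  ⟨fun i hi => ⟨.var i, hi, fun _ => rfl⟩, fun a ha ha' => ⟨a, ha, ha', fun _ => rfl⟩⟩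

theorem trans (h : Ext C C' π) (h' : Ext C' C'' π') : Ext C C'' fun g => π (π' g) :=
  ⟨fun i hi => (h.1 i hi).subst h', fun a ha ha' => (h.2 a ha ha').subst h'⟩

theorem wk : Ext C C.ext Prod.fst := by
  refine ⟨fun i hi => ⟨.var i, Or.inr hi, fun g => ?_⟩, fun a ha ha' => ⟨a, ha, ha', fun _ => rfl⟩⟩
  have := C.hV i hi
  exact Function.update_of_ne (by omega) _ _

theorem wkS : Ext C C.extS Prod.fst := by
  refine ⟨fun i hi => ⟨.var i, hi, fun g => rfl⟩,
    fun a ha ha' => ⟨a, ha.trans (Nat.lt_succ_self _), ha', fun _ => ?_⟩⟩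
  exact Function.update_of_ne (by omega) _ _

theorem sub (h : Ext C C' π) {t : γ' → Ordinal.{u}} (ht : TDfn C' t) :
    Ext C.ext C' fun g => (π g, t g) := by
  refine ⟨fun i hi => ?_, h.2⟩
  rcases hi with rfl | hi
  · simpa [Ctx.ext] using ht
  · have := C.hV i hi
    simpa [Ctx.ext, Function.update_of_ne (by omega : i ≠ C.d + 3)] using h.1 i hi

theorem subS (h : Ext C C' π) {S : γ' → Set Ordinal.{u}} (hS : SReg C' S) :
    Ext C.extS C' fun g => (π g, S g) := by
  refine ⟨h.1, fun a ha ha' => ?_⟩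
  by_cases hae : a = C.e
  · subst hae
    simpa [Ctx.extS] using hS
  · have h1 := h.2 a (by have : a < C.e + 1 := ha; omega) ha'
    simpa [Ctx.extS, Function.update_of_ne hae] using h1

end Ext

theorem TDfn.var : TDfn C.ext fun p => p.2 :=
  ⟨.var (C.d + 3), Or.inl rfl, fun _ => Function.update_self _ _ _⟩

theorem SReg.var : SReg C.extS fun p => p.2 :=
  ⟨C.e, Nat.lt_succ_self _, by have := C.he; omega, fun _ => Function.update_self _ _ _⟩

theorem Ext.lift (h : Ext C C' π) : Ext C.ext C'.ext fun p => (π p.1, p.2) :=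
  (h.trans .wk).sub .var

theorem Ext.liftS (h : Ext C C' π) : Ext C.extS C'.extS fun p => (π p.1, p.2) :=
  (h.trans .wkS).subS .var

theorem TDfn.w {f : γ → Ordinal.{u}} (h : TDfn C f) : TDfn C.ext fun p => f p.1 := h.subst .wk

theorem TDfn.wS {f : γ → Ordinal.{u}} (h : TDfn C f) : TDfn C.extS fun p => f p.1 := h.subst .wkS

namespace Dfn

variable {P Q : γ → Prop} {t t' : γ → Ordinal.{u}} {S : γ → Set Ordinal.{u}}

/-- `Dfn` quantifies over all contexts in which the registers of `C` are available as terms.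
Substitution is therefore mere composition, and no syntactic substitution in formulas, whose bound
variables depend on the depth, has to be defined. -/
theorem subst (h : Dfn C P) (E : Ext C C' π) : Dfn C' fun g => P (π g) :=
  fun _ _ _ E' => h _ _ _ (E.trans E')

theorem congr (h : Dfn C P) (h' : ∀ g, P g ↔ Q g) : Dfn C Q := by
  rwa [show Q = P from funext fun g => propext (h' g).symm]

theorem lt (h : TDfn C t) (h' : TDfn C t') : Dfn C fun g => t g < t' g := by
  intro γ' C' π E
  obtain ⟨a, ha, h⟩ := h.subst E
  obtain ⟨a', ha', h'⟩ := h'.subst E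
  exact ⟨.lt a a', ⟨ha, ha'⟩, fun g => by simp only [PE.sem, h, h']⟩

theorem memReg (h : TDfn C t) (h' : SReg C S) : Dfn C fun g => t g ∈ S g := by
  intro γ' C' π E
  obtain ⟨a, ha, h⟩ := h.subst E
  obtain ⟨b, hb, hb', h'⟩ := h'.subst E
  exact ⟨.mem a b, ⟨ha, hb, hb'⟩, fun g => by simp only [PE.sem, h, h']⟩

theorem not (h : Dfn C P) : Dfn C fun g => ¬ P g := by
  intro γ' C' π E
  obtain ⟨φ, hφ, h⟩ := h _ _ _ E
  exact ⟨.not φ, hφ, fun g => by simp only [PE.sem, h]⟩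

theorem and (h : Dfn C P) (h' : Dfn C Q) : Dfn C fun g => P g ∧ Q g := by
  intro γ' C' π E
  obtain ⟨φ, hφ, h⟩ := h _ _ _ E
  obtain ⟨ψ, hψ, h'⟩ := h' _ _ _ E
  exact ⟨.and φ ψ, ⟨hφ, hψ⟩, fun g => by simp only [PE.sem, h, h']⟩

theorem or (h : Dfn C P) (h' : Dfn C Q) : Dfn C fun g => P g ∨ Q g :=
  (h.not.and h'.not).not.congr fun g => by tauto

theorem imp (h : Dfn C P) (h' : Dfn C Q) : Dfn C fun g => P g → Q g :=
  (h.and h'.not).not.congr fun g => by tauto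

theorem iff (h : Dfn C P) (h' : Dfn C Q) : Dfn C fun g => (P g ↔ Q g) :=
  ((h.imp h').and (h'.imp h)).congr fun g => by tauto

theorem ex {R : γ → Ordinal.{u} → Prop} (ht : TDfn C t) (h : Dfn C.ext fun p => R p.1 p.2) :
    Dfn C fun g => ∃ α < t g, R g α := by
  intro γ' C' π E
  obtain ⟨a, ha, ht⟩ := ht.subst E
  obtain ⟨φ, hφ, h⟩ := h _ _ _ E.lift
  refine ⟨.ex a φ, ⟨ha, hφ⟩, fun g => ?_⟩
  simp only [PE.sem, ht]
  exact exists_congr fun α => and_congr_right fun _ => h (g, α)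

theorem all {R : γ → Ordinal.{u} → Prop} (ht : TDfn C t) (h : Dfn C.ext fun p => R p.1 p.2) :
    Dfn C fun g => ∀ α < t g, R g α :=
  (ex (R := fun g α => ¬ R g α) ht h.not).not.congr fun g => by push Not; rfl

theorem recur {Φ : γ → Set Ordinal.{u} → Ordinal.{u} → Prop} {R : γ → Set Ordinal.{u} → Prop}
    (ht : TDfn C t) (hΦ : Dfn C.extS.ext fun p => Φ p.1.1 p.1.2 p.2)
    (hR : Dfn C.extS fun p => R p.1 p.2) : Dfn C fun g => R g (recSet (Φ g) (t g)) := by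
  intro γ' C' π E
  obtain ⟨a, ha, ht⟩ := ht.subst E
  obtain ⟨φ, hφ, h⟩ := hΦ _ _ _ E.liftS.lift
  obtain ⟨ψ, hψ, h'⟩ := hR _ _ _ E.liftS
  refine ⟨.recur a φ ψ, ⟨ha, hφ, hψ⟩, fun g => ?_⟩
  simp only [PE.sem, ht]
  have : (fun S v => φ.sem (C'.d + 6) (C'.e + 1) (Function.update (C'.x g) (C'.d + 5) v)
      (Function.update (C'.A g) C'.e S)) = Φ (π g) := by
    funext S v
    exact propext (h ((g, S), v))
  rw [this]
  exact h' (g, _)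

theorem eq (h : TDfn C t) (h' : TDfn C t') : Dfn C fun g => t g = t' g :=
  ((lt h h').not.and (lt h' h).not).congr fun g => by
    rw [not_lt, not_lt]; exact ⟨fun h => le_antisymm h.2 h.1, fun h => ⟨h.ge, h.le⟩⟩

theorem le (h : TDfn C t) (h' : TDfn C t') : Dfn C fun g => t g ≤ t' g :=
  (lt h' h).not.congr fun _ => not_lt

theorem triv : Dfn C fun _ => True := (eq .zero .zero).congr fun _ => by simp

theorem false : Dfn C fun _ => False := triv.not.congr fun _ => by simp

theorem app {R : γ → Ordinal.{u} → Prop} (h : Dfn C.ext fun p => R p.1 p.2) (ht : TDfn C t) :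
    Dfn C fun g => R g (t g) := h.subst (Ext.refl.sub ht)

theorem app₂ {R : γ → Ordinal.{u} → Ordinal.{u} → Prop} (h : Dfn C.ext.ext fun p => R p.1.1 p.1.2 p.2)
    (ht : TDfn C t) (ht' : TDfn C t') : Dfn C fun g => R g (t g) (t' g) :=
  h.subst ((Ext.refl.sub ht).sub ht')

theorem mem (h : TDfn C t) (h' : SDfn C S) : Dfn C fun g => t g ∈ S g := app h' h

end Dfn

namespace SDfn

variable {S : γ → Set Ordinal.{u}}

theorem subst (h : SDfn C S) (E : Ext C C' π) : SDfn C' fun g => S (π g) := Dfn.subst h E.lift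

theorem w (h : SDfn C S) : SDfn C.ext fun p => S p.1 := h.subst .wk

theorem wS (h : SDfn C S) : SDfn C.extS fun p => S p.1 := h.subst .wkS

end SDfn

theorem SReg.sdfn {S : γ → Set Ordinal.{u}} (h : SReg C S) : SDfn C S :=
  Dfn.memReg .var (h.subst .wk)

/-! ### Recursion on ordinals with data -/

/-- The relation between stages `s` and data `y < Γ` that is defined by recursion on the stage. -/
def RecRel (Γ : Ordinal.{u}) (B : (Ordinal.{u} → Ordinal.{u} → Prop) → Ordinal.{u} → Ordinal.{u} → Prop)
    (s y : Ordinal.{u}) : Prop :=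
  B (fun s' y' => ∃ _ : s' < s, y' < Γ ∧ RecRel Γ B s' y') s y
termination_by s

theorem recRel_iff (Γ : Ordinal.{u})
    (B : (Ordinal.{u} → Ordinal.{u} → Prop) → Ordinal.{u} → Ordinal.{u} → Prop) (s y : Ordinal.{u}) :
    RecRel Γ B s y ↔ B (fun s' y' => s' < s ∧ y' < Γ ∧ RecRel Γ B s' y') s y := by
  rw [RecRel]
  simp only [exists_prop]

theorem mul_add_inj' {Γ s s' y y' : Ordinal.{u}} (hy : y < Γ) (hy' : y' < Γ)
    (h : Γ * s + y = Γ * s' + y') : s = s' ∧ y = y' := by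
  have h0 : Γ ≠ 0 := (pos_of_gt hy).ne'
  have h1 : s = s' := by
    rw [← add_zero s, ← div_eq_zero_of_lt hy, ← mul_add_div s h0, h, mul_add_div s' h0,
      div_eq_zero_of_lt hy', add_zero]
  subst h1
  exact ⟨rfl, add_left_cancel h⟩

theorem mul_add_lt' {Γ s s' y y' : Ordinal.{u}} (hy' : y' < Γ) (h : s' < s) :
    Γ * s' + y' < Γ * s + y :=
  calc Γ * s' + y' < Γ * s' + Γ := by gcongr
    _ = Γ * (s' + 1) := (mul_add_one _ _).symm
    _ ≤ Γ * s := by gcongr; exact Order.add_one_le_of_lt h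
    _ ≤ Γ * s + y := le_self_add

/-- The recursion on a single ordinal that corresponds to a recursion with data. -/
def recStep (Γ : Ordinal.{u})
    (B : (Ordinal.{u} → Ordinal.{u} → Prop) → Ordinal.{u} → Ordinal.{u} → Prop) (X : Set Ordinal.{u})
    (v : Ordinal.{u}) : Prop :=
  ∃ s < v + 1, ∃ y < Γ, v = Γ * s + y ∧ B (fun s' y' => s' < s ∧ y' < Γ ∧ Γ * s' + y' ∈ X) s y

/-- Stage `s` and datum `y < Γ` are coded as `Γ * s + y`. Codes at earlier stages are smaller
whatever their data, so the recursion on codes has all the earlier values at its disposal. -/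
theorem recMem_recStep (Γ : Ordinal.{u})
    (B : (Ordinal.{u} → Ordinal.{u} → Prop) → Ordinal.{u} → Ordinal.{u} → Prop) (s : Ordinal.{u}) :
    ∀ y < Γ, (RecMem (recStep Γ B) (Γ * s + y) ↔ RecRel Γ B s y) := by
  induction s using WellFoundedLT.induction with
  | ind s ih =>
    intro y hy
    rw [recMem_iff, recRel_iff]
    have key : (fun s' y' => s' < s ∧ y' < Γ ∧ Γ * s' + y' ∈ recSet (recStep Γ B) (Γ * s + y)) =
        fun s' y' => s' < s ∧ y' < Γ ∧ RecRel Γ B s' y' := by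
      funext s' y'
      refine propext (and_congr_right fun hs => and_congr_right fun hy' => ?_)
      rw [← ih s' hs y' hy']
      exact ⟨fun h => h.2, fun h => ⟨mul_add_lt' hy' hs, h⟩⟩
    constructor
    · rintro ⟨s₁, -, y₁, hy₁, h, hB⟩
      obtain ⟨rfl, rfl⟩ := mul_add_inj' hy hy₁ h
      rwa [key] at hB
    · intro hB
      refine ⟨s, Order.lt_add_one_iff.2 ?_, y, hy, rfl, by rwa [key]⟩
      exact (Ordinal.le_mul_right s (pos_of_gt hy)).trans le_self_add

/-- The body is required to be definable from an arbitrary definable relation `Q`. It is then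
applied to the `Q` that says that `Γ * s' + y'` is in the part of the set collected so far,
restricted to earlier stages and admissible data. -/
theorem Dfn.recRel {Γ s y : γ → Ordinal.{u}}
    {B : γ → (Ordinal.{u} → Ordinal.{u} → Prop) → Ordinal.{u} → Ordinal.{u} → Prop}
    (hΓ : TDfn C Γ) (hs : TDfn C s) (hy : TDfn C y)
    (hB : ∀ Q : (((γ × Set Ordinal.{u}) × Ordinal.{u}) × Ordinal.{u}) × Ordinal.{u} →
        Ordinal.{u} → Ordinal.{u} → Prop,
      Dfn C.extS.ext.ext.ext.ext.ext (fun p => Q p.1.1 p.1.2 p.2) →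
      Dfn C.extS.ext.ext.ext fun p => B p.1.1.1.1 (Q p) p.1.2 p.2) :
    Dfn C fun g => y g < Γ g ∧ RecRel (Γ g) (B g) (s g) (y g) := by
  have h1 : Dfn C fun g => Γ g * s g + y g ∈ recSet (recStep (Γ g) (B g)) (Γ g * s g + y g + 1) := by
    refine Dfn.recur (R := fun g X => Γ g * s g + y g ∈ X) ((hΓ.mul hs).add hy).succ ?_
      (.memReg ((hΓ.mul hs).add hy).wS .var)
    refine .ex TDfn.var.succ (.ex hΓ.wS.w.w (.and
      (.eq TDfn.var.w.w ((hΓ.wS.w.w.w.mul TDfn.var.w).add .var)) ?_))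
    exact hB (fun p s' y' => s' < p.1.2 ∧ y' < Γ p.1.1.1.1 ∧ Γ p.1.1.1.1 * s' + y' ∈ p.1.1.1.2)
      (.and (.lt TDfn.var.w TDfn.var.w.w.w) (.and (.lt .var hΓ.wS.w.w.w.w.w)
        (.memReg ((hΓ.wS.w.w.w.w.w.mul TDfn.var.w).add .var)
          ((((SReg.var.subst .wk).subst .wk).subst .wk).subst .wk |>.subst .wk))))
  refine ((Dfn.lt hy hΓ).and h1).congr fun g => and_congr_right fun hg => ?_
  rw [← recMem_recStep _ _ _ _ hg]
  exact ⟨fun h => h.2, fun h => ⟨Order.lt_add_one_iff.2 le_rfl, h⟩⟩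

end

section

/-! ### Programs for definable sets -/

/-- The registers of a program with a numeral, with `ω` in one more register. -/
def baseCtx : Ctx (Set Ordinal.{u} × Set Ordinal.{u} × ℕ) where
  x g := Function.update (initSt g.1 g.2.1 g.2.2).1 7 omega0
  A g := (initSt g.1 g.2.1 g.2.2).2
  V := {7, 0, 1, 3}
  d := 8
  e := 3
  hd := by omega
  he := by omega
  hV i hi := by
    simp only [mem_insert_iff, mem_singleton_iff] at hi
    omega
  w := 7
  hw := by simp
  hx g := by simp

theorem initSt_clean (x ρ : Set Ordinal.{u}) (N : ℕ) : (initSt x ρ N).Clean 4 := by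
  intro i hi
  obtain ⟨k, rfl⟩ := Nat.exists_eq_add_of_le' hi
  rfl

theorem initSt_empty (x ρ : Set Ordinal.{u}) (N : ℕ) : ∀ a, 2 ≤ a → (initSt x ρ N).2 a = ∅ := by
  intro i hi
  obtain ⟨k, rfl⟩ := Nat.exists_eq_add_of_le' hi
  rfl

/-- A formula about register 7 for which `ω` is the least solution. -/
def omegaPE : PE :=
  .and (.lt .zero (.var 7)) (.not (.ex (.var 7) (.not (.lt (.succ (.var 11)) (.var 7)))))

theorem omegaPE_sem (x : ℕ → Ordinal.{u}) (A : ℕ → Set Ordinal.{u}) (v : Ordinal.{u}) :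
    omegaPE.sem 8 3 (Function.update x 7 v) A ↔ 0 < v ∧ ∀ a < v, a + 1 < v := by
  simp [omegaPE, PE.sem, Tm.eval]

/-- No term denotes `ω`, but it is the least positive ordinal closed under successor, so it can be
found by a search. -/
theorem runs_omega (x ρ : Set Ordinal.{u}) (N : ℕ) :
    Runs (omegaPE.findC 4 3) (initSt x ρ N) (initSt x ρ N) ((initSt x ρ N).setX 7 omega0) := by
  refine PE.runs_findC omegaPE (V := {0, 1, 3}) (by omega) (by omega) ?_ ?_ _ (initSt_clean x ρ N)
    (fun a ha => initSt_empty x ρ N a (le_trans (by omega) ha)) omega0 ?_ (fun β hβ => ?_)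
  · intro i hi
    simp only [mem_insert_iff, mem_singleton_iff] at hi
    omega
  · simp [omegaPE, PE.Ok, Tm.Ok]
  · rw [omegaPE_sem]
    refine ⟨omega0_pos, fun a ha => ?_⟩
    rw [← Order.succ_eq_add_one]
    exact isSuccLimit_omega0.succ_lt ha
  · rw [omegaPE_sem]
    rintro ⟨h0, h1⟩
    obtain ⟨n, rfl⟩ := lt_omega0.1 hβ
    rcases n with _ | n
    · simp at h0
    · have := h1 n (by simp)
      simp at this

/-- The program searches for `ω`, then for the least `Γ` with `Q`, evaluates the bound, and collects
the solutions of `ψ` below it in set register 2, which is the output tape. -/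
theorem exists_lines {Q : Set Ordinal.{u} × Set Ordinal.{u} × ℕ → Ordinal.{u} → Prop}
    {b : Set Ordinal.{u} × Set Ordinal.{u} × ℕ → Ordinal.{u} → Ordinal.{u}}
    {ψ : Set Ordinal.{u} × Set Ordinal.{u} × ℕ → Ordinal.{u} → Ordinal.{u} → Prop}
    (hQ : Dfn baseCtx.ext fun p => Q p.1 p.2) (hb : TDfn baseCtx.ext fun p => b p.1 p.2)
    (hψ : Dfn baseCtx.ext.ext fun p => ψ p.1.1 p.1.2 p.2) :
    ∃ K : Program, ∀ (x ρ : Set Ordinal.{u}) (N : ℕ), BddAbove x → BddAbove ρ →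
      (∃ Γ, Q (x, ρ, N) Γ) → ∃ Γ, Q (x, ρ, N) Γ ∧
        (withNumeral K N).Outputs x ρ {v | v < b (x, ρ, N) Γ ∧ ψ (x, ρ, N) Γ v} := by
  classical
  obtain ⟨φ, hφ, hφ'⟩ := hQ _ _ _ .refl
  obtain ⟨t, ht, ht'⟩ := hb
  obtain ⟨θ, hθ, hθ'⟩ := hψ _ _ _ .refl
  refine ⟨mainLines (.seq (omegaPE.findC 4 3) (.seq (φ.findC 8 3) (.seq (t.comp 13)
    (.forC 14 13 (.seq (θ.comp 16 3) (.ite (2 * (14 + 2) + 1) (.seq (.clear (14 + 2))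
      (.putMem (14 + 1) 2 true)) .skip)))))), fun x ρ N hx hρ hex => ?_⟩
  obtain ⟨Γ, hΓ, hmin⟩ : ∃ Γ, Q (x, ρ, N) Γ ∧ ∀ β < Γ, ¬ Q (x, ρ, N) β :=
    ⟨_, WellFounded.min_mem wellFounded_lt {Γ | Q (x, ρ, N) Γ} hex,
      fun β hβ h => WellFounded.not_lt_min wellFounded_lt {Γ | Q (x, ρ, N) Γ} h hβ⟩
  refine ⟨Γ, hΓ, ?_⟩
  set g : Set Ordinal.{u} × Set Ordinal.{u} × ℕ := (x, ρ, N)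
  set s₀ := initSt x ρ N
  set s₁ := s₀.setX 7 omega0 with hs₁
  have c0 : s₀.Clean 4 := initSt_clean x ρ N
  have c1 : s₁.Clean 8 := (c0.mono (by omega)).setX (by omega)
  have l1 : s₀ ≤ s₁ := c0.le (by omega)
  have V1 : ∀ i ∈ baseCtx.{u}.V, i < 8 ∧ i ≠ 2 := baseCtx.{u}.hV
  have r1 : Runs (φ.findC 8 3) s₁ s₁ (s₁.setX 11 Γ) := by
    refine PE.runs_findC φ (V := baseCtx.{u}.V) (d := 8) (e := 3) (by omega) (by omega) V1 hφ _ c1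
      (fun a (ha : 3 ≤ a) => initSt_empty x ρ N a (by omega)) Γ ((hφ' (g, Γ)).2 hΓ)
      (fun β hβ h => hmin β hβ ((hφ' (g, β)).1 h))
  set s₂ := s₁.setX 11 Γ with hs₂
  have c2 : s₂.Clean 12 := (c1.mono (by omega)).setX (by omega)
  have l2 : s₀ ≤ s₂ := l1.trans (c1.le (by omega))
  have V2 : ∀ i ∈ baseCtx.{u}.ext.V, i < 12 ∧ i ≠ 2 := baseCtx.{u}.ext.hV
  have r2 := t.runs 13 (by omega) (fun i hi => ⟨(V2 i hi).1.trans (by omega), (V2 i hi).2⟩) ht s₂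
    (c2.mono (by omega))
  have e2 : t.eval s₂.1 = b g Γ := ht' (g, Γ)
  rw [e2] at r2
  set s₃ := s₂.setX 13 (b g Γ) with hs₃
  have c3 : s₃.Clean 14 := (c2.mono (by omega)).setX (by omega)
  have l3 : s₀ ≤ s₃ := l2.trans (c2.le (by omega))
  have V3 : ∀ i ∈ baseCtx.{u}.ext.ext.V, i < 16 ∧ i ≠ 2 := baseCtx.{u}.ext.ext.hV
  have r3 := Runs.collect (s := s₃) (d := 14) (j := 13) (e := 2) (c := θ.comp 16 3) (by omega)
    (by omega) (by omega) c3 (initSt_empty x ρ N 2 le_rfl) (fun _ v => ψ g Γ v) (fun p _ => by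
      intro t'
      have hc : t'.Clean (14 + 2) := St.Clean.stage (s := s₃.setA 2 _) c3
      have h1 := PE.runs θ (d := 16) (e := 3) (by omega) (by omega) V3 hθ t' hc (fun a (ha : 3 ≤ a) => by
        rw [show t'.2 = Function.update s₃.2 2 _ from rfl, Function.update_of_ne (by omega)]
        exact initSt_empty x ρ N a (by omega))
      have ec : θ.sem 16 3 t'.1 t'.2 ↔ ψ g Γ p := by
        -- During the collection register 2 already contains a part of the output; this does not
        -- influence `θ`.
        refine Iff.trans (PE.sem_congr θ hθ (by decide) (fun i hi => ?_) (fun a _ ha2 => ?_)) (hθ' ((g, Γ), p))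
        · simp only [t', St.stage, St.setX_apply, St.setA_fst, hs₃, hs₂, hs₁, Ctx.ext, baseCtx,
            Function.update_apply]
          have h13 : i ≠ 13 ∧ i ≠ 14 := by
            simp only [Ctx.ext, baseCtx, mem_insert_iff, mem_singleton_iff] at hi
            omega
          simp only [h13.1, h13.2, if_false]
          rfl
        · rw [show t'.2 = Function.update s₃.2 2 _ from rfl, Function.update_of_ne ha2]
          rfl
      simp only [ec] at h1
      exact h1)
  rw [St.setX_same] at r3
  have := withNumeral_outputs hx hρ ((runs_omega x ρ N).seq ((r1.mono l1).seq ((r2.mono l2).seq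
    (r3.mono l3))))
  rw [St.setA_same] at this
  convert this using 1
  ext v
  simp only [recSet, recMem_iff]

/-- A relation between sets `y`, `w`, `z` of ordinals, and ordinals `n`, `Γ` that is definable in every
context in which they are definable. -/
def UDfn (R : Set Ordinal.{u} → Set Ordinal.{u} → Set Ordinal.{u} → Ordinal.{u} → Ordinal.{u} → Prop) :
    Prop :=
  ∀ (γ : Type (u + 1)) (C : Ctx γ) (Y W Z : γ → Set Ordinal.{u}) (n Γ : γ → Ordinal.{u}),
    SDfn C Y → SDfn C W → SDfn C Z → TDfn C n → TDfn C Γ →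
      Dfn C fun g => R (Y g) (W g) (Z g) (n g) (Γ g)

theorem mem_join_even {x y : Set Ordinal.{u}} {v : Ordinal.{u}} : 2 * v ∈ join x y ↔ v ∈ x := by
  constructor
  · rintro (⟨w, hw, h⟩ | ⟨w, hw, h⟩)
    · have := mul_add_inj' (Γ := 2) (y := 0) (y' := 0) (s := w) (s' := v) (by simp) (by simp)
        (by simpa using h)
      exact this.1 ▸ hw
    · have := mul_add_inj' (Γ := 2) (y := 1) (y' := 0) (s := w) (s' := v) (by simp) (by simp)
        (by simpa using h)
      simp at this
  · exact fun h => Or.inl ⟨v, h, rfl⟩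

theorem mem_join_odd {x y : Set Ordinal.{u}} {v : Ordinal.{u}} : 2 * v + 1 ∈ join x y ↔ v ∈ y := by
  constructor
  · rintro (⟨w, hw, h⟩ | ⟨w, hw, h⟩)
    · have := mul_add_inj' (Γ := 2) (y := 0) (y' := 1) (s := w) (s' := v) (by simp) (by simp)
        (by simpa using h)
      simp at this
    · have := mul_add_inj' (Γ := 2) (y := 1) (y' := 1) (s := w) (s' := v) (by simp) (by simp)
        (by simpa using h)
      exact this.1 ▸ hw
  · exact fun h => Or.inr ⟨v, h, rfl⟩

theorem join_fst (x y : Set Ordinal.{u}) : {v | 2 * v ∈ join x y} = x := by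
  ext v; exact mem_join_even

theorem join_snd (x y : Set Ordinal.{u}) : {v | 2 * v + 1 ∈ join x y} = y := by
  ext v; exact mem_join_odd

theorem even_or_odd (v : Ordinal.{u}) : ∃ w ≤ v, v = 2 * w ∨ v = 2 * w + 1 := by
  refine ⟨v / 2, (Ordinal.le_mul_right _ (by simp)).trans (Ordinal.mul_div_le v 2), ?_⟩
  have h := div_add_mod v 2
  have h2 : v % 2 < 2 := mod_lt v two_ne_zero
  have h2' : v % 2 = 0 ∨ v % 2 = 1 := by
    rw [← Order.le_one_iff, ← Order.lt_add_one_iff, one_add_one_eq_two]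
    exact h2
  rcases h2' with h' | h'
  · left; rw [h', add_zero] at h; exact h.symm
  · right; rw [h'] at h; exact h.symm

theorem join_eq_self (x : Set Ordinal.{u}) : join {v | 2 * v ∈ x} {v | 2 * v + 1 ∈ x} = x := by
  ext v
  obtain ⟨w, -, rfl | rfl⟩ := even_or_odd v
  · exact mem_join_even
  · exact mem_join_odd

theorem bddAbove_join {x y : Set Ordinal.{u}} (hx : BddAbove x) (hy : BddAbove y) :
    BddAbove (join x y) := by
  obtain ⟨b, hb⟩ := hx
  obtain ⟨c, hc⟩ := hy
  refine ⟨max (2 * b) (2 * c + 1), ?_⟩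
  rintro _ (⟨w, hw, rfl⟩ | ⟨w, hw, rfl⟩)
  · exact le_max_of_le_left (by dsimp only; gcongr; exact hb hw)
  · exact le_max_of_le_right (by dsimp only; gcongr; exact hc hw)

theorem bddAbove_fst {x : Set Ordinal.{u}} (h : BddAbove x) : BddAbove {v | 2 * v ∈ x} := by
  obtain ⟨b, hb⟩ := h
  exact ⟨b, fun v hv => (Ordinal.le_mul_right v (by simp)).trans (hb hv)⟩

theorem bddAbove_snd {x : Set Ordinal.{u}} (h : BddAbove x) : BddAbove {v | 2 * v + 1 ∈ x} := by
  obtain ⟨b, hb⟩ := h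
  exact ⟨b, fun v hv => ((Ordinal.le_mul_right v (by simp)).trans le_self_add).trans (hb hv)⟩

namespace Base

theorem x0 : TDfn baseCtx.{u} fun g => endOf g.1 := ⟨.var 0, by simp [baseCtx, Tm.Ok], fun _ => rfl⟩
theorem x1 : TDfn baseCtx.{u} fun g => endOf g.2.1 := ⟨.var 1, by simp [baseCtx, Tm.Ok], fun _ => rfl⟩
theorem x3 : TDfn baseCtx.{u} fun g => (g.2.2 : Ordinal.{u}) + 1 :=
  ⟨.var 3, by simp [baseCtx, Tm.Ok], fun _ => rfl⟩
theorem A0 : SDfn baseCtx.{u} fun g => g.1 :=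
  SReg.sdfn ⟨0, by simp [baseCtx], by omega, fun _ => rfl⟩
theorem A1 : SDfn baseCtx.{u} fun g => g.2.1 :=
  SReg.sdfn ⟨1, by simp [baseCtx], by omega, fun _ => rfl⟩

end Base

theorem SDfn.of {γ : Type (u + 1)} {C : Ctx γ} {S : γ → Set Ordinal.{u}}
    (h : Dfn C.ext fun p => p.2 ∈ S p.1) : SDfn C S := h

theorem SDfn.fst {γ : Type (u + 1)} {C : Ctx γ} {S : γ → Set Ordinal.{u}} (h : SDfn C S) :
    SDfn C fun g => {v | 2 * v ∈ S g} :=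
  .of (Dfn.mem (S := fun p : γ × Ordinal.{u} => S p.1) (TDfn.two.mul .var) h.w)

theorem SDfn.snd {γ : Type (u + 1)} {C : Ctx γ} {S : γ → Set Ordinal.{u}} (h : SDfn C S) :
    SDfn C fun g => {v | 2 * v + 1 ∈ S g} :=
  .of (Dfn.mem (S := fun p : γ × Ordinal.{u} => S p.1) (TDfn.two.mul .var).succ h.w)

/-- The given sets are bounded by `Γ`. -/
def Below (Γ : Ordinal.{u}) (x : Set Ordinal.{u}) : Prop := ∀ v ∈ x, v < Γ

/-- `Q` certifies that `Γ` is large enough. Since it holds for arbitrarily large `Γ`, the search may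
in addition ask that `Γ` exceeds the marked ends of `y` and `ρ`. The second assumption says that the
result does not depend on which certified `Γ` is found. -/
theorem exists_computes
    {Q : Set Ordinal.{u} → Set Ordinal.{u} → Set Ordinal.{u} → Ordinal.{u} → Ordinal.{u} → Prop}
    {ψ : Ordinal.{u} → Set Ordinal.{u} → Set Ordinal.{u} → Ordinal.{u} → Ordinal.{u} → Prop}
    (hQ : UDfn Q) (hψ : ∀ (γ : Type (u + 1)) (C : Ctx γ) (Y Z : γ → Set Ordinal.{u})
      (n Γ v : γ → Ordinal.{u}), SDfn C Y → SDfn C Z → TDfn C n → TDfn C Γ → TDfn C v →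
      Dfn C fun g => ψ (v g) (Y g) (Z g) (n g) (Γ g)) :
    ∃ K : Program, ∀ (y ρ r : Set Ordinal.{u}) (N : ℕ), BddAbove y → BddAbove ρ →
      (∀ β, ∃ Γ > β, Q y ∅ ρ N Γ) →
      (∀ Γ, Below Γ y → Below Γ ρ → Q y ∅ ρ N Γ → ∀ v, v ∈ r ↔ v < Γ ∧ ψ v y ρ N Γ) →
      (withNumeral K N).Outputs y ρ r := by
  have E : Ext baseCtx.{u} baseCtx.ext.ext fun p => p.1.1 := Ext.wk.trans .wk
  have S0 : ∀ {γ : Type (u + 1)} {C : Ctx γ}, SDfn C fun _ => (∅ : Set Ordinal.{u}) :=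
    Dfn.false.congr fun p => by simp
  obtain ⟨K, hK⟩ := exists_lines
    (Q := fun g Γ => (endOf g.1 < Γ ∧ endOf g.2.1 < Γ) ∧ Q g.1 ∅ g.2.1 g.2.2 Γ) (b := fun _ Γ => Γ)
    (ψ := fun g Γ v => ψ v g.1 g.2.1 g.2.2 Γ)
    (.and (.and (.lt Base.x0.w .var) (.lt Base.x1.w .var)) (by
      -- Register 3 contains `N + 1`. The numeral is recovered as the `n` with `N + 1 = n + 1`.
      let R : Ordinal.{u} → Set Ordinal.{u} × Set Ordinal.{u} × ℕ → Ordinal.{u} → Prop :=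
        fun Γ g n => Q g.1 ∅ g.2.1 n Γ
      refine (Dfn.ex (R := fun p n => (p.1.2.2 : Ordinal.{u}) + 1 = n + 1 ∧ R p.2 p.1 n)
        Base.x3.w (.and (.eq Base.x3.w.w TDfn.var.succ)
          (hQ _ _ _ _ _ _ _ Base.A0.w.w S0 Base.A1.w.w .var TDfn.var.w))).congr fun p => ?_
      constructor
      · rintro ⟨n, -, hn, h⟩
        rwa [← Order.add_one_inj.1 hn] at h
      · exact fun h => ⟨_, Order.lt_add_one_iff.2 le_rfl, rfl, h⟩))
    .var (by
      refine (Dfn.ex (R := fun p n => (p.1.1.2.2 : Ordinal.{u}) + 1 = n + 1 ∧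
          ψ p.2 p.1.1.1 p.1.1.2.1 n p.1.2)
        Base.x3.w.w (.and (.eq Base.x3.w.w.w TDfn.var.succ)
          (hψ _ _ _ _ _ _ _ Base.A0.w.w.w Base.A1.w.w.w .var TDfn.var.w.w TDfn.var.w))).congr
          fun p => ?_
      constructor
      · rintro ⟨n, -, hn, h⟩
        rwa [← Order.add_one_inj.1 hn] at h
      · exact fun h => ⟨_, Order.lt_add_one_iff.2 le_rfl, rfl, h⟩)
  refine ⟨K, fun y ρ r N hy hρ hex hr => ?_⟩
  obtain ⟨Γ, ⟨⟨h1, h2⟩, h3⟩, h4⟩ := hK y ρ N hy hρ (by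
    obtain ⟨Γ, hΓ, h⟩ := hex (max (endOf y) (endOf ρ))
    exact ⟨Γ, ⟨(le_max_left _ _).trans_lt hΓ, (le_max_right _ _).trans_lt hΓ⟩, h⟩)
  have := hr Γ (fun v hv => (lt_endOf hy hv).trans h1) (fun v hv => (lt_endOf hρ hv).trans h2) h3
  rwa [show r = {v | v < Γ ∧ ψ v y ρ N Γ} from Set.ext this]

open Classical in
-- A decision is the computation of a subset of `{0}`: the output consists of the `v` with `v = 0`
-- for which the condition holds, and it is `1` or `0` as an ordinal.
theorem exists_decides
    {Q A : Set Ordinal.{u} → Set Ordinal.{u} → Set Ordinal.{u} → Ordinal.{u} → Ordinal.{u} → Prop}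
    (hQ : UDfn Q) (hA : UDfn A) :
    ∃ K : Program, ∀ (y w ρ : Set Ordinal.{u}) (N : ℕ) (a : Prop), BddAbove y → BddAbove w →
      BddAbove ρ → (∀ β, ∃ Γ > β, Q y w ρ N Γ) →
      (∀ Γ, Below Γ y → Below Γ w → Below Γ ρ → Q y w ρ N Γ → (A y w ρ N Γ ↔ a)) →
      (withNumeral K N).Outputs (join y w) ρ (ofOrd (if a then 1 else 0)) := by
  obtain ⟨K, hK⟩ := exists_computes
    (Q := fun x _ ρ n Γ => 1 < Γ ∧ Q {v | 2 * v ∈ x} {v | 2 * v + 1 ∈ x} ρ n Γ)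
    (ψ := fun v x ρ n Γ => v = 0 ∧ A {v | 2 * v ∈ x} {v | 2 * v + 1 ∈ x} ρ n Γ)
    (fun _ _ _ _ _ _ _ hY _ hZ hn hΓ => .and (.lt .one hΓ) (hQ _ _ _ _ _ _ _ hY.fst hY.snd hZ hn hΓ))
    (fun _ _ _ _ _ _ _ hY hZ hn hΓ hv => .and (.eq hv .zero) (hA _ _ _ _ _ _ _ hY.fst hY.snd hZ hn hΓ))
  refine ⟨K, fun y w ρ N a hy hw hρ hex h => ?_⟩
  refine hK _ _ _ _ (bddAbove_join hy hw) hρ (fun β => ?_) (fun Γ h1 h2 h3 v => ?_)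
  · obtain ⟨Γ, hΓ, h⟩ := hex (max β 1)
    refine ⟨Γ, (le_max_left _ _).trans_lt hΓ, (le_max_right _ _).trans_lt hΓ, ?_⟩
    rwa [join_fst, join_snd]
  · rw [join_fst, join_snd] at h3 ⊢
    rw [h Γ (fun v hv => ?_) (fun v hv => ?_) h2 h3.2]
    · by_cases ha : a
      · simp only [ha, if_true, ofOrd, mem_Iio, and_true]
        constructor
        · intro hv
          obtain rfl : v = 0 := by simpa using hv
          exact ⟨zero_lt_one.trans h3.1, rfl⟩
        · rintro ⟨-, rfl⟩; exact zero_lt_one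
      · simp [ha, ofOrd]
    · exact (Ordinal.le_mul_right v (by simp)).trans_lt (h1 _ (mem_join_even.2 hv))
    · exact ((Ordinal.le_mul_right v (by simp)).trans le_self_add).trans_lt (h1 _ (mem_join_odd.2 hv))

/-- For each mode there is a program that gives access to a definable set. -/
theorem exists_obtains (m : Mode)
    {Q : Set Ordinal.{u} → Set Ordinal.{u} → Ordinal.{u} → Ordinal.{u} → Prop}
    {ψ : Ordinal.{u} → Set Ordinal.{u} → Set Ordinal.{u} → Ordinal.{u} → Ordinal.{u} → Prop}
    (hQ : UDfn fun y _ => Q y) (hψ : ∀ (γ : Type (u + 1)) (C : Ctx γ) (Y Z : γ → Set Ordinal.{u})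
      (n Γ v : γ → Ordinal.{u}), SDfn C Y → SDfn C Z → TDfn C n → TDfn C Γ → TDfn C v →
      Dfn C fun g => ψ (v g) (Y g) (Z g) (n g) (Γ g)) :
    ∃ K : Program, ∀ (y ρ r : Set Ordinal.{u}) (N : ℕ), BddAbove y → BddAbove ρ → BddAbove r →
      (∀ β, ∃ Γ > β, Q y ρ N Γ) →
      (∀ Γ, Below Γ y → Below Γ ρ → Q y ρ N Γ → ∀ v, v ∈ r ↔ v < Γ ∧ ψ v y ρ N Γ) →
      m.Obtains (withNumeral K N) y ρ r := by
  cases m with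
  | computation =>
    obtain ⟨K, hK⟩ := exists_computes hQ hψ
    exact ⟨K, fun y ρ r N hy hρ _ hex h => hK y ρ r N hy hρ hex h⟩
  | recognition =>
    obtain ⟨K, hK⟩ := exists_decides (Q := fun y _ => Q y)
      (A := fun y w ρ n Γ => ∀ v < 2 * Γ, (v ∈ w ↔ ∃ v' < v + 1, v = 2 * v' ∧ v' < Γ ∧ ψ v' y ρ n Γ))
      hQ (fun _ _ _ _ _ _ _ hY hW hZ hn hΓ => .all (TDfn.two.mul hΓ) (.iff (.mem .var hW.w)
        (.ex TDfn.var.succ (.and (.eq TDfn.var.w (TDfn.two.mul .var)) (.and (.lt .var hΓ.w.w)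
          (hψ _ _ _ _ _ _ _ hY.w.w hZ.w.w hn.w.w hΓ.w.w .var))))))
    -- A definable set needs no auxiliary information in order to be recognized, so the second
    -- component of the recognized set is empty.
    refine ⟨K, fun y ρ r N hy hρ hr hex h => ⟨join r ∅, ⟨bddAbove_join hr (by simp), fun w hw => ?_⟩,
      (join_fst r ∅).symm⟩⟩
    refine hK y w ρ N _ hy hw hρ hex fun Γ h1 h2 h3 h4 => ?_
    have key : ∀ v, (∃ v' < v + 1, v = 2 * v' ∧ v' < Γ ∧ ψ v' y ρ N Γ) ↔ v ∈ join r ∅ := by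
      intro v
      constructor
      · rintro ⟨v', -, rfl, h5⟩
        exact mem_join_even.2 ((h Γ h1 h3 h4 v').2 h5)
      · rintro (⟨v', h5, rfl⟩ | ⟨v', h5, -⟩)
        · exact ⟨v', Order.lt_add_one_iff.2 (Ordinal.le_mul_right v' (by simp)), rfl,
            (h Γ h1 h3 h4 v').1 h5⟩
        · exact absurd h5 (notMem_empty _)
    simp only [key]
    constructor
    · intro h5
      ext v
      -- Only membership below `2 * Γ` is compared. Above it neither set has elements, because `w`
      -- and `r` are bounded by `Γ`.
      by_cases hv : v < 2 * Γ
      · exact h5 v hv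
      · refine iff_of_false (fun hv' => hv ((h2 v hv').trans_le (Ordinal.le_mul_right Γ (by simp)))) ?_
        rintro (⟨v', h6, rfl⟩ | ⟨v', h6, -⟩)
        · exact hv (mul_lt_mul_of_pos_left ((h Γ h1 h3 h4 v').1 h6).1 (by simp))
        · exact absurd h6 (notMem_empty _)
    · rintro rfl v _
      rfl

end

section

/-! ### Primitive recursive functions -/

theorem pairBase_natCast (n : ℕ) : pairBase (n : Ordinal.{u}) = (n * n : ℕ) := by
  induction n with
  | zero => simp
  | succ n ih =>
    rw [Nat.cast_succ, pairBase_succ, ih]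
    norm_cast
    ring

/-- On natural numbers the ordinal pairing function is the one on which `Nat.Primrec` and the Gödel
numbering are based, so both can be handled by terms. -/
theorem opair_natCast (a b : ℕ) : opair (a : Ordinal.{u}) b = (Nat.pair a b : ℕ) := by
  unfold opair Nat.pair
  simp only [Nat.cast_lt, pairBase_natCast]
  split_ifs <;> norm_cast

theorem exists_lt_omega {P : Ordinal.{u} → Prop} : (∃ a < omega0, P a) ↔ ∃ n : ℕ, P n := by
  constructor
  · rintro ⟨a, ha, h⟩
    obtain ⟨n, rfl⟩ := lt_omega0.1 ha
    exact ⟨n, h⟩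
  · rintro ⟨n, h⟩
    exact ⟨n, natCast_lt_omega0 n, h⟩

/-- The graph of a function on the natural numbers. -/
def NatGraph (f : ℕ → ℕ) (a b : Ordinal.{u}) : Prop := ∃ n : ℕ, a = n ∧ b = f n

theorem natGraph_natCast {f : ℕ → ℕ} {n : ℕ} {b : Ordinal.{u}} : NatGraph f n b ↔ b = f n := by
  constructor
  · rintro ⟨m, h, h'⟩
    rwa [Nat.cast_inj.1 h]
  · exact fun h => ⟨n, rfl, h⟩

/-- Programs have to compute with Gödel numbers of formulas and programs. All such manipulations are
primitive recursive, and this lemma makes them available at once. -/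
theorem Dfn.natGraph {f : ℕ → ℕ} (hf : Nat.Primrec f) : ∀ {γ : Type (u + 1)} {C : Ctx γ}
    {t t' : γ → Ordinal.{u}}, TDfn C t → TDfn C t' → Dfn C fun g => NatGraph f (t g) (t' g) := by
  induction hf with
  | zero =>
    intro γ C t t' h h'
    refine ((Dfn.lt h .omega).and (.eq h' .zero)).congr fun g => ?_
    simp only [NatGraph, lt_omega0]
    exact ⟨fun ⟨⟨n, h⟩, h'⟩ => ⟨n, h, by simpa using h'⟩, fun ⟨n, h, h'⟩ => ⟨⟨n, h⟩, by simpa using h'⟩⟩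
  | succ =>
    intro γ C t t' h h'
    refine ((Dfn.lt h .omega).and (.eq h' h.succ)).congr fun g => ?_
    simp only [NatGraph, lt_omega0]
    exact ⟨fun ⟨⟨n, h⟩, h'⟩ => ⟨n, h, by simpa [h] using h'⟩,
      fun ⟨n, h, h'⟩ => ⟨⟨n, h⟩, by simpa [h] using h'⟩⟩
  | left =>
    intro γ C t t' h h'
    refine (Dfn.ex (R := fun g a => ∃ b < omega0, t g = opair a b ∧ t' g = a) .omega
      (.ex .omega (.and (.eq h.w.w (TDfn.var.w.pair .var)) (.eq h'.w.w TDfn.var.w)))).congr fun g => ?_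
    simp only [exists_lt_omega, opair_natCast]
    constructor
    · rintro ⟨n, m, h1, h2⟩
      exact ⟨_, h1, by simp [h2]⟩
    · rintro ⟨n, h1, h2⟩
      exact ⟨n.unpair.1, n.unpair.2, by simp [h1], h2⟩
  | right =>
    intro γ C t t' h h'
    refine (Dfn.ex (R := fun g a => ∃ b < omega0, t g = opair a b ∧ t' g = b) .omega
      (.ex .omega (.and (.eq h.w.w (TDfn.var.w.pair .var)) (.eq h'.w.w TDfn.var)))).congr fun g => ?_
    simp only [exists_lt_omega, opair_natCast]
    constructor
    · rintro ⟨n, m, h1, h2⟩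
      exact ⟨_, h1, by simp [h2]⟩
    · rintro ⟨n, h1, h2⟩
      exact ⟨n.unpair.1, n.unpair.2, by simp [h1], h2⟩
  | @pair f f' _ _ ih ih' =>
    intro γ C t t' h h'
    refine (Dfn.ex (R := fun g a => ∃ b < omega0, NatGraph f (t g) a ∧ NatGraph f' (t g) b ∧
      t' g = opair a b) .omega (.ex .omega (.and (ih h.w.w TDfn.var.w) (.and (ih' h.w.w .var)
        (.eq h'.w.w (TDfn.var.w.pair .var)))))).congr fun g => ?_
    simp only [exists_lt_omega, opair_natCast]
    constructor
    · rintro ⟨a, b, ⟨n, h1, h2⟩, h3, h4⟩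
      rw [h1, natGraph_natCast] at h3
      rw [Nat.cast_inj] at h2 h3
      exact ⟨n, h1, by rw [h4, h2, h3]⟩
    · rintro ⟨n, h1, h2⟩
      exact ⟨f n, f' n, ⟨n, h1, rfl⟩, ⟨n, h1, rfl⟩, h2⟩
  | @comp f f' _ _ ih ih' =>
    intro γ C t t' h h'
    refine (Dfn.ex (R := fun g a => NatGraph f' (t g) a ∧ NatGraph f a (t' g)) .omega
      (.and (ih' h.w .var) (ih .var h'.w))).congr fun g => ?_
    simp only [exists_lt_omega]
    constructor
    · rintro ⟨a, ⟨n, h1, h2⟩, h3⟩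
      rw [natGraph_natCast] at h3
      rw [Nat.cast_inj] at h2
      exact ⟨n, h1, by rw [h3, h2]⟩
    · rintro ⟨n, h1, h2⟩
      exact ⟨f' n, ⟨n, h1, rfl⟩, ⟨_, rfl, h2⟩⟩
  | @prec f f' _ _ ih ih' =>
    intro γ C t t' h h'
    -- Primitive recursion with parameter `z`: the recursion variable is the stage, and the value is
    -- the datum.
    let B : Ordinal.{u} → (Ordinal.{u} → Ordinal.{u} → Prop) → Ordinal.{u} → Ordinal.{u} → Prop :=
      fun z Q s y => (s = 0 ∧ NatGraph f z y) ∨ ∃ s' < s, s = s' + 1 ∧ ∃ y' < omega0, Q s' y' ∧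
        NatGraph f' (opair z (opair s' y')) y
    refine (Dfn.ex (R := fun g z => ∃ n < omega0, t g = opair z n ∧ (t' g < omega0 ∧
      RecRel omega0 (B z) n (t' g))) .omega (.ex .omega (.and (.eq h.w.w (TDfn.var.w.pair .var))
        (.recRel .omega .var h'.w.w (B := fun p => B p.1.2) fun Q hQ => .or (.and (.eq TDfn.var.w .zero)
          (ih TDfn.var.w.wS.w.w.w .var)) (.ex TDfn.var.w (.and (.eq TDfn.var.w.w TDfn.var.succ)
            (.ex .omega (.and (.app₂ (hQ.subst (Ext.wk.trans .wk).lift.lift) TDfn.var.w .var)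
              (ih' (.pair TDfn.var.w.wS.w.w.w.w.w (.pair TDfn.var.w .var)) TDfn.var.w.w))))))))).congr
                fun g => ?_
    simp only [exists_lt_omega, opair_natCast]
    have key : ∀ (z n : ℕ) (y : Ordinal.{u}), RecRel omega0 (B z) n y ↔
        y = (Nat.rec (f z) (fun y IH => f' (Nat.pair z (Nat.pair y IH))) n : ℕ) := by
      intro z n
      induction n with
      | zero =>
        intro y
        rw [recRel_iff]
        simp [B, natGraph_natCast]
      | succ n ihn =>
        intro y
        rw [recRel_iff]
        simp only [B]
        constructor
        · rintro (⟨h1, -⟩ | ⟨s', h1, h2, y', h3, ⟨-, -, h4⟩, h5⟩)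
          · simp at h1
          · rw [Nat.cast_succ, Order.add_one_inj] at h2
            subst h2
            rw [ihn] at h4
            rw [h4, opair_natCast, opair_natCast, natGraph_natCast] at h5
            exact h5
        · rintro rfl
          refine Or.inr ⟨n, by simp, by simp, _, natCast_lt_omega0 _, ⟨by simp, natCast_lt_omega0 _,
            (ihn _).2 rfl⟩, ?_⟩
          rw [opair_natCast, opair_natCast, natGraph_natCast]
    constructor
    · rintro ⟨z, n, h1, -, h2⟩
      rw [key] at h2
      exact ⟨_, h1, by rw [h2]; simp [Nat.unpaired]⟩
    · rintro ⟨n, h1, h2⟩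
      refine ⟨n.unpair.1, n.unpair.2, by simp [h1], by rw [h2]; exact natCast_lt_omega0 _, ?_⟩
      rw [key, h2]

end

section

/-! ### Sets represented by pointers -/

theorem le_pairBase (a : Ordinal.{u}) : a ≤ pairBase a := pairBase_strictMono.le_apply

theorem left_le_opair (a b : Ordinal.{u}) : a ≤ opair a b := by
  unfold opair
  split_ifs with h
  · exact h.le.trans ((le_pairBase b).trans le_self_add)
  · exact ((le_pairBase a).trans le_self_add).trans le_self_add

theorem right_le_opair (a b : Ordinal.{u}) : b ≤ opair a b := by
  unfold opair
  split_ifs with h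
  · exact (le_pairBase b).trans le_self_add
  · exact (not_lt.1 h).trans (((le_pairBase a).trans le_self_add).trans le_self_add)

theorem pairBase_max_le_opair (a b : Ordinal.{u}) : pairBase (max a b) ≤ opair a b := by
  unfold opair
  split_ifs with h
  · rw [max_eq_right h.le]; exact le_self_add
  · rw [max_eq_left (not_lt.1 h), add_assoc]; exact le_self_add

theorem opair_lt_pairBase (a b : Ordinal.{u}) : opair a b < pairBase (max a b + 1) := by
  rw [pairBase_succ, Order.lt_add_one_iff]
  unfold opair
  split_ifs with h
  · rw [max_eq_right h.le]
    exact (add_le_add_right h.le _).trans le_self_add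
  · rw [max_eq_left (not_lt.1 h)]
    exact add_le_add_right (not_lt.1 h) _

/-- The pairs with maximum `μ` get values from `pairBase μ` up to, but excluding, `pairBase (μ +
1)`. So the value determines the maximum. The remainder is below `μ` exactly if the first component
is smaller than the second, and left cancellation does the rest. -/
theorem opair_inj {a b a' b' : Ordinal.{u}} : opair a b = opair a' b' ↔ a = a' ∧ b = b' := by
  refine ⟨fun h => ?_, by rintro ⟨rfl, rfl⟩; rfl⟩
  have hm : max a b = max a' b' := by
    refine le_antisymm ?_ ?_
    · refine Order.lt_add_one_iff.1 (pairBase_strictMono.lt_iff_lt.1 ?_)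
      exact (pairBase_max_le_opair a b).trans_lt (h ▸ opair_lt_pairBase a' b')
    · refine Order.lt_add_one_iff.1 (pairBase_strictMono.lt_iff_lt.1 ?_)
      exact (pairBase_max_le_opair a' b').trans_lt (h ▸ opair_lt_pairBase a b)
  unfold opair at h
  split_ifs at h with h1 h2 h2
  · rw [max_eq_right h1.le, max_eq_right h2.le] at hm
    subst hm
    exact ⟨add_left_cancel h, rfl⟩
  · rw [max_eq_right h1.le, max_eq_left (not_lt.1 h2)] at hm
    subst hm
    rw [add_assoc] at h
    have := add_left_cancel h
    exact absurd (this ▸ h1) (not_lt.2 le_self_add)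
  · rw [max_eq_left (not_lt.1 h1), max_eq_right h2.le] at hm
    subst hm
    rw [add_assoc] at h
    have := add_left_cancel h
    exact absurd (this ▸ h2) (not_lt.2 le_self_add)
  · rw [max_eq_left (not_lt.1 h1), max_eq_left (not_lt.1 h2)] at hm
    subst hm
    exact ⟨rfl, add_left_cancel h⟩

theorem opair_le_diag {a b m : Ordinal.{u}} (ha : a ≤ m) (hb : b ≤ m) : opair a b ≤ opair m m := by
  have hm : opair m m + 1 = pairBase (m + 1) := by
    rw [pairBase_succ, opair, if_neg (lt_irrefl m)]
  refine Order.lt_add_one_iff.1 (hm ▸ (opair_lt_pairBase a b).trans_le ?_)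
  exact pairBase_strictMono.monotone (by gcongr; exact max_le ha hb)

/-- The ordinal is closed under some operations. -/
def Closed (Γ : Ordinal.{u}) : Prop :=
  omega0 < Γ ∧ (∀ a < Γ, a + 1 < Γ ∧ ∀ i < omega0, omega0 * a + i < Γ) ∧
    ∀ a < Γ, ∀ b < Γ, opair a b < Γ

theorem exists_closed (β : Ordinal.{u}) : ∃ Γ > β, Closed Γ := by
  let f : Ordinal.{u} → Ordinal.{u} := fun a => max (opair a a) (omega0 * a + omega0) + 1
  have f1 : ∀ a, opair a a < f a := fun a => Order.lt_add_one_iff.2 (le_max_left _ _)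
  have f2 : ∀ a, omega0 * a + omega0 < f a := fun a => Order.lt_add_one_iff.2 (le_max_right _ _)
  have f3 : ∀ a, a < f a := fun a => (left_le_opair a a).trans_lt (f1 a)
  have hlt : ∀ a, a < nfp f (max β omega0) ↔ ∃ n, a < f^[n] (max β omega0) := fun a => lt_nfp_iff
  have h0 : max β omega0 < nfp f (max β omega0) := (hlt _).2 ⟨1, f3 _⟩
  have hs : ∀ n a, a ≤ f^[n] (max β omega0) → a < nfp f (max β omega0) := fun n a h =>
    (hlt _).2 ⟨n + 1, by rw [Function.iterate_succ_apply']; exact h.trans_lt (f3 _)⟩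
  refine ⟨_, (le_max_left β omega0).trans_lt h0, (le_max_right β omega0).trans_lt h0,
    fun a ha => ⟨?_, fun i hi => ?_⟩, fun a ha b hb => ?_⟩
  · obtain ⟨n, hn⟩ := (hlt _).1 ha
    exact hs n _ (Order.add_one_le_of_lt hn)
  · obtain ⟨n, hn⟩ := (hlt _).1 ha
    refine (hlt _).2 ⟨n + 1, ?_⟩
    rw [Function.iterate_succ_apply']
    refine lt_of_le_of_lt ?_ (f2 _)
    gcongr
  · obtain ⟨n, hn⟩ := (hlt _).1 (max_lt ha hb)
    refine (hlt _).2 ⟨n + 1, ?_⟩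
    rw [Function.iterate_succ_apply']
    exact (opair_le_diag ((le_max_left a b).trans hn.le) ((le_max_right a b).trans hn.le)).trans_lt
      (f1 _)

/-- The set with pointer `p'` is an element of the set with pointer `p`, according to codes whose
join is `Y`. -/
def PtrE (Y : Set Ordinal.{u}) (p' p : Ordinal.{u}) : Prop :=
  ∃ ξ' < p' + 1, ∃ ξ < p + 1, ∃ i < omega0, p' = omega0 * ξ' + i ∧ p = omega0 * ξ + i ∧
    omega0 * opair ξ' ξ + i ∈ Y

/-- Bisimilarity up to stage `s`. -/
def Bis (Y : Set Ordinal.{u}) (Γ s p q : Ordinal.{u}) : Prop :=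
  opair p q < Γ ∧ RecRel Γ (fun Q s d => ∃ p < Γ, ∃ q < Γ, d = opair p q ∧ ∀ t < s,
    (∀ p' < Γ, PtrE Y p' p → ∃ q' < Γ, PtrE Y q' q ∧ Q t (opair p' q')) ∧
    ∀ q' < Γ, PtrE Y q' q → ∃ p' < Γ, PtrE Y p' p ∧ Q t (opair p' q')) s (opair p q)

/-- The pointers have the same set. -/
def PtrEq (Y : Set Ordinal.{u}) (Γ p q : Ordinal.{u}) : Prop := ∀ s < Γ, Bis Y Γ s p q

/-- `Γ` is large enough for computations with the sets whose codes are in `Y`. -/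
def Good (Y : Set Ordinal.{u}) (Γ : Ordinal.{u}) : Prop :=
  Closed Γ ∧ ∃ s < Γ, ∀ p < Γ, ∀ q < Γ, Bis Y Γ s p q → Bis Y Γ (s + 1) p q

section

variable {γ : Type (u + 1)} {C : Ctx γ} {Y : γ → Set Ordinal.{u}} {Γ s p q : γ → Ordinal.{u}}

theorem Dfn.ptrE (hY : SDfn C Y) (hp : TDfn C p) (hq : TDfn C q) :
    Dfn C fun g => PtrE (Y g) (p g) (q g) :=
  .ex hp.succ (.ex hq.w.succ (.ex .omega (.and (.eq hp.w.w.w ((TDfn.omega.mul TDfn.var.w.w).add .var))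
    (.and (.eq hq.w.w.w ((TDfn.omega.mul TDfn.var.w).add .var))
      (.mem ((TDfn.omega.mul (.pair TDfn.var.w.w TDfn.var.w)).add .var) hY.w.w.w)))))

theorem Dfn.bis (hY : SDfn C Y) (hΓ : TDfn C Γ) (hs : TDfn C s) (hp : TDfn C p) (hq : TDfn C q) :
    Dfn C fun g => Bis (Y g) (Γ g) (s g) (p g) (q g) := by
  refine .recRel hΓ hs (hp.pair hq) fun Q hQ => ?_
  have hΓ' := hΓ.wS.w.w.w
  have hY' := hY.wS.w.w.w
  have hQ' := hQ.subst ((Ext.wk.trans (Ext.wk.trans (Ext.wk.trans (Ext.wk.trans .wk)))).lift.lift)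
  exact .ex hΓ' (.ex hΓ'.w (.and (.eq TDfn.var.w.w (TDfn.var.w.pair .var)) (.all TDfn.var.w.w.w (.and
    (.all hΓ'.w.w.w (.imp (.ptrE hY'.w.w.w.w .var TDfn.var.w.w.w)
      (.ex hΓ'.w.w.w.w (.and (.ptrE hY'.w.w.w.w.w .var TDfn.var.w.w.w)
        (.app₂ hQ' TDfn.var.w.w (TDfn.var.w.pair .var))))))
    (.all hΓ'.w.w.w (.imp (.ptrE hY'.w.w.w.w .var TDfn.var.w.w)
      (.ex hΓ'.w.w.w.w (.and (.ptrE hY'.w.w.w.w.w .var TDfn.var.w.w.w.w)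
        (.app₂ hQ' TDfn.var.w.w (TDfn.var.pair TDfn.var.w))))))))))

theorem Dfn.ptrEq (hY : SDfn C Y) (hΓ : TDfn C Γ) (hp : TDfn C p) (hq : TDfn C q) :
    Dfn C fun g => PtrEq (Y g) (Γ g) (p g) (q g) := .all hΓ (.bis hY.w hΓ.w .var hp.w hq.w)

theorem Dfn.closed (hΓ : TDfn C Γ) : Dfn C fun g => Closed (Γ g) :=
  .and (.lt .omega hΓ) (.and (.all hΓ (.and (.lt TDfn.var.succ hΓ.w) (.all .omega
    (.lt ((TDfn.omega.mul TDfn.var.w).add .var) hΓ.w.w)))) (.all hΓ (.all hΓ.w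
      (.lt (TDfn.var.w.pair .var) hΓ.w.w))))

theorem Dfn.good (hY : SDfn C Y) (hΓ : TDfn C Γ) : Dfn C fun g => Good (Y g) (Γ g) :=
  .and (.closed hΓ) (.ex hΓ (.all hΓ.w (.all hΓ.w.w (.imp
    (.bis hY.w.w.w hΓ.w.w.w TDfn.var.w.w TDfn.var.w .var)
    (.bis hY.w.w.w hΓ.w.w.w TDfn.var.w.w.succ TDfn.var.w .var)))))

end

theorem ptrE_iff {Y : Set Ordinal.{u}} {p' p : Ordinal.{u}} : PtrE Y p' p ↔
    ∃ (ξ' ξ : Ordinal.{u}) (i : ℕ), p' = omega0 * ξ' + i ∧ p = omega0 * ξ + i ∧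
      omega0 * opair ξ' ξ + i ∈ Y := by
  constructor
  · rintro ⟨ξ', -, ξ, -, i, hi, h⟩
    obtain ⟨i, rfl⟩ := lt_omega0.1 hi
    exact ⟨ξ', ξ, i, h⟩
  · rintro ⟨ξ', ξ, i, rfl, rfl, h⟩
    have hle : ∀ ξ : Ordinal.{u}, ξ < omega0 * ξ + i + 1 := fun ξ =>
      Order.lt_add_one_iff.2 ((Ordinal.le_mul_right ξ omega0_pos).trans le_self_add)
    exact ⟨ξ', hle _, ξ, hle _, i, natCast_lt_omega0 i, rfl, rfl, h⟩

theorem PtrE.exists_le {Y : Set Ordinal.{u}} {p' p : Ordinal.{u}} (h : PtrE Y p' p) :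
    ∃ v ∈ Y, p' ≤ v ∧ p ≤ v := by
  obtain ⟨ξ', ξ, i, rfl, rfl, hv⟩ := ptrE_iff.1 h
  refine ⟨_, hv, ?_, ?_⟩ <;> gcongr
  · exact left_le_opair _ _
  · exact right_le_opair _ _

/-- A pointer related to another by `PtrE` is bounded by an element of `Y`, hence by `Γ`. So the
bounds that definability requires can be dropped. -/
theorem bis_iff {Y : Set Ordinal.{u}} {Γ s p q : Ordinal.{u}} (hΓ : Closed Γ) (hY : Below Γ Y)
    (hp : p < Γ) (hq : q < Γ) : Bis Y Γ s p q ↔ ∀ t < s,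
      (∀ p', PtrE Y p' p → ∃ q', PtrE Y q' q ∧ Bis Y Γ t p' q') ∧
      ∀ q', PtrE Y q' q → ∃ p', PtrE Y p' p ∧ Bis Y Γ t p' q' := by
  have hlt : ∀ {p' p}, PtrE Y p' p → p' < Γ := fun h => by
    obtain ⟨v, hv, h1, -⟩ := h.exists_le
    exact h1.trans_lt (hY v hv)
  rw [Bis, recRel_iff]
  constructor
  · rintro ⟨-, p₁, -, q₁, -, h, h'⟩ t ht
    obtain ⟨rfl, rfl⟩ := opair_inj.1 h
    refine ⟨fun p' hp' => ?_, fun q' hq' => ?_⟩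
    · obtain ⟨q', -, h1, -, h2⟩ := (h' t ht).1 p' (hlt hp') hp'
      exact ⟨q', h1, h2⟩
    · obtain ⟨p', -, h1, -, h2⟩ := (h' t ht).2 q' (hlt hq') hq'
      exact ⟨p', h1, h2⟩
  · intro h
    refine ⟨hΓ.2.2 p hp q hq, p, hp, q, hq, rfl, fun t ht => ⟨fun p' _ hp' => ?_, fun q' _ hq' => ?_⟩⟩
    · obtain ⟨q', h1, h2⟩ := (h t ht).1 p' hp'
      exact ⟨q', hlt h1, h1, ht, h2⟩
    · obtain ⟨p', h1, h2⟩ := (h t ht).2 q' hq'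
      exact ⟨p', hlt h1, h1, ht, h2⟩

/-- `val` gives the sets that the pointers represent. -/
def PtrVal (Y : Set Ordinal.{u}) (val : Ordinal.{u} → ZFSet.{u}) : Prop :=
  ∀ q z, z ∈ val q ↔ ∃ p, PtrE Y p q ∧ val p = z

section

variable {Y : Set Ordinal.{u}} {Γ : Ordinal.{u}} {val : Ordinal.{u} → ZFSet.{u}}

theorem PtrE.left_lt {p q : Ordinal.{u}} (hY : Below Γ Y) (h : PtrE Y p q) : p < Γ := by
  obtain ⟨v, hv, h1, -⟩ := h.exists_le
  exact h1.trans_lt (hY v hv)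

theorem bis_of_eq (hΓ : Closed Γ) (hY : Below Γ Y) (hval : PtrVal Y val) (s : Ordinal.{u}) :
    ∀ p < Γ, ∀ q < Γ, val p = val q → Bis Y Γ s p q := by
  induction s using WellFoundedLT.induction with
  | ind s ih =>
    intro p hp q hq h
    rw [bis_iff hΓ hY hp hq]
    refine fun t ht => ⟨fun p' hp' => ?_, fun q' hq' => ?_⟩
    · have h1 : val p' ∈ val p := (hval _ _).2 ⟨p', hp', rfl⟩
      obtain ⟨q', h2, h3⟩ := (hval _ _).1 (h ▸ h1)
      exact ⟨q', h2, ih t ht _ (hp'.left_lt hY) _ (h2.left_lt hY) h3.symm⟩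
    · have h1 : val q' ∈ val q := (hval _ _).2 ⟨q', hq', rfl⟩
      obtain ⟨p', h2, h3⟩ := (hval _ _).1 (h ▸ h1)
      exact ⟨p', h2, ih t ht _ (h2.left_lt hY) _ (hq'.left_lt hY) h3⟩

/-- Bisimilarity at a stage beyond the rank of the first set already yields equality: its elements
have rank below the stage at which they are matched. -/
theorem eq_of_bis (hΓ : Closed Γ) (hY : Below Γ Y) (hval : PtrVal Y val) (s : Ordinal.{u}) :
    ∀ p < Γ, ∀ q < Γ, (val p).rank < s → Bis Y Γ s p q → val p = val q := by
  induction s using WellFoundedLT.induction with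
  | ind s ih =>
    intro p hp q hq hs h
    rw [bis_iff hΓ hY hp hq] at h
    obtain ⟨h1, h2⟩ := h _ hs
    ext z
    constructor
    · intro hz
      obtain ⟨p', h3, rfl⟩ := (hval _ _).1 hz
      obtain ⟨q', h4, h5⟩ := h1 p' h3
      rw [ih _ hs p' (h3.left_lt hY) q' (h4.left_lt hY) (ZFSet.rank_lt_of_mem hz) h5]
      exact (hval _ _).2 ⟨q', h4, rfl⟩
    · intro hz
      obtain ⟨q', h3, rfl⟩ := (hval _ _).1 hz
      obtain ⟨p', h4, h5⟩ := h2 q' h3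
      have hz' : val p' ∈ val p := (hval _ _).2 ⟨p', h4, rfl⟩
      rwa [← ih _ hs p' (h4.left_lt hY) q' (h3.left_lt hY) (ZFSet.rank_lt_of_mem hz') h5]

/-- Once stage `s + 1` adds nothing to stage `s`, the relation at stage `s` is itself a
bisimulation, and it survives at every stage. -/
theorem Bis.stable {s : Ordinal.{u}} (hΓ : Closed Γ) (hY : Below Γ Y)
    (hs : ∀ p < Γ, ∀ q < Γ, Bis Y Γ s p q → Bis Y Γ (s + 1) p q) (s' : Ordinal.{u}) :
    ∀ p < Γ, ∀ q < Γ, Bis Y Γ s p q → Bis Y Γ s' p q := by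
  induction s' using WellFoundedLT.induction with
  | ind s' ih =>
    intro p hp q hq h
    have h1 := (bis_iff hΓ hY hp hq).1 (hs p hp q hq h) s (Order.lt_add_one_iff.2 le_rfl)
    rw [bis_iff hΓ hY hp hq]
    refine fun t ht => ⟨fun p' hp' => ?_, fun q' hq' => ?_⟩
    · obtain ⟨q', h2, h3⟩ := h1.1 p' hp'
      exact ⟨q', h2, ih t ht _ (hp'.left_lt hY) _ (h2.left_lt hY) h3⟩
    · obtain ⟨p', h2, h3⟩ := h1.2 q' hq'
      exact ⟨p', h2, ih t ht _ (h2.left_lt hY) _ (hq'.left_lt hY) h3⟩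

/-- The machine does not know the ranks of the coded sets, but it can test whether the stages have
become stable below `Γ`. By `Bis.stable` a stable stage is as good as one beyond all ranks. -/
theorem ptrEq_iff (hΓ : Good Y Γ) (hY : Below Γ Y) (hval : PtrVal Y val) {p q : Ordinal.{u}}
    (hp : p < Γ) (hq : q < Γ) : PtrEq Y Γ p q ↔ val p = val q := by
  obtain ⟨hc, s, hs, h⟩ := hΓ
  refine ⟨fun h' => ?_, fun h' t _ => bis_of_eq hc hY hval t p hp q hq h'⟩
  exact eq_of_bis hc hY hval ((val p).rank + 1) p hp q hq (Order.lt_add_one_iff.2 le_rfl)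
    (Bis.stable hc hY h _ p hp q hq (h' s hs))

/-- Pointers beyond a bound of `Y` represent the empty set, so the ranks of all represented sets
have a common bound `μ`. Stage `μ + 1` is stable by `eq_of_bis`. -/
theorem exists_good (hY : BddAbove Y) (hval : PtrVal Y val) (β : Ordinal.{u}) : ∃ Γ > β, Good Y Γ := by
  obtain ⟨b, hb⟩ := hY
  have hbdd : BddAbove (range fun p : Iio (b + 1) => (val p).rank) := bddAbove_of_small
  obtain ⟨μ, hμ⟩ := hbdd
  have hμ' : ∀ p, (val p).rank ≤ μ := by
    intro p
    by_cases hp : p < b + 1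
    · exact hμ ⟨⟨p, hp⟩, rfl⟩
    · have : val p = ∅ := by
        rw [ZFSet.eq_empty]
        intro z hz
        obtain ⟨p', h, -⟩ := (hval _ _).1 hz
        obtain ⟨v, hv, -, h2⟩ := h.exists_le
        exact hp (Order.lt_add_one_iff.2 (h2.trans (hb hv)))
      rw [this, ZFSet.rank_empty]
      exact zero_le
  obtain ⟨Γ, h1, hΓ⟩ := exists_closed (max β (max (μ + 1) b))
  have hY' : Below Γ Y := fun v hv =>
    (hb hv).trans_lt (((le_max_right _ _).trans (le_max_right _ _)).trans_lt h1)
  refine ⟨Γ, (le_max_left _ _).trans_lt h1, hΓ, μ + 1,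
    ((le_max_left _ _).trans (le_max_right _ _)).trans_lt h1, fun p hp q hq h => ?_⟩
  exact bis_of_eq hΓ hY' hval _ p hp q hq
    (eq_of_bis hΓ hY' hval _ p hp q hq (Order.lt_add_one_iff.2 (hμ' p)) h)

end

end

section

/-! ### Truth of formulas under assignments of pointers -/

/-- The assignment `a` changed at the variable `i`. Assignments are coded as lists. -/
def asgUpd (a i p : Ordinal.{u}) : Ordinal.{u} := opair (opair i p) a + 1

/-- The pointer assigned to the variable `i` is `p`. -/
def Look (Γ i a p : Ordinal.{u}) : Prop :=
  p < Γ ∧ RecRel Γ (fun Q a p => (a = 0 ∧ p = i) ∨ ∃ j < a, ∃ p' < a, ∃ a' < a, a = asgUpd a' j p' ∧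
    ((j = i ∧ p = p') ∨ (¬ j = i ∧ Q a' p))) a p

/-- The relation `F` for the parts of the code `n` of a formula. -/
def CodeCases (F : Ordinal.{u} → Ordinal.{u} → Ordinal.{u} → Prop) (n : Ordinal.{u}) : Prop :=
  ∃ k < omega0, ∃ x < omega0, ∃ y < omega0, n = opair k (opair x y) ∧ F k x y

/-- The clauses of the definition of truth. -/
def truthCases (Y : Set Ordinal.{u}) (Γ : Ordinal.{u}) (Q : Ordinal.{u} → Ordinal.{u} → Prop)
    (a k x y : Ordinal.{u}) : Prop :=
  (k = 1 ∧ ∃ p < Γ, ∃ q < Γ, Look Γ x a p ∧ Look Γ y a q ∧ ∃ r < Γ, PtrE Y r q ∧ PtrEq Y Γ r p) ∨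
  (k = 2 ∧ ∃ p < Γ, ∃ q < Γ, Look Γ x a p ∧ Look Γ y a q ∧ PtrEq Y Γ p q) ∨
  (k = 3 ∧ Q x a ∧ Q y a) ∨ (k = 4 ∧ (Q x a ∨ Q y a)) ∨ (k = 5 ∧ (Q x a → Q y a)) ∨
  (k = 6 ∧ ∀ p < Γ, Q y (asgUpd a x p)) ∨ (k = 7 ∧ ∃ p < Γ, Q y (asgUpd a x p))

/-- The formula with code `n` is true under the assignment `a`. -/
def PtrTruth (Y : Set Ordinal.{u}) (Γ n a : Ordinal.{u}) : Prop :=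
  a < Γ ∧ RecRel Γ (fun Q n a => CodeCases (truthCases Y Γ Q a) n) n a

section

variable {γ : Type (u + 1)} {C : Ctx γ} {Y : γ → Set Ordinal.{u}} {Γ i a p n : γ → Ordinal.{u}}

theorem TDfn.asgUpd (ha : TDfn C a) (hi : TDfn C i) (hp : TDfn C p) :
    TDfn C fun g => asgUpd (a g) (i g) (p g) := ((hi.pair hp).pair ha).succ

theorem Dfn.look (hΓ : TDfn C Γ) (hi : TDfn C i) (ha : TDfn C a) (hp : TDfn C p) :
    Dfn C fun g => Look (Γ g) (i g) (a g) (p g) := by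
  refine .recRel hΓ ha hp fun Q hQ => ?_
  have hi' := hi.wS.w.w.w
  have hQ' := hQ.subst ((Ext.wk.trans (Ext.wk.trans .wk)).lift.lift)
  exact .or (.and (.eq TDfn.var.w .zero) (.eq .var hi')) (.ex TDfn.var.w (.ex TDfn.var.w.w
    (.ex TDfn.var.w.w.w (.and (.eq TDfn.var.w.w.w.w (.asgUpd .var TDfn.var.w.w TDfn.var.w))
      (.or (.and (.eq TDfn.var.w.w hi'.w.w.w) (.eq TDfn.var.w.w.w TDfn.var.w))
        (.and (.not (.eq TDfn.var.w.w hi'.w.w.w)) (.app₂ hQ' .var TDfn.var.w.w.w)))))))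

theorem Dfn.ptrTruth (hY : SDfn C Y) (hΓ : TDfn C Γ) (hn : TDfn C n) (ha : TDfn C a) :
    Dfn C fun g => PtrTruth (Y g) (Γ g) (n g) (a g) := by
  refine .recRel hΓ hn ha fun Q hQ => ?_
  have hΓ' := hΓ.wS.w.w.w.w.w.w
  have hY' := hY.wS.w.w.w.w.w.w
  have hQ' := hQ.subst ((Ext.wk.trans (Ext.wk.trans .wk)).lift.lift)
  have hQ'' := hQ.subst ((Ext.wk.trans (Ext.wk.trans (Ext.wk.trans .wk))).lift.lift)
  refine .ex .omega (.ex .omega (.ex .omega (.and (.eq TDfn.var.w.w.w.w (TDfn.var.w.w.pair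
    (TDfn.var.w.pair .var))) ?_)))
  have hk : ∀ m : ℕ, Dfn C.extS.ext.ext.ext.ext.ext.ext fun p => p.1.1.2 = (m : Ordinal.{u}) :=
    fun m => .eq TDfn.var.w.w (.nat m)
  have h0 := hk 1
  have h1 := hk 2
  simp only [Nat.cast_one, Nat.cast_ofNat] at h0 h1
  refine .or (.and h0 (.ex hΓ' (.ex hΓ'.w (.and (.look hΓ'.w.w TDfn.var.w.w.w TDfn.var.w.w.w.w.w TDfn.var.w)
    (.and (.look hΓ'.w.w TDfn.var.w.w TDfn.var.w.w.w.w.w .var) (.ex hΓ'.w.w (.and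
      (.ptrE hY'.w.w.w .var TDfn.var.w) (.ptrEq hY'.w.w.w hΓ'.w.w.w .var TDfn.var.w.w)))))))) (.or ?_
    (.or (.and (hk 3) (.and (.app₂ hQ' TDfn.var.w TDfn.var.w.w.w) (.app₂ hQ' TDfn.var TDfn.var.w.w.w)))
    (.or (.and (hk 4) (.or (.app₂ hQ' TDfn.var.w TDfn.var.w.w.w) (.app₂ hQ' TDfn.var TDfn.var.w.w.w)))
    (.or (.and (hk 5) (.imp (.app₂ hQ' TDfn.var.w TDfn.var.w.w.w) (.app₂ hQ' TDfn.var TDfn.var.w.w.w)))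
    (.or (.and (hk 6) (.all hΓ' (.app₂ hQ'' TDfn.var.w (.asgUpd TDfn.var.w.w.w.w TDfn.var.w.w .var))))
      (.and (hk 7) (.ex hΓ' (.app₂ hQ'' TDfn.var.w (.asgUpd TDfn.var.w.w.w.w TDfn.var.w.w .var)))))))))
  exact .and h1 (.ex hΓ' (.ex hΓ'.w (.and (.look hΓ'.w.w TDfn.var.w.w.w TDfn.var.w.w.w.w.w TDfn.var.w)
    (.and (.look hΓ'.w.w TDfn.var.w.w TDfn.var.w.w.w.w.w .var)
      (.ptrEq hY'.w.w hΓ'.w.w TDfn.var.w .var)))))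

end

/-- `a` codes the assignment `σ`. -/
inductive IsAsg (Γ : Ordinal.{u}) : Ordinal.{u} → (ℕ → Ordinal.{u}) → Prop
  | nil : IsAsg Γ 0 fun i => i
  | upd {a σ} (i : ℕ) {p : Ordinal.{u}} (hp : p < Γ) (h : IsAsg Γ a σ) :
      IsAsg Γ (asgUpd a i p) (Function.update σ i p)

theorem IsAsg.lt {Γ a : Ordinal.{u}} {σ : ℕ → Ordinal.{u}} (hΓ : Closed Γ) (h : IsAsg Γ a σ) :
    a < Γ ∧ ∀ i, σ i < Γ := by
  induction h with
  | nil => exact ⟨omega0_pos.trans hΓ.1, fun i => (natCast_lt_omega0 i).trans hΓ.1⟩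
  | @upd a σ i p hp h ih =>
    refine ⟨(hΓ.2.1 _ (hΓ.2.2 _ (hΓ.2.2 _ ((natCast_lt_omega0 i).trans hΓ.1) _ hp) _ ih.1)).1,
      fun j => ?_⟩
    rw [Function.update_apply]
    split_ifs
    · exact hp
    · exact ih.2 j

theorem lt_asgUpd (a i p : Ordinal.{u}) :
    i < asgUpd a i p ∧ p < asgUpd a i p ∧ a < asgUpd a i p :=
  ⟨Order.lt_add_one_iff.2 ((left_le_opair i p).trans (left_le_opair _ _)),
    Order.lt_add_one_iff.2 ((right_le_opair i p).trans (left_le_opair _ _)),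
    Order.lt_add_one_iff.2 (right_le_opair _ _)⟩

theorem IsAsg.look {Γ a : Ordinal.{u}} {σ : ℕ → Ordinal.{u}} (hΓ : Closed Γ) (h : IsAsg Γ a σ) (i : ℕ)
    (p : Ordinal.{u}) : Look Γ i a p ↔ p = σ i := by
  induction h generalizing p with
  | nil =>
    rw [Look, recRel_iff]
    constructor
    · rintro ⟨-, ⟨-, h⟩ | ⟨j, h, -⟩⟩
      · exact h
      · exact absurd h not_lt_bot
    · rintro rfl
      exact ⟨(natCast_lt_omega0 i).trans hΓ.1, Or.inl ⟨rfl, rfl⟩⟩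
  | @upd a σ j p' hp h ih =>
    have hl := lt_asgUpd a j p'
    rw [Look, recRel_iff]
    constructor
    · rintro ⟨h1, ⟨h0, -⟩ | ⟨j₁, -, p₁, -, a₁, -, h2, h3⟩⟩
      · exact absurd (h0 ▸ hl.1) not_lt_bot
      · have h4 := Order.add_one_inj.1 h2
        simp only [opair_inj] at h4
        obtain ⟨⟨rfl, rfl⟩, rfl⟩ := h4
        rcases h3 with ⟨h3, rfl⟩ | ⟨h3, -, h4, h5⟩
        · rw [Nat.cast_inj.1 h3, Function.update_self]
        · rw [Function.update_of_ne (by rintro rfl; exact h3 rfl)]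
          exact (ih _).1 ⟨h4, h5⟩
    · rintro rfl
      have hlt := ((IsAsg.upd j hp h).lt hΓ).2 i
      refine ⟨hlt, Or.inr ⟨j, hl.1, p', hl.2.1, a, hl.2.2, rfl, ?_⟩⟩
      by_cases hij : (j : Ordinal.{u}) = i
      · obtain rfl := Nat.cast_inj.1 hij
        exact Or.inl ⟨rfl, by simp⟩
      · have e := Function.update_of_ne (by rintro rfl; exact hij rfl : i ≠ j) p' σ
        rw [e]
        exact Or.inr ⟨hij, hl.2.2, (ih _).2 rfl⟩

/-- The parts of a code are smaller than the code, which is what a recursion on Gödel numbers needs.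
-/
theorem lt_pair_pair {k x y : ℕ} (hk : k ≠ 0) : x < Nat.pair k (Nat.pair x y) ∧
    y < Nat.pair k (Nat.pair x y) := by
  have h1 := Nat.add_le_pair k (Nat.pair x y)
  have h2 := Nat.left_le_pair x y
  have h3 := Nat.right_le_pair x y
  omega

theorem codeCases_natCast {F : Ordinal.{u} → Ordinal.{u} → Ordinal.{u} → Prop} {k x y : ℕ} :
    CodeCases F (Nat.pair k (Nat.pair x y) : ℕ) ↔ F k x y := by
  have key : ∀ (k' x' y' : ℕ), ((Nat.pair k (Nat.pair x y) : ℕ) : Ordinal.{u}) =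
      opair k' (opair x' y') ↔ k = k' ∧ x = x' ∧ y = y' := by
    intro k' x' y'
    rw [opair_natCast, opair_natCast, Nat.cast_inj, Nat.pair_eq_pair, Nat.pair_eq_pair]
  simp only [CodeCases, exists_lt_omega, key]
  exact ⟨by rintro ⟨k', x', y', ⟨rfl, rfl, rfl⟩, h⟩; exact h, fun h => ⟨k, x, y, ⟨rfl, rfl, rfl⟩, h⟩⟩

theorem ptrTruth_iff {Y : Set Ordinal.{u}} {Γ a : Ordinal.{u}} (ha : a < Γ) (k x y : ℕ) :
    PtrTruth Y Γ (Nat.pair k (Nat.pair x y) : ℕ) a ↔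
    (k = 1 ∧ ∃ p < Γ, ∃ q < Γ, Look Γ x a p ∧ Look Γ y a q ∧ ∃ r < Γ, PtrE Y r q ∧ PtrEq Y Γ r p) ∨
    (k = 2 ∧ ∃ p < Γ, ∃ q < Γ, Look Γ x a p ∧ Look Γ y a q ∧ PtrEq Y Γ p q) ∨
    (k = 3 ∧ PtrTruth Y Γ x a ∧ PtrTruth Y Γ y a) ∨ (k = 4 ∧ (PtrTruth Y Γ x a ∨ PtrTruth Y Γ y a)) ∨
    (k = 5 ∧ (PtrTruth Y Γ x a → PtrTruth Y Γ y a)) ∨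
    (k = 6 ∧ ∀ p < Γ, PtrTruth Y Γ y (asgUpd a x p)) ∨
    (k = 7 ∧ ∃ p < Γ, PtrTruth Y Γ y (asgUpd a x p)) := by
  have h1 : PtrTruth Y Γ (Nat.pair k (Nat.pair x y) : ℕ) a ↔ truthCases Y Γ (PtrTruth Y Γ) a k x y := by
    rw [PtrTruth, recRel_iff, and_iff_right ha, codeCases_natCast]
    -- For `k = 0` the parts need not be smaller than the code (`falsum` has the code `0`), but no
    -- clause applies in this case.
    by_cases hk : k = 0
    · subst hk
      simp [truthCases]
    · have hl := lt_pair_pair (x := x) (y := y) hk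
      simp only [truthCases, Nat.cast_lt, hl.1, hl.2, true_and]
      exact Iff.rfl
  rw [h1, truthCases]
  norm_cast

/-- Quantifiers are evaluated over the pointers below `Γ` instead of all sets. For bounded
quantifiers this is enough, because every element of a represented set is represented by a pointer
that occurs in `Y`. -/
theorem ptrTruth_iff_truth {Y : Set Ordinal.{u}} {Γ : Ordinal.{u}} {val : Ordinal.{u} → ZFSet.{u}}
    (hΓ : Good Y Γ) (hY : Below Γ Y) (hval : PtrVal Y val) {φ : Formula} (hφ : φ.IsDelta0) :
    ∀ {a : Ordinal.{u}} {σ : ℕ → Ordinal.{u}}, IsAsg Γ a σ →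
      (PtrTruth Y Γ φ.code a ↔ φ.Truth fun i => val (σ i)) := by
  have hupd : ∀ (σ : ℕ → Ordinal.{u}) i p, (fun j => val (Function.update σ i p j)) =
      Function.update (fun j => val (σ j)) i (val p) := fun σ i p => by
    funext j
    simp only [Function.update_apply]
    split_ifs <;> rfl
  have hmem : ∀ (i j : ℕ) {a : Ordinal.{u}} {σ : ℕ → Ordinal.{u}}, IsAsg Γ a σ →
      (PtrTruth Y Γ (Formula.mem i j).code a ↔ val (σ i) ∈ val (σ j)) := by
    intro i j a σ ha
    have hlt := (ha.lt hΓ.1).2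
    rw [Formula.code, ptrTruth_iff (ha.lt hΓ.1).1]
    simp only [ha.look hΓ.1]
    constructor
    · intro h
      obtain ⟨-, p, -, q, -, rfl, rfl, r, hr, h1, h2⟩ := h.resolve_right (by omega)
      rw [← (ptrEq_iff hΓ hY hval hr (hlt i)).1 h2]
      exact (hval _ _).2 ⟨r, h1, rfl⟩
    · intro h
      obtain ⟨r, h1, h2⟩ := (hval _ _).1 h
      exact Or.inl ⟨trivial, _, hlt i, _, hlt j, rfl, rfl, r, h1.left_lt hY, h1,
        (ptrEq_iff hΓ hY hval (h1.left_lt hY) (hlt i)).2 h2⟩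
  induction hφ with
  | falsum =>
    intro a σ ha
    rw [show Formula.falsum.code = Nat.pair 0 (Nat.pair 0 0) from rfl, ptrTruth_iff (ha.lt hΓ.1).1]
    simp [Formula.Truth]
  | mem i j => exact hmem i j
  | eq i j =>
    intro a σ ha
    have hlt := (ha.lt hΓ.1).2
    rw [Formula.code, ptrTruth_iff (ha.lt hΓ.1).1]
    simp only [ha.look hΓ.1, Formula.Truth]
    rw [← ptrEq_iff hΓ hY hval (hlt i) (hlt j)]
    constructor
    · intro h
      obtain ⟨-, p, -, q, -, rfl, rfl, h1⟩ := (h.resolve_left (by omega)).resolve_right (by omega)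
      exact h1
    · intro h
      exact Or.inr (Or.inl ⟨trivial, _, hlt i, _, hlt j, rfl, rfl, h⟩)
  | and _ _ ih ih' =>
    intro a σ ha
    rw [Formula.code, ptrTruth_iff (ha.lt hΓ.1).1, ih ha, ih' ha]
    simp [Formula.Truth]
  | or _ _ ih ih' =>
    intro a σ ha
    rw [Formula.code, ptrTruth_iff (ha.lt hΓ.1).1, ih ha, ih' ha]
    simp [Formula.Truth]
  | imp _ _ ih ih' =>
    intro a σ ha
    rw [Formula.code, ptrTruth_iff (ha.lt hΓ.1).1, ih ha, ih' ha]
    simp [Formula.Truth]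
  | @ball i j φ hij _ ih =>
    intro a σ ha
    rw [Formula.ball, Formula.code, ptrTruth_iff (ha.lt hΓ.1).1]
    simp only [Formula.Truth, Function.update_self, Function.update_of_ne hij.symm]
    have key : ∀ p < Γ, PtrTruth Y Γ ((Formula.mem i j).imp φ).code (asgUpd a i p) ↔
        (val p ∈ val (σ j) → φ.Truth (Function.update (fun j => val (σ j)) i (val p))) := by
      intro p hp
      have ha' := ha.upd i hp
      rw [Formula.code, ptrTruth_iff (ha'.lt hΓ.1).1, hmem i j ha', ih ha', hupd]
      simp [Function.update_of_ne hij.symm]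
    constructor
    · intro h z hz
      obtain ⟨r, h1, rfl⟩ := (hval _ _).1 hz
      exact (key r (h1.left_lt hY)).1 ((by simpa using h : ∀ p < Γ, PtrTruth Y Γ ((Formula.mem i j).imp φ).code (asgUpd a i p)) r
        (h1.left_lt hY)) hz
    · intro h
      refine Or.inr (Or.inr (Or.inr (Or.inr (Or.inr (Or.inl ⟨trivial, fun p hp => (key p hp).2 ?_⟩)))))
      exact h (val p)
  | @bex i j φ hij _ ih =>
    intro a σ ha
    rw [Formula.bex, Formula.code, ptrTruth_iff (ha.lt hΓ.1).1]
    simp only [Formula.Truth, Function.update_self, Function.update_of_ne hij.symm]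
    have key : ∀ p < Γ, PtrTruth Y Γ ((Formula.mem i j).and φ).code (asgUpd a i p) ↔
        (val p ∈ val (σ j) ∧ φ.Truth (Function.update (fun j => val (σ j)) i (val p))) := by
      intro p hp
      have ha' := ha.upd i hp
      rw [Formula.code, ptrTruth_iff (ha'.lt hΓ.1).1, hmem i j ha', ih ha', hupd]
      simp [Function.update_of_ne hij.symm]
    constructor
    · intro h
      obtain ⟨p, hp, h1⟩ := (by simpa using h : ∃ p < Γ, PtrTruth Y Γ ((Formula.mem i j).and φ).code (asgUpd a i p))
      exact ⟨val p, (key p hp).1 h1⟩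
    · rintro ⟨z, hz, h⟩
      obtain ⟨r, h1, rfl⟩ := (hval _ _).1 hz
      exact Or.inr (Or.inr (Or.inr (Or.inr (Or.inr (Or.inr ⟨trivial, r, h1.left_lt hY,
        (key r (h1.left_lt hY)).2 ⟨hz, h⟩⟩)))))

end

section

/-! ### Pointers for codes -/

theorem mem_joinFam {s : Finset ℕ} {c : ℕ → Set Ordinal.{u}} {ξ : Ordinal.{u}} {i : ℕ} :
    omega0 * ξ + i ∈ joinFam s c ↔ i ∈ s ∧ ξ ∈ c i := by
  constructor
  · rintro ⟨j, hj, η, hη, h⟩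
    obtain ⟨rfl, h'⟩ := mul_add_inj' (natCast_lt_omega0 i) (natCast_lt_omega0 j) h
    obtain rfl := Nat.cast_inj.1 h'
    exact ⟨hj, hη⟩
  · rintro ⟨hi, hξ⟩
    exact ⟨i, hi, ξ, hξ, rfl⟩

theorem IsCode.bddAbove {c : Set Ordinal.{u}} {x : ZFSet.{u}} (h : IsCode c x) : BddAbove c := by
  obtain ⟨α, f, -, -, -, rfl⟩ := h
  refine ⟨opair α α, ?_⟩
  rintro _ ⟨ι, hι, ξ, hξ, -, rfl⟩
  exact opair_le_diag hι.le hξ.le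

theorem bddAbove_joinFam {s : Finset ℕ} {c : ℕ → Set Ordinal.{u}} (h : ∀ i ∈ s, BddAbove (c i)) :
    BddAbove (joinFam s c) := by
  have : joinFam s c = ⋃ i ∈ s, (fun ξ => omega0 * ξ + (i : Ordinal.{u})) '' c i := by
    ext η
    simp only [joinFam, mem_ofPred_eq, mem_iUnion, mem_image]
    exact ⟨fun ⟨i, hi, ξ, hξ, h⟩ => ⟨i, hi, ξ, hξ, h.symm⟩, fun ⟨i, hi, ξ, hξ, h⟩ => ⟨i, hi, ξ, hξ, h.symm⟩⟩
  rw [this, ← Finset.set_biUnion_coe, s.finite_toSet.bddAbove_biUnion]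
  intro i hi
  obtain ⟨b, hb⟩ := h i hi
  refine ⟨omega0 * b + i, ?_⟩
  rintro _ ⟨ξ, hξ, rfl⟩
  dsimp only
  gcongr
  exact hb hξ

/-- Different pointers from which the pointer `r` can be reached represent different sets. -/
def PtrInj (Y : Set Ordinal.{u}) (val : Ordinal.{u} → ZFSet.{u}) : Prop :=
  ∀ r p q, Relation.ReflTransGen (PtrE Y) p r → Relation.ReflTransGen (PtrE Y) q r → val p = val q →
    p = q

/-- The pointer `omega0 * ξ + i` stands for the set with index `ξ` in the code number `i`. The root
of each code has the index `0`, so the pointer `i` represents `v i`, and the empty assignment, which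
sends `i` to `i`, is the assignment of the given sets. -/
theorem CodesOn.exists_ptrVal {s : Finset ℕ} {v : ℕ → ZFSet.{u}} {c : ℕ → Set Ordinal.{u}}
    (h : CodesOn s v c) : ∃ val, PtrVal (joinFam s c) val ∧ (∀ i ∈ s, val i = v i) ∧
      PtrInj (joinFam s c) val := by
  classical
  have h' : ∀ i, ∃ (α : Ordinal.{u}) (f : Ordinal.{u} → ZFSet.{u}), i ∈ s → 0 < α ∧
      Set.BijOn f (Set.Iio α) (tcSingleton (v i)) ∧ f 0 = v i ∧
      c i = {η | ∃ ι < α, ∃ ξ < α, f ι ∈ f ξ ∧ η = opair ι ξ} := by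
    intro i
    by_cases hi : i ∈ s
    · obtain ⟨α, f, h⟩ := h i hi
      exact ⟨α, f, fun _ => h⟩
    · exact ⟨0, fun _ => ∅, fun h => absurd h hi⟩
  choose α f hf using h'
  -- Ordinals that are not pointers into one of the codes have no predecessors in `PtrE`, so the
  -- default value `∅` is the right one.
  let val : Ordinal.{u} → ZFSet.{u} := fun p =>
    if h : ∃ iξ : ℕ × Ordinal.{u}, iξ.1 ∈ s ∧ iξ.2 < α iξ.1 ∧ p = omega0 * iξ.2 + iξ.1 then
      f h.choose.1 h.choose.2 else ∅
  have hv : ∀ i ∈ s, ∀ ξ < α i, val (omega0 * ξ + i) = f i ξ := by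
    intro i hi ξ hξ
    have hex : ∃ iξ : ℕ × Ordinal.{u}, iξ.1 ∈ s ∧ iξ.2 < α iξ.1 ∧
        omega0 * ξ + i = omega0 * iξ.2 + iξ.1 := ⟨(i, ξ), hi, hξ, rfl⟩
    have h1 : val (omega0 * ξ + i) = f hex.choose.1 hex.choose.2 := dif_pos hex
    obtain ⟨-, -, h2⟩ := hex.choose_spec
    obtain ⟨h3, h4⟩ := mul_add_inj' (natCast_lt_omega0 _) (natCast_lt_omega0 _) h2
    rw [h1, ← h3, ← Nat.cast_inj.1 h4]
  have hv0 : ∀ p, (¬ ∃ iξ : ℕ × Ordinal.{u}, iξ.1 ∈ s ∧ iξ.2 < α iξ.1 ∧ p = omega0 * iξ.2 + iξ.1) →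
      val p = ∅ := fun p h => dif_neg h
  have hE : ∀ p' p, PtrE (joinFam s c) p' p ↔ ∃ i ∈ s, ∃ ξ' < α i, ∃ ξ < α i,
      p' = omega0 * ξ' + i ∧ p = omega0 * ξ + i ∧ f i ξ' ∈ f i ξ := by
    intro p' p
    rw [ptrE_iff]
    constructor
    · rintro ⟨ξ', ξ, i, rfl, rfl, h⟩
      obtain ⟨hi, h⟩ := mem_joinFam.1 h
      obtain ⟨-, -, -, hc⟩ := hf i hi
      rw [hc] at h
      obtain ⟨ι, hι, η, hη, h1, h2⟩ := h
      obtain ⟨rfl, rfl⟩ := opair_inj.1 h2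
      exact ⟨i, hi, _, hι, _, hη, rfl, rfl, h1⟩
    · rintro ⟨i, hi, ξ', hξ', ξ, hξ, rfl, rfl, h⟩
      refine ⟨ξ', ξ, i, rfl, rfl, mem_joinFam.2 ⟨hi, ?_⟩⟩
      rw [(hf i hi).2.2.2]
      exact ⟨ξ', hξ', ξ, hξ, h, rfl⟩
  refine ⟨val, fun q z => ?_, fun i hi => ?_, fun r p q hp hq hpq => ?_⟩
  · constructor
    · intro hz
      by_cases hq : ∃ iξ : ℕ × Ordinal.{u}, iξ.1 ∈ s ∧ iξ.2 < α iξ.1 ∧ q = omega0 * iξ.2 + iξ.1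
      · obtain ⟨⟨i, ξ⟩, hi, hξ, rfl⟩ := hq
        simp only at hi hξ hz ⊢
        rw [hv i hi ξ hξ] at hz
        have htc : z ∈ tcSingleton (v i) := Relation.ReflTransGen.head hz ((hf i hi).2.1.1 hξ)
        obtain ⟨ξ', hξ', rfl⟩ := (hf i hi).2.1.2.2 htc
        exact ⟨_, (hE _ _).2 ⟨i, hi, ξ', hξ', ξ, hξ, rfl, rfl, hz⟩, hv i hi ξ' hξ'⟩
      · rw [hv0 q hq] at hz
        exact absurd hz (ZFSet.notMem_empty _)
    · rintro ⟨p, hp, rfl⟩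
      obtain ⟨i, hi, ξ', hξ', ξ, hξ, rfl, rfl, h1⟩ := (hE _ _).1 hp
      rwa [hv i hi ξ hξ, hv i hi ξ' hξ']
  · have := hv i hi 0 (hf i hi).1
    rw [mul_zero, zero_add] at this
    rw [this, (hf i hi).2.2.1]
  -- A nontrivial chain stays within one code, and there the indexing of the sets is injective. The
  -- same set may well have several pointers in different codes.
  · have key : ∀ p, Relation.ReflTransGen (PtrE (joinFam s c)) p r → p = r ∨ ∃ i ∈ s, ∃ ξ' < α i,
        ∃ ξ < α i, p = omega0 * ξ' + i ∧ r = omega0 * ξ + i := by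
      intro p hp
      induction hp using Relation.ReflTransGen.head_induction_on with
      | refl => exact Or.inl rfl
      | head h1 _ ih =>
        obtain ⟨i, hi, ξ', hξ', ξ, hξ, rfl, rfl, -⟩ := (hE _ _).1 h1
        rcases ih with rfl | ⟨j, hj, η', hη', η, hη, h2, rfl⟩
        · exact Or.inr ⟨i, hi, _, hξ', _, hξ, rfl, rfl⟩
        · obtain ⟨-, h3⟩ := mul_add_inj' (natCast_lt_omega0 _) (natCast_lt_omega0 _) h2
          obtain rfl := Nat.cast_inj.1 h3
          exact Or.inr ⟨i, hi, _, hξ', _, hη, rfl, rfl⟩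
    have key' : ∀ i ∈ s, ∀ ξ < α i, ∀ η < α i, val (omega0 * ξ + i) = val (omega0 * η + i) →
        omega0 * ξ + i = omega0 * η + i := by
      intro i hi ξ hξ η hη h
      rw [hv i hi ξ hξ, hv i hi η hη] at h
      rw [(hf i hi).2.1.2.1 hξ hη h]
    rcases key p hp with rfl | ⟨i, hi, ξ, hξ, ζ, hζ, rfl, rfl⟩
    · rcases key q hq with rfl | ⟨i, hi, ξ, hξ, η, hη, rfl, rfl⟩
      · rfl
      · exact key' i hi _ hη _ hξ hpq
    · rcases key q hq with rfl | ⟨j, hj, ξ', hξ', η, hη, rfl, h⟩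
      · exact key' i hi _ hξ _ hζ hpq
      · obtain ⟨-, h⟩ := mul_add_inj' (natCast_lt_omega0 _) (natCast_lt_omega0 _) h
        obtain rfl := Nat.cast_inj.1 h
        exact key' i hi _ hξ _ hξ' hpq

/-! ### The code of the set with a given pointer -/

/-- The pointer `q` leads to `p`. -/
def Reach (Y : Set Ordinal.{u}) (Γ p q : Ordinal.{u}) : Prop :=
  q < Γ ∧ RecRel Γ (fun Q n q => q = p ∨ ∃ m < n, ∃ r < Γ, PtrE Y q r ∧ Q m r) omega0 q

/-- The index of the pointer `q` in the code of the set with pointer `p` is `β`. -/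
def PtrIdx (Y : Set Ordinal.{u}) (Γ p q β : Ordinal.{u}) : Prop :=
  β < Γ ∧ RecRel Γ (fun Q q β => (q = p ∧ β = 0) ∨ (¬ q = p ∧ 0 < β ∧
    (∀ q' < q, Reach Y Γ p q' → ¬ q' = p → ∃ β' < β, Q q' β') ∧
    ∀ β₁ < β, 0 < β₁ → ¬ ∀ q' < q, Reach Y Γ p q' → ¬ q' = p → ∃ β' < β₁, Q q' β')) q β

/-- The code of the set with pointer `p`. -/
def ptrCode (Y : Set Ordinal.{u}) (Γ p : Ordinal.{u}) : Set Ordinal.{u} :=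
  {η | ∃ q < Γ, ∃ q' < Γ, Reach Y Γ p q ∧ Reach Y Γ p q' ∧ PtrE Y q q' ∧ ∃ ι < Γ, ∃ ξ < Γ,
    PtrIdx Y Γ p q ι ∧ PtrIdx Y Γ p q' ξ ∧ η = opair ι ξ}

section

variable {γ : Type (u + 1)} {C : Ctx γ} {Y : γ → Set Ordinal.{u}} {Γ p q β : γ → Ordinal.{u}}

theorem Dfn.reach (hY : SDfn C Y) (hΓ : TDfn C Γ) (hp : TDfn C p) (hq : TDfn C q) :
    Dfn C fun g => Reach (Y g) (Γ g) (p g) (q g) := by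
  refine .recRel hΓ .omega hq fun Q hQ => ?_
  have hQ' := hQ.subst ((Ext.wk.trans .wk).lift.lift)
  exact .or (.eq .var hp.wS.w.w.w) (.ex TDfn.var.w (.ex hΓ.wS.w.w.w.w (.and
    (.ptrE hY.wS.w.w.w.w.w TDfn.var.w.w .var) (.app₂ hQ' TDfn.var.w .var))))

theorem Dfn.ptrIdx (hY : SDfn C Y) (hΓ : TDfn C Γ) (hp : TDfn C p) (hq : TDfn C q) (hβ : TDfn C β) :
    Dfn C fun g => PtrIdx (Y g) (Γ g) (p g) (q g) (β g) := by
  refine .recRel hΓ hq hβ fun Q hQ => ?_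
  have hQ' := hQ.subst ((Ext.wk.trans .wk).lift.lift)
  have hQ'' := hQ.subst ((Ext.wk.trans (Ext.wk.trans .wk)).lift.lift)
  have hp' := hp.wS.w.w.w
  refine .or (.and (.eq TDfn.var.w hp') (.eq .var .zero)) (.and (.not (.eq TDfn.var.w hp'))
    (.and (.lt .zero .var) (.and ?_ (.all .var (.imp (.lt .zero .var) (.not ?_))))))
  · exact .all TDfn.var.w (.imp (.reach hY.wS.w.w.w.w hΓ.wS.w.w.w.w hp'.w .var) (.imp
      (.not (.eq .var hp'.w)) (.ex TDfn.var.w (.app₂ hQ' TDfn.var.w .var))))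
  · exact .all TDfn.var.w.w (.imp (.reach hY.wS.w.w.w.w.w hΓ.wS.w.w.w.w.w hp'.w.w .var) (.imp
      (.not (.eq .var hp'.w.w)) (.ex TDfn.var.w (.app₂ hQ'' TDfn.var.w .var))))

theorem SDfn.ptrCode (hY : SDfn C Y) (hΓ : TDfn C Γ) (hp : TDfn C p) :
    SDfn C fun g => ptrCode (Y g) (Γ g) (p g) :=
  .of (.ex hΓ.w (.ex hΓ.w.w (.and (.reach hY.w.w.w hΓ.w.w.w hp.w.w.w TDfn.var.w) (.and
    (.reach hY.w.w.w hΓ.w.w.w hp.w.w.w .var) (.and (.ptrE hY.w.w.w TDfn.var.w .var)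
      (.ex hΓ.w.w.w (.ex hΓ.w.w.w.w (.and
        (.ptrIdx hY.w.w.w.w.w hΓ.w.w.w.w.w hp.w.w.w.w.w TDfn.var.w.w.w TDfn.var.w)
        (.and (.ptrIdx hY.w.w.w.w.w hΓ.w.w.w.w.w hp.w.w.w.w.w TDfn.var.w.w .var)
          (.eq TDfn.var.w.w.w.w (TDfn.var.w.pair .var)))))))))))

end

/-- The recursion runs to the stage `ω`, because chains are finite but of unbounded length. -/
theorem reach_iff {Y : Set Ordinal.{u}} {Γ p q : Ordinal.{u}} (hY : Below Γ Y) (hp : p < Γ) :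
    Reach Y Γ p q ↔ Relation.ReflTransGen (PtrE Y) q p := by
  constructor
  · rintro ⟨-, h⟩
    have : ∀ (s q : Ordinal.{u}), RecRel Γ (fun Q n q => q = p ∨ ∃ m < n, ∃ r < Γ, PtrE Y q r ∧ Q m r)
        s q → Relation.ReflTransGen (PtrE Y) q p := by
      intro s
      induction s using WellFoundedLT.induction with
      | ind s ih =>
        intro q h
        rw [recRel_iff] at h
        rcases h with rfl | ⟨m, hm, r, -, h1, -, -, h2⟩
        · exact .refl
        · exact .head h1 (ih m hm r h2)
    exact this _ _ h
  · intro h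
    -- A chain shows up at a finite stage. The clause asks only for some earlier stage, so what
    -- holds at a finite stage still holds at stage `ω`.
    have : q < Γ ∧ ∃ n : ℕ, RecRel Γ (fun Q n q => q = p ∨ ∃ m < n, ∃ r < Γ, PtrE Y q r ∧ Q m r) n q := by
      induction h using Relation.ReflTransGen.head_induction_on with
      | refl => exact ⟨hp, 0, by rw [recRel_iff]; exact Or.inl rfl⟩
      | head h1 _ ih =>
        obtain ⟨hr, n, hn⟩ := ih
        refine ⟨h1.left_lt hY, n + 1, ?_⟩
        rw [recRel_iff]
        exact Or.inr ⟨n, by simp, _, hr, h1, by simp, hr, hn⟩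
    obtain ⟨hq, n, hn⟩ := this
    refine ⟨hq, ?_⟩
    rw [recRel_iff] at hn ⊢
    rcases hn with rfl | ⟨m, hm, r, hr, h1, h2, h3, h4⟩
    · exact Or.inl rfl
    · have := hm.trans (natCast_lt_omega0 n)
      exact Or.inr ⟨m, this, r, hr, h1, this, h3, h4⟩

/-- The order-preserving enumeration, from `1` on, of the elements of a set of ordinals, inverted. -/
def collapse (S : Set Ordinal.{u}) (q : Ordinal.{u}) : Ordinal.{u} :=
  sInf {β | 0 < β ∧ ∀ q' : Iio q, q'.1 ∈ S → collapse S q'.1 < β}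
termination_by q
decreasing_by exact q'.2

theorem collapse_spec (S : Set Ordinal.{u}) (q : Ordinal.{u}) :
    0 < collapse S q ∧ (∀ q' < q, q' ∈ S → collapse S q' < collapse S q) ∧
      ∀ β, 0 < β → (∀ q' < q, q' ∈ S → collapse S q' < β) → collapse S q ≤ β := by
  have hne : {β | 0 < β ∧ ∀ q' : Iio q, q'.1 ∈ S → collapse S q'.1 < β}.Nonempty := by
    obtain ⟨b, hb⟩ := bddAbove_of_small (s := range fun q' : Iio q => collapse S q'.1)
    exact ⟨b + 1, Order.lt_add_one_iff.2 zero_le, fun q' _ => Order.lt_add_one_iff.2 (hb ⟨q', rfl⟩)⟩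
  have h := csInf_mem hne
  rw [← collapse] at h
  refine ⟨h.1, fun q' hq' hS => h.2 ⟨q', hq'⟩ hS, fun β h0 hβ => ?_⟩
  rw [collapse]
  exact csInf_le' ⟨h0, fun q' hS => hβ q'.1 q'.2 hS⟩

theorem collapse_le (S : Set Ordinal.{u}) (q : Ordinal.{u}) : collapse S q ≤ q + 1 := by
  induction q using WellFoundedLT.induction with
  | ind q ih =>
    refine (collapse_spec S q).2.2 _ (Order.lt_add_one_iff.2 zero_le) fun q' hq' _ => ?_
    refine (ih q' hq').trans_lt ?_
    rw [Order.lt_add_one_iff]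
    exact Order.add_one_le_of_lt hq'

/-- The indices have no gaps: a value left out would have been the least admissible one for some
later element. -/
theorem exists_collapse_eq {S : Set Ordinal.{u}} {q β : Ordinal.{u}} (hq : q ∈ S) (h0 : 0 < β)
    (h : β ≤ collapse S q) : ∃ q' ∈ S, collapse S q' = β := by
  induction q using WellFoundedLT.induction with
  | ind q ih =>
    rcases h.lt_or_eq with h | h
    · by_contra hne
      push Not at hne
      refine absurd ((collapse_spec S q).2.2 β h0 fun q' hq' hS => ?_) h.not_ge
      by_contra hh
      rcases (not_lt.1 hh).lt_or_eq with h1 | h1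
      · obtain ⟨q'', h2, h3⟩ := ih q' hq' hS h1.le
        exact hne q'' h2 h3
      · exact hne q' hS h1.symm
    · exact ⟨q, hq, h.symm⟩

theorem collapse_inj {S : Set Ordinal.{u}} {q q' : Ordinal.{u}} (hq : q ∈ S) (hq' : q' ∈ S)
    (h : collapse S q = collapse S q') : q = q' := by
  rcases lt_trichotomy q q' with h1 | h1 | h1
  · exact absurd h ((collapse_spec S q').2.1 q h1 hq).ne
  · exact h1
  · exact absurd h ((collapse_spec S q).2.1 q' h1 hq').ne'

open Classical in
-- `PtrIdx` is a definable form of `collapse`. The infimum is expressed by the condition that no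
-- smaller positive ordinal exceeds the indices of the earlier pointers. The pointer `p` itself gets
-- the index `0`, as codes demand.
theorem ptrIdx_iff {Y : Set Ordinal.{u}} {Γ p q β : Ordinal.{u}} (hΓ : Closed Γ) (hq : q < Γ) :
    PtrIdx Y Γ p q β ↔ β = if q = p then 0 else collapse {q | Reach Y Γ p q ∧ ¬ q = p} q := by
  induction q using WellFoundedLT.induction generalizing β with
  | ind q ih =>
    rw [PtrIdx, recRel_iff]
    split_ifs with hqp
    · simp only [hqp, true_and, not_true, false_and, or_false]
      exact ⟨fun h => h.2, fun h => ⟨h ▸ omega0_pos.trans hΓ.1, h⟩⟩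
    · simp only [hqp, false_and, false_or, not_false_eq_true, true_and]
      set S : Set Ordinal.{u} := {q | Reach Y Γ p q ∧ ¬ q = p}
      obtain ⟨c0, c1, c2⟩ := collapse_spec S q
      have key : ∀ β₁, (∀ q' < q, Reach Y Γ p q' → ¬ q' = p → ∃ β' < β₁, q' < q ∧ PtrIdx Y Γ p q' β') ↔
          ∀ q' < q, q' ∈ S → collapse S q' < β₁ := by
        intro β₁
        refine forall_congr' fun q' => imp_congr_right fun hq' => ?_
        constructor
        · rintro h ⟨h1, h2⟩
          obtain ⟨β', h3, -, h4⟩ := h h1 h2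
          rw [ih q' hq' (hq'.trans hq), if_neg h2] at h4
          rwa [← h4]
        · intro h h1 h2
          exact ⟨_, h ⟨h1, h2⟩, hq', (ih q' hq' (hq'.trans hq)).2 (by rw [if_neg h2])⟩
      constructor
      · rintro ⟨-, h0, h1, h2⟩
        refine le_antisymm ?_ (c2 β h0 ((key β).1 h1))
        by_contra hlt
        exact h2 _ (not_le.1 hlt) c0 ((key _).2 c1)
      · rintro rfl
        refine ⟨(collapse_le S q).trans_lt (hΓ.2.1 q hq).1, c0, (key _).2 c1, fun β₁ h1 h0 h2 => ?_⟩
        exact absurd (c2 β₁ h0 ((key β₁).1 h2)) h1.not_ge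

/-- The pointers from which `p` can be reached represent the elements of the transitive closure of
`{val p}`, each of them only once by `PtrInj`. Renumbering them without gaps gives a code. This is
how a machine obtains a code of a witness that it has found as a pointer. -/
theorem isCode_ptrCode {Y : Set Ordinal.{u}} {Γ p : Ordinal.{u}} {val : Ordinal.{u} → ZFSet.{u}}
    (hΓ : Closed Γ) (hY : Below Γ Y) (hval : PtrVal Y val) (hinj : PtrInj Y val) (hp : p < Γ) :
    IsCode (ptrCode Y Γ p) (val p) := by
  classical
  set R : Set Ordinal.{u} := {q | Relation.ReflTransGen (PtrE Y) q p} with hR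
  set S : Set Ordinal.{u} := {q | Reach Y Γ p q ∧ ¬ q = p} with hS
  have hRΓ : ∀ q ∈ R, q < Γ := fun q hq => ((reach_iff hY hp).2 hq).1
  have hRS : ∀ q ∈ R, q ≠ p → q ∈ S := fun q hq h => ⟨(reach_iff hY hp).2 hq, h⟩
  let idx : Ordinal.{u} → Ordinal.{u} := fun q => if q = p then 0 else collapse S q
  have hidx0 : idx p = 0 := if_pos rfl
  have hidx : ∀ q, q ≠ p → idx q = collapse S q := fun q h => if_neg h
  have hidxΓ : ∀ q ∈ R, idx q < Γ := fun q hq => ((ptrIdx_iff (Y := Y) (p := p) hΓ (hRΓ q hq)).2 rfl).1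
  have hidxinj : ∀ q ∈ R, ∀ q' ∈ R, idx q = idx q' → q = q' := by
    intro q hq q' hq' h
    by_cases h1 : q = p <;> by_cases h2 : q' = p
    · rw [h1, h2]
    · rw [h1, hidx0, hidx q' h2] at h
      exact absurd h (collapse_spec S q').1.ne
    · rw [h2, hidx0, hidx q h1] at h
      exact absurd h (collapse_spec S q).1.ne'
    · rw [hidx q h1, hidx q' h2] at h
      exact collapse_inj (hRS q hq h1) (hRS q' hq' h2) h
  -- As the least strict bound of the indices, `α` has only indices below it, since these have no
  -- gaps.
  set α := sInf {β | 0 < β ∧ ∀ q ∈ R, idx q < β} with hα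
  have hαm : 0 < α ∧ ∀ q ∈ R, idx q < α :=
    csInf_mem (s := {β | 0 < β ∧ ∀ q ∈ R, idx q < β}) ⟨Γ, omega0_pos.trans hΓ.1, hidxΓ⟩
  have hsurj : ∀ β < α, ∃ q, q ∈ R ∧ idx q = β := by
    intro β hβ
    rcases eq_or_ne β 0 with rfl | h0
    · exact ⟨p, .refl, hidx0⟩
    · have h0 := pos_iff_ne_zero.2 h0
      have : ¬ (0 < β ∧ ∀ q ∈ R, idx q < β) := fun h =>
        absurd (csInf_le' (s := {β | 0 < β ∧ ∀ q ∈ R, idx q < β}) h) hβ.not_ge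
      push Not at this
      obtain ⟨q, hq, h1⟩ := this h0
      have hqp : q ≠ p := by
        rintro rfl
        rw [hidx0] at h1
        exact absurd h0 h1.not_gt
      rw [hidx q hqp] at h1
      obtain ⟨q', h2, h3⟩ := exists_collapse_eq (hRS q hq hqp) h0 h1
      exact ⟨q', (reach_iff hY hp).1 h2.1, by rw [hidx q' h2.2, h3]⟩
  choose! g hgR hg using hsurj
  have hgi : ∀ q ∈ R, g (idx q) = q := fun q hq =>
    hidxinj _ (hgR _ (hαm.2 q hq)) _ hq (hg _ (hαm.2 q hq))
  have htc : ∀ z, z ∈ tcSingleton (val p) ↔ ∃ q ∈ R, val q = z := by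
    intro z
    constructor
    · intro (hz : Relation.ReflTransGen (fun a b : ZFSet.{u} => a ∈ b) z (val p))
      induction hz using Relation.ReflTransGen.head_induction_on with
      | refl => exact ⟨p, .refl, rfl⟩
      | head h1 _ ih =>
        obtain ⟨q, hq, rfl⟩ := ih
        obtain ⟨q', h2, rfl⟩ := (hval _ _).1 h1
        exact ⟨q', .head h2 hq, rfl⟩
    · rintro ⟨q, (hq : Relation.ReflTransGen (PtrE Y) q p), rfl⟩
      induction hq using Relation.ReflTransGen.head_induction_on with
      | refl => exact .refl
      | head h1 _ ih => exact .head ((hval _ _).2 ⟨_, h1, rfl⟩) ih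
  have hmem : ∀ a ∈ R, ∀ b ∈ R, val a ∈ val b ↔ PtrE Y a b := by
    intro a ha b hb
    refine ⟨fun h => ?_, fun h => (hval _ _).2 ⟨a, h, rfl⟩⟩
    obtain ⟨a', h1, h2⟩ := (hval _ _).1 h
    rwa [← hinj p a' a (.head h1 hb) ha h2]
  refine ⟨α, fun β => val (g β), hαm.1, ⟨fun β hβ => ?_, fun β hβ β' hβ' h => ?_, fun z hz => ?_⟩, ?_, ?_⟩
  · exact (htc _).2 ⟨_, hgR β hβ, rfl⟩
  · have := hinj p _ _ (hgR β hβ) (hgR β' hβ') h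
    rw [← hg β hβ, this, hg β' hβ']
  · obtain ⟨q, hq, rfl⟩ := (htc z).1 hz
    exact ⟨idx q, hαm.2 q hq, by dsimp only; rw [hgi q hq]⟩
  · dsimp only
    rw [← hidx0, hgi p .refl]
  · ext η
    constructor
    · rintro ⟨q, hq, q', hq', h1, h2, h3, ι, -, ξ, -, h4, h5, rfl⟩
      rw [reach_iff hY hp] at h1 h2
      rw [ptrIdx_iff hΓ hq] at h4
      rw [ptrIdx_iff hΓ hq'] at h5
      refine ⟨idx q, hαm.2 q h1, idx q', hαm.2 q' h2, ?_, by rw [h4, h5]⟩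
      dsimp only
      rw [hgi q h1, hgi q' h2]
      exact (hmem q h1 q' h2).2 h3
    · rintro ⟨ι, hι, ξ, hξ, h, rfl⟩
      have h1 := hgR ι hι
      have h2 := hgR ξ hξ
      refine ⟨g ι, hRΓ _ h1, g ξ, hRΓ _ h2, (reach_iff hY hp).2 h1, (reach_iff hY hp).2 h2,
        (hmem _ h1 _ h2).1 h, ι, hg ι hι ▸ hidxΓ _ h1, ξ, hg ξ hξ ▸ hidxΓ _ h2, ?_, ?_, rfl⟩
      · rw [ptrIdx_iff hΓ (hRΓ _ h1)]; exact (hg ι hι).symm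
      · rw [ptrIdx_iff hΓ (hRΓ _ h2)]; exact (hg ξ hξ).symm

theorem ptrCode_below {Y : Set Ordinal.{u}} {Γ p : Ordinal.{u}} (hΓ : Closed Γ) :
    Below Γ (ptrCode Y Γ p) := by
  rintro _ ⟨q, -, q', -, -, -, -, ι, hι, ξ, hξ, -, -, rfl⟩
  exact hΓ.2.2 ι hι ξ hξ

end

section

/-! ### Canonical realizers -/

/-- The program with the lines `K` that knows the code of `K` and the number `n`. -/
def prg (K : Program) (n : ℕ) : Program := withNumeral K (Nat.pair (Encodable.encode K) n)

/-- The code of a program with a numeral, where the first component of the numeral is the code of the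
lines of the program. -/
def prgCode (N : ℕ) : ℕ :=
  Encodable.encode (withNumeral ((Encodable.decode N.unpair.1 : Option Program).getD []) N)

/-- The numeral of `prg K n` contains the code of `K`. So the program can compute, by the primitive
recursive `prgCode`, the code of `prg K n'` for every `n'`, that is, of the canonical programs for
other formulas. -/
theorem prgCode_pair (K : Program) (n : ℕ) :
    prgCode (Nat.pair (Encodable.encode K) n) = Encodable.encode (prg K n) := by
  simp [prgCode, prg]

theorem primrec_prgCode : Nat.Primrec prgCode := by
  rw [← Primrec.nat_iff]
  have hK : Primrec fun N : ℕ => (Encodable.decode N.unpair.1 : Option Program).getD [] :=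
    Primrec.option_getD.comp (Primrec.decode.comp (Primrec.fst.comp Primrec.unpair))
      (Primrec.const ([] : Program))
  have hL : Primrec fun N : ℕ => ((Encodable.decode N.unpair.1 : Option Program).getD []).length :=
    Primrec.list_length.comp hK
  have h1 : Primrec₂ fun N j : ℕ => ((Encodable.decode N.unpair.1 : Option Program).getD []).length + j + 1 :=
    Primrec.succ.comp (Primrec.nat_add.comp (hL.comp Primrec.fst) Primrec.snd)
  have h2 : Primrec₂ fun N j : ℕ => ((7, (true, some true,
      ((Encodable.decode N.unpair.1 : Option Program).getD []).length + j + 1), (true, some true,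
      ((Encodable.decode N.unpair.1 : Option Program).getD []).length + j + 1)) : Line) :=
    (Primrec.const 7).pair (((Primrec.const true).pair ((Primrec.const (some true)).pair h1)).pair
      ((Primrec.const true).pair ((Primrec.const (some true)).pair h1)))
  have h3 : Primrec fun N : ℕ => ((5, (false, none, 1), (true, none,
      ((Encodable.decode N.unpair.1 : Option Program).getD []).length + N + 1)) : Line) :=
    (Primrec.const 5).pair ((Primrec.const (false, none, 1)).pair ((Primrec.const true).pair
      ((Primrec.const none).pair (Primrec.succ.comp (Primrec.nat_add.comp hL Primrec.id)))))
  exact Primrec.encode.comp (Primrec.list_append.comp hK (Primrec.list_append.comp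
    (Primrec.list_map Primrec.list_range h2) (Primrec.list_cons.comp h3 (Primrec.const []))))

open Classical in
/-- The canonical realizer of a formula, where `K` are the lines of the programs in it. -/
def rz (K : Program) : Formula → (ℕ → ZFSet.{u}) → Set Ordinal.{u}
  | .and φ ψ, v => join (rz K φ v) (rz K ψ v)
  | .or φ ψ, v => if φ.Truth v then join (ofOrd 0) (rz K φ v) else join (ofOrd 1) (rz K ψ v)
  | .imp φ ψ, _ => progPair (prg K (φ.imp ψ).code) ∅
  | .all i φ, _ => progPair (prg K (φ.all i).code) ∅
  | .ex i φ, _ => progPair (prg K (φ.ex i).code) ∅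
  | _, _ => ∅

theorem double_lt_omega0 {v : Ordinal.{u}} (h : v < omega0) : 2 * v + 1 < omega0 := by
  obtain ⟨n, rfl⟩ := lt_omega0.1 h
  exact_mod_cast natCast_lt_omega0 (2 * n + 1)

theorem join_below_omega0 {x y : Set Ordinal.{u}} (hx : Below omega0 x) (hy : Below omega0 y) :
    Below omega0 (join x y) := by
  rintro _ (⟨w, hw, rfl⟩ | ⟨w, hw, rfl⟩)
  · exact (Order.lt_add_one_iff.2 le_rfl).trans (double_lt_omega0 (hx _ hw))
  · exact double_lt_omega0 (hy _ hw)

theorem ofOrd_below_omega0 (n : ℕ) : Below omega0 (ofOrd (n : Ordinal.{u})) :=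
  fun _ hv => lt_trans hv (natCast_lt_omega0 n)

/-- Canonical realizers use the empty parameter, so they consist of natural numbers only. They are
bounded, and every closed `Γ` is large enough for them. -/
theorem rz_below (K : Program) : ∀ (φ : Formula) (v : ℕ → ZFSet.{u}), Below omega0 (rz K φ v)
  | .falsum, _ => fun _ h => absurd h (notMem_empty _)
  | .mem _ _, _ => fun _ h => absurd h (notMem_empty _)
  | .eq _ _, _ => fun _ h => absurd h (notMem_empty _)
  | .and φ ψ, v => join_below_omega0 (rz_below K φ v) (rz_below K ψ v)
  | .or φ ψ, v => by
    rw [rz]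
    split_ifs
    · exact join_below_omega0 (by simpa using ofOrd_below_omega0 0) (rz_below K φ v)
    · exact join_below_omega0 (by simpa using ofOrd_below_omega0 1) (rz_below K ψ v)
  | .imp φ ψ, _ => join_below_omega0 (ofOrd_below_omega0 _) fun _ h => absurd h (notMem_empty _)
  | .all _ φ, _ => join_below_omega0 (ofOrd_below_omega0 _) fun _ h => absurd h (notMem_empty _)
  | .ex _ φ, _ => join_below_omega0 (ofOrd_below_omega0 _) fun _ h => absurd h (notMem_empty _)

theorem Below.bddAbove {Γ : Ordinal.{u}} {x : Set Ordinal.{u}} (h : Below Γ x) : BddAbove x :=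
  ⟨Γ, fun v hv => (h v hv).le⟩

theorem Formula.truth_congr : ∀ (φ : Formula) {v v' : ℕ → ZFSet.{u}}, (∀ i ∈ φ.fv, v i = v' i) →
    (φ.Truth v ↔ φ.Truth v')
  | .falsum, _, _, _ => Iff.rfl
  | .mem i j, v, v', h => by simp only [Truth]; rw [h i (by simp [fv]), h j (by simp [fv])]
  | .eq i j, v, v', h => by simp only [Truth]; rw [h i (by simp [fv]), h j (by simp [fv])]
  | .and φ ψ, _, _, h => and_congr (truth_congr φ fun i hi => h i (Finset.mem_union_left _ hi))
      (truth_congr ψ fun i hi => h i (Finset.mem_union_right _ hi))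
  | .or φ ψ, _, _, h => or_congr (truth_congr φ fun i hi => h i (Finset.mem_union_left _ hi))
      (truth_congr ψ fun i hi => h i (Finset.mem_union_right _ hi))
  | .imp φ ψ, _, _, h => imp_congr (truth_congr φ fun i hi => h i (Finset.mem_union_left _ hi))
      (truth_congr ψ fun i hi => h i (Finset.mem_union_right _ hi))
  | .all i φ, _, _, h => forall_congr' fun a => truth_congr φ fun j hj => by
      by_cases hij : j = i
      · subst hij; simp
      · simp only [Function.update_of_ne hij]
        exact h j (Finset.mem_erase.2 ⟨hij, hj⟩)
  | .ex i φ, _, _, h => exists_congr fun a => truth_congr φ fun j hj => by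
      by_cases hij : j = i
      · subst hij; simp
      · simp only [Function.update_of_ne hij]
        exact h j (Finset.mem_erase.2 ⟨hij, hj⟩)

theorem rz_congr (K : Program) : ∀ (φ : Formula) {v v' : ℕ → ZFSet.{u}}, (∀ i ∈ φ.fv, v i = v' i) →
    rz K φ v = rz K φ v'
  | .falsum, _, _, _ => rfl
  | .mem _ _, _, _, _ => rfl
  | .eq _ _, _, _, _ => rfl
  | .and φ ψ, _, _, h => by
    rw [rz, rz, rz_congr K φ fun i hi => h i (Finset.mem_union_left _ hi),
      rz_congr K ψ fun i hi => h i (Finset.mem_union_right _ hi)]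
  | .or φ ψ, v, _, h => by
    have h1 : ∀ i ∈ φ.fv, _ := fun i hi => h i (Finset.mem_union_left _ hi)
    rw [rz, rz, rz_congr K φ h1, rz_congr K ψ fun i hi => h i (Finset.mem_union_right _ hi)]
    by_cases ht : φ.Truth v
    · rw [if_pos ht, if_pos ((Formula.truth_congr φ h1).1 ht)]
    · rw [if_neg ht, if_neg fun h' => ht ((Formula.truth_congr φ h1).2 h')]
  | .imp _ _, _, _, _ => rfl
  | .all _ _, _, _, _ => rfl
  | .ex _ _, _, _, _ => rfl

/-- The clauses of the definition of the canonical realizer. -/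
def rzCases (κ : Ordinal.{u}) (Y : Set Ordinal.{u}) (Γ a : Ordinal.{u})
    (Q : Ordinal.{u} → Ordinal.{u} → Prop) (β k x y : Ordinal.{u}) : Prop :=
  (k = 3 ∧ ∃ β' < β + 1, (β = 2 * β' ∧ Q x β') ∨ (β = 2 * β' + 1 ∧ Q y β')) ∨
  (k = 4 ∧ PtrTruth Y Γ x a ∧ ∃ β' < β + 1, β = 2 * β' + 1 ∧ Q x β') ∨
  (k = 4 ∧ ¬ PtrTruth Y Γ x a ∧ (β = 0 ∨ ∃ β' < β + 1, β = 2 * β' + 1 ∧ Q y β')) ∨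
  ((k = 5 ∨ k = 6 ∨ k = 7) ∧ ∃ β' < β + 1, β = 2 * β' ∧ ∃ c < omega0, β' < c ∧
    NatGraph prgCode (opair κ (opair k (opair x y))) c)

/-- `β` is in the canonical realizer of the formula with code `n` under the assignment `a`. -/
def RzMem (κ : Ordinal.{u}) (Y : Set Ordinal.{u}) (Γ a n β : Ordinal.{u}) : Prop :=
  β < Γ ∧ RecRel Γ (fun Q n β => CodeCases (rzCases κ Y Γ a Q β) n) n β

section

variable {γ : Type (u + 1)} {C : Ctx γ} {Y : γ → Set Ordinal.{u}} {κ Γ a n β : γ → Ordinal.{u}}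

theorem Dfn.codeCases {F : γ → Ordinal.{u} → Ordinal.{u} → Ordinal.{u} → Prop} (hn : TDfn C n)
    (h : Dfn C.ext.ext.ext fun p => F p.1.1.1 p.1.1.2 p.1.2 p.2) :
    Dfn C fun g => CodeCases (F g) (n g) :=
  .ex .omega (.ex .omega (.ex .omega (.and (.eq hn.w.w.w (TDfn.var.w.w.pair (TDfn.var.w.pair .var))) h)))

theorem Dfn.eqNat {t : γ → Ordinal.{u}} (h : TDfn C t) (n : ℕ) [n.AtLeastTwo] :
    Dfn C fun g => t g = OfNat.ofNat n := .eq h (TDfn.nat n)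

theorem Dfn.rzMem (hκ : TDfn C κ) (hY : SDfn C Y) (hΓ : TDfn C Γ) (ha : TDfn C a) (hn : TDfn C n)
    (hβ : TDfn C β) : Dfn C fun g => RzMem (κ g) (Y g) (Γ g) (a g) (n g) (β g) := by
  refine .recRel hΓ hn hβ fun Q hQ => .codeCases TDfn.var.w ?_
  have hQ' := hQ.subst ((Ext.wk.trans (Ext.wk.trans (Ext.wk.trans .wk))).lift.lift)
  have hT := Dfn.ptrTruth hY.wS.w.w.w.w.w.w hΓ.wS.w.w.w.w.w.w TDfn.var.w ha.wS.w.w.w.w.w.w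
  have hb := (TDfn.var (C := C.extS.ext.ext)).w.w.w
  refine .or (.and (.eqNat TDfn.var.w.w 3) (.ex hb.succ (.or
    (.and (.eq hb.w (TDfn.two.mul .var)) (.app₂ hQ' TDfn.var.w.w .var))
    (.and (.eq hb.w (TDfn.two.mul .var).succ) (.app₂ hQ' TDfn.var.w .var))))) (.or ?_ (.or ?_ ?_))
  · exact .and (.eqNat TDfn.var.w.w 4) (.and hT (.ex hb.succ (.and (.eq hb.w (TDfn.two.mul .var).succ)
      (.app₂ hQ' TDfn.var.w.w .var))))
  · exact .and (.eqNat TDfn.var.w.w 4) (.and (.not hT) (.or (.eq hb .zero) (.ex hb.succ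
      (.and (.eq hb.w (TDfn.two.mul .var).succ) (.app₂ hQ' TDfn.var.w .var)))))
  · exact .and (.or (.eqNat TDfn.var.w.w 5) (.or (.eqNat TDfn.var.w.w 6) (.eqNat TDfn.var.w.w 7)))
      (.ex hb.succ (.and (.eq hb.w (TDfn.two.mul .var)) (.ex .omega (.and (.lt TDfn.var.w .var)
        (.natGraph primrec_prgCode (hκ.wS.w.w.w.w.w.w.w.w.pair (TDfn.var.w.w.w.w.pair
          (TDfn.var.w.w.w.pair TDfn.var.w.w))) .var)))))

end

theorem rzMem_iff {κ : Ordinal.{u}} {Y : Set Ordinal.{u}} {Γ a β : Ordinal.{u}} (hβ : β < Γ)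
    (k x y : ℕ) : RzMem κ Y Γ a (Nat.pair k (Nat.pair x y) : ℕ) β ↔
      rzCases κ Y Γ a (RzMem κ Y Γ a) β k x y := by
  rw [RzMem, recRel_iff, and_iff_right hβ, codeCases_natCast]
  by_cases hk : k = 0
  · subst hk
    simp [rzCases]
  · have hl := lt_pair_pair (x := x) (y := y) hk
    simp only [rzCases, Nat.cast_lt, hl.1, hl.2, true_and]
    exact Iff.rfl

theorem mem_join_iff {x y : Set Ordinal.{u}} {v : Ordinal.{u}} : v ∈ join x y ↔
    ∃ w < v + 1, (v = 2 * w ∧ w ∈ x) ∨ (v = 2 * w + 1 ∧ w ∈ y) := by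
  constructor
  · rintro (⟨w, hw, rfl⟩ | ⟨w, hw, rfl⟩)
    · exact ⟨w, Order.lt_add_one_iff.2 (Ordinal.le_mul_right w (by simp)), Or.inl ⟨rfl, hw⟩⟩
    · exact ⟨w, Order.lt_add_one_iff.2 ((Ordinal.le_mul_right w (by simp)).trans le_self_add),
        Or.inr ⟨rfl, hw⟩⟩
  · rintro ⟨w, -, ⟨rfl, h⟩ | ⟨rfl, h⟩⟩
    · exact mem_join_even.2 h
    · exact mem_join_odd.2 h

/-- `Δ₀` formulas and universal formulas: the canonical realizers of these formulas can be
computed. -/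
def HasRz (φ : Formula) : Prop := φ.IsDelta0 ∨ ∃ i ψ, φ = .all i ψ

/-- For implications and quantifiers the realizer is determined by the Gödel number alone. Nothing
about the truth of the formula or the realizers of its parts has to be known. -/
theorem rzMem_progPair {K : Program} {Y : Set Ordinal.{u}} {Γ a β : Ordinal.{u}} (hβ : β < Γ)
    {k x y : ℕ} (hk : k = 5 ∨ k = 6 ∨ k = 7) :
    RzMem (Encodable.encode K : ℕ) Y Γ a (Nat.pair k (Nat.pair x y) : ℕ) β ↔
      β ∈ progPair (prg K (Nat.pair k (Nat.pair x y))) (∅ : Set Ordinal.{u}) := by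
  have hk' : (k : Ordinal.{u}) = 5 ∨ (k : Ordinal.{u}) = 6 ∨ (k : Ordinal.{u}) = 7 := by exact_mod_cast hk
  have h34 : (k : Ordinal.{u}) ≠ 3 ∧ (k : Ordinal.{u}) ≠ 4 := by
    constructor <;> norm_cast <;> omega
  rw [rzMem_iff hβ, rzCases, opair_natCast, opair_natCast, opair_natCast, progPair, mem_join_iff]
  simp only [h34.1, h34.2, false_and, false_or, hk', true_and, natGraph_natCast, prgCode_pair, ofOrd,
    mem_Iio, mem_empty_iff_false, and_false, or_false]
  refine exists_congr fun β' => and_congr_right fun _ => and_congr_right fun _ => ?_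
  exact ⟨by rintro ⟨c, -, h, rfl⟩; exact h, fun h => ⟨_, natCast_lt_omega0 _, h, rfl⟩⟩

/-- Only a disjunction requires knowledge of truth, which `ptrTruth_iff_truth` supplies for `Δ₀`
formulas. A universal formula is admitted with an arbitrary body, because its realizer is just the
code of a program. -/
theorem rzMem_iff_mem {K : Program} {Y : Set Ordinal.{u}} {Γ : Ordinal.{u}}
    {val : Ordinal.{u} → ZFSet.{u}} (hΓ : Good Y Γ) (hY : Below Γ Y) (hval : PtrVal Y val)
    {φ : Formula} (hφ : HasRz φ) {a : Ordinal.{u}} {σ : ℕ → Ordinal.{u}} (ha : IsAsg Γ a σ)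
    {β : Ordinal.{u}} (hβ : β < Γ) : RzMem (Encodable.encode K : ℕ) Y Γ a φ.code β ↔
      β ∈ rz K φ fun i => val (σ i) := by
  rcases hφ with hφ | ⟨i, ψ, rfl⟩
  swap
  · exact rzMem_progPair hβ (by omega)
  induction hφ generalizing β with
  | falsum =>
    rw [show Formula.falsum.code = Nat.pair 0 (Nat.pair 0 0) from rfl, rzMem_iff hβ]
    simp [rzCases, rz]
  | mem i j => rw [Formula.code, rzMem_iff hβ]; simp [rzCases, rz]
  | eq i j => rw [Formula.code, rzMem_iff hβ]; simp [rzCases, rz]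
  | and _ _ ih ih' =>
    rw [Formula.code, rzMem_iff hβ, rz, mem_join_iff]
    simp only [rzCases]
    norm_num
    refine exists_congr fun w => and_congr_right fun hw => ?_
    rw [ih (hw.trans_lt hβ), ih' (hw.trans_lt hβ)]
  | @or φ ψ hφ _ ih ih' =>
    rw [Formula.code, rzMem_iff hβ, rz]
    simp only [rzCases, ptrTruth_iff_truth hΓ hY hval hφ ha]
    split_ifs with ht
    · rw [mem_join_iff]
      norm_num [ofOrd, ht]
      refine exists_congr fun w => and_congr_right fun hw => and_congr_right fun _ => ?_
      rw [ih (hw.trans_lt hβ)]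
    · rw [mem_join_iff]
      norm_num [ofOrd, ht]
      constructor
      · rintro (rfl | ⟨w, hw, rfl, h⟩)
        · exact ⟨0, le_rfl, Or.inl (by simp)⟩
        · rw [ih' (hw.trans_lt hβ)] at h
          exact ⟨w, hw, Or.inr ⟨rfl, h⟩⟩
      · rintro ⟨w, hw, ⟨hb, h⟩ | ⟨rfl, h⟩⟩
        · left; simp [h, hb]
        · rw [← ih' (hw.trans_lt hβ)] at h
          exact Or.inr ⟨w, hw, rfl, h⟩
  | imp _ _ _ _ => exact rzMem_progPair hβ (by omega)
  | ball _ _ _ => exact rzMem_progPair hβ (by omega)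
  | bex _ _ _ => exact rzMem_progPair hβ (by omega)

end

section

/-! ### Programs for canonical realizers -/

open Classical in
-- The machine works with whatever `Γ` it finds, while the realizer has to contain one fixed code.
-- So the code must not depend on `Γ`.
theorem ptrCode_congr {Y : Set Ordinal.{u}} {Γ Γ' p : Ordinal.{u}} (hΓ : Closed Γ) (hY : Below Γ Y)
    (hp : p < Γ) (hΓ' : Closed Γ') (hY' : Below Γ' Y) (hp' : p < Γ') :
    ptrCode Y Γ p = ptrCode Y Γ' p := by
  suffices key : ∀ {Γ}, Closed Γ → Below Γ Y → p < Γ → ptrCode Y Γ p =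
      {η | ∃ q q', Relation.ReflTransGen (PtrE Y) q p ∧ Relation.ReflTransGen (PtrE Y) q' p ∧
        PtrE Y q q' ∧ η = opair
          (if q = p then 0 else collapse {q | Relation.ReflTransGen (PtrE Y) q p ∧ ¬ q = p} q)
          (if q' = p then 0 else collapse {q | Relation.ReflTransGen (PtrE Y) q p ∧ ¬ q = p} q')} by
    rw [key hΓ hY hp, key hΓ' hY' hp']
  intro Γ hΓ hY hp
  ext η
  simp only [ptrCode, mem_ofPred_eq]
  constructor
  · rintro ⟨q, hq, q', hq', h1, h2, h3, ι, hι, ξ, hξ, h4, h5, rfl⟩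
    rw [ptrIdx_iff hΓ hq] at h4
    rw [ptrIdx_iff hΓ hq'] at h5
    simp only [reach_iff hY hp] at h1 h2 h4 h5
    exact ⟨q, q', h1, h2, h3, by rw [h4, h5]⟩
  · rintro ⟨q, q', h1, h2, h3, rfl⟩
    simp only [← reach_iff hY hp] at h1 h2 ⊢
    have h4 := (ptrIdx_iff (Y := Y) (p := p) hΓ h1.1).2 rfl
    have h5 := (ptrIdx_iff (Y := Y) (p := p) hΓ h2.1).2 rfl
    exact ⟨q, h1.1, q', h2.1, h1, h2, h3, _, h4.1, _, h5.1, h4, h5, rfl⟩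

/-- The relation `F` for the parts of the numeral of a program. -/
def NumCases (F : Ordinal.{u} → Ordinal.{u} → Ordinal.{u} → Ordinal.{u} → Prop) (n : Ordinal.{u}) : Prop :=
  ∃ κ < omega0, ∃ m < omega0, n = opair κ m ∧ CodeCases (F κ) m

theorem numCases_natCast {F : Ordinal.{u} → Ordinal.{u} → Ordinal.{u} → Ordinal.{u} → Prop}
    {κ k x y : ℕ} : NumCases F (Nat.pair κ (Nat.pair k (Nat.pair x y)) : ℕ) ↔ F κ k x y := by
  rw [← codeCases_natCast (F := F κ)]
  constructor
  · rintro ⟨κ', hκ, m, hm, h, h'⟩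
    rw [← opair_natCast, opair_inj] at h
    rwa [h.1, h.2]
  · intro h
    exact ⟨_, natCast_lt_omega0 _, _, natCast_lt_omega0 _, (opair_natCast _ _).symm, h⟩

theorem Dfn.numCases {γ : Type (u + 1)} {C : Ctx γ} {n : γ → Ordinal.{u}}
    {F : γ → Ordinal.{u} → Ordinal.{u} → Ordinal.{u} → Ordinal.{u} → Prop} (hn : TDfn C n)
    (h : Dfn C.ext.ext.ext.ext.ext fun p => F p.1.1.1.1.1 p.1.1.1.1.2 p.1.1.2 p.1.2 p.2) :
    Dfn C fun g => NumCases (F g) (n g) :=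
  .ex .omega (.ex .omega (.and (.eq hn.w.w (TDfn.var.w.pair .var)) (.codeCases .var h)))

/-- The join of a family of codes, where the code with index `x` is given separately. -/
def famOf (y : Set Ordinal.{u}) (x : Ordinal.{u}) : Set Ordinal.{u} :=
  {w | 2 * w + 1 ∈ y ∨ ∃ ξ < w + 1, w = omega0 * ξ + x ∧ 2 * ξ ∈ y}

theorem SDfn.famOf {γ : Type (u + 1)} {C : Ctx γ} {Y : γ → Set Ordinal.{u}} {x : γ → Ordinal.{u}}
    (hY : SDfn C Y) (hx : TDfn C x) : SDfn C fun g => famOf (Y g) (x g) :=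
  .of (.or (.mem (TDfn.two.mul .var).succ hY.w) (.ex TDfn.var.succ (.and
    (.eq TDfn.var.w ((TDfn.omega.mul .var).add hx.w.w)) (.mem (TDfn.two.mul .var) hY.w.w))))

theorem famOf_join {s : Finset ℕ} {c : ℕ → Set Ordinal.{u}} {e : Set Ordinal.{u}} (i : ℕ) :
    famOf (join e (joinFam (s.erase i) c)) i = joinFam (insert i (s.erase i)) (Function.update c i e) := by
  ext w
  simp only [famOf, mem_ofPred_eq, mem_join_odd, mem_join_even]
  constructor
  · rintro (⟨j, hj, ξ, hξ, rfl⟩ | ⟨ξ, -, rfl, h⟩)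
    · refine ⟨j, Finset.mem_insert_of_mem hj, ξ, ?_, rfl⟩
      rwa [Function.update_of_ne (Finset.ne_of_mem_erase hj)]
    · exact ⟨i, Finset.mem_insert_self _ _, ξ, by rwa [Function.update_self], rfl⟩
  · rintro ⟨j, hj, ξ, hξ, rfl⟩
    rcases Finset.mem_insert.1 hj with rfl | hj
    · rw [Function.update_self] at hξ
      exact Or.inr ⟨ξ, Order.lt_add_one_iff.2
        ((Ordinal.le_mul_right ξ omega0_pos).trans le_self_add), rfl, hξ⟩
    · rw [Function.update_of_ne (Finset.ne_of_mem_erase hj)] at hξ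
      exact Or.inl ⟨j, hj, ξ, hξ, rfl⟩

/-- The conditions on `Γ` for the computation of a canonical realizer. -/
def RzGood (y : Set Ordinal.{u}) (Γ n : Ordinal.{u}) : Prop :=
  NumCases (fun _ k x _ => (k = 5 ∧ Good {v | 2 * v + 1 ∈ {v | 2 * v + 1 ∈ y}} Γ) ∨
    (k = 6 ∧ Good (famOf y x) Γ) ∨ (k = 7 ∧ Good y Γ)) n

/-- The elements of the canonical realizer that a program has to provide, and of the code of a
witness in the case of an existential formula. -/
def RzOut (y : Set Ordinal.{u}) (Γ n v : Ordinal.{u}) : Prop :=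
  NumCases (fun κ k x m =>
    (k = 5 ∧ RzMem κ {v | 2 * v + 1 ∈ {v | 2 * v + 1 ∈ y}} Γ 0 m v) ∨
    (k = 6 ∧ RzMem κ (famOf y x) Γ 0 m v) ∨
    (k = 7 ∧ ∃ p < Γ, PtrTruth y Γ m (asgUpd 0 x p) ∧ (∀ q < p, ¬ PtrTruth y Γ m (asgUpd 0 x q)) ∧
      ∃ w < v + 1, (v = 2 * w ∧ w ∈ ptrCode y Γ p) ∨
        (v = 2 * w + 1 ∧ RzMem κ y Γ (asgUpd 0 x p) m w))) n

theorem Dfn.rzGood {γ : Type (u + 1)} {C : Ctx γ} {Y : γ → Set Ordinal.{u}} {Γ n : γ → Ordinal.{u}}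
    (hY : SDfn C Y) (hΓ : TDfn C Γ) (hn : TDfn C n) : Dfn C fun g => RzGood (Y g) (Γ g) (n g) :=
  .numCases hn (.or (.and (.eqNat TDfn.var.w.w 5) (.good hY.w.w.w.w.w.snd.snd hΓ.w.w.w.w.w)) (.or
    (.and (.eqNat TDfn.var.w.w 6) (.good (hY.w.w.w.w.w.famOf TDfn.var.w) hΓ.w.w.w.w.w))
    (.and (.eqNat TDfn.var.w.w 7) (.good hY.w.w.w.w.w hΓ.w.w.w.w.w))))

theorem Dfn.rzOut {γ : Type (u + 1)} {C : Ctx γ} {Y : γ → Set Ordinal.{u}} {Γ n v : γ → Ordinal.{u}}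
    (hY : SDfn C Y) (hΓ : TDfn C Γ) (hn : TDfn C n) (hv : TDfn C v) :
    Dfn C fun g => RzOut (Y g) (Γ g) (n g) (v g) := by
  have hY' := hY.w.w.w.w.w
  have hΓ' := hΓ.w.w.w.w.w
  have hv' := hv.w.w.w.w.w
  refine .numCases hn (.or (.and (.eqNat TDfn.var.w.w 5)
    (.rzMem TDfn.var.w.w.w.w hY'.snd.snd hΓ' .zero .var hv')) (.or (.and (.eqNat TDfn.var.w.w 6)
    (.rzMem TDfn.var.w.w.w.w (hY'.famOf TDfn.var.w) hΓ' .zero .var hv')) (.and (.eqNat TDfn.var.w.w 7)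
    (.ex hΓ' (.and (.ptrTruth hY'.w hΓ'.w TDfn.var.w (.asgUpd .zero TDfn.var.w.w .var)) (.and
      (.all .var (.not (.ptrTruth hY'.w.w hΓ'.w.w TDfn.var.w.w (.asgUpd .zero TDfn.var.w.w.w .var))))
      (.ex hv'.w.succ (.or (.and (.eq hv'.w.w (TDfn.two.mul .var))
          (.mem .var (.ptrCode hY'.w.w hΓ'.w.w TDfn.var.w)))
        (.and (.eq hv'.w.w (TDfn.two.mul .var).succ)
          (.rzMem TDfn.var.w.w.w.w.w.w hY'.w.w hΓ'.w.w (.asgUpd .zero TDfn.var.w.w.w TDfn.var.w)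
            TDfn.var.w.w .var))))))))))

/-- The lines of the programs in the canonical realizers. -/
def rzLines : Mode → Program := fun m => (exists_obtains.{u} m
  (Q := fun y _ n Γ => RzGood y Γ n) (ψ := fun v y _ n Γ => RzOut y Γ n v)
  (fun _ _ _ _ _ _ _ hY _ _ hn hΓ => .rzGood hY hΓ hn)
  (fun _ _ _ _ _ _ _ hY _ hn hΓ hv => .rzOut hY hΓ hn hv)).choose

theorem rzLines_spec (m : Mode) {y r : Set Ordinal.{u}} {N : ℕ} (hy : BddAbove y) (hr : BddAbove r)
    (h : ∀ β, ∃ Γ > β, RzGood y Γ N) (h' : ∀ Γ, Below Γ y → RzGood y Γ N →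
      ∀ v, v ∈ r ↔ v < Γ ∧ RzOut y Γ N v) : m.Obtains (withNumeral (rzLines.{u} m) N) y ∅ r :=
  (exists_obtains.{u} m (Q := fun y _ n Γ => RzGood y Γ n) (ψ := fun v y _ n Γ => RzOut y Γ n v)
    (fun _ _ _ _ _ _ _ hY _ _ hn hΓ => .rzGood hY hΓ hn)
    (fun _ _ _ _ _ _ _ hY _ hn hΓ hv => .rzOut hY hΓ hn hv)).choose_spec y ∅ r N hy
    bddAbove_empty hr h fun Γ hΓ _ => h' Γ hΓ

theorem Below.odd {Γ : Ordinal.{u}} {y : Set Ordinal.{u}} (h : Below Γ y) :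
    Below Γ {v | 2 * v + 1 ∈ y} := fun v hv =>
  ((Ordinal.le_mul_right v (by simp : (0 : Ordinal.{u}) < 2)).trans le_self_add).trans_lt (h _ hv)

theorem Below.even {Γ : Ordinal.{u}} {y : Set Ordinal.{u}} (h : Below Γ y) :
    Below Γ {v | 2 * v ∈ y} := fun v hv =>
  (Ordinal.le_mul_right v (by simp : (0 : Ordinal.{u}) < 2)).trans_lt (h _ hv)

theorem Below.famOf {Γ : Ordinal.{u}} {y : Set Ordinal.{u}} (hΓ : Closed Γ) (h : Below Γ y) (i : ℕ) :
    Below Γ (famOf y i) := by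
  rintro w (hw | ⟨ξ, -, rfl, hξ⟩)
  · exact h.odd w hw
  · exact (hΓ.2.1 ξ (h.even ξ hξ)).2 i (natCast_lt_omega0 i)

theorem CodesOn.bddAbove {s : Finset ℕ} {v : ℕ → ZFSet.{u}} {c : ℕ → Set Ordinal.{u}}
    (h : CodesOn s v c) : BddAbove (joinFam s c) := bddAbove_joinFam fun i hi => (h i hi).bddAbove

theorem rzGood_natCast {y : Set Ordinal.{u}} {Γ : Ordinal.{u}} {κ k x m : ℕ} :
    RzGood y Γ (Nat.pair κ (Nat.pair k (Nat.pair x m)) : ℕ) ↔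
      (k = 5 ∧ Good {v | 2 * v + 1 ∈ {v | 2 * v + 1 ∈ y}} Γ) ∨ (k = 6 ∧ Good (famOf y x) Γ) ∨
        (k = 7 ∧ Good y Γ) := by
  rw [RzGood, numCases_natCast]
  norm_cast

theorem rzMem_zero {K : Program} {s : Finset ℕ} {c : ℕ → Set Ordinal.{u}} {v : ℕ → ZFSet.{u}}
    (hc : CodesOn s v c) {Γ : Ordinal.{u}} (hΓ : Good (joinFam s c) Γ) (hY : Below Γ (joinFam s c))
    {φ : Formula} (hφ : HasRz φ) (hs : φ.fv ⊆ s) {β : Ordinal.{u}} (hβ : β < Γ) :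
    RzMem (Encodable.encode K : ℕ) (joinFam s c) Γ 0 φ.code β ↔ β ∈ rz K φ v := by
  obtain ⟨val, h1, h2, -⟩ := hc.exists_ptrVal
  rw [rzMem_iff_mem hΓ hY h1 hφ .nil hβ, rz_congr K φ fun i hi => h2 i (hs hi)]

theorem CodesOn.exists_good {s : Finset ℕ} {c : ℕ → Set Ordinal.{u}} {v : ℕ → ZFSet.{u}}
    (hc : CodesOn s v c) (β : Ordinal.{u}) : ∃ Γ > β, Good (joinFam s c) Γ := by
  obtain ⟨val, h1, -⟩ := hc.exists_ptrVal
  exact OTM.exists_good hc.bddAbove h1 β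

theorem Closed.double_lt {Γ w : Ordinal.{u}} (hΓ : Closed Γ) (hw : w < Γ) : 2 * w < Γ ∧ 2 * w + 1 < Γ := by
  have h : 2 * w < Γ := by
    refine lt_of_le_of_lt ?_ ((hΓ.2.1 w hw).2 0 omega0_pos)
    rw [add_zero]
    gcongr
    exact_mod_cast (natCast_lt_omega0 2).le
  exact ⟨h, (hΓ.2.1 _ h).1⟩

theorem mem_rz_iff {K : Program} {φ : Formula} {v : ℕ → ZFSet.{u}} {Γ β : Ordinal.{u}} (hΓ : Closed Γ) :
    β ∈ rz K φ v ↔ β < Γ ∧ β ∈ rz K φ v :=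
  ⟨fun h => ⟨(rz_below K φ v β h).trans hΓ.1, h⟩, fun h => h.2⟩

/-- The oracle consists of a realizer of the premise and the codes for both sides. The program uses
only the last component, the codes for `ψ`. -/
theorem obtains_rz_imp (m : Mode) {φ ψ : Formula} (hψ : ψ.IsDelta0) {v : ℕ → ZFSet.{u}}
    {c d : ℕ → Set Ordinal.{u}} (hc : CodesOn φ.fv v c) (hd : CodesOn ψ.fv v d) {r : Set Ordinal.{u}}
    (hr : BddAbove r) : m.Obtains (prg (rzLines.{u} m) (φ.imp ψ).code)
      (join r (join (joinFam φ.fv c) (joinFam ψ.fv d))) ∅ (rz (rzLines.{u} m) ψ v) := by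
  refine rzLines_spec m (bddAbove_join hr (bddAbove_join hc.bddAbove hd.bddAbove))
    (rz_below _ ψ v).bddAbove (fun β => ?_) fun Γ hΓ hG β => ?_
  · obtain ⟨Γ, h1, h2⟩ := hd.exists_good β
    refine ⟨Γ, h1, ?_⟩
    rw [Formula.code, rzGood_natCast]
    simpa only [join_snd, true_and] using Or.inl h2
  · rw [Formula.code, rzGood_natCast] at hG
    have hY := hΓ.odd.odd
    simp only [join_snd] at hG hY
    norm_num at hG
    rw [mem_rz_iff hG.1, RzOut, Formula.code, numCases_natCast]
    refine and_congr_right fun hβ => ?_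
    simp only [join_snd]
    norm_num
    exact (rzMem_zero hd hG hY (Or.inl hψ) subset_rfl hβ).symm

theorem codesOn_insert {φ : Formula} {i : ℕ} {v : ℕ → ZFSet.{u}} {c : ℕ → Set Ordinal.{u}}
    (hc : CodesOn (φ.fv.erase i) v c) {a : ZFSet.{u}} {e : Set Ordinal.{u}} (he : IsCode e a) :
    CodesOn (insert i (φ.fv.erase i)) (Function.update v i a) (Function.update c i e) := by
  intro j hj
  by_cases hji : j = i
  · subst hji; simpa using he
  · simp only [Function.update_of_ne hji]
    exact hc j ((Finset.mem_insert.1 hj).resolve_left hji)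

theorem fv_subset_insert (φ : Formula) (i : ℕ) : φ.fv ⊆ insert i (φ.fv.erase i) := by
  intro j hj
  by_cases hji : j = i
  · exact hji ▸ Finset.mem_insert_self _ _
  · exact Finset.mem_insert_of_mem (Finset.mem_erase.2 ⟨hji, hj⟩)

/-- The code of the instance is put at index `i` among the other codes, replacing nothing because
`i` has been erased from the free variables. Then the realizer of the body is computed as usual. -/
theorem obtains_rz_all (m : Mode) {i : ℕ} {φ : Formula} (hφ : HasRz φ) {v : ℕ → ZFSet.{u}}
    {c : ℕ → Set Ordinal.{u}} (hc : CodesOn (φ.all i).fv v c) {a : ZFSet.{u}} {e : Set Ordinal.{u}}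
    (he : IsCode e a) : m.Obtains (prg (rzLines.{u} m) (φ.all i).code)
      (join e (joinFam (φ.all i).fv c)) ∅ (rz (rzLines.{u} m) φ (Function.update v i a)) := by
  have hc' := codesOn_insert hc he
  refine rzLines_spec m (bddAbove_join he.bddAbove hc.bddAbove)
    (rz_below _ φ _).bddAbove (fun β => ?_) fun Γ hΓ hG β => ?_
  · obtain ⟨Γ, h1, h2⟩ := hc'.exists_good β
    refine ⟨Γ, h1, ?_⟩
    rw [Formula.code, rzGood_natCast, Formula.fv, famOf_join]
    exact Or.inr (Or.inl ⟨rfl, h2⟩)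
  · rw [Formula.code, rzGood_natCast, Formula.fv, famOf_join] at hG
    norm_num at hG
    have hY := hΓ.famOf hG.1 i
    rw [Formula.fv, famOf_join] at hY
    rw [mem_rz_iff hG.1, RzOut, Formula.code, numCases_natCast, Formula.fv, famOf_join]
    refine and_congr_right fun hβ => ?_
    norm_num
    exact (rzMem_zero hc' hG hY hφ (fv_subset_insert φ i) hβ).symm

/-- The program chooses the least pointer that represents a witness. This choice, unlike that of an
arbitrary witness, is definable and does not depend on `Γ`. -/
theorem obtains_rz_bex (m : Mode) {i j : ℕ} {φ : Formula} (hij : i ≠ j) (hφ : φ.IsDelta0)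
    {v : ℕ → ZFSet.{u}} (hv : (φ.bex i j).Truth v)
    {c : ℕ → Set Ordinal.{u}} (hc : CodesOn (φ.bex i j).fv v c) :
    ∃ e a, IsCode e a ∧ (Formula.and (.mem i j) φ).Truth (Function.update v i a) ∧
      m.Obtains (prg (rzLines.{u} m) (φ.bex i j).code) (joinFam (φ.bex i j).fv c) ∅
        (join e (rz (rzLines.{u} m) (Formula.and (.mem i j) φ) (Function.update v i a))) := by
  set θ := Formula.and (.mem i j) φ with hθ
  have hθ' : θ.IsDelta0 := .and (.mem i j) hφ
  change CodesOn (θ.ex i).fv v c at hc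
  obtain ⟨val, h1, h2, h3⟩ := hc.exists_ptrVal
  set Y := joinFam (θ.ex i).fv c with hYdef
  have hcong : ∀ p, ∀ k ∈ θ.fv, val (Function.update (fun k : ℕ => (k : Ordinal.{u})) i p k) =
      Function.update v i (val p) k := by
    intro p k hk
    by_cases hki : k = i
    · subst hki; simp
    · simp only [Function.update_of_ne hki]
      exact h2 k (Finset.mem_erase.2 ⟨hki, hk⟩)
  obtain ⟨b, hb⟩ := hc.bddAbove
  have hne : {p | θ.Truth (Function.update v i (val p))}.Nonempty := by
    obtain ⟨a, ha⟩ := hv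
    have hj := ha.1
    simp only [Formula.Truth, Function.update_self, Function.update_of_ne hij.symm] at hj
    rw [← h2 j (by simp [Formula.fv, hθ, hij.symm]), h1] at hj
    obtain ⟨p, -, rfl⟩ := hj
    exact ⟨p, ha⟩
  set p := sInf {p | θ.Truth (Function.update v i (val p))} with hp
  have hpT : θ.Truth (Function.update v i (val p)) := csInf_mem hne
  -- The witness is an element of `v j`, so it is also represented by a pointer that occurs in `Y`.
  -- The least pointer with a witness is at most that one.
  have hpΓ : ∀ Γ, Below Γ Y → p < Γ := by
    intro Γ hΓ
    have hj := hpT.1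
    simp only [Formula.Truth, Function.update_self, Function.update_of_ne hij.symm] at hj
    rw [← h2 j (by simp [Formula.fv, hθ, hij.symm]), h1] at hj
    obtain ⟨q, hq, hq'⟩ := hj
    refine lt_of_le_of_lt (csInf_le' ?_) (hq.left_lt hΓ)
    simpa only [mem_ofPred_eq, hq'] using hpT
  -- `Δ` serves only to name the code. The `Γ` found by the machine gives the same code by
  -- `ptrCode_congr`.
  obtain ⟨Δ, hΔb, hΔ⟩ := hc.exists_good b
  have hY₀ : Below Δ Y := fun w hw => (hb hw).trans_lt hΔb
  have hcode := isCode_ptrCode hΔ.1 hY₀ h1 h3 (hpΓ _ hY₀)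
  refine ⟨_, val p, hcode, hpT, ?_⟩
  refine rzLines_spec m hc.bddAbove (bddAbove_join hcode.bddAbove (rz_below _ θ _).bddAbove)
    (fun β => ?_) fun Γ hΓ hG β => ?_
  · obtain ⟨Γ, h1, h2⟩ := hc.exists_good β
    refine ⟨Γ, h1, ?_⟩
    rw [Formula.bex, Formula.code, rzGood_natCast]
    exact Or.inr (Or.inr ⟨rfl, h2⟩)
  · rw [Formula.bex, Formula.code, rzGood_natCast] at hG
    norm_num at hG
    rw [RzOut, Formula.bex, Formula.code, numCases_natCast, mem_join_iff]
    rw [ptrCode_congr hΔ.1 hY₀ (hpΓ _ hY₀) hG.1 hΓ (hpΓ _ hΓ)]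
    have hT : ∀ q < Γ, (PtrTruth Y Γ θ.code (asgUpd 0 i q) ↔ θ.Truth (Function.update v i (val q))) := by
      intro q hq
      rw [ptrTruth_iff_truth hG hΓ h1 hθ' (.upd i hq .nil), Formula.truth_congr θ (hcong q)]
    have hR : ∀ β < Γ, (RzMem (Encodable.encode (rzLines.{u} m) : ℕ) Y Γ (asgUpd 0 i p) θ.code β ↔
        β ∈ rz (rzLines.{u} m) θ (Function.update v i (val p))) := by
      intro β hβ
      rw [rzMem_iff_mem hG hΓ h1 (Or.inl hθ') (.upd i (hpΓ _ hΓ) .nil) hβ, rz_congr _ θ (hcong p)]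
    norm_num
    constructor
    · rintro ⟨w, hw, h⟩
      have hβ : β < Γ := by
        rcases h with ⟨rfl, h⟩ | ⟨rfl, h⟩
        · exact (hG.1.double_lt (ptrCode_below hG.1 _ h)).1
        · exact (hG.1.double_lt ((rz_below _ _ _ _ h).trans hG.1.1)).2
      refine ⟨hβ, p, hpΓ _ hΓ, (hT p (hpΓ _ hΓ)).2 hpT, fun q hq h' => ?_, w, hw, ?_⟩
      · exact notMem_of_lt_csInf' hq ((hT q (hq.trans (hpΓ _ hΓ))).1 h')
      · rwa [hR w (hw.trans_lt hβ)]
    · rintro ⟨hβ, q, hq, h4, h5, w, hw, h6⟩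
      have hqp : q = p := by
        refine le_antisymm ?_ (csInf_le' ((hT q hq).1 h4))
        by_contra hlt
        exact h5 p (not_le.1 hlt) ((hT p (hpΓ _ hΓ)).2 hpT)
      subst hqp
      rw [hR w (hw.trans_lt hβ)] at h6
      exact ⟨w, hw, h6⟩

end

section

/-! ### Realizability and truth -/

theorem small_tcSingleton (x : ZFSet.{u}) : Small.{u} (tcSingleton x) := by
  have h : tcSingleton x ⊆ {y | y ∈ ZFSet.vonNeumann (x.rank + 1)} := by
    intro y hy
    rw [mem_ofPred_eq, ZFSet.mem_vonNeumann, Order.lt_add_one_iff]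
    induction (show Relation.ReflTransGen _ _ _ from hy) using Relation.ReflTransGen.head_induction_on with
    | refl => exact le_rfl
    | head h1 h2 ih => exact (ZFSet.rank_lt_of_mem h1).le.trans (ih h2)
  have : Small.{u} {y | y ∈ ZFSet.vonNeumann (x.rank + 1)} :=
    inferInstanceAs (Small.{u} (ZFSet.vonNeumann (x.rank + 1)))
  exact small_subset h

/-- The transitive closure is small, so it is in bijection with an ordinal, namely the initial
ordinal of its cardinality. -/
theorem exists_isCode (x : ZFSet.{u}) : ∃ c, IsCode c x := by
  classical
  have := small_tcSingleton x
  have hx : x ∈ tcSingleton x := Relation.ReflTransGen.refl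
  set α : Ordinal.{u} := (Cardinal.mk (Shrink.{u} (tcSingleton x))).ord with hα
  obtain ⟨e⟩ : Nonempty (Iio α ≃ tcSingleton x) := by
    rw [← Cardinal.eq, Cardinal.mk_Iio_ordinal, hα, Cardinal.card_ord]
    exact Cardinal.lift_mk_shrink''.{u + 1, u} (tcSingleton x)
  have h0 : 0 < α := zero_le.trans_lt (e.symm ⟨x, hx⟩).2
  -- A transposition moves `x` to the index `0`.
  let e' := e.trans (Equiv.swap (e ⟨0, h0⟩) ⟨x, hx⟩)
  let f : Ordinal.{u} → ZFSet.{u} := fun ξ => if h : ξ < α then (e' ⟨ξ, h⟩).1 else ∅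
  have hf : ∀ ξ (h : ξ < α), f ξ = (e' ⟨ξ, h⟩).1 := fun ξ h => dif_pos h
  refine ⟨_, α, f, h0, ⟨fun ξ h => ?_, fun ξ h ξ' h' hh => ?_, fun y hy => ?_⟩, ?_, rfl⟩
  · rw [hf ξ h]; exact (e' ⟨ξ, h⟩).2
  · rw [hf ξ h, hf ξ' h'] at hh
    exact congrArg Subtype.val (e'.injective (Subtype.ext hh))
  · refine ⟨(e'.symm ⟨y, hy⟩).1, (e'.symm ⟨y, hy⟩).2, ?_⟩
    rw [hf _ (e'.symm ⟨y, hy⟩).2]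
    simp
  · rw [hf 0 h0]
    simp [e']

theorem exists_codesOn (v : ℕ → ZFSet.{u}) : ∃ c, ∀ s, CodesOn s v c := by
  choose c hc using fun i => exists_isCode (v i)
  exact ⟨c, fun _ i _ => hc i⟩

theorem allows_empty : ∀ k : Params, k.Allows (∅ : Set Ordinal.{u})
  | .none => rfl
  | .ordinal => ⟨0, by ext; simp [ofOrd]⟩
  | .set => bddAbove_empty

theorem bddAbove_ofOrd (α : Ordinal.{u}) : BddAbove (ofOrd α) := ⟨α, fun _ h => le_of_lt h⟩

theorem bddAbove_progPair (P : Program) {ρ : Set Ordinal.{u}} (h : BddAbove ρ) :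
    BddAbove (progPair P ρ) := bddAbove_join (bddAbove_ofOrd _) h

theorem Params.Allows.bddAbove {ρ : Set Ordinal.{u}} : ∀ {k : Params}, k.Allows ρ → BddAbove ρ
  | .none, h => by rw [show ρ = ∅ from h]; exact bddAbove_empty
  | .ordinal, ⟨_, h⟩ => h ▸ bddAbove_ofOrd _
  | .set, h => h

/-- Formulas that are true when they have a realizer. -/
def Sound (m : Mode) (k : Params) (φ : Formula) : Prop :=
  ∀ (v : ℕ → ZFSet.{u}) (r : Set Ordinal.{u}), Realizes m k φ v r → φ.Truth v

/-- True instances of the formula have their canonical realizer as a realizer. -/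
def Complete (m : Mode) (k : Params) (φ : Formula) : Prop :=
  ∀ v : ℕ → ZFSet.{u}, φ.Truth v → Realizes m k φ v (rz (rzLines.{u} m) φ v)

variable {m : Mode} {k : Params}

/-- A realizer speaks about codes only. That every set has a code is what makes it say something
about every instance. -/
theorem Sound.all {φ : Formula} (i : ℕ) (h : Sound.{u} m k φ) : Sound.{u} m k (φ.all i) := by
  rintro v r ⟨P, ρ, -, -, h'⟩ a
  obtain ⟨c, hc⟩ := exists_codesOn v
  obtain ⟨e, he⟩ := exists_isCode a
  obtain ⟨r', -, hr⟩ := h' c (hc _) a e he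
  exact h _ _ hr

theorem Sound.ex {φ : Formula} (i : ℕ) (h : Sound.{u} m k φ) : Sound.{u} m k (φ.ex i) := by
  rintro v r ⟨P, ρ, -, -, h'⟩
  obtain ⟨c, hc⟩ := exists_codesOn v
  obtain ⟨e, r', -, a, -, hr⟩ := h' c (hc _)
  exact ⟨a, h _ _ hr⟩

theorem Sound.and {φ ψ : Formula} (h : Sound.{u} m k φ) (h' : Sound.{u} m k ψ) : Sound.{u} m k (φ.and ψ) := by
  rintro v r ⟨r₀, r₁, -, h0, h1⟩
  exact ⟨h _ _ h0, h' _ _ h1⟩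

theorem Sound.or {φ ψ : Formula} (h : Sound.{u} m k φ) (h' : Sound.{u} m k ψ) : Sound.{u} m k (φ.or ψ) := by
  rintro v r ⟨r', ⟨-, h0⟩ | ⟨-, h0⟩⟩
  · exact Or.inl (h _ _ h0)
  · exact Or.inr (h' _ _ h0)

/-- If the premise is true, its canonical realizer can be fed to the realizer of the implication. -/
theorem Sound.imp {φ ψ : Formula} (h : Complete.{u} m k φ) (h' : Sound.{u} m k ψ) :
    Sound.{u} m k (φ.imp ψ) := by
  rintro v r ⟨P, ρ, -, -, h1⟩ ht
  obtain ⟨c, hc⟩ := exists_codesOn v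
  obtain ⟨r'', -, h2⟩ := h1 c c (hc _) (hc _) _ (rz_below _ _ _).bddAbove (h v ht)
  exact h' _ _ h2

theorem Complete.and {φ ψ : Formula} (h : Complete.{u} m k φ) (h' : Complete.{u} m k ψ) :
    Complete.{u} m k (φ.and ψ) :=
  fun v ht => ⟨_, _, rfl, h v ht.1, h' v ht.2⟩

theorem Complete.or {φ ψ : Formula} (h : Complete.{u} m k φ) (h' : Complete.{u} m k ψ) :
    Complete.{u} m k (φ.or ψ) := by
  intro v ht
  rw [rz]
  split_ifs with h1
  · exact ⟨_, Or.inl ⟨rfl, h v h1⟩⟩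
  · exact ⟨_, Or.inr ⟨rfl, h' v (ht.resolve_left h1)⟩⟩

/-- The realizer of the premise is not inspected; by soundness it guarantees that `φ`, and therefore
`ψ`, is true. Then the canonical realizer of `ψ` is correct. -/
theorem Complete.imp {φ ψ : Formula} (hψ : ψ.IsDelta0) (h : Sound.{u} m k φ) (h' : Complete.{u} m k ψ) :
    Complete.{u} m k (φ.imp ψ) :=
  fun v ht => ⟨_, _, allows_empty k, rfl, fun _ _ hc hd r' hr h1 =>
    ⟨_, obtains_rz_imp m hψ hc hd hr, h' v (ht (h v r' h1))⟩⟩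

theorem Complete.all {φ : Formula} (hφ : HasRz φ) (i : ℕ) (h : Complete.{u} m k φ) :
    Complete.{u} m k (φ.all i) :=
  fun _ ht => ⟨_, _, allows_empty k, rfl, fun _ hc a _ he => ⟨_, obtains_rz_all m hφ hc he, h _ (ht a)⟩⟩

theorem Complete.bex {φ : Formula} (hφ : φ.IsDelta0) {i j : ℕ} (hij : i ≠ j) (h : Complete.{u} m k φ) :
    Complete.{u} m k (φ.bex i j) := by
  refine fun v ht => ⟨_, _, allows_empty k, rfl, fun c hc => ?_⟩
  obtain ⟨e, a, he, ht', h'⟩ := obtains_rz_bex m hij hφ ht hc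
  exact ⟨e, _, h', a, he, Complete.and (φ := .mem i j) (fun _ h => h) h _ ht'⟩

/-- Both properties have to be proved together, because each of them for an implication uses the
other one for the premise. -/
theorem Formula.IsDelta0.sound_complete {φ : Formula} (hφ : φ.IsDelta0) :
    Sound.{u} m k φ ∧ Complete.{u} m k φ := by
  induction hφ with
  | falsum => exact ⟨fun _ _ h => h, fun _ h => h⟩
  | mem i j => exact ⟨fun _ _ h => h, fun _ h => h⟩
  | eq i j => exact ⟨fun _ _ h => h, fun _ h => h⟩
  | and _ _ ih ih' => exact ⟨.and ih.1 ih'.1, .and ih.2 ih'.2⟩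
  | or _ _ ih ih' => exact ⟨.or ih.1 ih'.1, .or ih.2 ih'.2⟩
  | imp _ hψ ih ih' => exact ⟨.imp ih.2 ih'.1, .imp hψ ih.1 ih'.2⟩
  | ball _ hφ ih =>
    exact ⟨.all _ (.imp (fun _ h => h) ih.1),
      .all (Or.inl (.imp (.mem _ _) hφ)) _ (.imp hφ (fun _ _ h => h) ih.2)⟩
  | bex hij hφ ih => exact ⟨.ex _ (.and (fun _ _ h => h) ih.1), .bex hφ hij ih.2⟩

theorem hasRz_alls {φ : Formula} (hφ : φ.IsDelta0) : ∀ l, HasRz (Formula.alls l φ)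
  | [] => Or.inl hφ
  | _ :: _ => Or.inr ⟨_, _, rfl⟩

theorem Sound.alls {φ : Formula} (h : Sound.{u} m k φ) : ∀ l, Sound.{u} m k (Formula.alls l φ)
  | [] => h
  | i :: l => (Sound.alls h l).all i

theorem Sound.exs {φ : Formula} (h : Sound.{u} m k φ) : ∀ l, Sound.{u} m k (Formula.exs l φ)
  | [] => h
  | i :: l => (Sound.exs h l).ex i

theorem complete_alls {φ : Formula} (hφ : φ.IsDelta0) : ∀ l, Complete.{u} m k (Formula.alls l φ)
  | [] => hφ.sound_complete.2
  | i :: l => (complete_alls hφ l).all (hasRz_alls hφ l) i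

theorem Complete.realizable {φ : Formula} (h : Complete.{u} m k φ) {v : ℕ → ZFSet.{u}} (ht : φ.Truth v) :
    Realizable m k φ v := ⟨_, (rz_below _ _ _).bddAbove, h v ht⟩

theorem Sound.truth {φ : Formula} (h : Sound.{u} m k φ) {v : ℕ → ZFSet.{u}} (hr : Realizable m k φ v) :
    φ.Truth v := by
  obtain ⟨r, -, hr⟩ := hr
  exact h v r hr

theorem Formula.IsDelta0.realizable_iff {φ : Formula} (hφ : φ.IsDelta0) {v : ℕ → ZFSet.{u}} :
    Realizable m k φ v ↔ φ.Truth v :=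
  ⟨hφ.sound_complete.1.truth, hφ.sound_complete.2.realizable⟩

theorem Formula.IsPi1.sound {φ : Formula} (hφ : φ.IsPi1) : Sound.{u} m k φ := by
  obtain ⟨l, ψ, hψ, rfl⟩ := hφ
  exact hψ.sound_complete.1.alls l

theorem Formula.IsPi1.realizable_iff {φ : Formula} (hφ : φ.IsPi1) {v : ℕ → ZFSet.{u}} :
    Realizable m k φ v ↔ φ.Truth v := by
  refine ⟨hφ.sound.truth, ?_⟩
  obtain ⟨l, ψ, hψ, rfl⟩ := hφ
  exact (complete_alls hψ l).realizable

theorem Formula.IsPi2.sound {φ : Formula} (hφ : φ.IsPi2) : Sound.{u} m k φ := by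
  obtain ⟨l, _, ⟨l', θ, hθ, rfl⟩, rfl⟩ := hφ
  exact (hθ.sound_complete.1.exs l').alls l

/-! ### Witnesses in parameters -/

theorem exists_obtains_parameter (m : Mode) : ∃ P : Program, ∀ y ρ : Set Ordinal.{u}, BddAbove y →
    BddAbove ρ → m.Obtains P y ρ ρ := by
  obtain ⟨K, hK⟩ := exists_obtains.{u} m (Q := fun _ _ _ _ => True) (ψ := fun v _ ρ _ _ => v ∈ ρ)
    (fun _ _ _ _ _ _ _ _ _ _ _ _ => .triv) (fun _ _ _ _ _ _ _ _ hZ _ _ hv => .mem hv hZ)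
  exact ⟨withNumeral K 0, fun y ρ hy hρ => hK y ρ ρ 0 hy hρ hρ
    (fun β => ⟨β + 1, Order.lt_add_one_iff.2 le_rfl, trivial⟩)
    fun Γ _ h _ v => ⟨fun hv => ⟨h v hv, hv⟩, fun hv => hv.2⟩⟩

/-- A set parameter may be any bounded set, in particular the pair of a code of a witness and a
realizer. The program only has to hand over its parameter. -/
theorem realizable_ex {φ : Formula} {i : ℕ} {v : ℕ → ZFSet.{u}} {a : ZFSet.{u}}
    (h : Realizable m .set φ (Function.update v i a)) : Realizable m .set (φ.ex i) v := by
  obtain ⟨r, hr, h⟩ := h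
  obtain ⟨e, he⟩ := exists_isCode a
  obtain ⟨P, hP⟩ := exists_obtains_parameter.{u} m
  have hb := bddAbove_join he.bddAbove hr
  exact ⟨_, bddAbove_progPair P hb, P, _, hb, rfl, fun c hc => ⟨e, r, hP _ _ hc.bddAbove hb, a, he, h⟩⟩

theorem Formula.IsSigma2.realizable_iff {φ : Formula} (hφ : φ.IsSigma2) {v : ℕ → ZFSet.{u}} :
    Realizable m .set φ v ↔ φ.Truth v := by
  obtain ⟨l, ψ, hψ, rfl⟩ := hφ
  refine ⟨(hψ.sound.exs l).truth, ?_⟩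
  induction l generalizing v with
  | nil => exact hψ.realizable_iff.2
  | cons i l ih =>
    rintro ⟨a, ha⟩
    exact realizable_ex (ih ha)

end

section

/-! ### A program for the realizers of true formulas -/

/-- In contrast to the programs inside realizers, this single program gets the formula as input. The
code of `K` is a constant in the definition, and no numeral is used. -/
theorem exists_outputs_rz (K : Program) : ∃ P : Program, ∀ (φ : Formula) (v : ℕ → ZFSet.{u})
    (c : ℕ → Set Ordinal.{u}), HasRz φ → CodesOn φ.fv v c →
    P.Outputs (join (ofOrd (φ.code : Ordinal.{u})) (joinFam φ.fv c)) ∅ (rz K φ v) := by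
  obtain ⟨L, hL⟩ := exists_computes.{u} (Q := fun y _ _ _ Γ => Good {v | 2 * v + 1 ∈ y} Γ)
    -- The Gödel number is given as an initial segment in the first component of the input; it is
    -- the natural number with the same elements.
    (ψ := fun v y _ _ Γ => ∃ n < omega0, (∀ w < omega0, w < n ↔ 2 * w ∈ y) ∧
      RzMem (Encodable.encode K : ℕ) {v | 2 * v + 1 ∈ y} Γ 0 n v)
    (fun _ _ _ _ _ _ _ hY _ _ _ hΓ => .good hY.snd hΓ)
    (fun _ _ _ _ _ _ _ hY _ _ hΓ hv => .ex .omega (.and (.all .omega (.iff (.lt .var TDfn.var.w)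
      (.mem (TDfn.two.mul .var) hY.w.w))) (.rzMem (.nat _) hY.w.snd hΓ.w .zero .var hv.w)))
  refine ⟨withNumeral L 0, fun φ v c hφ hc => ?_⟩
  refine hL _ _ _ 0 (bddAbove_join (bddAbove_ofOrd _) hc.bddAbove) bddAbove_empty (fun β => ?_)
    fun Γ hΓ _ hG β => ?_
  · simpa only [join_snd] using hc.exists_good β
  · have hY := hΓ.odd
    simp only [join_snd] at hG hY
    rw [mem_rz_iff hG.1]
    refine and_congr_right fun hβ => ?_
    rw [← rzMem_zero hc hG hY hφ subset_rfl hβ]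
    simp only [join_snd, mem_join_even]
    constructor
    · exact fun h => ⟨_, natCast_lt_omega0 _, fun w _ => Iff.rfl, h⟩
    · rintro ⟨n, hn, h1, h2⟩
      have : n = φ.code := by
        refine eq_of_forall_lt_iff fun w => ?_
        by_cases hw : w < omega0
        · exact h1 w hw
        · exact iff_of_false (fun h => hw (h.trans hn)) fun h => hw (h.trans (natCast_lt_omega0 _))
      rwa [← this]

end

section

/-! ### Bounds on computations -/

/-- The bound on the states keeps the supremum in `ℕ` from degenerating to its default value. It is
then attained, so the limit state is eventually a lower bound and recurs cofinally often. -/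
theorem limitConfig_state {t : Ordinal.{u}} (ht : 0 < t) {C : Ordinal.{u} → Config.{u}} {B : ℕ}
    (hB : ∀ s < t, (C s).state ≤ B) :
    (∃ r < t, ∀ s < t, r ≤ s → (limitConfig t fun s => C s.1).state ≤ (C s).state) ∧
      ∀ r < t, ∃ s < t, r ≤ s ∧ (C s).state = (limitConfig t fun s => C s.1).state := by
  let f : Iio t → ℕ := fun r => sInf ((fun s : Iio t => (C s.1).state) '' {s | r ≤ s ∧ s ∈ Set.univ})
  have hq : (limitConfig t fun s => C s.1).state = ⨆ r, f r := rfl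
  have hmem : ∀ r, f r ∈ (fun s : Iio t => (C s.1).state) '' {s | r ≤ s ∧ s ∈ Set.univ} :=
    fun r => Nat.sInf_mem ⟨_, r, ⟨le_rfl, trivial⟩, rfl⟩
  have hbdd : BddAbove (range f) := by
    refine ⟨B, ?_⟩
    rintro _ ⟨r, rfl⟩
    obtain ⟨s, -, hs⟩ := hmem r
    rw [← hs]
    exact hB s.1 s.2
  have hle : ∀ r s : Iio t, r ≤ s → f r ≤ (C s.1).state := fun r s h => Nat.sInf_le ⟨s, ⟨h, trivial⟩, rfl⟩
  obtain ⟨r₀, hr₀⟩ : (⨆ r, f r) ∈ range f := Nat.sSup_mem ⟨_, ⟨⟨0, ht⟩, rfl⟩⟩ hbdd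
  rw [hq]
  refine ⟨⟨r₀.1, r₀.2, fun s hs h => ?_⟩, fun r hr => ?_⟩
  · rw [← hr₀]
    exact hle r₀ ⟨s, hs⟩ h
  · obtain ⟨s, ⟨h1, -⟩, h2⟩ := hmem (max r₀ ⟨r, hr⟩)
    refine ⟨s.1, s.2, (le_max_right _ _).trans h1, le_antisymm ?_ ?_⟩
    · change (C s.1).state = _ at h2
      rw [h2]
      exact le_ciSup hbdd _
    · rw [← hr₀]
      exact hle r₀ s ((le_max_left _ _).trans h1)

/-- In this form the head position at a limit can be defined with quantifiers over earlier times,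
without suprema of infima. -/
theorem limitConfig_head {t : Ordinal.{u}} (ht : 0 < t) {C : Ordinal.{u} → Config.{u}} {B : ℕ}
    (hB : ∀ s < t, (C s).state ≤ B) (i : ℕ) :
    IsLeast {a | ∀ r < t, ∃ s < t, r ≤ s ∧ (C s).state = (limitConfig t fun s => C s.1).state ∧
      (C s).head i ≤ a} ((limitConfig t fun s => C s.1).head i) := by
  have hcof := (limitConfig_state ht hB).2
  set q := (limitConfig t fun s => C s.1).state with hq
  let f : Iio t → Ordinal.{u} := fun r =>
    sInf ((fun s : Iio t => (C s.1).head i) '' {s | r ≤ s ∧ s ∈ {s : Iio t | (C s.1).state = q}})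
  have hh : (limitConfig t fun s => C s.1).head i = ⨆ r, f r := rfl
  have hmem : ∀ r, f r ∈ (fun s : Iio t => (C s.1).head i) ''
      {s | r ≤ s ∧ s ∈ {s : Iio t | (C s.1).state = q}} := by
    intro r
    obtain ⟨s, hs, h1, h2⟩ := hcof r.1 r.2
    exact csInf_mem ⟨_, ⟨s, hs⟩, ⟨h1, h2⟩, rfl⟩
  rw [hh]
  refine ⟨fun r hr => ?_, fun a ha => ciSup_le' fun r => ?_⟩
  · obtain ⟨s, ⟨h1, h2⟩, h3⟩ := hmem ⟨r, hr⟩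
    exact ⟨s.1, s.2, h1, h2, h3.trans_le (le_ciSup (f := f) bddAbove_of_small _)⟩
  · obtain ⟨s, hs, h1, h2, h3⟩ := ha r.1 r.2
    have : f r ≤ (C s).head i := csInf_le' ⟨⟨s, hs⟩, ⟨h1, h2⟩, rfl⟩
    exact this.trans h3

theorem moveLeft_le (h : Ordinal.{u}) : moveLeft h ≤ h := by
  unfold moveLeft
  split_ifs with hs
  · conv_rhs => rw [hs.choose_spec]
    exact le_self_add
  · exact zero_le

theorem Program.step_none {P : Program} {C : Config.{u}} (h : P[C.state]? = none) : P.step C = C := by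
  unfold Program.step
  rw [h]

open Classical in
theorem Program.step_some {P : Program} {C : Config.{u}} {l : Line} (h : P[C.state]? = some l) :
    P.step C = C.act l.1 (if C.head l.1 ∈ C.tape l.1 then l.2.2 else l.2.1) := by
  unfold Program.step
  rw [h]
  obtain ⟨i, a, a'⟩ := l
  dsimp only
  split_ifs <;> rfl

theorem Program.exists_state_bound : ∀ P : Program, ∃ B, ∀ l ∈ P, l.2.1.2.2 ≤ B ∧ l.2.2.2.2 ≤ B
  | [] => ⟨0, by simp⟩
  | l :: P => by
    obtain ⟨B, hB⟩ := exists_state_bound P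
    refine ⟨max B (max l.2.1.2.2 l.2.2.2.2), fun l' hl' => ?_⟩
    rcases List.mem_cons.1 hl' with rfl | h
    · exact ⟨by simp, by simp⟩
    · exact ⟨(hB l' h).1.trans (le_max_left _ _), (hB l' h).2.trans (le_max_left _ _)⟩

section

variable {P : Program} {x ρ : Set Ordinal.{u}}

theorem run_zero : P.run x ρ 0 = initConfig x ρ := by
  unfold Program.run; rw [limitRecOn_zero]

theorem exists_run_state_le (P : Program) (x ρ : Set Ordinal.{u}) : ∃ B, ∀ t, (P.run x ρ t).state ≤ B := by
  obtain ⟨B, hB⟩ := P.exists_state_bound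
  refine ⟨B, fun t => ?_⟩
  induction t using Ordinal.limitRecOn with
  | zero => rw [run_zero]; exact Nat.zero_le _
  | add_one t ih =>
    rw [(isRun_run P x ρ).step]
    rcases h : P[(P.run x ρ t).state]? with _ | l
    · rwa [Program.step_none h]
    · rw [Program.step_some h]
      have := hB l (List.mem_of_getElem? h)
      simp only [Config.act]
      split_ifs
      exacts [this.2, this.1]
  | limit t ht ih =>
    obtain ⟨s, hs, -, h⟩ := (limitConfig_state ht.bot_lt ih).2 0 ht.bot_lt
    rw [(isRun_run P x ρ).limit t ht, ← h]
    exact ih s hs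

theorem run_head_le (t : Ordinal.{u}) (i : ℕ) : (P.run x ρ t).head i ≤ t := by
  induction t using Ordinal.limitRecOn with
  | zero => rw [run_zero]; exact le_rfl
  | add_one t ih =>
    rw [(isRun_run P x ρ).step]
    rcases h : P[(P.run x ρ t).state]? with _ | l
    · rw [Program.step_none h]; exact ih.trans le_self_add
    · rw [Program.step_some h]
      simp only [Config.act, Function.update_apply]
      split_ifs with h1
      · subst h1
        split
        · exact ih.trans le_self_add
        · gcongr
        · exact (moveLeft_le _).trans (ih.trans le_self_add)
      · subst h1
        split
        · exact ih.trans le_self_add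
        · gcongr
        · exact (moveLeft_le _).trans (ih.trans le_self_add)
      all_goals exact ih.trans le_self_add
  | limit t ht ih =>
    obtain ⟨B, hB⟩ := exists_run_state_le P x ρ
    rw [(isRun_run P x ρ).limit t ht]
    refine (limitConfig_head ht.bot_lt (fun s _ => hB s) i).2 fun r hr => ?_
    obtain ⟨s, hs, h1, h2⟩ := (limitConfig_state ht.bot_lt fun s _ => hB s).2 r hr
    exact ⟨s, hs, h1, h2, (ih s hs).trans hs.le⟩

/-- Heads are bounded by the time, so a computation cannot mark a cell beyond `Γ` before time `Γ`.
This allows a simulation inside `Γ`. -/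
theorem run_tape_below {Γ : Ordinal.{u}} (hx : Below Γ x) (hρ : Below Γ ρ) (i : ℕ) (t : Ordinal.{u})
    (ht : t < Γ) : Below Γ ((P.run x ρ t).tape i) := by
  induction t using Ordinal.limitRecOn generalizing i with
  | zero =>
    rw [run_zero]
    match i with
    | 0 => exact hx
    | 1 => exact fun ξ ⟨η, hη, h⟩ => h.trans_lt (hx η hη)
    | 2 => exact hρ
    | 3 => exact fun ξ ⟨η, hη, h⟩ => h.trans_lt (hρ η hη)
    | n + 4 => exact fun ξ h => absurd h (notMem_empty _)
  | add_one t ih =>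
    have ht' : t < Γ := lt_of_le_of_lt le_self_add ht
    rw [(isRun_run P x ρ).step]
    rcases h : P[(P.run x ρ t).state]? with _ | l
    · rw [Program.step_none h]; exact ih i ht'
    · rw [Program.step_some h]
      simp only [Config.act, Function.update_apply]
      have hh := (run_head_le (P := P) (x := x) (ρ := ρ) t l.1).trans_lt ht'
      have hins : Below Γ (insert ((P.run x ρ t).head l.1) ((P.run x ρ t).tape l.1)) := by
        rintro ξ (rfl | hξ)
        exacts [hh, ih _ ht' ξ hξ]
      have hdiff : Below Γ ((P.run x ρ t).tape l.1 \ {(P.run x ρ t).head l.1}) :=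
        fun ξ hξ => ih _ ht' ξ hξ.1
      split_ifs <;> first | assumption | exact ih _ ht'
  | limit t hl ih =>
    rw [(isRun_run P x ρ).limit t hl]
    rintro ξ ⟨r, hr⟩
    exact ih r.1 r.2 i (r.2.trans ht) ξ (hr r le_rfl)

theorem run_eq_of_halted {t s : Ordinal.{u}} (h : P.length ≤ (P.run x ρ t).state) (hts : t ≤ s) :
    P.run x ρ s = P.run x ρ t := by
  induction s using Ordinal.limitRecOn with
  | zero => rw [le_antisymm hts zero_le]
  | add_one s ih =>
    rcases hts.lt_or_eq with h1 | rfl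
    · rw [(isRun_run P x ρ).step, ih (Order.lt_add_one_iff.1 h1),
        Program.step_none (List.getElem?_eq_none h)]
    · rfl
  | limit s hs ih =>
    rcases hts.lt_or_eq with h1 | rfl
    · obtain ⟨B, hB⟩ := exists_run_state_le P x ρ
      have hB' : ∀ r < s, (P.run x ρ r).state ≤ B := fun r _ => hB r
      obtain ⟨-, h3⟩ := limitConfig_state hs.bot_lt hB'
      have hstate : (P.run x ρ s).state = (P.run x ρ t).state := by
        rw [(isRun_run P x ρ).limit s hs]
        obtain ⟨r, hr, h4, h5⟩ := h3 t h1
        rw [← h5, ih r hr h4]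
      refine Config.eq_of hstate (fun i => ?_) fun i => ?_
      · have hl := limitConfig_head hs.bot_lt hB' i
        rw [← (isRun_run P x ρ).limit s hs] at hl
        refine le_antisymm (hl.2 fun r hr => ?_) ?_
        · have hm := max_lt h1 hr
          refine ⟨max t r, hm, le_max_right _ _, ?_, ?_⟩
          · rw [ih _ hm (le_max_left _ _), hstate]
          · rw [ih _ hm (le_max_left _ _)]
        · obtain ⟨r, hr, h4, -, h5⟩ := hl.1 t h1
          rwa [ih r hr h4] at h5
      · rw [(isRun_run P x ρ).limit s hs]
        ext ξ
        constructor
        · rintro ⟨r, hr⟩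
          have hm := max_lt h1 r.2
          have := hr ⟨_, hm⟩ (show r.1 ≤ _ from le_max_right _ _)
          change ξ ∈ (P.run x ρ (max t r.1)).tape i at this
          rwa [ih _ hm (le_max_left _ _)] at this
        · intro hξ
          refine ⟨⟨t, h1⟩, fun r hr => ?_⟩
          change ξ ∈ (P.run x ρ r.1).tape i
          rwa [ih r.1 r.2 hr]
    · rfl

/-- A halting configuration is kept forever, at limits too, so any two halting times show the same
tapes. -/
theorem Program.Outputs.unique {y y' : Set Ordinal.{u}} (h : P.Outputs x ρ y) (h' : P.Outputs x ρ y') :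
    y = y' := by
  obtain ⟨t, h1, rfl⟩ := h
  obtain ⟨t', h2, rfl⟩ := h'
  rcases le_total t t' with h | h
  · rw [run_eq_of_halted h1 h]
  · rw [run_eq_of_halted h2 h]

end

end

section

/-! ### Simulation of programs -/

/-- What a program does in a state after reading a symbol, in a code. -/
def lookup (N : ℕ) : ℕ :=
  Encodable.encode ((((Encodable.decode N.unpair.1 : Option Program).getD [])[N.unpair.2.unpair.1]?).map
    fun l => (l.1, bif N.unpair.2.unpair.2 == 0 then l.2.1 else l.2.2))

theorem primrec_lookup : Nat.Primrec lookup := by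
  rw [← Primrec.nat_iff]
  have hK : Primrec fun N : ℕ => (Encodable.decode N.unpair.1 : Option Program).getD [] :=
    Primrec.option_getD.comp (Primrec.decode.comp (Primrec.fst.comp Primrec.unpair))
      (Primrec.const ([] : Program))
  have h2 : Primrec fun N : ℕ => N.unpair.2.unpair := Primrec.unpair.comp (Primrec.snd.comp Primrec.unpair)
  refine Primrec.encode.comp (Primrec.option_map
    (Primrec.list_getElem?.comp hK (Primrec.fst.comp h2)) ?_)
  refine (Primrec.fst.comp Primrec.snd).pair (Primrec.cond ?_ ?_ ?_)
  · exact Primrec.beq.comp (Primrec.snd.comp (h2.comp Primrec.fst)) (Primrec.const 0)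
  · exact Primrec.fst.comp (Primrec.snd.comp Primrec.snd)
  · exact Primrec.snd.comp (Primrec.snd.comp Primrec.snd)

/-- The ordinal `d` describes a part of a configuration. -/
def CfgCode (C : Config.{u}) (d : Ordinal.{u}) : Prop :=
  d = opair 0 C.state ∨ ∃ i : ℕ, ∃ a : Ordinal.{u},
    (d = opair 1 (opair i a) ∧ a = C.head i) ∨ (d = opair 2 (opair i a) ∧ a ∈ C.tape i)

/-- The initial configuration. -/
def SimInit (x ρ : Set Ordinal.{u}) (Γ d : Ordinal.{u}) : Prop :=
  d = opair 0 0 ∨ ∃ i < omega0, ∃ a < Γ, (d = opair 1 (opair i a) ∧ a = 0) ∨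
    (d = opair 2 (opair i a) ∧ ((i = 0 ∧ a ∈ x) ∨ (i = 1 ∧ ∃ η < Γ, η ∈ x ∧ a ≤ η) ∨
      (i = 2 ∧ a ∈ ρ) ∨ (i = 3 ∧ ∃ η < Γ, η ∈ ρ ∧ a ≤ η)))

/-- The effect of an action. -/
def SimAct (S : Ordinal.{u} → Prop) (Γ j w m n h d : Ordinal.{u}) : Prop :=
  d = opair 0 n ∨ ∃ i < omega0, ∃ a < Γ,
    (d = opair 1 (opair i a) ∧ ((¬ i = j ∧ S d) ∨ (i = j ∧ ((m = 0 ∧ a = h) ∨ (m = 2 ∧ a = h + 1) ∨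
      (m = 1 ∧ (h = a + 1 ∨ (a = 0 ∧ ∀ b < h, ¬ h = b + 1))))))) ∨
    (d = opair 2 (opair i a) ∧ ((¬ (i = j ∧ a = h) ∧ S d) ∨ ((i = j ∧ a = h) ∧ w = 1)))

/-- The successor configuration. -/
def SimStep (κ Γ : Ordinal.{u}) (S : Ordinal.{u} → Prop) (d : Ordinal.{u}) : Prop :=
  ∃ q < omega0, S (opair 0 q) ∧ ∃ b < 2, (NatGraph lookup (opair κ (opair q b)) 0 ∧ S d) ∨
    ∃ j < omega0, ∃ w < omega0, ∃ m < omega0, ∃ n < omega0,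
      NatGraph lookup (opair κ (opair q b)) (opair j (opair w (opair m n)) + 1) ∧
      ∃ h < Γ, S (opair 1 (opair j h)) ∧ (b = 1 ↔ S (opair 2 (opair j h))) ∧ SimAct S Γ j w m n h d

/-- The head `i` is at `a` or further left again and again in the state `q`. -/
def SimOften (R : Ordinal.{u} → Ordinal.{u} → Prop) (t q i a : Ordinal.{u}) : Prop :=
  ∀ r < t, ∃ s < t, r ≤ s ∧ R s (opair 0 q) ∧ ∃ h < a + 1, R s (opair 1 (opair i h))

/-- The configuration at a limit. -/
def SimLim (Γ : Ordinal.{u}) (R : Ordinal.{u} → Ordinal.{u} → Prop) (t d : Ordinal.{u}) : Prop :=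
  ∃ q < omega0, ((∃ r < t, ∀ s < t, r ≤ s → ∀ q' < q, ¬ R s (opair 0 q')) ∧
    ∀ r < t, ∃ s < t, r ≤ s ∧ R s (opair 0 q)) ∧
    (d = opair 0 q ∨ ∃ i < omega0, ∃ a < Γ,
      (d = opair 1 (opair i a) ∧ SimOften R t q i a ∧ ∀ b < a, ¬ SimOften R t q i b) ∨
      (d = opair 2 (opair i a) ∧ ∃ r < t, ∀ s < t, r ≤ s → R s d))

/-- The recursion for a computation. -/
def SimBody (κ : Ordinal.{u}) (x ρ : Set Ordinal.{u}) (Γ : Ordinal.{u})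
    (R : Ordinal.{u} → Ordinal.{u} → Prop) (t d : Ordinal.{u}) : Prop :=
  (t = 0 ∧ SimInit x ρ Γ d) ∨ (∃ s < t, t = s + 1 ∧ SimStep κ Γ (R s) d) ∨
    (¬ t = 0 ∧ (∀ s < t, s + 1 < t) ∧ SimLim Γ R t d)

/-- The computation of the program with code `κ`. -/
def Sim (κ : Ordinal.{u}) (x ρ : Set Ordinal.{u}) (Γ t d : Ordinal.{u}) : Prop :=
  d < Γ ∧ RecRel Γ (SimBody κ x ρ Γ) t d

section

variable {γ : Type (u + 1)} {C : Ctx γ} {x ρ : γ → Set Ordinal.{u}} {κ Γ t d j w m n h q i a : γ → Ordinal.{u}}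

theorem Dfn.simInit (hx : SDfn C x) (hρ : SDfn C ρ) (hΓ : TDfn C Γ) (hd : TDfn C d) :
    Dfn C fun g => SimInit (x g) (ρ g) (Γ g) (d g) := by
  have hd' := hd.w.w
  have hv : TDfn C.ext.ext fun p => p.1.2 := TDfn.var.w
  have hn : ∀ {γ : Type (u + 1)} {C : Ctx γ} {x : γ → Set Ordinal.{u}} {Γ a : γ → Ordinal.{u}},
      SDfn C x → TDfn C Γ → TDfn C a → Dfn C fun g => ∃ η < Γ g, η ∈ x g ∧ a g ≤ η :=
    fun hx hΓ ha => .ex hΓ (.and (.mem .var hx.w) (.le ha.w .var))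
  refine .or (.eq hd (.pair .zero .zero)) (.ex .omega (.ex hΓ.w (.or
    (.and (.eq hd' (.pair .one (hv.pair .var))) (.eq .var .zero))
    (.and (.eq hd' (.pair .two (hv.pair .var))) (.or (.and (.eq hv .zero) (.mem .var hx.w.w))
      (.or (.and (.eq hv .one) (hn hx.w.w hΓ.w.w .var)) (.or (.and (.eq hv .two) (.mem .var hρ.w.w))
        (.and (.eqNat hv 3) (hn hρ.w.w hΓ.w.w .var)))))))))

theorem Dfn.simAct {S : γ → Ordinal.{u} → Prop} (hS : Dfn C.ext fun p => S p.1 p.2) (hΓ : TDfn C Γ)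
    (hj : TDfn C j) (hw : TDfn C w) (hm : TDfn C m) (hn : TDfn C n) (hh : TDfn C h) (hd : TDfn C d) :
    Dfn C fun g => SimAct (S g) (Γ g) (j g) (w g) (m g) (n g) (h g) (d g) := by
  have hd' := hd.w.w
  have hv : TDfn C.ext.ext fun p => p.1.2 := TDfn.var.w
  have hS' : Dfn C.ext.ext fun p => S p.1.1 (d p.1.1) :=
    .app (R := fun p => S p.1.1) (hS.subst (Ext.wk.trans .wk).lift) hd'
  refine .or (.eq hd (.pair .zero hn)) (.ex .omega (.ex hΓ.w (.or
    (.and (.eq hd' (.pair .one (hv.pair .var))) (.or (.and (.not (.eq hv hj.w.w)) hS')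
      (.and (.eq hv hj.w.w) (.or (.and (.eq hm.w.w .zero) (.eq .var hh.w.w)) (.or
        (.and (.eq hm.w.w .two) (.eq .var hh.w.w.succ)) (.and (.eq hm.w.w .one) (.or
          (.eq hh.w.w TDfn.var.succ) (.and (.eq .var .zero) (.all hh.w.w (.not
            (.eq hh.w.w.w TDfn.var.succ)))))))))))
    (.and (.eq hd' (.pair .two (hv.pair .var))) (.or
      (.and (.not (.and (.eq hv hj.w.w) (.eq .var hh.w.w))) hS')
      (.and (.and (.eq hv hj.w.w) (.eq .var hh.w.w)) (.eq hw.w.w .one)))))))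

theorem Dfn.simStep {S : γ → Ordinal.{u} → Prop} (hκ : TDfn C κ) (hΓ : TDfn C Γ)
    (hS : Dfn C.ext fun p => S p.1 p.2) (hd : TDfn C d) :
    Dfn C fun g => SimStep (κ g) (Γ g) (S g) (d g) := by
  have hS7 := hS.subst (Ext.lift (Ext.wk.trans (Ext.wk.trans (Ext.wk.trans (Ext.wk.trans
    (Ext.wk.trans (Ext.wk.trans .wk)))))))
  refine .ex .omega (.and (.app (hS.subst (Ext.lift .wk)) (.pair .zero .var)) (.ex .two (.or
    (.and (.natGraph primrec_lookup (hκ.w.w.pair (TDfn.var.w.pair .var)) .zero)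
      (.app (hS.subst (Ext.lift (Ext.wk.trans .wk))) hd.w.w))
    (.ex .omega (.ex .omega (.ex .omega (.ex .omega (.and
      (.natGraph primrec_lookup (hκ.w.w.w.w.w.w.pair (TDfn.var.w.w.w.w.w.pair TDfn.var.w.w.w.w))
        (TDfn.var.w.w.w.pair (TDfn.var.w.w.pair (TDfn.var.w.pair .var))).succ)
      (.ex hΓ.w.w.w.w.w.w (.and (.app hS7 (.pair .one (TDfn.var.w.w.w.w.pair .var))) (.and
        (.iff (.eq TDfn.var.w.w.w.w.w .one) (.app hS7 (.pair .two (TDfn.var.w.w.w.w.pair .var))))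
        (.simAct hS7 hΓ.w.w.w.w.w.w.w TDfn.var.w.w.w.w TDfn.var.w.w.w TDfn.var.w.w TDfn.var.w .var
          hd.w.w.w.w.w.w.w))))))))))))

theorem Dfn.simOften {R : γ → Ordinal.{u} → Ordinal.{u} → Prop}
    (hR : Dfn C.ext.ext fun p => R p.1.1 p.1.2 p.2) (ht : TDfn C t) (hq : TDfn C q) (hi : TDfn C i)
    (ha : TDfn C a) : Dfn C fun g => SimOften (R g) (t g) (q g) (i g) (a g) :=
  .all ht (.ex ht.w (.and (.le TDfn.var.w .var) (.and
    (.app₂ (hR.subst (Ext.wk.trans .wk).lift.lift) .var (.pair .zero hq.w.w))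
    (.ex ha.w.w.succ (.app₂ (hR.subst (Ext.wk.trans (Ext.wk.trans .wk)).lift.lift) TDfn.var.w
      (.pair .one (hi.w.w.w.pair .var)))))))

theorem Dfn.simLim {R : γ → Ordinal.{u} → Ordinal.{u} → Prop} (hΓ : TDfn C Γ)
    (hR : Dfn C.ext.ext fun p => R p.1.1 p.1.2 p.2) (ht : TDfn C t) (hd : TDfn C d) :
    Dfn C fun g => SimLim (Γ g) (R g) (t g) (d g) := by
  have e3 : Ext C C.ext.ext.ext fun p => p.1.1.1 := Ext.wk.trans (Ext.wk.trans .wk)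
  have e4 : Ext C C.ext.ext.ext.ext fun p => p.1.1.1.1 := e3.trans .wk
  have e5 : Ext C C.ext.ext.ext.ext.ext fun p => p.1.1.1.1.1 := e4.trans .wk
  refine .ex .omega (.and (.and
    (.ex ht.w (.all ht.w.w (.imp (.le TDfn.var.w .var) (.all TDfn.var.w.w (.not
      (.app₂ (hR.subst e4.lift.lift) TDfn.var.w (.pair .zero .var)))))))
    (.all ht.w (.ex ht.w.w (.and (.le TDfn.var.w .var)
      (.app₂ (hR.subst e3.lift.lift) .var (.pair .zero TDfn.var.w.w))))))
    (.or (.eq hd.w (.pair .zero .var)) (.ex .omega (.ex hΓ.w.w (.or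
      (.and (.eq hd.w.w.w (.pair .one (TDfn.var.w.pair .var))) (.and
        (.simOften (hR.subst e3.lift.lift) ht.w.w.w TDfn.var.w.w TDfn.var.w .var)
        (.all .var (.not (.simOften (hR.subst e4.lift.lift) ht.w.w.w.w TDfn.var.w.w.w TDfn.var.w.w .var)))))
      (.and (.eq hd.w.w.w (.pair .two (TDfn.var.w.pair .var))) (.ex ht.w.w.w (.all ht.w.w.w.w (.imp
        (.le TDfn.var.w .var) (.app₂ (hR.subst e5.lift.lift) .var hd.w.w.w.w.w))))))))))

theorem Dfn.sim (hκ : TDfn C κ) (hx : SDfn C x) (hρ : SDfn C ρ) (hΓ : TDfn C Γ) (ht : TDfn C t)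
    (hd : TDfn C d) : Dfn C fun g => Sim (κ g) (x g) (ρ g) (Γ g) (t g) (d g) := by
  refine .recRel hΓ ht hd fun Q hQ => ?_
  refine .or (.and (.eq TDfn.var.w .zero) (.simInit hx.wS.w.w.w hρ.wS.w.w.w hΓ.wS.w.w.w .var)) (.or
    (.ex TDfn.var.w (.and (.eq TDfn.var.w.w TDfn.var.succ)
      (.simStep hκ.wS.w.w.w.w hΓ.wS.w.w.w.w ?_ TDfn.var.w)))
    (.and (.not (.eq TDfn.var.w .zero)) (.and (.all TDfn.var.w (.lt TDfn.var.succ TDfn.var.w.w))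
      (.simLim hΓ.wS.w.w.w hQ TDfn.var.w .var))))
  exact .app₂ (hQ.subst (Ext.wk.trans .wk).lift.lift) TDfn.var.w .var

end

end

/-! ### Correctness of the simulation. -/

section

theorem exists_lt_two {F : Ordinal.{u} → Prop} : (∃ b < 2, F b) ↔ F 0 ∨ F 1 := by
  constructor
  · rintro ⟨b, hb, h⟩
    have hb' : b ≤ 1 := Order.lt_add_one_iff.1 (by rwa [one_add_one_eq_two])
    rcases Order.le_one_iff.1 hb' with rfl | rfl
    exacts [Or.inl h, Or.inr h]
  · rintro (h | h)
    exacts [⟨0, by simp, h⟩, ⟨1, one_lt_two, h⟩]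

theorem lookup_none {P : Program} {q b : ℕ} (h : P[q]? = none) :
    lookup (Nat.pair (Encodable.encode P) (Nat.pair q b)) = 0 := by
  simp [lookup, h]

theorem lookup_some {P : Program} {q b : ℕ} {l : Line} (h : P[q]? = some l) {a : Action}
    (ha : a = bif b == 0 then l.2.1 else l.2.2) :
    lookup (Nat.pair (Encodable.encode P) (Nat.pair q b)) = Nat.pair l.1
      (Nat.pair (Encodable.encode a.1) (Nat.pair (Encodable.encode a.2.1) a.2.2)) + 1 := by
  subst ha
  simp only [lookup, Nat.unpair_pair, Encodable.encodek, Option.getD_some, h, Option.map_some,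
    Encodable.encode_some, Nat.succ_eq_add_one]
  rfl

theorem cfgCode_state {C : Config.{u}} {q : Ordinal.{u}} : CfgCode C (opair 0 q) ↔ q = C.state := by
  simp [CfgCode, opair_inj]

theorem cfgCode_head {C : Config.{u}} {i : ℕ} {a : Ordinal.{u}} :
    CfgCode C (opair 1 (opair i a)) ↔ a = C.head i := by
  simp only [CfgCode, opair_inj, one_ne_zero, false_and, true_and, false_or]
  constructor
  · rintro ⟨j, b, ⟨⟨h1, rfl⟩, h3⟩ | ⟨⟨h, -⟩, -⟩⟩
    · rw [Nat.cast_inj.1 h1, ← h3]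
    · norm_num at h
  · rintro rfl
    exact ⟨i, _, Or.inl ⟨⟨rfl, rfl⟩, rfl⟩⟩

theorem cfgCode_tape {C : Config.{u}} {i : ℕ} {a : Ordinal.{u}} :
    CfgCode C (opair 2 (opair i a)) ↔ a ∈ C.tape i := by
  simp only [CfgCode, opair_inj, true_and]
  constructor
  · rintro (⟨h, -⟩ | ⟨j, b, ⟨⟨h, -⟩, -⟩ | ⟨⟨h1, rfl⟩, h3⟩⟩)
    · norm_num at h
    · norm_num at h
    · rwa [Nat.cast_inj.1 h1]
  · intro h
    exact Or.inr ⟨i, _, Or.inr ⟨⟨rfl, rfl⟩, h⟩⟩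

/-- The heads and the cells with the symbol `1` are below `Γ`. -/
def Config.Within (C : Config.{u}) (Γ : Ordinal.{u}) : Prop :=
  ∀ i, C.head i < Γ ∧ Below Γ (C.tape i)

theorem CfgCode.lt {C : Config.{u}} {Γ d : Ordinal.{u}} (hC : C.Within Γ) (hΓ : Closed Γ)
    (h : CfgCode C d) : d < Γ := by
  have h1 : ∀ n : ℕ, (n : Ordinal.{u}) < Γ := fun n => (natCast_lt_omega0 n).trans hΓ.1
  rcases h with rfl | ⟨i, a, ⟨rfl, rfl⟩ | ⟨rfl, h⟩⟩
  · exact hΓ.2.2 _ (by simpa using h1 0) _ (h1 _)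
  · exact hΓ.2.2 _ (by simpa using h1 1) _ (hΓ.2.2 _ (h1 _) _ (hC i).1)
  · exact hΓ.2.2 _ (by simpa using h1 2) _ (hΓ.2.2 _ (h1 _) _ ((hC i).2 a h))

/-- A way to show that a relation describes a configuration. -/
theorem cfgCode_iff {C : Config.{u}} {Γ d s : Ordinal.{u}} (hC : C.Within Γ)
    {H T : Ordinal.{u} → Ordinal.{u} → Prop} (hs : s = C.state)
    (hH : ∀ (i : ℕ), ∀ a < Γ, d = opair 1 (opair i a) → (H i a ↔ a = C.head i))
    (hT : ∀ (i : ℕ), ∀ a < Γ, d = opair 2 (opair i a) → (T i a ↔ a ∈ C.tape i)) :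
    (d = opair 0 s ∨ ∃ i < omega0, ∃ a < Γ, (d = opair 1 (opair i a) ∧ H i a) ∨
      (d = opair 2 (opair i a) ∧ T i a)) ↔ CfgCode C d := by
  rw [exists_lt_omega, CfgCode, hs]
  refine or_congr_right (exists_congr fun i => exists_congr fun a => ?_)
  constructor
  · rintro ⟨ha, ⟨h1, h2⟩ | ⟨h1, h2⟩⟩
    · exact Or.inl ⟨h1, (hH i a ha h1).1 h2⟩
    · exact Or.inr ⟨h1, (hT i a ha h1).1 h2⟩
  · rintro (⟨h1, h2⟩ | ⟨h1, h2⟩)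
    · have ha : a < Γ := h2 ▸ (hC i).1
      exact ⟨ha, Or.inl ⟨h1, (hH i a ha h1).2 h2⟩⟩
    · have ha := (hC i).2 a h2
      exact ⟨ha, Or.inr ⟨h1, (hT i a ha h1).2 h2⟩⟩

theorem simInit_iff {x ρ : Set Ordinal.{u}} {Γ d : Ordinal.{u}} (hx : Below Γ x) (hρ : Below Γ ρ)
    (hC : (initConfig x ρ).Within Γ) : SimInit x ρ Γ d ↔ CfgCode (initConfig x ρ) d := by
  refine cfgCode_iff hC (by simp [initConfig]) (fun i a _ _ => Iff.rfl) fun i a _ _ => ?_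
  have hend : ∀ {x : Set Ordinal.{u}}, Below Γ x → ((∃ η < Γ, η ∈ x ∧ a ≤ η) ↔ ∃ η ∈ x, a ≤ η) :=
    fun hx => exists_congr fun η => ⟨fun h => h.2, fun h => ⟨hx η h.1, h⟩⟩
  rw [hend hx, hend hρ]
  match i with
  | 0 => simp [initConfig]
  | 1 => simp [initConfig]
  | 2 => simp [initConfig]
  | 3 => norm_num [initConfig]
  | n + 4 =>
    have h0 : ((n + 4 : ℕ) : Ordinal.{u}) ≠ 0 := by exact_mod_cast (by omega : n + 4 ≠ 0)
    have h1 : ((n + 4 : ℕ) : Ordinal.{u}) ≠ 1 := by exact_mod_cast (by omega : n + 4 ≠ 1)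
    have h2 : ((n + 4 : ℕ) : Ordinal.{u}) ≠ 2 := by exact_mod_cast (by omega : n + 4 ≠ 2)
    have h3 : ((n + 4 : ℕ) : Ordinal.{u}) ≠ 3 := by exact_mod_cast (by omega : n + 4 ≠ 3)
    simp only [h0, h1, h2, h3, false_and, or_false, initConfig, mem_empty_iff_false]

theorem eq_moveLeft_iff {a h : Ordinal.{u}} :
    a = moveLeft h ↔ h = a + 1 ∨ (a = 0 ∧ ∀ b < h, ¬ h = b + 1) := by
  by_cases hs : ∃ b, h = b + 1
  · obtain ⟨b, rfl⟩ := hs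
    rw [moveLeft_add_one, Order.add_one_inj]
    constructor
    · exact fun h => Or.inl h.symm
    · rintro (h | ⟨-, h⟩)
      · exact h.symm
      · exact absurd rfl (h b (Order.lt_add_one_iff.2 le_rfl))
  · rw [moveLeft, dif_neg hs]
    push Not at hs
    constructor
    · exact fun h => Or.inr ⟨h, fun b _ => hs b⟩
    · rintro (h | ⟨h, -⟩)
      · exact absurd h (hs a)
      · exact h

/-- The encodings of `none`, `some false` and `some true` are `0`, `1` and `2`; these are the values
that `SimAct` interprets as no move, left and right. -/
theorem simAct_iff {C : Config.{u}} {Γ d : Ordinal.{u}} {j : ℕ} {a : Action}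
    (hC : (C.act j a).Within Γ) :
    SimAct (CfgCode C) Γ j (Encodable.encode a.1 : ℕ) (Encodable.encode a.2.1 : ℕ) (a.2.2 : ℕ)
      (C.head j) d ↔ CfgCode (C.act j a) d := by
  obtain ⟨w, m, n⟩ := a
  refine cfgCode_iff hC rfl (fun i a _ hd => ?_) fun i a _ hd => ?_
  · rw [hd, cfgCode_head, Nat.cast_inj]
    simp only [Config.act, Function.update_apply]
    split_ifs with h
    · subst h
      simp only [not_true, false_and, true_and, false_or]
      rcases m with _ | _ | _
      · simp
      · norm_num
        exact eq_moveLeft_iff.symm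
      · norm_num
    · simp [h]
  · rw [hd, cfgCode_tape, Nat.cast_inj]
    simp only [Config.act, Function.update_apply]
    by_cases h : i = j
    · subst h
      simp only [true_and, if_true]
      rcases w with _ | _
      · simp; tauto
      · simp; tauto
    · simp [h]

open Classical in
-- `SimStep` guesses the symbol that is read and the action, and then checks the guess against the
-- configuration and the program. A halting state is recognized by the value `0` of `lookup`, the
-- encoding of `none`, for which the guess is irrelevant.
theorem simStep_iff {P : Program} {C : Config.{u}} {Γ d : Ordinal.{u}} (hC : C.Within Γ)
    (hC' : (P.step C).Within Γ) :
    SimStep (Encodable.encode P : ℕ) Γ (CfgCode C) d ↔ CfgCode (P.step C) d := by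
  simp only [SimStep, cfgCode_state]
  have hq : ∀ {F : Ordinal.{u} → Prop}, (∃ q < omega0, q = (C.state : Ordinal.{u}) ∧ F q) ↔ F C.state :=
    ⟨fun ⟨q, _, h, h'⟩ => h ▸ h', fun h => ⟨_, natCast_lt_omega0 _, rfl, h⟩⟩
  rw [hq]
  simp only [exists_lt_omega]
  have hb : ∀ {F : Ordinal.{u} → Prop}, (∃ b < 2, F b) ↔ ∃ b : ℕ, b < 2 ∧ F b := by
    intro F
    rw [exists_lt_two]
    constructor
    · rintro (h | h)
      exacts [⟨0, by norm_num, by simpa using h⟩, ⟨1, by norm_num, by simpa using h⟩]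
    · rintro ⟨b, hb, h⟩
      interval_cases b
      exacts [Or.inl (by simpa using h), Or.inr (by simpa using h)]
  rw [hb]
  simp only [opair_natCast, natGraph_natCast]
  rcases h : P[C.state]? with _ | l
  · simp only [lookup_none h, Nat.cast_zero, true_and]
    rw [Program.step_none h]
    constructor
    · rintro ⟨b, -, h1 | ⟨j, w, m, n, h1, -⟩⟩
      · exact h1
      · exact absurd h1 (by norm_cast)
    · exact fun h1 => ⟨0, by norm_num, Or.inl h1⟩
  · rw [Program.step_some h] at hC' ⊢
    rw [← simAct_iff hC']
    constructor
    · rintro ⟨b, hb, ⟨h1, -⟩ | ⟨j, w, m, n, h1, a, -, h2, h3, h4⟩⟩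
      · rw [lookup_some h rfl] at h1
        exact absurd h1 (by norm_cast)
      · rw [lookup_some h rfl] at h1
        norm_cast at h1
        rw [add_left_inj, Nat.pair_eq_pair, Nat.pair_eq_pair, Nat.pair_eq_pair] at h1
        obtain ⟨rfl, rfl, rfl, rfl⟩ := h1
        rw [cfgCode_head] at h2
        subst h2
        rw [cfgCode_tape] at h3
        have h5 : (bif b == 0 then l.2.1 else l.2.2) = if C.head l.1 ∈ C.tape l.1 then l.2.2 else l.2.1 := by
          interval_cases b <;> norm_num at h3 <;> simp [h3]
        rwa [h5] at h4
    · intro h1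
      refine ⟨if C.head l.1 ∈ C.tape l.1 then 1 else 0, by split_ifs <;> norm_num, Or.inr ⟨_, _, _, _, ?_,
        C.head l.1, (hC _).1, cfgCode_head.2 rfl, ?_, h1⟩⟩
      · rw [lookup_some h (a := if C.head l.1 ∈ C.tape l.1 then l.2.2 else l.2.1) (by split_ifs <;> rfl)]
        norm_cast
      · rw [cfgCode_tape]
        split_ifs with h2 <;> simp [h2]

/-- The limit state is the one that recurs cofinally while smaller ones eventually disappear. A
limit head position is the least one that, in this state, is not exceeded cofinally often. -/
theorem simLim_iff {C : Ordinal.{u} → Config.{u}} {Γ t d : Ordinal.{u}} {B : ℕ} (ht : 0 < t)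
    {R : Ordinal.{u} → Ordinal.{u} → Prop} (hR : ∀ s < t, ∀ d, R s d ↔ CfgCode (C s) d)
    (hB : ∀ s < t, (C s).state ≤ B) (hC : (limitConfig t fun s => C s.1).Within Γ) :
    SimLim Γ R t d ↔ CfgCode (limitConfig t fun s => C s.1) d := by
  obtain ⟨⟨r₀, hr₀, h1⟩, h2⟩ := limitConfig_state ht hB
  have h3 := limitConfig_head ht hB
  set D := limitConfig t fun s => C s.1 with hD
  have hstate : ∀ q : ℕ, ((∃ r < t, ∀ s < t, r ≤ s → ∀ q' < (q : Ordinal.{u}), ¬ R s (opair 0 q')) ∧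
      ∀ r < t, ∃ s < t, r ≤ s ∧ R s (opair 0 q)) ↔ q = D.state := by
    intro q
    constructor
    · rintro ⟨⟨r, hr, h4⟩, h5⟩
      refine le_antisymm (not_lt.1 fun h => ?_) ?_
      · obtain ⟨s, hs, h6, h7⟩ := h2 r hr
        refine h4 s hs h6 (D.state) (by exact_mod_cast h) ?_
        rw [hR s hs, cfgCode_state, h7]
      · obtain ⟨s, hs, h6, h7⟩ := h5 r₀ hr₀
        rw [hR s hs, cfgCode_state, Nat.cast_inj] at h7
        rw [h7]
        exact h1 s hs h6
    · rintro rfl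
      refine ⟨⟨r₀, hr₀, fun s hs h q' hq' h' => ?_⟩, fun r hr => ?_⟩
      · rw [hR s hs, cfgCode_state] at h'
        subst h'
        exact absurd (h1 s hs h) (not_le.2 (by exact_mod_cast hq'))
      · obtain ⟨s, hs, h6, h7⟩ := h2 r hr
        exact ⟨s, hs, h6, by rw [hR s hs, cfgCode_state, h7]⟩
  have hoften : ∀ (i : ℕ) (a : Ordinal.{u}), SimOften R t D.state i a ↔
      ∀ r < t, ∃ s < t, r ≤ s ∧ (C s).state = D.state ∧ (C s).head i ≤ a := by
    intro i a
    refine forall_congr' fun r => imp_congr_right fun _ => exists_congr fun s =>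
      and_congr_right fun hs => and_congr_right fun _ => ?_
    simp only [hR s hs, cfgCode_state, cfgCode_head, Nat.cast_inj]
    refine and_congr eq_comm ⟨?_, fun h => ⟨_, Order.lt_add_one_iff.2 h, rfl⟩⟩
    rintro ⟨b, hb, rfl⟩
    exact Order.lt_add_one_iff.1 hb
  rw [SimLim, exists_lt_omega]
  simp only [hstate, exists_eq_left]
  refine cfgCode_iff hC rfl (fun i a _ hd => ?_) fun i a _ hd => ?_
  · simp only [hoften]
    constructor
    · rintro ⟨h4, h5⟩
      refine le_antisymm (not_lt.1 fun h => h5 _ h (h3 i).1) ((h3 i).2 h4)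
    · rintro rfl
      exact ⟨(h3 i).1, fun b hb h => absurd ((h3 i).2 h) hb.not_ge⟩
  · rw [hd]
    constructor
    · rintro ⟨r, hr, h⟩
      refine ⟨⟨r, hr⟩, fun s hs => ?_⟩
      exact cfgCode_tape.1 ((hR s.1 s.2 _).1 (h s.1 s.2 hs))
    · rintro ⟨r, h⟩
      exact ⟨r.1, r.2, fun s hs hrs => (hR s hs _).2 (cfgCode_tape.2 (h ⟨s, hs⟩ hrs))⟩

theorem run_within {P : Program} {x ρ : Set Ordinal.{u}} {Γ : Ordinal.{u}} (hx : Below Γ x) (hρ : Below Γ ρ)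
    {t : Ordinal.{u}} (ht : t < Γ) : (P.run x ρ t).Within Γ :=
  fun i => ⟨(run_head_le t i).trans_lt ht, run_tape_below hx hρ i t ht⟩

/-- Induction on time, with time as the stage of the recursion and the parts of configurations as
data. The heads and the cells marked before time `Γ` are below `Γ`, hence so are the ordinals that
describe them. -/
theorem sim_iff {P : Program} {x ρ : Set Ordinal.{u}} {Γ : Ordinal.{u}} (hΓ : Closed Γ) (hx : Below Γ x)
    (hρ : Below Γ ρ) {t : Ordinal.{u}} (ht : t < Γ) (d : Ordinal.{u}) :
    Sim (Encodable.encode P : ℕ) x ρ Γ t d ↔ CfgCode (P.run x ρ t) d := by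
  induction t using WellFoundedLT.induction generalizing d with
  | ind t ih =>
    have hW := run_within (P := P) hx hρ ht
    have hQ : ∀ s < t, ∀ d, (s < t ∧ d < Γ ∧ RecRel Γ (SimBody (Encodable.encode P : ℕ) x ρ Γ) s d) ↔
        CfgCode (P.run x ρ s) d := fun s hs d =>
      ⟨fun h => (ih s hs (hs.trans ht) d).1 h.2, fun h => ⟨hs, (ih s hs (hs.trans ht) d).2 h⟩⟩
    rw [Sim, recRel_iff]
    set Q : Ordinal.{u} → Ordinal.{u} → Prop := fun s d =>
      s < t ∧ d < Γ ∧ RecRel Γ (SimBody (Encodable.encode P : ℕ) x ρ Γ) s d with hQdef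
    have key : SimBody (Encodable.encode P : ℕ) x ρ Γ Q t d ↔ CfgCode (P.run x ρ t) d := by
      rw [SimBody]
      rcases Ordinal.zero_or_succ_or_isSuccLimit t with h | ⟨s, h⟩ | hl
      · subst h
        rw [run_zero] at hW ⊢
        rw [← simInit_iff hx hρ hW]
        simp
      · rw [Order.succ_eq_add_one] at h
        have hs : s < t := h ▸ Order.lt_add_one_iff.2 le_rfl
        have hQs : Q s = CfgCode (P.run x ρ s) := funext fun d => propext (hQ s hs d)
        have hstep : P.run x ρ t = P.step (P.run x ρ s) := by rw [← h, (isRun_run P x ρ).step]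
        rw [hstep] at hW ⊢
        rw [← simStep_iff (run_within hx hρ (hs.trans ht)) hW, ← hQs]
        constructor
        · rintro (⟨h0, -⟩ | ⟨s', -, h1, h2⟩ | ⟨-, h1, -⟩)
          · exact absurd hs (h0 ▸ not_lt_bot)
          · rw [← h, Order.add_one_inj] at h1
            rwa [h1]
          · exact absurd h (h1 s hs).ne
        · exact fun h1 => Or.inr (Or.inl ⟨s, hs, h.symm, h1⟩)
      · rw [(isRun_run P x ρ).limit t hl] at hW ⊢
        obtain ⟨B, hB⟩ := exists_run_state_le P x ρ
        rw [← simLim_iff hl.bot_lt hQ (fun s _ => hB s) hW]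
        constructor
        · rintro (⟨h0, -⟩ | ⟨s, hs, h1, -⟩ | ⟨-, -, h1⟩)
          · exact absurd h0 hl.bot_lt.ne'
          · exact absurd (h1 ▸ hl) (Order.not_isSuccLimit_add_one s)
          · exact h1
        · refine fun h1 => Or.inr (Or.inr ⟨hl.bot_lt.ne', fun s hs => ?_, h1⟩)
          rw [← Order.succ_eq_add_one]
          exact hl.succ_lt hs
    rw [key]
    exact ⟨fun h => h.2, fun h => ⟨h.lt hW hΓ, h⟩⟩

end

section

/-! ### Recognition by simulation -/

/-- `n` is the first component of `Z`. -/
def IsNum (Z : Set Ordinal.{u}) (n : Ordinal.{u}) : Prop := ∀ w < omega0, w < n ↔ 2 * w ∈ Z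

/-- The computation is in a halting state at time `t`. -/
def SimHalts (κ : Ordinal.{u}) (x ρ : Set Ordinal.{u}) (Γ t : Ordinal.{u}) : Prop :=
  ∃ s < omega0, Sim κ x ρ Γ t (opair 0 s) ∧ NatGraph lookup (opair κ (opair s 0)) 0

/-- The pair `Z` of a program and a parameter halts before time `Γ` on the oracle `x`. -/
def PairHalts (Z x : Set Ordinal.{u}) (Γ : Ordinal.{u}) : Prop :=
  ∃ κ < omega0, IsNum Z κ ∧ ∃ t < Γ, SimHalts κ x {v | 2 * v + 1 ∈ Z} Γ t

/-- The pair `Z` of a program and a parameter has the output `1` before time `Γ` on the oracle `x`. -/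
def PairAccepts (Z x : Set Ordinal.{u}) (Γ : Ordinal.{u}) : Prop :=
  ∃ κ < omega0, IsNum Z κ ∧ ∃ t < Γ, SimHalts κ x {v | 2 * v + 1 ∈ Z} Γ t ∧
    ∀ ξ < Γ, (Sim κ x {v | 2 * v + 1 ∈ Z} Γ t (opair 2 (opair 4 ξ)) ↔ ξ = 0)

section

variable {γ : Type (u + 1)} {C : Ctx γ} {x y Z : γ → Set Ordinal.{u}} {κ Γ t n : γ → Ordinal.{u}}

theorem SDfn.join (hx : SDfn C x) (hy : SDfn C y) : SDfn C fun g => join (x g) (y g) :=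
  .of (Dfn.congr (.ex TDfn.var.succ (.or (.and (.eq TDfn.var.w (TDfn.two.mul .var)) (.mem .var hx.w.w))
    (.and (.eq TDfn.var.w (TDfn.two.mul .var).succ) (.mem .var hy.w.w)))) fun _ => mem_join_iff.symm)

theorem Dfn.isNum (hZ : SDfn C Z) (hn : TDfn C n) : Dfn C fun g => IsNum (Z g) (n g) :=
  .all .omega (.iff (.lt .var hn.w) (.mem (TDfn.two.mul .var) hZ.w))

theorem Dfn.simHalts (hκ : TDfn C κ) (hx : SDfn C x) (hy : SDfn C y) (hΓ : TDfn C Γ) (ht : TDfn C t) :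
    Dfn C fun g => SimHalts (κ g) (x g) (y g) (Γ g) (t g) :=
  .ex .omega (.and (.sim hκ.w hx.w hy.w hΓ.w ht.w (.pair .zero .var))
    (.natGraph primrec_lookup (hκ.w.pair (TDfn.var.pair .zero)) .zero))

theorem Dfn.pairHalts (hZ : SDfn C Z) (hx : SDfn C x) (hΓ : TDfn C Γ) :
    Dfn C fun g => PairHalts (Z g) (x g) (Γ g) :=
  .ex .omega (.and (.isNum hZ.w .var) (.ex hΓ.w (.simHalts TDfn.var.w hx.w.w hZ.w.w.snd hΓ.w.w .var)))

theorem Dfn.pairAccepts (hZ : SDfn C Z) (hx : SDfn C x) (hΓ : TDfn C Γ) :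
    Dfn C fun g => PairAccepts (Z g) (x g) (Γ g) :=
  .ex .omega (.and (.isNum hZ.w .var) (.ex hΓ.w (.and
    (.simHalts TDfn.var.w hx.w.w hZ.w.w.snd hΓ.w.w .var) (.all hΓ.w.w (.iff
      (.sim TDfn.var.w.w hx.w.w.w hZ.w.w.w.snd hΓ.w.w.w TDfn.var.w (.pair .two (.pair (.nat 4) .var)))
      (.eq .var .zero))))))

end

theorem isNum_progPair {P : Program} {ρ : Set Ordinal.{u}} {n : Ordinal.{u}} (hn : n < omega0) :
    IsNum (progPair P ρ) n ↔ n = (Encodable.encode P : ℕ) := by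
  simp only [IsNum, progPair, mem_join_even, ofOrd, mem_Iio]
  refine ⟨fun h => eq_of_forall_lt_iff fun w => ?_, fun h w _ => by rw [h]⟩
  by_cases hw : w < omega0
  · exact h w hw
  · exact iff_of_false (fun h => hw (h.trans hn)) fun h => hw (h.trans (natCast_lt_omega0 _))

theorem lookup_eq_zero_iff {P : Program} {q : ℕ} :
    lookup (Nat.pair (Encodable.encode P) (Nat.pair q 0)) = 0 ↔ P.length ≤ q := by
  rw [← List.getElem?_eq_none_iff]
  rcases h : P[q]? with _ | l
  · simp [lookup_none h]
  · simp [lookup_some h rfl]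

section

variable {P : Program} {x ρ : Set Ordinal.{u}} {Γ : Ordinal.{u}}

theorem simHalts_iff (hΓ : Closed Γ) (hx : Below Γ x) (hρ : Below Γ ρ) {t : Ordinal.{u}} (ht : t < Γ) :
    SimHalts (Encodable.encode P : ℕ) x ρ Γ t ↔ P.length ≤ (P.run x ρ t).state := by
  simp only [SimHalts, exists_lt_omega, sim_iff hΓ hx hρ ht, cfgCode_state, Nat.cast_inj, exists_eq_left]
  have h0 : (0 : Ordinal.{u}) = ((0 : ℕ) : Ordinal.{u}) := by simp
  rw [h0, opair_natCast, opair_natCast, natGraph_natCast, Nat.cast_inj, eq_comm, lookup_eq_zero_iff]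

theorem pairHalts_iff (hΓ : Closed Γ) (hx : Below Γ x) (hρ : Below Γ ρ) :
    PairHalts (progPair P ρ) x Γ ↔ ∃ t < Γ, P.length ≤ (P.run x ρ t).state := by
  have h : {v | 2 * v + 1 ∈ progPair P ρ} = ρ := join_snd _ _
  rw [PairHalts, h]
  constructor
  · rintro ⟨κ, hκ, h1, t, ht, h2⟩
    rw [isNum_progPair hκ] at h1
    subst h1
    exact ⟨t, ht, (simHalts_iff hΓ hx hρ ht).1 h2⟩
  · rintro ⟨t, ht, h1⟩
    exact ⟨_, natCast_lt_omega0 _, (isNum_progPair (natCast_lt_omega0 _)).2 rfl, t, ht,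
      (simHalts_iff hΓ hx hρ ht).2 h1⟩

/-- Since the program halts before time `Γ`, the output seen there is its only output. So acceptance
anywhere is acceptance before `Γ`. -/
theorem pairAccepts_iff (hΓ : Closed Γ) (hx : Below Γ x) (hρ : Below Γ ρ)
    (h : PairHalts (progPair P ρ) x Γ) : PairAccepts (progPair P ρ) x Γ ↔ P.Outputs x ρ (ofOrd 1) := by
  have h' : {v | 2 * v + 1 ∈ progPair P ρ} = ρ := join_snd _ _
  have hout : ∀ t < Γ, (∀ ξ < Γ, (Sim (Encodable.encode P : ℕ) x ρ Γ t (opair 2 (opair 4 ξ)) ↔ ξ = 0)) ↔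
      (P.run x ρ t).tape 4 = ofOrd 1 := by
    intro t ht
    have h4 : (4 : Ordinal.{u}) = ((4 : ℕ) : Ordinal.{u}) := by simp
    simp only [sim_iff hΓ hx hρ ht, h4, cfgCode_tape]
    constructor
    · intro h1
      ext ξ
      rw [ofOrd, mem_Iio, Order.lt_one_iff]
      by_cases hξ : ξ < Γ
      · exact h1 ξ hξ
      · refine iff_of_false (fun h => hξ (run_tape_below hx hρ 4 t ht ξ h)) fun h => hξ ?_
        rw [h]
        exact omega0_pos.trans hΓ.1
    · intro h1 ξ _
      rw [h1, ofOrd, mem_Iio, Order.lt_one_iff]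
  rw [pairHalts_iff hΓ hx hρ] at h
  rw [PairAccepts, h']
  constructor
  · rintro ⟨κ, hκ, h1, t, ht, h2, h3⟩
    rw [isNum_progPair hκ] at h1
    subst h1
    exact ⟨t, (simHalts_iff hΓ hx hρ ht).1 h2, (hout t ht).1 h3⟩
  · intro h1
    obtain ⟨t, ht, h2⟩ := h
    refine ⟨_, natCast_lt_omega0 _, (isNum_progPair (natCast_lt_omega0 _)).2 rfl, t, ht,
      (simHalts_iff hΓ hx hρ ht).2 h2, (hout t ht).2 ?_⟩
    exact Program.Outputs.unique ⟨t, h2, rfl⟩ h1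

end

/-- The join of the codes in `y` and a further code, which is found in `y` in the case of a universal
formula (`x = 6`) and in `z` in the case of an existential formula (`x = 7`). -/
def xferFam (y z : Set Ordinal.{u}) (x i : Ordinal.{u}) : Set Ordinal.{u} :=
  {v | (x = 6 ∧ v ∈ famOf y i) ∨ (x = 7 ∧ v ∈ famOf (join {v | 2 * v ∈ {v | 2 * v ∈ z}} y) i)}

/-- Membership in the strong realizer, of a formula with `k - 1` quantifiers in front of a `Δ₀` formula,
that belongs to the realizer `r`. -/
def XferMem (κ k : Ordinal.{u}) (Y : Set Ordinal.{u}) (Γ n : Ordinal.{u}) (r : Set Ordinal.{u})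
    (v : Ordinal.{u}) : Prop :=
  (k = 1 ∧ RzMem (Encodable.encode (rzLines.{u} .recognition) : ℕ) Y Γ 0 n v) ∨
  (¬ k = 1 ∧ ∃ k' < k, k = k' + 1 ∧ ∃ v' < v + 1,
    (v = 2 * v' ∧ ∃ c < omega0, v' < c ∧ NatGraph prgCode (opair κ (opair k' n)) c) ∨
    (v = 2 * v' + 1 ∧ v' ∈ r))

/-- What has to be provided in place of `z`. -/
def XferOut (y z : Set Ordinal.{u}) (Γ κ k x i n v : Ordinal.{u}) : Prop :=
  (x = 6 ∧ XferMem κ k (xferFam y z x i) Γ n {v | 2 * v ∈ z} v) ∨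
  (x = 7 ∧ ∃ v' < v + 1, (v = 2 * v' ∧ v' ∈ {v | 2 * v ∈ {v | 2 * v ∈ z}}) ∨
    (v = 2 * v' + 1 ∧ XferMem κ k (xferFam y z x i) Γ n {v | 2 * v + 1 ∈ {v | 2 * v ∈ z}} v'))

/-- The conditions on `Γ` for a simulation. -/
def XferGood (y w Z : Set Ordinal.{u}) (N Γ : Ordinal.{u}) : Prop :=
  Closed Γ ∧ PairHalts Z (join y {v | 2 * v + 1 ∈ w}) Γ ∧ (PairAccepts Z (join y {v | 2 * v + 1 ∈ w}) Γ →
    NumCases (fun _ _ x m => ∃ i < omega0, ∃ n < omega0, m = opair i n ∧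
      Good (xferFam y {v | 2 * v + 1 ∈ w} x i) Γ) N)

/-- The oracle is accepted after a simulation. -/
def XferAccepts (y w Z : Set Ordinal.{u}) (N Γ : Ordinal.{u}) : Prop :=
  PairAccepts Z (join y {v | 2 * v + 1 ∈ w}) Γ ∧
    NumCases (fun κ k x m => ∃ i < omega0, ∃ n < omega0, m = opair i n ∧
      ∀ v < Γ, (v ∈ {v | 2 * v ∈ w} ↔ XferOut y {v | 2 * v + 1 ∈ w} Γ κ k x i n v)) N

section

variable {γ : Type (u + 1)} {C : Ctx γ} {y z w Z r Y : γ → Set Ordinal.{u}}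
  {κ k x i n v Γ N : γ → Ordinal.{u}}

theorem SDfn.xferFam (hy : SDfn C y) (hz : SDfn C z) (hx : TDfn C x) (hi : TDfn C i) :
    SDfn C fun g => xferFam (y g) (z g) (x g) (i g) :=
  .of (.or (.and (.eqNat hx.w 6) (.mem .var (hy.famOf hi).w))
    (.and (.eqNat hx.w 7) (.mem .var ((hz.fst.fst.join hy).famOf hi).w)))

theorem Dfn.xferMem (hκ : TDfn C κ) (hk : TDfn C k) (hY : SDfn C Y) (hΓ : TDfn C Γ) (hn : TDfn C n)
    (hr : SDfn C r) (hv : TDfn C v) :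
    Dfn C fun g => XferMem (κ g) (k g) (Y g) (Γ g) (n g) (r g) (v g) :=
  .or (.and (.eq hk .one) (.rzMem (.nat _) hY hΓ .zero hn hv)) (.and (.not (.eq hk .one))
    (.ex hk (.and (.eq hk.w TDfn.var.succ) (.ex hv.w.succ (.or
      (.and (.eq hv.w.w (TDfn.two.mul .var)) (.ex .omega (.and (.lt TDfn.var.w .var)
        (.natGraph primrec_prgCode (hκ.w.w.w.pair (TDfn.var.w.w.pair hn.w.w.w)) .var))))
      (.and (.eq hv.w.w (TDfn.two.mul .var).succ) (.mem .var hr.w.w)))))))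

theorem Dfn.xferOut (hy : SDfn C y) (hz : SDfn C z) (hΓ : TDfn C Γ) (hκ : TDfn C κ) (hk : TDfn C k)
    (hx : TDfn C x) (hi : TDfn C i) (hn : TDfn C n) (hv : TDfn C v) :
    Dfn C fun g => XferOut (y g) (z g) (Γ g) (κ g) (k g) (x g) (i g) (n g) (v g) :=
  .or (.and (.eqNat hx 6) (.xferMem hκ hk (hy.xferFam hz hx hi) hΓ hn hz.fst hv))
    (.and (.eqNat hx 7) (.ex hv.succ (.or (.and (.eq hv.w (TDfn.two.mul .var)) (.mem .var hz.w.fst.fst))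
      (.and (.eq hv.w (TDfn.two.mul .var).succ)
        (.xferMem hκ.w hk.w (hy.xferFam hz hx hi).w hΓ.w hn.w hz.w.fst.snd .var)))))

theorem Dfn.xferGood (hy : SDfn C y) (hw : SDfn C w) (hZ : SDfn C Z) (hN : TDfn C N) (hΓ : TDfn C Γ) :
    Dfn C fun g => XferGood (y g) (w g) (Z g) (N g) (Γ g) := by
  have h2 : SDfn C fun g => {v | 2 * v + 1 ∈ w g} := hw.snd
  refine .and (.closed hΓ) (.and (.pairHalts hZ (hy.join h2) hΓ) (.imp (.pairAccepts hZ (hy.join h2) hΓ)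
    (.numCases hN (.ex .omega (.ex .omega (.and (.eq TDfn.var.w.w (TDfn.var.w.pair .var))
      (.good (SDfn.xferFam hy.w.w.w.w.w.w.w h2.w.w.w.w.w.w.w TDfn.var.w.w.w TDfn.var.w)
        hΓ.w.w.w.w.w.w.w)))))))

theorem Dfn.xferAccepts (hy : SDfn C y) (hw : SDfn C w) (hZ : SDfn C Z) (hN : TDfn C N) (hΓ : TDfn C Γ) :
    Dfn C fun g => XferAccepts (y g) (w g) (Z g) (N g) (Γ g) := by
  have h2 : SDfn C fun g => {v | 2 * v + 1 ∈ w g} := hw.snd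
  have h1 : SDfn C fun g => {v | 2 * v ∈ w g} := hw.fst
  refine .and (.pairAccepts hZ (hy.join h2) hΓ)
    (.numCases hN (.ex .omega (.ex .omega (.and (.eq TDfn.var.w.w (TDfn.var.w.pair .var))
      (.all hΓ.w.w.w.w.w.w.w (.iff (.mem .var h1.w.w.w.w.w.w.w.w)
        (.xferOut hy.w.w.w.w.w.w.w.w h2.w.w.w.w.w.w.w.w hΓ.w.w.w.w.w.w.w.w TDfn.var.w.w.w.w.w.w.w
          TDfn.var.w.w.w.w.w TDfn.var.w.w.w.w TDfn.var.w.w TDfn.var.w .var)))))))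

end

/-- The lines of the programs that simulate other programs. -/
def xferLines : Program := (exists_decides.{u} (Q := XferGood) (A := XferAccepts)
  (fun _ _ _ _ _ _ _ hY hW hZ hn hΓ => .xferGood hY hW hZ hn hΓ)
  (fun _ _ _ _ _ _ _ hY hW hZ hn hΓ => .xferAccepts hY hW hZ hn hΓ)).choose

open Classical in
theorem xferLines_spec {y w Z : Set Ordinal.{u}} {N : ℕ} {a : Prop} (hy : BddAbove y) (hw : BddAbove w)
    (hZ : BddAbove Z) (h : ∀ β, ∃ Γ > β, XferGood y w Z N Γ)
    (h' : ∀ Γ, Below Γ y → Below Γ w → Below Γ Z → XferGood y w Z N Γ → (XferAccepts y w Z N Γ ↔ a)) :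
    (withNumeral xferLines.{u} N).Outputs (join y w) Z (ofOrd (if a then 1 else 0)) :=
  (exists_decides.{u} (Q := XferGood) (A := XferAccepts)
    (fun _ _ _ _ _ _ _ hY hW hZ hn hΓ => .xferGood hY hW hZ hn hΓ)
    (fun _ _ _ _ _ _ _ hY hW hZ hn hΓ => .xferAccepts hY hW hZ hn hΓ)).choose_spec y w Z N a hy hw hZ h h'

end

section

/-! ### Strong realizers from realizers -/

theorem exists_opair_natCast {F : Ordinal.{u} → Ordinal.{u} → Prop} {i n : ℕ} :
    (∃ i' < omega0, ∃ n' < omega0, ((Nat.pair i n : ℕ) : Ordinal.{u}) = opair i' n' ∧ F i' n') ↔ F i n := by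
  constructor
  · rintro ⟨i', -, n', -, h, h'⟩
    rw [← opair_natCast, opair_inj] at h
    rwa [h.1, h.2]
  · exact fun h => ⟨_, natCast_lt_omega0 _, _, natCast_lt_omega0 _, (opair_natCast _ _).symm, h⟩

theorem Below.join {Γ : Ordinal.{u}} {x y : Set Ordinal.{u}} (hΓ : Closed Γ) (hx : Below Γ x)
    (hy : Below Γ y) : Below Γ (join x y) := by
  rintro _ (⟨v, hv, rfl⟩ | ⟨v, hv, rfl⟩)
  · exact (hΓ.double_lt (hx v hv)).1
  · exact (hΓ.double_lt (hy v hv)).2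

theorem ofOrd_one_ne_zero : ofOrd (1 : Ordinal.{u}) ≠ ofOrd 0 := by
  intro h
  have h0 : (0 : Ordinal.{u}) ∈ ofOrd (1 : Ordinal.{u}) := show (0 : Ordinal.{u}) < 1 from zero_lt_one
  rw [h] at h0
  exact lt_irrefl (0 : Ordinal.{u}) h0

theorem Program.Recognizes.outputs_one_iff {P : Program} {y ρ z w : Set Ordinal.{u}}
    (h : P.Recognizes y ρ z) (hw : BddAbove w) : P.Outputs (join y w) ρ (ofOrd 1) ↔ w = z := by
  have h1 := h.2 w hw
  split_ifs at h1 with hwz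
  · exact iff_of_true h1 hwz
  · exact iff_of_false (fun h2 => ofOrd_one_ne_zero (h2.unique h1)) hwz

/-- An oracle is split into two components. The program `P` from the parameter is simulated on the
second one, and it accepts exactly `z`. After acceptance `z` is known, and `T`, which is definable
from `z`, can be compared with the first component. Hence exactly `join T z` is accepted. -/
theorem xfer_recognizes {P : Program} {ρ y z T : Set Ordinal.{u}} {k x i n : ℕ}
    (hP : P.Recognizes y ρ z) (hy : BddAbove y) (hρ : BddAbove ρ) (hT : BddAbove T)
    (hG : ∀ β, ∃ Γ > β, Good (xferFam y z x i) Γ)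
    (hO : ∀ Γ, Below Γ y → Below Γ z → Good (xferFam y z x i) Γ → Below Γ T ∧
      ∀ v < Γ, (v ∈ T ↔ XferOut y z Γ (Encodable.encode xferLines.{u} : ℕ) k x i n v)) :
    (prg xferLines.{u} (Nat.pair k (Nat.pair x (Nat.pair i n)))).Recognizes y (progPair P ρ)
      (join T z) := by
  refine ⟨bddAbove_join hT hP.1, fun w hw => ?_⟩
  set w' := {v | 2 * v + 1 ∈ w} with hw'
  have hbw' : BddAbove w' := bddAbove_snd hw
  refine xferLines_spec hy hw (bddAbove_progPair P hρ) (fun β => ?_) fun Γ h1 h2 h3 h4 => ?_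
  · obtain ⟨b, hb⟩ := bddAbove_join hy hbw'
    obtain ⟨b', hb'⟩ := hρ
    obtain ⟨t, ht, -⟩ := hP.2 w' hbw'
    set B := max β (max t (max b b')) with hB
    have hle : β ≤ B ∧ t ≤ B ∧ b ≤ B ∧ b' ≤ B :=
      ⟨le_max_left _ _, (le_max_left _ _).trans (le_max_right _ _),
        ((le_max_left _ _).trans (le_max_right _ _)).trans (le_max_right _ _),
        ((le_max_right _ _).trans (le_max_right _ _)).trans (le_max_right _ _)⟩
    have hbelow : ∀ Γ > B, Below Γ (join y w') ∧ Below Γ ρ := fun Γ hΓ =>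
      ⟨fun v hv => ((hb hv).trans hle.2.2.1).trans_lt hΓ, fun v hv => ((hb' hv).trans hle.2.2.2).trans_lt hΓ⟩
    have hh : ∀ Γ > B, Closed Γ → PairHalts (progPair P ρ) (join y w') Γ := fun Γ hΓ hc =>
      (pairHalts_iff hc (hbelow Γ hΓ).1 (hbelow Γ hΓ).2).2 ⟨t, hle.2.1.trans_lt hΓ, ht⟩
    -- If `P` rejects, the second component need not contain any code, and a `Γ` that is good for it
    -- may not exist. This is why goodness is demanded only after acceptance; otherwise the search
    -- might not end.
    by_cases hz : w' = z
    · obtain ⟨Γ, hΓ, hg⟩ := hG B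
      refine ⟨Γ, hle.1.trans_lt hΓ, hg.1, hh Γ hΓ hg.1, fun _ => ?_⟩
      rw [numCases_natCast, exists_opair_natCast, ← hw', hz]
      exact hg
    · obtain ⟨Γ, hΓ, hc⟩ := exists_closed B
      refine ⟨Γ, hle.1.trans_lt hΓ, hc, hh Γ hΓ hc, fun h => absurd ?_ hz⟩
      rwa [pairAccepts_iff hc (hbelow Γ hΓ).1 (hbelow Γ hΓ).2 (hh Γ hΓ hc), hP.outputs_one_iff hbw'] at h
  · obtain ⟨hc, hh, hg⟩ := h4
    have hρΓ : Below Γ ρ := by simpa only [progPair, join_snd] using h3.odd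
    rw [← hw'] at hh hg
    rw [XferAccepts, ← hw', numCases_natCast, exists_opair_natCast]
    rw [numCases_natCast, exists_opair_natCast] at hg
    rw [pairAccepts_iff hc (h1.join hc h2.odd) hρΓ hh, hP.outputs_one_iff hbw'] at hg ⊢
    constructor
    · rintro ⟨hz, h5⟩
      have hg := hg hz
      have hwz : Below Γ w' := h2.odd
      rw [hz] at h5 hg hwz
      obtain ⟨hTΓ, hT'⟩ := hO Γ h1 hwz hg
      -- Every set is the join of its two components, so `w` is determined once both are known.
      rw [← join_eq_self w, ← hw', hz]
      congr 1
      ext v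
      by_cases hv : v < Γ
      · rw [h5 v hv, hT' v hv]
      · exact iff_of_false (fun h => hv (h2.even v h)) fun h => hv (hTΓ v h)
    · intro hwT
      have hz : w' = z := by rw [hw', hwT, join_snd]
      have hwz : Below Γ w' := h2.odd
      have hg := hg hz
      refine ⟨hz, fun v hv => ?_⟩
      rw [hz] at hg hwz ⊢
      rw [hwT, join_fst]
      exact (hO Γ h1 hwz hg).2 v hv

/-- Formulas with `k` quantifiers in front of a `Δ₀` formula. -/
inductive Prenex : ℕ → Formula → Prop
  | matrix {φ : Formula} : φ.IsDelta0 → Prenex 0 φ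
  | all {k : ℕ} {φ : Formula} (i : ℕ) : Prenex k φ → Prenex (k + 1) (φ.all i)
  | ex {k : ℕ} {φ : Formula} (i : ℕ) : Prenex k φ → Prenex (k + 1) (φ.ex i)

/-- The strong realizer that belongs to the realizer `r`. -/
def xfer : ℕ → Formula → (ℕ → ZFSet.{u}) → Set Ordinal.{u} → Set Ordinal.{u}
  | 0, φ, v, _ => rz (rzLines.{u} .recognition) φ v
  | k + 1, φ, _, r => progPair (prg xferLines.{u} (Nat.pair (k + 1) φ.code)) r

theorem bddAbove_xfer (k : ℕ) (φ : Formula) (v : ℕ → ZFSet.{u}) {r : Set Ordinal.{u}} (hr : BddAbove r) :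
    BddAbove (xfer k φ v r) := by
  cases k with
  | zero => exact (rz_below _ _ _).bddAbove
  | succ k => exact bddAbove_progPair _ hr

theorem xfer_below (k : ℕ) (φ : Formula) (v : ℕ → ZFSet.{u}) {r : Set Ordinal.{u}} {Γ : Ordinal.{u}}
    (hΓ : Closed Γ) (hr : Below Γ r) : Below Γ (xfer k φ v r) := by
  cases k with
  | zero => exact fun w hw => (rz_below _ _ _ w hw).trans hΓ.1
  | succ k => exact Below.join hΓ (fun w hw => (ofOrd_below_omega0 _ w hw).trans hΓ.1) hr

/-- The first argument is the number of quantifiers plus one, that is, the number before the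
outermost quantifier was removed. The code of the program for the remaining formula comes from the
code of `xferLines`, which the program carries in its numeral. -/
theorem xferMem_iff {k : ℕ} {φ : Formula} (hφ : Prenex k φ) {s : Finset ℕ} {c : ℕ → Set Ordinal.{u}}
    {v : ℕ → ZFSet.{u}} (hc : CodesOn s v c) (hs : φ.fv ⊆ s) {Γ : Ordinal.{u}} (hΓ : Good (joinFam s c) Γ)
    (hY : Below Γ (joinFam s c)) (r : Set Ordinal.{u}) {w : Ordinal.{u}} (hw : w < Γ) :
    XferMem (Encodable.encode xferLines.{u} : ℕ) (k + 1 : ℕ) (joinFam s c) Γ φ.code r w ↔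
      w ∈ xfer k φ v r := by
  cases k with
  | zero =>
    obtain ⟨hφ⟩ := hφ
    simp only [XferMem, zero_add, Nat.cast_one, true_and, not_true, false_and, or_false]
    exact rzMem_zero hc hΓ hY (Or.inl hφ) hs hw
  | succ k =>
    have h1 : ((k + 1 + 1 : ℕ) : Ordinal.{u}) ≠ 1 := by exact_mod_cast (by omega : k + 1 + 1 ≠ 1)
    have h2 : ∀ {F : Ordinal.{u} → Prop}, (∃ k' < ((k + 1 + 1 : ℕ) : Ordinal.{u}),
        ((k + 1 + 1 : ℕ) : Ordinal.{u}) = k' + 1 ∧ F k') ↔ F (k + 1 : ℕ) := by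
      intro F
      constructor
      · rintro ⟨k', -, h, h'⟩
        rw [Nat.cast_succ, Order.add_one_inj] at h
        rwa [h]
      · exact fun h => ⟨_, by simp, by simp, h⟩
    simp only [XferMem, h1, false_and, false_or, not_false_eq_true, true_and, h2, opair_natCast,
      natGraph_natCast, prgCode_pair]
    rw [xfer, progPair, mem_join_iff]
    refine exists_congr fun w' => and_congr_right fun _ => or_congr_left (and_congr_right fun _ => ?_)
    exact ⟨by rintro ⟨c, -, h, rfl⟩; exact h, fun h => ⟨_, natCast_lt_omega0 _, h, rfl⟩⟩

theorem xferFam_all (y z : Set Ordinal.{u}) (i : Ordinal.{u}) : xferFam y z (6 : ℕ) i = famOf y i := by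
  ext v
  norm_num [xferFam]

theorem xferFam_ex {y z e r : Set Ordinal.{u}} (h : join e r = {v | 2 * v ∈ z}) (i : Ordinal.{u}) :
    xferFam y z (7 : ℕ) i = famOf (join e y) i := by
  ext v
  rw [xferFam, ← h, join_fst]
  norm_num

/-- Admitting more parameters does no harm to quantifiers, but the implications in the matrix then
face more realizers of their premises. So the realizer of the matrix is exchanged for the canonical
one, and each quantifier in front needs a program that recognizes the exchanged realizer of its
body. The argument works for every quantifier prefix. -/
theorem Prenex.realizes {p : Params} {k : ℕ} {φ : Formula} (hφ : Prenex k φ) : ∀ {v : ℕ → ZFSet.{u}}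
    {r : Set Ordinal.{u}}, BddAbove r → Realizes .recognition p φ v r →
      Realizes .recognition .set φ v (xfer k φ v r) := by
  induction hφ with
  -- A realizer in the given sense makes the matrix true, and then the canonical realizer is a
  -- realizer in the strong sense.
  | matrix hφ => exact fun _ h => hφ.sound_complete.2 _ (hφ.sound_complete.1 _ _ h)
  | @all k φ i hφ ih =>
    rintro v r hr ⟨P, ρ, hρ, rfl, h⟩
    refine ⟨_, _, hr, rfl, fun c hc a e he => ?_⟩
    obtain ⟨r', ⟨z, hz, rfl⟩, h'⟩ := h c hc a e he
    have hb := bddAbove_fst hz.1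
    refine ⟨_, ⟨_, ?_, (join_fst _ z).symm⟩, ih hb h'⟩
    have hc' := codesOn_insert hc he
    have hfam : xferFam (join e (joinFam (φ.all i).fv c)) z (6 : ℕ) i = _ :=
      (xferFam_all _ _ _).trans (famOf_join i)
    refine xfer_recognizes hz (bddAbove_join he.bddAbove hc.bddAbove) hρ.bddAbove
      (bddAbove_xfer _ _ _ hb) (fun β => ?_) fun Γ h1 h2 h3 => ?_
    · rw [hfam]; exact hc'.exists_good β
    · have hY := h1.famOf h3.1 i
      rw [Formula.fv, famOf_join] at hY
      rw [hfam] at h3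
      refine ⟨xfer_below _ _ _ h3.1 h2.even, fun w hw => ?_⟩
      rw [XferOut, hfam, xferMem_iff hφ hc' (fv_subset_insert φ i) h3 hY _ hw]
      norm_num
  | @ex k φ i hφ ih =>
    rintro v r hr ⟨P, ρ, hρ, rfl, h⟩
    refine ⟨_, _, hr, rfl, fun c hc => ?_⟩
    obtain ⟨e, r', ⟨z, hz, hzr⟩, a, he, h'⟩ := h c hc
    have hb := bddAbove_fst hz.1
    -- The realizer `r'` is the second component of what `P` provides, next to the code `e`; as part
    -- of the bounded set `z` it is bounded.
    have hb' : BddAbove r' := by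
      rw [← hzr] at hb
      simpa only [join_snd] using bddAbove_snd hb
    refine ⟨e, _, ⟨_, ?_, (join_fst _ z).symm⟩, a, he, ih hb' h'⟩
    have hc' := codesOn_insert hc he
    have hfam : xferFam (joinFam (φ.ex i).fv c) z (7 : ℕ) i = _ :=
      (xferFam_ex hzr _).trans (famOf_join i)
    refine xfer_recognizes hz hc.bddAbove hρ.bddAbove
      (bddAbove_join he.bddAbove (bddAbove_xfer _ _ _ hb')) (fun β => ?_) fun Γ h1 h2 h3 => ?_
    · rw [hfam]; exact hc'.exists_good β
    · have he' : Below Γ e := by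
        have := h2.even.even
        rwa [← hzr, join_fst] at this
      have hr' : Below Γ r' := by
        have := h2.even.odd
        rwa [← hzr, join_snd] at this
      have hY := (he'.join h3.1 h1).famOf h3.1 i
      rw [Formula.fv, famOf_join] at hY
      rw [hfam] at h3
      refine ⟨he'.join h3.1 (xfer_below _ _ _ h3.1 hr'), fun w hw => ?_⟩
      rw [XferOut, hfam, ← hzr, join_fst, join_snd, mem_join_iff]
      norm_num
      refine exists_congr fun w' => and_congr_right fun hw' => or_congr_right (and_congr_right fun _ => ?_)
      have := xferMem_iff hφ hc' (fv_subset_insert φ i) h3 hY r' (hw'.trans_lt hw)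
      rw [← this]
      norm_num

theorem prenex_exs {θ : Formula} (hθ : θ.IsDelta0) : ∀ l, Prenex l.length (Formula.exs l θ)
  | [] => .matrix hθ
  | i :: l => .ex i (prenex_exs hθ l)

theorem Prenex.alls {k : ℕ} {φ : Formula} (h : Prenex k φ) : ∀ l, ∃ k', Prenex k' (Formula.alls l φ)
  | [] => ⟨k, h⟩
  | i :: l => by
    obtain ⟨k', h'⟩ := h.alls l
    exact ⟨_, h'.all i⟩

theorem Formula.IsPi2.realizable_set {φ : Formula} (hφ : φ.IsPi2) {v : ℕ → ZFSet.{u}} {p : Params}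
    (h : Realizable .recognition p φ v) : Realizable .recognition .set φ v := by
  obtain ⟨l, _, ⟨l', θ, hθ, rfl⟩, rfl⟩ := hφ
  obtain ⟨k, hk⟩ := (prenex_exs hθ l').alls l
  obtain ⟨r, hr, h⟩ := h
  exact ⟨_, bddAbove_xfer _ _ _ hr, hk.realizes hr h⟩

end

end

end OTM

/-! ### The truth lemma. -/

theorem mainTheorem7 :
    -- one program computes realizers of true `Δ₀` formulas; variables in the list `l` are
    -- free variables, for which a formula is read as its universal closure
    (∃ P : OTM.Program, ∀ (φ : OTM.Formula) (l : List ℕ) (v : ℕ → ZFSet.{u})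
        (c : ℕ → Set Ordinal.{u}),
      φ.IsDelta0 → (OTM.Formula.alls l φ).Truth v →
      OTM.CodesOn (OTM.Formula.alls l φ).fv v c →
      ∃ r : Set Ordinal.{u},
        P.Outputs (OTM.join (OTM.ofOrd ((OTM.Formula.alls l φ).code : Ordinal.{u}))
          (OTM.joinFam (OTM.Formula.alls l φ).fv c)) ∅ r ∧ BddAbove r ∧
        ∀ k : OTM.Params, OTM.Realizes .recognition k (OTM.Formula.alls l φ) v r) ∧
    -- `Δ₀` formulas
    (∀ (φ : OTM.Formula) (v : ℕ → ZFSet.{u}), φ.IsDelta0 →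
      ∀ (m : OTM.Mode) (k : OTM.Params), OTM.Realizable m k φ v ↔ φ.Truth v) ∧
    -- `Π₁` formulas
    (∀ (φ : OTM.Formula) (v : ℕ → ZFSet.{u}), φ.IsPi1 →
      ∀ (m : OTM.Mode) (k : OTM.Params), OTM.Realizable m k φ v ↔ φ.Truth v) ∧
    -- `Σ₂` formulas
    (∀ (φ : OTM.Formula) (v : ℕ → ZFSet.{u}), φ.IsSigma2 →
      (OTM.Realizable .recognition .set φ v ↔ φ.Truth v)) ∧
    -- realizable `Π₂` formulas are true
    (∀ (φ : OTM.Formula) (v : ℕ → ZFSet.{u}), φ.IsPi2 →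
      ∀ k : OTM.Params, OTM.Realizable .recognition k φ v → φ.Truth v) ∧
    -- realizable `Π₂` formulas are strongly realizable
    (∀ (φ : OTM.Formula) (v : ℕ → ZFSet.{u}), φ.IsPi2 →
      ∀ k : OTM.Params, OTM.Realizable .recognition k φ v →
        OTM.Realizable .recognition .set φ v) := by
  refine ⟨?_, fun φ v hφ m k => hφ.realizable_iff, fun φ v hφ m k => hφ.realizable_iff,
    fun φ v hφ => hφ.realizable_iff, fun φ v hφ k => hφ.sound.truth, fun φ v hφ k h => ?_⟩
  · obtain ⟨P, hP⟩ := OTM.exists_outputs_rz.{u} (OTM.rzLines.{u} .recognition)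
    exact ⟨P, fun φ l v c hφ ht hc => ⟨_, hP _ v c (OTM.hasRz_alls hφ l) hc,
      (OTM.rz_below _ _ _).bddAbove, fun k => OTM.complete_alls hφ l v ht⟩⟩
  · exact hφ.realizable_set h
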